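/- Let $\Gamma=(\Gamma_1,\Gamma_2):\mathbb{R}\to\mathbb{R}^2$ be a $C^2$ curve parametrized by arc length, with signed curvature $\gamma=\Gamma_1''\Gamma_2'-\Gamma_2''\Gamma_1'$. Assume (A.1) $\gamma\in C^2(\mathbb{R})$; (A.2) $L>0$ and $\gamma(\cdot+L)=\gamma(\cdot)$ on $\mathbb{R}$; (A.3) $\int_0^L\gamma(t)\,dt=0$. Use the Cartesian coordinates with origin $\Gamma(0)$ and first axis directed along $\Gamma'(0)$, so that $\Gamma(0)=(0,0)$ and $\Gamma'(0)=(1,0)$, and put $$K_1=\int_0^L\cos\Big(-\int_0^t\gamma(u)\,du\Big)dt,\qquad K_2=\int_0^L\sin\Big(-\int_0^t\gamma(u)\,du\Big)dt,$$ $$\Phi(s,u)=(\Gamma_1(s)-u\Gamma_2'(s),\ \Gamma_2(s)+u\Gamma_1'(s)).$$ Assume further (A.4) $K_1>0$; (A.5) there is $a_0>0$ such that for all $a\in(0,a_0)$ the map $\Phi$ is injective on $[0,L)\times(-a,a)$ and $\Phi((0,L)\times(-a,a))\subset\Lambda:=(0,K_1)\times\mathbb{R}$. For $\beta>0$ and $\theta\in[0,2\pi)$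 let $H_{\beta,\theta}$ be the self-adjoint operator in $L^2(\Lambda)$ associated with the form $$q_{\beta,\theta}(f,f)=\|\nabla f\|^2_{L^2(\Lambda)}-\beta\int_{\Gamma((0,L))}|f|^2\,dS$$ with the domain $\{f\in H^1(\Lambda):\ f(K_1,K_2+\cdot)=e^{i\theta}f(0,\cdot)\ \text{on}\ \mathbb{R}\}$, where the values of $f$ on lines and on $\Gamma$ are traces. Let $\mu_j(\theta)$ be the $j$th eigenvalue, in increasing order and counted with multiplicity, of the operator $S_\theta=-\frac{d^2}{ds^2}-\frac14\gamma(s)^2$ in $L^2((0,L))$ with the domain $\{u\in H^2((0,L)):\ u(L)=e^{i\theta}u(0),\ u'(L)=e^{i\theta}u'(0)\}$. Then for every integer $n\ge1$ there is $\beta(n)>0$ such that $$\sharp\,\sigma_{\mathrm d}(H_{\beta,\theta})\ge n\qquad\text{for all }\beta\ge\beta(n)\text{ and }\theta\in[0,2\pi),$$ where $\sigma_{\mathrm d}$ is the discrete spectrum (the set of isolated points of the spectrum that are eigenvalues of finite multiplicity) and $\sharp$ is the number of its elements. Moreover, for $\beta\ge\beta(n)$ the $n$th eigenvalue $\lambda_n(\beta,\theta)$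 of $H_{\beta,\theta}$, in increasing order and counted with multiplicity, exists and belongs to $\sigma_{\mathrm d}(H_{\beta,\theta})$, the eigenvalue $\mu_n(\theta)$ exists, and $$\lambda_n(\beta,\theta)=-\frac14\beta^2+\mu_n(\theta)+\mathcal{O}(\beta^{-1}\log\beta)\qquad\text{as }\beta\to\infty,$$ where the error term is uniform with respect to $\theta\in[0,2\pi)$. -/

import Mathlib

open MeasureTheory Set
open scoped ContDiff InnerProductSpace

noncomputable section

namespace StrongDelta

/-! ### Spectral notions for an unbounded operator in a complex Hilbert space -/

section Spectral

variable {H : Type*} [NormedAddCommGroup H] [InnerProductSpace ℂ H]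

/-- `z` is in the resolvent set of `T` if `T - z` maps the domain of `T` bijectively onto `H`
and has a bounded inverse `R`. -/
def IsResolventPoint (T : H →ₗ.[ℂ] H) (z : ℂ) : Prop :=
  ∃ R : H →L[ℂ] H,
    (∀ w : H, ∃ h : R w ∈ T.domain, T ⟨R w, h⟩ - z • R w = w) ∧
    (∀ u : T.domain, R (T u - z • (u : H)) = u)

/-- The spectrum `σ(T)`. -/
def spectrumOf (T : H →ₗ.[ℂ] H) : Set ℂ := {z | ¬ IsResolventPoint T z}

/-- The eigenspace `ker (T - z)`, as a subspace of `H`. -/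
def eigenspaceOf (T : H →ₗ.[ℂ] H) (z : ℂ) : Submodule ℂ H :=
  (LinearMap.ker (T.toFun - z • T.domain.subtype)).map T.domain.subtype

/-- The discrete spectrum `σ_d(T)`: the isolated points of `σ(T)` that are eigenvalues of finite
multiplicity. -/
def discreteSpectrum (T : H →ₗ.[ℂ] H) : Set ℂ :=
  {z | z ∈ spectrumOf T ∧ (∃ ε > 0, Metric.ball z ε ∩ spectrumOf T = {z}) ∧
    eigenspaceOf T z ≠ ⊥ ∧ FiniteDimensional ℂ (eigenspaceOf T z)}

/-- The real number `lam` is the `n`th eigenvalue (`n = 1, 2, …`) of `T`, in increasing order and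
counted with multiplicity: fewer than `n` linearly independent eigenvectors belong to eigenvalues
`< lam`, and at least `n` of them belong to eigenvalues `≤ lam`. -/
def IsNthEigenvalue (T : H →ₗ.[ℂ] H) (n : ℕ) (lam : ℝ) : Prop :=
  Module.rank ℂ ↥(⨆ (x : ℝ) (_ : x < lam), eigenspaceOf T (x : ℂ)) < (n : Cardinal) ∧
  (n : Cardinal) ≤ Module.rank ℂ ↥(⨆ (x : ℝ) (_ : x ≤ lam), eigenspaceOf T (x : ℂ))

end Spectral

/-! ### The curve -/

/-- The signed curvature `γ = Γ₁'' Γ₂' - Γ₂'' Γ₁'` of a plane curve. -/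
def signedCurvature (Γ : ℝ → ℝ × ℝ) (s : ℝ) : ℝ :=
  deriv (deriv fun t => (Γ t).1) s * deriv (fun t => (Γ t).2) s
    - deriv (deriv fun t => (Γ t).2) s * deriv (fun t => (Γ t).1) s

/-- The curve in the coordinates `(x', y')` with origin `Γ(0)` and first axis along
`Γ'(0) = (cos α, sin α)`. -/
def normalized (Γ : ℝ → ℝ × ℝ) (s : ℝ) : ℝ × ℝ :=
  let c : ℝ := deriv (fun t => (Γ t).1) 0
  let d : ℝ := deriv (fun t => (Γ t).2) 0
  (c * ((Γ s).1 - (Γ 0).1) + d * ((Γ s).2 - (Γ 0).2),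
    -d * ((Γ s).1 - (Γ 0).1) + c * ((Γ s).2 - (Γ 0).2))

/-- `K₁ = ∫₀ᴸ cos (-∫₀ᵗ γ)`. -/
def K₁ (γ : ℝ → ℝ) (L : ℝ) : ℝ := ∫ t in (0 : ℝ)..L, Real.cos (-∫ u in (0 : ℝ)..t, γ u)

/-- `K₂ = ∫₀ᴸ sin (-∫₀ᵗ γ)`. -/
def K₂ (γ : ℝ → ℝ) (L : ℝ) : ℝ := ∫ t in (0 : ℝ)..L, Real.sin (-∫ u in (0 : ℝ)..t, γ u)

/-- The curvilinear coordinates `Φ(s, u) = (Γ₁(s) - u Γ₂'(s), Γ₂(s) + u Γ₁'(s))`. -/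
def tubeMap (Γ : ℝ → ℝ × ℝ) (p : ℝ × ℝ) : ℝ × ℝ :=
  ((Γ p.1).1 - p.2 * deriv (fun t => (Γ t).2) p.1,
    (Γ p.1).2 + p.2 * deriv (fun t => (Γ t).1) p.1)

/-- The vertical strip `Λ = (0, k) × ℝ`. -/
def strip (k : ℝ) : Set (ℝ × ℝ) := Ioo 0 k ×ˢ univ

/-! ### Sobolev functions and traces in the plane -/

/-- `L²(Ω)` for a plane set `Ω`. -/
abbrev L2 (Ω : Set (ℝ × ℝ)) : Type := Lp ℂ 2 (volume.restrict Ω)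

/-- `L²(I)` for a set `I` of real parameters. -/
abbrev L2P (I : Set ℝ) : Type := Lp ℂ 2 (volume.restrict I)

/-- `g` is the weak derivative of `f` in the direction `v` on `Ω`. -/
def HasWeakDeriv (Ω : Set (ℝ × ℝ)) (v : ℝ × ℝ) (f g : L2 Ω) : Prop :=
  ∀ φ : ℝ × ℝ → ℂ, ContDiff ℝ ∞ φ → HasCompactSupport φ → tsupport φ ⊆ Ω →
    ∫ x in Ω, f x * fderiv ℝ φ x v = -∫ x in Ω, g x * φ x

lemma integrable_mul_of_continuous {Ω : Set (ℝ × ℝ)} (f : L2 Ω) {ψ : ℝ × ℝ → ℂ}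
    (hψ : Continuous ψ) (hc : HasCompactSupport ψ) :
    Integrable (fun x => f x * ψ x) (volume.restrict Ω) :=
  (Lp.memLp f).integrable_mul (q := 2) (hψ.memLp_of_hasCompactSupport hc)

lemma HasWeakDeriv.zero (Ω : Set (ℝ × ℝ)) (v : ℝ × ℝ) : HasWeakDeriv Ω v 0 0 := by
  intro φ _ _ _
  have h : ∀ ψ : ℝ × ℝ → ℂ, ∫ x in Ω, (0 : L2 Ω) x * ψ x = 0 := fun ψ => by
    rw [← integral_zero (ℝ × ℝ) ℂ (μ := volume.restrict Ω)]
    apply integral_congr_ae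
    filter_upwards [Lp.coeFn_zero ℂ 2 (volume.restrict Ω)] with x hx
    rw [hx]
    simp
  rw [h, h, neg_zero]

lemma HasWeakDeriv.add {Ω : Set (ℝ × ℝ)} {v : ℝ × ℝ} {f g f' g' : L2 Ω}
    (h : HasWeakDeriv Ω v f g) (h' : HasWeakDeriv Ω v f' g') :
    HasWeakDeriv Ω v (f + f') (g + g') := by
  intro φ hφ hc hs
  have key : ∀ (a b : L2 Ω) (ψ : ℝ × ℝ → ℂ), Continuous ψ → HasCompactSupport ψ →
      ∫ x in Ω, (a + b) x * ψ x = (∫ x in Ω, a x * ψ x) + ∫ x in Ω, b x * ψ x := by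
    intro a b ψ h1 h2
    rw [← integral_add (integrable_mul_of_continuous a h1 h2)
      (integrable_mul_of_continuous b h1 h2)]
    apply integral_congr_ae
    filter_upwards [Lp.coeFn_add a b] with x hx
    rw [hx, Pi.add_apply, add_mul]
  have hd : Continuous fun x => fderiv ℝ φ x v :=
    (hφ.continuous_fderiv (by simp)).clm_apply continuous_const
  have hdc : HasCompactSupport fun x => fderiv ℝ φ x v := hc.fderiv_apply ℝ v
  rw [key f f' _ hd hdc, key g g' _ hφ.continuous hc, h φ hφ hc hs, h' φ hφ hc hs, neg_add]

lemma HasWeakDeriv.smul {Ω : Set (ℝ × ℝ)} {v : ℝ × ℝ} {f g : L2 Ω} (c : ℂ)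
    (h : HasWeakDeriv Ω v f g) : HasWeakDeriv Ω v (c • f) (c • g) := by
  intro φ hφ hc hs
  have key : ∀ (a : L2 Ω) (ψ : ℝ × ℝ → ℂ),
      ∫ x in Ω, (c • a) x * ψ x = c * ∫ x in Ω, a x * ψ x := by
    intro a ψ
    rw [← integral_const_mul]
    apply integral_congr_ae
    filter_upwards [Lp.coeFn_smul c a] with x hx
    rw [hx, Pi.smul_apply, smul_eq_mul, mul_assoc]
  rw [key, key, h φ hφ hc hs, mul_neg]

/-- The Sobolev space `H¹(Ω)`: its elements are recorded as triples `(u, ∂u/∂x, ∂u/∂y)`, where the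
last two entries are the weak partial derivatives of `u ∈ L²(Ω)` and lie in `L²(Ω)`. -/
def H1 (Ω : Set (ℝ × ℝ)) : Submodule ℂ (L2 Ω × L2 Ω × L2 Ω) where
  carrier := {p | HasWeakDeriv Ω (1, 0) p.1 p.2.1 ∧ HasWeakDeriv Ω (0, 1) p.1 p.2.2}
  zero_mem' := ⟨HasWeakDeriv.zero _ _, HasWeakDeriv.zero _ _⟩
  add_mem' h h' := ⟨h.1.add h'.1, h.2.add h'.2⟩
  smul_mem' c _ h := ⟨h.1.smul c, h.2.smul c⟩

/-- The graph of the restriction `φ ↦ φ ∘ c` of smooth compactly supported functions `φ` on the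
plane to the parametrized curve `c : I → ℝ²`; `φ` is regarded as the element
`(φ, ∂φ/∂x, ∂φ/∂y)` of `H¹(Ω)`. -/
def restrictionGraph (Ω : Set (ℝ × ℝ)) (c : ℝ → ℝ × ℝ) (I : Set ℝ) :
    Submodule ℂ ((L2 Ω × L2 Ω × L2 Ω) × L2P I) where
  carrier := {p | ∃ φ : ℝ × ℝ → ℂ, ContDiff ℝ ∞ φ ∧ HasCompactSupport φ ∧
    p.1.1 =ᵐ[volume.restrict Ω] φ ∧
    p.1.2.1 =ᵐ[volume.restrict Ω] (fun x => fderiv ℝ φ x (1, 0)) ∧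
    p.1.2.2 =ᵐ[volume.restrict Ω] (fun x => fderiv ℝ φ x (0, 1)) ∧
    p.2 =ᵐ[volume.restrict I] (fun t => φ (c t))}
  zero_mem' := by
    refine ⟨fun _ => 0, contDiff_const, HasCompactSupport.zero, ?_, ?_, ?_, ?_⟩
    · exact Lp.coeFn_zero _ _ _
    · filter_upwards [Lp.coeFn_zero ℂ 2 (volume.restrict Ω)] with x hx
      exact hx.trans (by simp)
    · filter_upwards [Lp.coeFn_zero ℂ 2 (volume.restrict Ω)] with x hx
      exact hx.trans (by simp)
    · exact Lp.coeFn_zero _ _ _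
  add_mem' := by
    rintro p q ⟨φ, hφ, hφc, h1, h2, h3, h4⟩ ⟨ψ, hψ, hψc, k1, k2, k3, k4⟩
    have hf : ∀ x, fderiv ℝ (φ + ψ) x = fderiv ℝ φ x + fderiv ℝ ψ x := fun x =>
      fderiv_add (hφ.differentiable (by simp) x) (hψ.differentiable (by simp) x)
    refine ⟨φ + ψ, hφ.add hψ, hφc.add hψc, ?_, ?_, ?_, ?_⟩
    · filter_upwards [Lp.coeFn_add p.1.1 q.1.1, h1, k1] with x hx e1 e2
      exact hx.trans (by simp [e1, e2])
    · filter_upwards [Lp.coeFn_add p.1.2.1 q.1.2.1, h2, k2] with x hx e1 e2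
      exact hx.trans (by simp [e1, e2, hf])
    · filter_upwards [Lp.coeFn_add p.1.2.2 q.1.2.2, h3, k3] with x hx e1 e2
      exact hx.trans (by simp [e1, e2, hf])
    · filter_upwards [Lp.coeFn_add p.2 q.2, h4, k4] with x hx e1 e2
      exact hx.trans (by simp [e1, e2])
  smul_mem' := by
    rintro a p ⟨φ, hφ, hφc, h1, h2, h3, h4⟩
    have hf : ∀ x, fderiv ℝ (a • φ) x = a • fderiv ℝ φ x := fun x =>
      fderiv_const_smul (hφ.differentiable (by simp) x) a
    refine ⟨a • φ, contDiff_const.smul hφ, hφc.smul_left (f := fun _ => a), ?_, ?_, ?_, ?_⟩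
    · filter_upwards [Lp.coeFn_smul a p.1.1, h1] with x hx e1
      exact hx.trans (by simp [e1])
    · filter_upwards [Lp.coeFn_smul a p.1.2.1, h2] with x hx e1
      exact hx.trans (by simp [e1, hf])
    · filter_upwards [Lp.coeFn_smul a p.1.2.2, h3] with x hx e1
      exact hx.trans (by simp [e1, hf])
    · filter_upwards [Lp.coeFn_smul a p.2, h4] with x hx e1
      exact hx.trans (by simp [e1])

/-- The graph of the trace operator `H¹(Ω) → L²(I)`, `f ↦ f ∘ c`, along the parametrized curve `c`:
the closure, in `H¹(Ω) × L²(I)`, of the restriction of smooth functions. -/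
def traceGraph (Ω : Set (ℝ × ℝ)) (c : ℝ → ℝ × ℝ) (I : Set ℝ) :
    Submodule ℂ ((L2 Ω × L2 Ω × L2 Ω) × L2P I) :=
  (restrictionGraph Ω c I).topologicalClosure

/-! ### The fiber operator -/

/-- The form domain `Q_θ = {u ∈ H¹(Λ) : u(k₁, k₂ + ·) = e^{iθ} u(0, ·)}` on `Λ = (0, k₁) × ℝ`,
whose elements `u` are recorded as `((u, ∂u/∂x, ∂u/∂y), u|_Γ)`, the last entry being the
trace `s ↦ u(Γ(s))`, `0 < s < L`. -/
def formDomain (Γ : ℝ → ℝ × ℝ) (L k₁ k₂ θ : ℝ) :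
    Submodule ℂ ((L2 (strip k₁) × L2 (strip k₁) × L2 (strip k₁)) × L2P (Ioo 0 L)) where
  carrier := {p | p.1 ∈ H1 (strip k₁) ∧ p ∈ traceGraph (strip k₁) Γ (Ioo 0 L) ∧
    ∃ g : L2P univ, (p.1, g) ∈ traceGraph (strip k₁) (fun y => (0, y)) univ ∧
      (p.1, Complex.exp (Complex.I * θ) • g) ∈
        traceGraph (strip k₁) (fun y => (k₁, k₂ + y)) univ}
  zero_mem' := by
    refine ⟨zero_mem _, zero_mem _, 0, zero_mem _, ?_⟩
    rw [smul_zero]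
    exact zero_mem _
  add_mem' := by
    rintro p q ⟨h1, h2, g, h3, h4⟩ ⟨k1, k2, g', k3, k4⟩
    refine ⟨add_mem h1 k1, add_mem h2 k2, g + g', add_mem h3 k3, ?_⟩
    rw [smul_add]
    exact add_mem h4 k4
  smul_mem' := by
    rintro a p ⟨h1, h2, g, h3, h4⟩
    refine ⟨Submodule.smul_mem _ a h1, Submodule.smul_mem _ a h2, a • g,
      Submodule.smul_mem _ a h3, ?_⟩
    rw [smul_comm]
    exact Submodule.smul_mem _ a h4

/-- The sesquilinear form `q_β(v, u) = (∇v, ∇u)_{L²(Λ)} - β ∫_Γ v̄ u dS`, antilinear in `v`. For a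
curve parametrized by arc length `dS = ds`. -/
def deltaForm {Ω : Set (ℝ × ℝ)} {I : Set ℝ} (β : ℝ)
    (v u : (L2 Ω × L2 Ω × L2 Ω) × L2P I) : ℂ :=
  ⟪v.1.2.1, u.1.2.1⟫_ℂ + ⟪v.1.2.2, u.1.2.2⟫_ℂ - (β : ℂ) * ⟪v.2, u.2⟫_ℂ

/-- The graph of the operator associated with the form `q_β` on `Q_θ`: `(u, w)` belongs to it if
and only if `u ∈ Q_θ`, `w ∈ L²(Λ)` and `q_β(v, u) = (v, w)` for all `v ∈ Q_θ`. -/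
def fiberGraph (Γ : ℝ → ℝ × ℝ) (L k₁ k₂ β θ : ℝ) :
    Submodule ℂ (L2 (strip k₁) × L2 (strip k₁)) where
  carrier := {p | ∃ u ∈ formDomain Γ L k₁ k₂ θ, u.1.1 = p.1 ∧
    ∀ v ∈ formDomain Γ L k₁ k₂ θ, deltaForm β v u = ⟪v.1.1, p.2⟫_ℂ}
  zero_mem' := ⟨0, zero_mem _, rfl, fun v _ => by simp [deltaForm]⟩
  add_mem' := by
    rintro p q ⟨u, hu, hup, h⟩ ⟨u', hu', hup', h'⟩
    refine ⟨u + u', add_mem hu hu', by simp [hup, hup'], fun v hv => ?_⟩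
    have e1 := h v hv
    have e2 := h' v hv
    simp only [deltaForm, Prod.fst_add, Prod.snd_add, inner_add_right] at e1 e2 ⊢
    rw [← e1, ← e2]
    ring
  smul_mem' := by
    rintro a p ⟨u, hu, hup, h⟩
    refine ⟨a • u, Submodule.smul_mem _ a hu, by simp [hup], fun v hv => ?_⟩
    have e1 := h v hv
    simp only [deltaForm, Prod.smul_fst, Prod.smul_snd, inner_smul_right] at e1 ⊢
    rw [← e1]
    ring

/-- The fiber operator `H_{β,θ}` in `L²(Λ)`, `Λ = (0, K₁) × ℝ`, of the curve `Γ`, in the coordinates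
`(x', y')` in which `Γ(0) = 0` and `Γ'(0) = (1, 0)`. -/
def fiberOperator (Γ : ℝ → ℝ × ℝ) (L β θ : ℝ) :
    L2 (strip (K₁ (signedCurvature Γ) L)) →ₗ.[ℂ] L2 (strip (K₁ (signedCurvature Γ) L)) :=
  (fiberGraph (normalized Γ) L (K₁ (signedCurvature Γ) L) (K₂ (signedCurvature Γ) L)
    β θ).toLinearPMap

/-! ### The comparison operator -/

/-- The graph of `S_θ = -d²/ds² - γ²/4` in `L²((0, L))` on the domain of all `u ∈ H²((0, L))` with
`u(L) = e^{iθ} u(0)` and `u'(L) = e^{iθ} u'(0)`. Here `u ∈ H²((0, L))` means that `u` has a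
representative `f` which is differentiable on `[0, L]` and whose derivative `f₁` is absolutely
continuous with `f₁' = g ∈ L²((0, L))`. -/
def comparisonGraph (γ : ℝ → ℝ) (L θ : ℝ) : Submodule ℂ (L2P (Ioo 0 L) × L2P (Ioo 0 L)) where
  carrier := {p | ∃ (f f₁ : ℝ → ℂ) (g : L2P (Ioo 0 L)),
    p.1 =ᵐ[volume.restrict (Ioo 0 L)] f ∧
    (∀ t ∈ Icc 0 L, HasDerivWithinAt f (f₁ t) (Icc 0 L) t) ∧
    (∀ t ∈ Icc 0 L, f₁ t = f₁ 0 + ∫ s in Ioo 0 t, g s) ∧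
    f L = Complex.exp (Complex.I * θ) * f 0 ∧
    f₁ L = Complex.exp (Complex.I * θ) * f₁ 0 ∧
    p.2 =ᵐ[volume.restrict (Ioo 0 L)] fun s => -g s - ((γ s ^ 2 / 4 : ℝ) : ℂ) * f s}
  zero_mem' := by
    refine ⟨fun _ => 0, fun _ => 0, 0, Lp.coeFn_zero _ _ _,
      fun t _ => hasDerivWithinAt_const _ _ _, fun t ht => ?_, by simp, by simp, ?_⟩
    · have hz : ∀ᵐ s ∂(volume.restrict (Ioo 0 t)), (0 : L2P (Ioo 0 L)) s = 0 :=
        ae_restrict_of_ae_restrict_of_subset (Ioo_subset_Ioo_right ht.2)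
          (Lp.coeFn_zero ℂ 2 (volume.restrict (Ioo 0 L)))
      rw [integral_congr_ae hz]
      simp
    · filter_upwards [Lp.coeFn_zero ℂ 2 (volume.restrict (Ioo 0 L))] with x hx
      exact hx.trans (by rw [hx]; simp)
  add_mem' := by
    rintro p q ⟨f, f₁, g, h1, h2, h3, h4, h5, h6⟩ ⟨f', f₁', g', k1, k2, k3, k4, k5, k6⟩
    refine ⟨f + f', f₁ + f₁', g + g', ?_, fun t ht => (h2 t ht).add (k2 t ht), fun t ht => ?_,
      by simp [h4, k4, mul_add], by simp [h5, k5, mul_add], ?_⟩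
    · filter_upwards [Lp.coeFn_add p.1 q.1, h1, k1] with x hx e1 e2
      exact hx.trans (by simp [e1, e2])
    · have hz : ∀ᵐ s ∂(volume.restrict (Ioo 0 t)), (g + g') s = g s + g' s :=
        ae_restrict_of_ae_restrict_of_subset (Ioo_subset_Ioo_right ht.2) (Lp.coeFn_add g g')
      have hi : ∀ a : L2P (Ioo 0 L), Integrable a (volume.restrict (Ioo 0 t)) := fun a =>
        IntegrableOn.mono_set ((Lp.memLp a).integrable (by norm_num))
          (Ioo_subset_Ioo_right ht.2)
      rw [integral_congr_ae hz, integral_add (hi g) (hi g'), Pi.add_apply, Pi.add_apply,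
        h3 t ht, k3 t ht]
      ring
    · filter_upwards [Lp.coeFn_add p.2 q.2, Lp.coeFn_add g g', h6, k6] with x hx hg e1 e2
      simp only [Prod.snd_add, hx, hg, Pi.add_apply, e1, e2]
      ring
  smul_mem' := by
    rintro a p ⟨f, f₁, g, h1, h2, h3, h4, h5, h6⟩
    refine ⟨a • f, a • f₁, a • g, ?_, fun t ht => (h2 t ht).const_smul a, fun t ht => ?_,
      by simp [h4, mul_left_comm], by simp [h5, mul_left_comm], ?_⟩
    · filter_upwards [Lp.coeFn_smul a p.1, h1] with x hx e1
      exact hx.trans (by simp [e1])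
    · have hz : ∀ᵐ s ∂(volume.restrict (Ioo 0 t)), (a • g) s = a * g s :=
        ae_restrict_of_ae_restrict_of_subset (Ioo_subset_Ioo_right ht.2) (Lp.coeFn_smul a g)
      rw [integral_congr_ae hz, integral_const_mul, Pi.smul_apply, Pi.smul_apply, h3 t ht,
        smul_eq_mul, smul_eq_mul, mul_add]
    · filter_upwards [Lp.coeFn_smul a p.2, Lp.coeFn_smul a g, h6] with x hx hg e1
      simp only [Prod.smul_snd, hx, hg, Pi.smul_apply, e1, smul_eq_mul]
      ring

/-- The comparison operator `S_θ`. -/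
def comparisonOperator (γ : ℝ → ℝ) (L θ : ℝ) : L2P (Ioo 0 L) →ₗ.[ℂ] L2P (Ioo 0 L) :=
  (comparisonGraph γ L θ).toLinearPMap

end StrongDelta

end

/-! Close to the curve, in the coordinates `(s, u)` of arc length and signed distance, put `g = √(1
+ uγ) f`. Up to coefficients that differ from constants by `O(|u|)`, the energy of `f` becomes the
longitudinal energy `∫ |∂ₛg|² - (γ²/4)|g|²` plus that of the transverse operator `-d²/du² - β δ(u)`.
The latter has the ground state `e^{-β|u|/2}` of energy `-β²/4`, concentrated at distance `1/β` from
the curve, so all errors are `O(1/β)` and the longitudinal operator is `S_θ`. The proof obtains the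
error `C/β` and weakens it to `C log β / β` only at the end.

Both operators are described by closed forms on Hilbert spaces. A min-max principle without any
compactness assumption is enough: a trial space of dimension `n` with form at most `b`, and a lower
bound `c > b` on the kernel of finitely many functionals, make the `n`th eigenvalue exist in the
discrete spectrum and lie below `b` (`IsFormGraph.exists_nth_eigenvalue`). A lower bound on the
kernel of fewer than `n` functionals bounds it from below (`le_of_finrank_eigenSpan`). So it remains
to carry trial spaces and functionals from `S_θ` over to the strip.

Upper bound (`IsTube.exists_trialSpace`): for `h` in the span of eigenfunctions of `S_θ`, the
function `(1 + uγ)^{-1/2} ψ(u) h(s)` is a trial function, where `ψ` is a cut-off and smoothed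
`e^{-β|u|/2}`. Periodicity of the curvature turns quasi-periodicity of `h` into the boundary
condition on the strip.

Lower bound (`IsTube.exists_functional`): outside the tube the energy is nonnegative and is dropped.
In the tube, `g` is projected on the ground state `χ` of a transverse Robin problem with energy
`-k²`, where `k = β/2 + β⁻²`. The Robin constants at `±a` are chosen so that a boundary term `(k/2)
g(±a)²` is gained; it absorbs the boundary terms produced by the curvature. The part of `g`
orthogonal to `χ` has transverse energy at least `-k²/4`, far above `-k²`. The projection extends to
a bounded map `Q` from the form domain on the strip to the quasi-periodic `H¹((0, L))`
(`IsTube.exists_projection`), because the boundary lines of the strip contain the fibers `s = 0` and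
`s = L` of the tube. A functional `ℓ` for `S_θ` then gives the functional `ℓ ∘ Q` on the strip.

To produce `n` different points of the discrete spectrum, eigenvalues of `S_θ` are selected whose
mutual distances are at least `2`, uniformly in `θ` (`exists_comparison_sequence`). -/

noncomputable section

namespace StrongDelta

/-! ### Eigenvalues of an operator given by a closed form -/

section AbstractForm

variable {V H : Type*} [NormedAddCommGroup V] [InnerProductSpace ℂ V] [CompleteSpace V]
  [NormedAddCommGroup H] [InnerProductSpace ℂ H] [CompleteSpace H]

/-- An operator that is coercive on the kernel of finitely many functionals is surjective as soon
as it is injective. -/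
lemma bijective_of_coercive_on_ker {F : Type*} [NormedAddCommGroup F] [NormedSpace ℂ F]
    [FiniteDimensional ℂ F] (B : V →L[ℂ] V) (ℓ : V →L[ℂ] F) {ε : ℝ} (hε : 0 < ε)
    (h : ∀ x, ℓ x = 0 → ε * ‖x‖ ^ 2 ≤ (⟪x, B x⟫_ℂ).re) (hB : Function.Injective B) :
    Function.Bijective B := by
  set K : Submodule ℂ V := LinearMap.ker ℓ.toLinearMap with hK
  have hKc : IsClosed (K : Set V) := ℓ.isClosed_ker
  have : CompleteSpace K := hKc.completeSpace_coe
  set P : V →L[ℂ] V := K.starProjection with hP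
  have hPK : ∀ x, ℓ (P x) = 0 := fun x => by
    have : P x ∈ K := by rw [hP, Submodule.starProjection_apply]; exact Subtype.coe_prop _
    exact this
  have hPo : ∀ x, x - P x ∈ Kᗮ := fun x => K.sub_starProjection_mem_orthogonal x
  have hPsym : ∀ x y, ⟪x, P y⟫_ℂ = ⟪P x, y⟫_ℂ := fun x y =>
    (K.inner_starProjection_left_eq_right x y).symm
  have hpyth : ∀ x, ‖x‖ ^ 2 = ‖P x‖ ^ 2 + ‖x - P x‖ ^ 2 := fun x => by
    have h0 : ⟪P x, x - P x⟫_ℂ = 0 := hPo x _ (hPK x)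
    have := norm_add_sq_eq_norm_sq_add_norm_sq_of_inner_eq_zero (P x) (x - P x) h0
    rw [add_sub_cancel] at this
    rw [sq, sq, sq, this]
  -- The compression of `B` to `ker ℓ`, completed by the identity on the orthogonal complement, is
  -- coercive and hence invertible; `B` differs from it by a finite-rank operator.
  set S : V →L[ℂ] V := P ∘L B ∘L P + (ContinuousLinearMap.id ℂ V - P) with hS
  have hSx : ∀ x, S x = P (B (P x)) + (x - P x) := fun x => rfl
  have hSre : ∀ x, (⟪x, S x⟫_ℂ).re = (⟪P x, B (P x)⟫_ℂ).re + ‖x - P x‖ ^ 2 := fun x => by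
    rw [hSx, inner_add_right, hPsym, Complex.add_re]
    congr 1
    have h0 : ⟪P x, x - P x⟫_ℂ = 0 := hPo x _ (hPK x)
    have : ⟪x, x - P x⟫_ℂ = ⟪x - P x, x - P x⟫_ℂ := by
      rw [inner_sub_left, h0, sub_zero]
    rw [this, inner_self_eq_norm_sq_to_K]
    norm_cast
  set e0 : ℝ := min ε 1 with he0
  have he0p : 0 < e0 := lt_min hε one_pos
  have hSu : IsUnit S := by
    apply ContinuousLinearMap.isUnit_of_forall_le_norm_inner_map S (c := ⟨e0, he0p.le⟩) he0p
    intro x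
    have h1 := h (P x) (hPK x)
    have h2 : ‖x‖ ^ 2 * e0 ≤ (⟪x, S x⟫_ℂ).re := by
      rw [hSre, hpyth]
      have := min_le_left ε 1
      have := min_le_right ε 1
      nlinarith [sq_nonneg ‖P x‖, sq_nonneg ‖x - P x‖]
    refine h2.trans ?_
    rw [← norm_inner_symm]
    exact (le_abs_self _).trans (Complex.abs_re_le_norm _)
  have hSb : Function.Bijective S := ContinuousLinearMap.isUnit_iff_bijective.mp hSu
  let e : V ≃ₗ[ℂ] V := LinearEquiv.ofBijective S.toLinearMap hSb
  have he : ∀ x, e x = S x := fun x => rfl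
  have : FiniteDimensional ℂ Kᗮ := by
    refine Module.Finite.of_injective (ℓ.toLinearMap.domRestrict Kᗮ) ?_
    rw [← LinearMap.ker_eq_bot, LinearMap.ker_eq_bot']
    intro m hm
    have h1 : (m : V) ∈ K := hm
    have h2 : ⟪(m : V), m⟫_ℂ = 0 := m.2 _ h1
    exact Subtype.ext (inner_self_eq_zero.mp h2)
  -- `W` contains the range of `S⁻¹B - 1`. An injective map that preserves this finite-dimensional
  -- space is onto it, and this is all that surjectivity of `B` needs.
  set W : Submodule ℂ V := (Kᗮ ⊔ Kᗮ.map B.toLinearMap).map e.symm.toLinearMap with hW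
  have : FiniteDimensional ℂ W := by
    have : FiniteDimensional ℂ (Kᗮ ⊔ Kᗮ.map B.toLinearMap : Submodule ℂ V) := inferInstance
    exact inferInstance
  let D : V →ₗ[ℂ] V := e.symm.toLinearMap ∘ₗ B.toLinearMap
  have hDx : ∀ x, D x = e.symm (B x) := fun x => rfl
  have hDW : ∀ x, D x - x ∈ W := fun x => by
    refine ⟨B x - S x, ?_, by simp [hDx, ← he]⟩
    have : B x - S x = ((B (P x) - P (B (P x))) - (x - P x)) + B (x - P x) := by
      rw [hSx, map_sub]; abel
    rw [this]
    exact Submodule.add_mem_sup (sub_mem (hPo _) (hPo _)) ⟨x - P x, hPo x, rfl⟩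
  have hDinj : Function.Injective D := e.symm.injective.comp hB
  have hDm : ∀ x ∈ W, D x ∈ W := fun x hx => by
    have := add_mem (hDW x) hx
    rwa [sub_add_cancel] at this
  have hsurj : Function.Surjective (D.restrict hDm) := by
    rw [← LinearMap.injective_iff_surjective]
    intro x y hxy
    exact Subtype.ext (hDinj (congrArg Subtype.val hxy))
  refine ⟨hB, fun y => ?_⟩
  obtain ⟨w, hw⟩ := hsurj ⟨_, hDW (e.symm y)⟩
  have hw' : D w = D (e.symm y) - e.symm y := congrArg Subtype.val hw
  refine ⟨e.symm y - w, e.symm.injective ?_⟩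
  rw [← hDx, map_sub, hw', sub_sub_cancel]

/-- `ι : V → H` and the self-adjoint `A : V → V` describe the closed semibounded form
`(x, y) ↦ ⟪x, A y⟫` with the form domain `ι V`, which is dense in `H`. -/
structure IsClosedForm (ι : V →L[ℂ] H) (A : V →L[ℂ] V) : Prop where
  symm : ∀ x y, ⟪A x, y⟫_ℂ = ⟪x, A y⟫_ℂ
  coercive : ∃ c > 0, ∃ C : ℝ, ∀ x, c * ‖x‖ ^ 2 ≤ (⟪x, A x⟫_ℂ).re + C * ‖ι x‖ ^ 2
  injective : Function.Injective ι
  denseRange : DenseRange ι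

/-- `A - z ι†ι`. -/
def shiftedForm (ι : V →L[ℂ] H) (A : V →L[ℂ] V) (z : ℂ) : V →L[ℂ] V :=
  A - z • (ContinuousLinearMap.adjoint ι ∘L ι)

lemma inner_shiftedForm (ι : V →L[ℂ] H) (A : V →L[ℂ] V) (z : ℂ) (x y : V) :
    ⟪x, shiftedForm ι A z y⟫_ℂ = ⟪x, A y⟫_ℂ - z * ⟪ι x, ι y⟫_ℂ := by
  simp [shiftedForm, ContinuousLinearMap.adjoint_inner_right]

lemma re_inner_shiftedForm (ι : V →L[ℂ] H) (A : V →L[ℂ] V) (z : ℂ) (x : V) :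
    (⟪x, shiftedForm ι A z x⟫_ℂ).re = (⟪x, A x⟫_ℂ).re - z.re * ‖ι x‖ ^ 2 := by
  have h : ⟪ι x, ι x⟫_ℂ = ((‖ι x‖ ^ 2 : ℝ) : ℂ) := by
    rw [inner_self_eq_norm_sq_to_K]; norm_cast
  rw [inner_shiftedForm, h, Complex.sub_re, Complex.re_mul_ofReal]

/-- Nonnegativity of the form at the vector `N x - B x`, with `N = ‖B‖ + 1`, expands to this. It
makes a bijective nonnegative form coercive in the norm of `V`. -/
lemma norm_sq_le_of_nonneg {B : V →L[ℂ] V} (hs : ∀ x y, ⟪B x, y⟫_ℂ = ⟪x, B y⟫_ℂ)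
    (hB : ∀ x, 0 ≤ (⟪x, B x⟫_ℂ).re) (x : V) : ‖B x‖ ^ 2 ≤ (‖B‖ + 1) * (⟪x, B x⟫_ℂ).re := by
  set N := ‖B‖ + 1
  have hN : 0 < N := by positivity
  have h := hB ((N : ℂ) • x - B x)
  have h1 : (⟪B x, B x⟫_ℂ).re = ‖B x‖ ^ 2 := by
    rw [inner_self_eq_norm_sq_to_K]; norm_cast
  have h2 : (⟪B x, B (B x)⟫_ℂ).re ≤ N * ‖B x‖ ^ 2 := by
    refine (Complex.re_le_norm _).trans ((norm_inner_le_norm _ _).trans ?_)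
    have := B.le_opNorm (B x)
    nlinarith [norm_nonneg (B x), norm_nonneg B]
  have e : (⟪(N : ℂ) • x - B x, B ((N : ℂ) • x - B x)⟫_ℂ).re
      = N ^ 2 * (⟪x, B x⟫_ℂ).re - 2 * N * ‖B x‖ ^ 2 + (⟪B x, B (B x)⟫_ℂ).re := by
    rw [← h1]
    simp only [map_sub, map_smul, inner_sub_left, inner_sub_right, inner_smul_left,
      inner_smul_right, ← hs x (B x)]
    simp only [Complex.sub_re, Complex.conj_ofReal, Complex.re_ofReal_mul]
    ring
  rw [e] at h
  have : 0 ≤ N * (N * (⟪x, B x⟫_ℂ).re - ‖B x‖ ^ 2) := by nlinarith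
  have := nonneg_of_mul_nonneg_right this hN
  linarith

/-- Let `m` be the best lower bound not exceeding `c`. If `m < c`, the form shifted by `m` is
nonnegative and bijective, hence coercive by `norm_sq_le_of_nonneg`, and so the bound could be
raised by a positive amount `d`. -/
lemma form_ge_of_bijective {ι : V →L[ℂ] H} {A : V →L[ℂ] V}
    (hs : ∀ x y, ⟪A x, y⟫_ℂ = ⟪x, A y⟫_ℂ)
    {C : ℝ} (hC : ∀ x, 0 ≤ (⟪x, A x⟫_ℂ).re + C * ‖ι x‖ ^ 2) {c : ℝ}
    (hb : ∀ z : ℝ, z < c → Function.Bijective (shiftedForm ι A z)) (x : V) :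
    c * ‖ι x‖ ^ 2 ≤ (⟪x, A x⟫_ℂ).re := by
  set S : Set ℝ := {z | z ≤ c ∧ ∀ x, z * ‖ι x‖ ^ 2 ≤ (⟪x, A x⟫_ℂ).re} with hS
  have hne : (min c (-C)) ∈ S := ⟨min_le_left _ _, fun x => by
    have := hC x
    have := min_le_right c (-C)
    nlinarith [sq_nonneg ‖ι x‖]⟩
  have hcl : IsClosed S := by
    have : S = Iic c ∩ ⋂ x, {z | z * ‖ι x‖ ^ 2 ≤ (⟪x, A x⟫_ℂ).re} := by
      ext z; simp [hS]
    rw [this]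
    exact isClosed_Iic.inter (isClosed_iInter fun x =>
      isClosed_le (continuous_id.mul continuous_const) continuous_const)
  have hbd : BddAbove S := ⟨c, fun z hz => hz.1⟩
  set m := sSup S with hm
  have hmS : m ∈ S := hcl.csSup_mem ⟨_, hne⟩ hbd
  rcases hmS.1.eq_or_lt with h | hlt
  · rw [← h]; exact hmS.2 x
  exfalso
  set B := shiftedForm ι A m with hB
  have hBs : ∀ x y, ⟪B x, y⟫_ℂ = ⟪x, B y⟫_ℂ := fun x y => by
    rw [← inner_conj_symm, hB, inner_shiftedForm, inner_shiftedForm, ← hs, map_sub, map_mul,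
      inner_conj_symm, inner_conj_symm, Complex.conj_ofReal]
  have hB0 : ∀ x, 0 ≤ (⟪x, B x⟫_ℂ).re := fun x => by
    rw [hB, re_inner_shiftedForm, Complex.ofReal_re]
    linarith [hmS.2 x]
  let e : V ≃L[ℂ] V := ContinuousLinearEquiv.ofBijective B
    (LinearMap.ker_eq_bot.mpr (hb m hlt).1) (LinearMap.range_eq_top.mpr (hb m hlt).2)
  set M := ‖(e.symm : V →L[ℂ] V)‖ + 1 with hMd
  have hM : 0 < M := by positivity
  have hM1 : ∀ x, ‖x‖ ≤ M * ‖B x‖ := fun x => by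
    have h1 := (e.symm : V →L[ℂ] V).le_opNorm (B x)
    have h2 : (e.symm : V →L[ℂ] V) (B x) = x := e.symm_apply_apply x
    rw [h2] at h1
    nlinarith [norm_nonneg (B x)]
  set N := ‖B‖ + 1 with hNd
  have hN : 0 < N := by positivity
  have key : ∀ x, ‖x‖ ^ 2 ≤ M ^ 2 * N * ((⟪x, A x⟫_ℂ).re - m * ‖ι x‖ ^ 2) := fun x => by
    have h1 := norm_sq_le_of_nonneg hBs hB0 x
    have h3 : (⟪x, B x⟫_ℂ).re = (⟪x, A x⟫_ℂ).re - m * ‖ι x‖ ^ 2 := by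
      rw [hB, re_inner_shiftedForm, Complex.ofReal_re]
    rw [h3] at h1
    have h2 : ‖x‖ ^ 2 ≤ M ^ 2 * ‖B x‖ ^ 2 := by
      rw [← mul_pow]; exact pow_le_pow_left₀ (norm_nonneg _) (hM1 x) 2
    nlinarith [sq_nonneg M]
  set I := ‖ι‖ + 1
  have hI : 0 < I := by positivity
  have hιI : ∀ x, ‖ι x‖ ^ 2 ≤ I ^ 2 * ‖x‖ ^ 2 := fun x => by
    rw [← mul_pow]
    refine pow_le_pow_left₀ (norm_nonneg _) ((ι.le_opNorm x).trans ?_) 2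
    nlinarith [norm_nonneg x]
  set d := (I ^ 2 * (M ^ 2 * N))⁻¹ with hd
  have hdp : 0 < d := by positivity
  have hmem : min c (m + d) ∈ S := by
    refine ⟨min_le_left _ _, fun x => ?_⟩
    have h1 : ‖ι x‖ ^ 2 ≤ I ^ 2 * (M ^ 2 * N) * ((⟪x, A x⟫_ℂ).re - m * ‖ι x‖ ^ 2) := by
      rw [mul_assoc]
      exact (hιI x).trans (mul_le_mul_of_nonneg_left (key x) (by positivity))
    have h2 : d * ‖ι x‖ ^ 2 ≤ (⟪x, A x⟫_ℂ).re - m * ‖ι x‖ ^ 2 := by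
      rw [hd, inv_mul_le_iff₀ (by positivity)]; exact h1
    have := min_le_right c (m + d)
    nlinarith [sq_nonneg ‖ι x‖]
  have := le_csSup hbd hmem
  rw [← hm] at this
  rcases min_le_iff.mp this with h | h <;> linarith

end AbstractForm

end StrongDelta

end

/-! ### Eigenvectors of a form below a threshold. -/

noncomputable section

namespace StrongDelta

section AbstractEigenvalues

variable {V H : Type*} [NormedAddCommGroup V] [InnerProductSpace ℂ V] [CompleteSpace V]
  [NormedAddCommGroup H] [InnerProductSpace ℂ H] [CompleteSpace H]
  {ι : V →L[ℂ] H} {A : V →L[ℂ] V}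

/-- The span of the form eigenvectors with eigenvalues in `S`. -/
def eigenSpan (ι : V →L[ℂ] H) (A : V →L[ℂ] V) (S : Set ℝ) : Submodule ℂ V :=
  ⨆ x ∈ S, LinearMap.ker (shiftedForm ι A (x : ℂ)).toLinearMap

lemma mem_ker_shiftedForm {z : ℂ} {x : V} :
    x ∈ LinearMap.ker (shiftedForm ι A z).toLinearMap ↔
      ∀ y, ⟪y, A x⟫_ℂ = z * ⟪ι y, ι x⟫_ℂ := by
  rw [LinearMap.mem_ker]
  constructor
  · intro h y
    have := inner_shiftedForm ι A z y x
    rw [show shiftedForm ι A z x = 0 from h, inner_zero_right] at this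
    exact (sub_eq_zero.mp this.symm)
  · intro h
    apply ext_inner_left ℂ
    intro y
    have := inner_shiftedForm ι A z y x
    rw [h y, sub_self] at this
    rw [inner_zero_right]
    exact this

lemma eigenSpan_mono {S S' : Set ℝ} (h : S ⊆ S') : eigenSpan ι A S ≤ eigenSpan ι A S' :=
  biSup_mono h

lemma inner_eq_zero_of_ne (hs : ∀ x y, ⟪A x, y⟫_ℂ = ⟪x, A y⟫_ℂ) {i j : ℝ} (hij : i ≠ j) {u v : V}
    (hu : u ∈ LinearMap.ker (shiftedForm ι A (i : ℂ)).toLinearMap)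
    (hv : v ∈ LinearMap.ker (shiftedForm ι A (j : ℂ)).toLinearMap) : ⟪ι u, ι v⟫_ℂ = 0 := by
  have h1 := mem_ker_shiftedForm.mp hv u
  have h2 := mem_ker_shiftedForm.mp hu v
  rw [← hs, ← inner_conj_symm, h2, map_mul, inner_conj_symm, Complex.conj_ofReal] at h1
  have h3 : ((i : ℂ) - j) * ⟪ι u, ι v⟫_ℂ = 0 := by rw [sub_mul, h1, sub_self]
  rcases mul_eq_zero.mp h3 with h | h
  · exact absurd (by exact_mod_cast sub_eq_zero.mp h) hij
  · exact h

lemma exists_sum_of_mem_eigenSpan {S : Set ℝ} {w : V} (hw : w ∈ eigenSpan ι A S) :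
    ∃ (s : Finset ℝ) (f : ℝ → V), (∀ i ∈ s, i ∈ S) ∧
      (∀ i : ℝ, f i ∈ LinearMap.ker (shiftedForm ι A (i : ℂ)).toLinearMap) ∧ ∑ i ∈ s, f i = w := by
  classical
  rw [eigenSpan, Submodule.mem_iSup_iff_exists_finset] at hw
  obtain ⟨s, hs⟩ := hw
  obtain ⟨f, hf⟩ := (Submodule.mem_iSup_finset_iff_exists_sum _ _).mp hs
  refine ⟨s.filter (· ∈ S), fun i => f i, fun i hi => (Finset.mem_filter.mp hi).2, fun i => ?_, ?_⟩
  · exact (iSup_le fun _ => le_rfl : (⨆ _ : i ∈ S,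
      LinearMap.ker (shiftedForm ι A (i : ℂ)).toLinearMap) ≤ _) (f i).2
  · rw [← hf, Finset.sum_filter_of_ne]
    intro i _ h0
    by_contra hi
    have := (f i).2
    simp only [hi, iSup_false, Submodule.mem_bot] at this
    exact h0 this

/-- Eigenvectors of different eigenvalues are orthogonal in `H`, so the norm and the form are
simultaneously diagonal on their span. -/
lemma sums_of_mem_eigenSpan (hs : ∀ x y, ⟪A x, y⟫_ℂ = ⟪x, A y⟫_ℂ) {s : Finset ℝ} {f : ℝ → V}
    (hf : ∀ i : ℝ, f i ∈ LinearMap.ker (shiftedForm ι A (i : ℂ)).toLinearMap) :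
    ‖ι (∑ i ∈ s, f i)‖ ^ 2 = ∑ i ∈ s, ‖ι (f i)‖ ^ 2 ∧
    (⟪∑ i ∈ s, f i, A (∑ i ∈ s, f i)⟫_ℂ).re = ∑ i ∈ s, i * ‖ι (f i)‖ ^ 2 := by
  have hself : ∀ u : H, ⟪u, u⟫_ℂ = ((‖u‖ ^ 2 : ℝ) : ℂ) := fun u => by
    rw [inner_self_eq_norm_sq_to_K]; norm_cast
  have ho : ∀ i ∈ s, ∀ j ∈ s, j ≠ i → ⟪ι (f i), ι (f j)⟫_ℂ = 0 := fun i _ j _ hij =>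
    inner_eq_zero_of_ne hs hij.symm (hf i) (hf j)
  constructor
  · have h1 : ⟪ι (∑ i ∈ s, f i), ι (∑ i ∈ s, f i)⟫_ℂ = ∑ i ∈ s, ((‖ι (f i)‖ ^ 2 : ℝ) : ℂ) := by
      rw [map_sum, sum_inner]
      refine Finset.sum_congr rfl fun i hi => ?_
      rw [inner_sum, Finset.sum_eq_single i (ho i hi) (fun h => absurd hi h), hself]
    rw [hself] at h1
    exact_mod_cast h1
  · have h1 : ⟪∑ i ∈ s, f i, A (∑ i ∈ s, f i)⟫_ℂ = ∑ i ∈ s, ((i * ‖ι (f i)‖ ^ 2 : ℝ) : ℂ) := by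
      rw [map_sum, sum_inner]
      refine Finset.sum_congr rfl fun i hi => ?_
      rw [inner_sum, Finset.sum_eq_single i, mem_ker_shiftedForm.mp (hf i), hself]
      · push_cast; rfl
      · intro j hj hji
        rw [mem_ker_shiftedForm.mp (hf j), ho i hi j hj hji, mul_zero]
      · exact fun h => absurd hi h
    rw [h1, ← Complex.ofReal_sum, Complex.ofReal_re]

lemma form_le_of_mem_eigenSpan_Iic (hs : ∀ x y, ⟪A x, y⟫_ℂ = ⟪x, A y⟫_ℂ) {r : ℝ} {w : V}
    (hw : w ∈ eigenSpan ι A (Iic r)) : (⟪w, A w⟫_ℂ).re ≤ r * ‖ι w‖ ^ 2 := by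
  obtain ⟨s, f, h1, h2, rfl⟩ := exists_sum_of_mem_eigenSpan hw
  obtain ⟨e1, e2⟩ := sums_of_mem_eigenSpan hs (s := s) h2
  rw [e1, e2, Finset.mul_sum]
  exact Finset.sum_le_sum fun i hi => mul_le_mul_of_nonneg_right (h1 i hi) (sq_nonneg _)

lemma form_lt_of_mem_eigenSpan_Iio (h : IsClosedForm ι A) {r : ℝ} {w : V}
    (hw : w ∈ eigenSpan ι A (Iio r)) (hw0 : w ≠ 0) : (⟪w, A w⟫_ℂ).re < r * ‖ι w‖ ^ 2 := by
  obtain ⟨s, f, h1, h2, rfl⟩ := exists_sum_of_mem_eigenSpan hw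
  obtain ⟨e1, e2⟩ := sums_of_mem_eigenSpan h.symm (s := s) h2
  rw [e1, e2, Finset.mul_sum]
  obtain ⟨i, hi, hi0⟩ : ∃ i ∈ s, f i ≠ 0 := by
    by_contra! hall
    exact hw0 (Finset.sum_eq_zero hall)
  refine Finset.sum_lt_sum (fun i hi => mul_le_mul_of_nonneg_right (h1 i hi).le (sq_nonneg _))
    ⟨i, hi, mul_lt_mul_of_pos_right (h1 i hi) ?_⟩
  have : ι (f i) ≠ 0 := fun h0 => hi0 (h.injective (by rw [h0, map_zero]))
  positivity

variable {F : Type*} [NormedAddCommGroup F] [NormedSpace ℂ F] [FiniteDimensional ℂ F]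

/-- On the span the form is strictly below `c`, on `ker ℓ` it is at least `c`; hence `ℓ` is
injective on the span. -/
lemma finiteDimensional_eigenSpan (h : IsClosedForm ι A) {c : ℝ} {ℓ : V →L[ℂ] F}
    (hℓ : ∀ x, ℓ x = 0 → c * ‖ι x‖ ^ 2 ≤ (⟪x, A x⟫_ℂ).re) :
    FiniteDimensional ℂ (eigenSpan ι A (Iio c)) := by
  refine Module.Finite.of_injective (ℓ.toLinearMap.domRestrict _) ?_
  rw [← LinearMap.ker_eq_bot, LinearMap.ker_eq_bot']
  intro w hw
  by_contra hw0
  have h1 := hℓ w hw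
  have h2 := form_lt_of_mem_eigenSpan_Iio h w.2 (fun h0 => hw0 (Subtype.ext h0))
  linarith

/-- A convex combination of the coercivity estimate, with small weight `τ`, and of the bound on `ker
ℓ`: since `z.re < c`, there is room for the negative multiple of `‖ι x‖ ^ 2` that the former brings
along. The larger form `A'` is allowed for use in `form_ge_of_orthogonal`. -/
lemma coercive_shift (h : IsClosedForm ι A) {c : ℝ} {A' : V →L[ℂ] V}
    (hA' : ∀ x, (⟪x, A x⟫_ℂ).re ≤ (⟪x, A' x⟫_ℂ).re) {ℓ : V →L[ℂ] F}
    (hℓ : ∀ x, ℓ x = 0 → c * ‖ι x‖ ^ 2 ≤ (⟪x, A x⟫_ℂ).re) {z : ℂ} (hz : z.re < c) :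
    ∃ ε > 0, ∀ x, ℓ x = 0 → ε * ‖x‖ ^ 2 ≤ (⟪x, shiftedForm ι A' z x⟫_ℂ).re := by
  obtain ⟨c0, hc0, C, hC⟩ := h.coercive
  set D := |c + C| with hD
  have hDn : 0 ≤ D := abs_nonneg _
  set τ := (c - z.re) / ((c - z.re) + D) with hτ
  have hcz : 0 < c - z.re := by linarith
  have hτ0 : 0 < τ := by positivity
  have hτ1 : τ ≤ 1 := by rw [hτ, div_le_one (by positivity)]; linarith
  have hτ2 : τ * D ≤ c - z.re := by
    rw [hτ, div_mul_eq_mul_div, div_le_iff₀ (by positivity)]; nlinarith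
  refine ⟨τ * c0, by positivity, fun x hx => ?_⟩
  rw [re_inner_shiftedForm]
  have h1 := hℓ x hx
  have h2 := hC x
  have h3 := hA' x
  have h4 : τ * (c + C) ≤ c - z.re :=
    (mul_le_mul_of_nonneg_left (le_abs_self _) hτ0.le).trans hτ2
  nlinarith [sq_nonneg ‖ι x‖, mul_le_mul_of_nonneg_left h2 hτ0.le,
    mul_le_mul_of_nonneg_left h1 (sub_nonneg.mpr hτ1),
    mul_le_mul_of_nonneg_right h4 (sq_nonneg ‖ι x‖)]

lemma ker_shiftedForm_eq_bot_of_im_ne (h : IsClosedForm ι A) {z : ℂ} (hz : z.im ≠ 0) :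
    LinearMap.ker (shiftedForm ι A z).toLinearMap = ⊥ := by
  rw [Submodule.eq_bot_iff]
  intro x hx
  have h1 := mem_ker_shiftedForm.mp hx x
  have h2 : (⟪x, A x⟫_ℂ).im = 0 := by
    rw [← Complex.conj_eq_iff_im, inner_conj_symm, h.symm]
  have h3 : ⟪ι x, ι x⟫_ℂ = ((‖ι x‖ ^ 2 : ℝ) : ℂ) := by
    rw [inner_self_eq_norm_sq_to_K]; norm_cast
  rw [h1, h3, Complex.im_mul_ofReal] at h2
  have h4 : ‖ι x‖ = 0 := by
    rcases mul_eq_zero.mp h2 with h | h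
    · exact absurd h hz
    · exact pow_eq_zero_iff (two_ne_zero) |>.mp h
  exact h.injective (by rw [norm_eq_zero.mp h4, map_zero])

/-- Below `c` the form is determined by its eigenvectors. -/
lemma form_ge_of_orthogonal (h : IsClosedForm ι A) {c : ℝ} {ℓ : V →L[ℂ] F}
    (hℓ : ∀ x, ℓ x = 0 → c * ‖ι x‖ ^ 2 ≤ (⟪x, A x⟫_ℂ).re) {x : V}
    (hx : ∀ w ∈ eigenSpan ι A (Iio c), ⟪ι w, ι x⟫_ℂ = 0) :
    c * ‖ι x‖ ^ 2 ≤ (⟪x, A x⟫_ℂ).re := by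
  have hfin := finiteDimensional_eigenSpan h hℓ
  set U : Submodule ℂ H := (eigenSpan ι A (Iio c)).map ι.toLinearMap with hU
  have hUf : FiniteDimensional ℂ U := inferInstance
  obtain ⟨c0, hc0, C, hC⟩ := h.coercive
  have hC' : ∀ x, 0 ≤ (⟪x, A x⟫_ℂ).re + C * ‖ι x‖ ^ 2 := fun x =>
    le_trans (by positivity) (hC x)
  set κ : ℝ := max (c + C) 0 with hκ
  have hκ0 : 0 ≤ κ := le_max_right _ _
  set Q : H →L[ℂ] H := U.starProjection with hQ
  have hQs : ∀ u v, ⟪u, Q v⟫_ℂ = ⟪Q u, v⟫_ℂ := fun u v =>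
    (U.inner_starProjection_left_eq_right u v).symm
  have hQi : ∀ u, Q (Q u) = Q u := fun u => by
    rw [hQ]; exact U.starProjection_eq_self_iff.mpr (by
      rw [Submodule.starProjection_apply]; exact Subtype.coe_prop _)
  -- The eigenvalues below `c` are lifted by `κ`. Every eigenvalue is at least `-C` and `κ ≥ c + C`,
  -- so none remains below `c`, while the form does not change on vectors orthogonal to the lifted
  -- eigenvectors.
  set A' : V →L[ℂ] V := A + (κ : ℂ) • (ContinuousLinearMap.adjoint ι ∘L Q ∘L ι) with hA'
  have hin : ∀ x y, ⟪x, A' y⟫_ℂ = ⟪x, A y⟫_ℂ + κ * ⟪ι x, Q (ι y)⟫_ℂ := fun x y => by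
    simp [hA', inner_add_right, inner_smul_right, ContinuousLinearMap.adjoint_inner_right]
  have hQre : ∀ u : H, ⟪u, Q u⟫_ℂ = ((‖Q u‖ ^ 2 : ℝ) : ℂ) := fun u => by
    rw [← hQi u, hQs, hQi, inner_self_eq_norm_sq_to_K]; norm_cast
  have hre : ∀ x, (⟪x, A' x⟫_ℂ).re = (⟪x, A x⟫_ℂ).re + κ * ‖Q (ι x)‖ ^ 2 := fun x => by
    rw [hin, hQre, Complex.add_re, ← Complex.ofReal_mul, Complex.ofReal_re]
  have hA's : ∀ x y, ⟪A' x, y⟫_ℂ = ⟪x, A' y⟫_ℂ := fun x y => by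
    rw [← inner_conj_symm, hin, hin, map_add, map_mul, inner_conj_symm, inner_conj_symm,
      Complex.conj_ofReal, h.symm, hQs]
  have hle : ∀ x, (⟪x, A x⟫_ℂ).re ≤ (⟪x, A' x⟫_ℂ).re := fun x => by
    rw [hre]; nlinarith [sq_nonneg ‖Q (ι x)‖]
  -- A vector `y` in the kernel of `A' - z` with `z < c` is orthogonal to all lifted eigenvectors.
  -- The added term then vanishes at `y`, so `y` is itself one of these eigenvectors and is
  -- orthogonal to itself.
  have hbij : ∀ z : ℝ, z < c → Function.Bijective (shiftedForm ι A' z) := by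
    intro z hz
    obtain ⟨ε, hε, hco⟩ := coercive_shift h hle hℓ (z := (z : ℂ)) (by simpa using hz)
    refine bijective_of_coercive_on_ker _ ℓ hε hco ?_
    refine LinearMap.ker_eq_bot.mp ((Submodule.eq_bot_iff _).mpr fun y hy => ?_)
    have hy' := mem_ker_shiftedForm.mp hy
    have horth : ∀ w ∈ eigenSpan ι A (Iio c), ⟪ι w, ι y⟫_ℂ = 0 := by
      let N : Submodule ℂ V := LinearMap.ker ((innerSL ℂ (ι y)).toLinearMap ∘ₗ ι.toLinearMap)
      suffices eigenSpan ι A (Iio c) ≤ N by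
        intro w hw
        have := this hw
        rw [← inner_conj_symm, show ⟪ι y, ι w⟫_ℂ = 0 from this, map_zero]
      refine iSup₂_le fun i hi w hw => ?_
      have hi : i < c := hi
      have h1 := hy' w
      have hwQ : Q (ι w) = ι w := U.starProjection_eq_self_iff.mpr
        ⟨w, (le_biSup (fun x : ℝ => LinearMap.ker (shiftedForm ι A (x : ℂ)).toLinearMap)
          (show i ∈ Iio c from hi)) hw, rfl⟩
      have h2 := mem_ker_shiftedForm.mp hw y
      rw [hin, hQs, hwQ, ← h.symm, ← inner_conj_symm, h2, map_mul, Complex.conj_ofReal,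
        inner_conj_symm] at h1
      have h3 : ((i + κ - z : ℝ) : ℂ) * ⟪ι w, ι y⟫_ℂ = 0 := by
        push_cast
        linear_combination h1
      have hi2 : 0 ≤ (i + C) * ‖ι w‖ ^ 2 := by
        have e1 := hC' w
        have e2 := mem_ker_shiftedForm.mp hw w
        rw [e2, inner_self_eq_norm_sq_to_K] at e1
        have : ((i : ℂ) * ((‖ι w‖ : ℝ) : ℂ) ^ 2).re = i * ‖ι w‖ ^ 2 := by norm_cast
        rw [show (((i : ℂ) * (RCLike.ofReal ‖ι w‖ : ℂ) ^ 2).re) = i * ‖ι w‖ ^ 2 from this] at e1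
        linarith
      show ⟪ι y, ι w⟫_ℂ = 0
      rw [← inner_conj_symm, map_eq_zero]
      rcases eq_or_ne w 0 with rfl | hw0
      · simp
      have hιw : 0 < ‖ι w‖ ^ 2 := by
        have : ι w ≠ 0 := fun h0 => hw0 (h.injective (by rw [h0, map_zero]))
        positivity
      have hiC : 0 ≤ i + C := by
        by_contra hneg
        push Not at hneg
        nlinarith
      rcases mul_eq_zero.mp h3 with h4 | h4
      · exfalso
        have h5 : i + κ - z = 0 := by exact_mod_cast h4
        have := le_max_left (c + C) 0
        linarith
      · exact h4
    have hQy : Q (ι y) = 0 := by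
      rw [hQ, Submodule.starProjection_apply_eq_zero_iff]
      rintro _ ⟨w, hw, rfl⟩
      exact horth w hw
    have hyA : y ∈ LinearMap.ker (shiftedForm ι A (z : ℂ)).toLinearMap := by
      rw [mem_ker_shiftedForm]
      intro v
      have := hy' v
      rwa [hin, hQy, inner_zero_right, mul_zero, add_zero] at this
    have hyS : y ∈ eigenSpan ι A (Iio c) :=
      (le_biSup (fun x : ℝ => LinearMap.ker (shiftedForm ι A (x : ℂ)).toLinearMap)
          (show z ∈ Iio c from hz)) hyA
    have := horth y hyS
    exact h.injective (by rw [inner_self_eq_zero.mp this, map_zero])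
  have key := form_ge_of_bijective hA's (C := C) (fun x => (hC' x).trans (by linarith [hle x]))
    hbij x
  have hQx : Q (ι x) = 0 := by
    rw [hQ, Submodule.starProjection_apply_eq_zero_iff]
    rintro _ ⟨w, hw, rfl⟩
    exact hx w hw
  rw [hre, hQx] at key
  simpa using key

/-- One eigenvector for each eigenvalue gives an orthogonal, hence independent, family in the
finite-dimensional span. -/
lemma finite_eigenvalues (h : IsClosedForm ι A) {c : ℝ} {ℓ : V →L[ℂ] F}
    (hℓ : ∀ x, ℓ x = 0 → c * ‖ι x‖ ^ 2 ≤ (⟪x, A x⟫_ℂ).re) :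
    {r : ℝ | r < c ∧ LinearMap.ker (shiftedForm ι A (r : ℂ)).toLinearMap ≠ ⊥}.Finite := by
  have hfin := finiteDimensional_eigenSpan h hℓ
  set S := {r : ℝ | r < c ∧ LinearMap.ker (shiftedForm ι A (r : ℂ)).toLinearMap ≠ ⊥}
  have hex : ∀ r : S, ∃ v : V, v ∈ LinearMap.ker (shiftedForm ι A (r : ℂ)).toLinearMap ∧ v ≠ 0 :=
    fun r => Submodule.exists_mem_ne_zero_of_ne_bot r.2.2
  choose v hv hv0 using hex
  have hmem : ∀ r : S, v r ∈ eigenSpan ι A (Iio c) := fun r =>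
    (le_biSup (fun x : ℝ => LinearMap.ker (shiftedForm ι A (x : ℂ)).toLinearMap)
          (show (r : ℝ) ∈ Iio c from r.2.1)) (hv r)
  have hli : LinearIndependent ℂ (fun r : S => ι (v r)) := by
    refine linearIndependent_of_ne_zero_of_inner_eq_zero (𝕜 := ℂ) (fun r h0 => hv0 r ?_)
      fun r r' hne => ?_
    · exact h.injective (by rw [h0, map_zero])
    · exact inner_eq_zero_of_ne h.symm (fun h => hne (Subtype.ext h)) (hv r) (hv r')
  have hli' : LinearIndependent ℂ (fun r : S => (⟨v r, hmem r⟩ : eigenSpan ι A (Iio c))) := by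
    apply LinearIndependent.of_comp (ι.toLinearMap ∘ₗ (eigenSpan ι A (Iio c)).subtype)
    exact hli
  exact Set.finite_coe_iff.mp hli'.finite_of_isNoetherian

end AbstractEigenvalues

end StrongDelta

end

/-! ### The operator of a closed form: resolvent, discrete spectrum and min-max principle. -/

noncomputable section

namespace StrongDelta

section FormOperator

variable {V H : Type*} [NormedAddCommGroup V] [InnerProductSpace ℂ V] [CompleteSpace V]
  [NormedAddCommGroup H] [InnerProductSpace ℂ H] [CompleteSpace H]
  {ι : V →L[ℂ] H} {A : V →L[ℂ] V} {g : Submodule ℂ (H × H)}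
  {F : Type*} [NormedAddCommGroup F] [NormedSpace ℂ F] [FiniteDimensional ℂ F]

/-- `g` is the graph of the operator associated with the form `⟪x, A y⟫`. -/
def IsFormGraph (ι : V →L[ℂ] H) (A : V →L[ℂ] V) (g : Submodule ℂ (H × H)) : Prop :=
  ∀ p, p ∈ g ↔ ∃ x, ι x = p.1 ∧ ∀ y, ⟪y, A x⟫_ℂ = ⟪ι y, p.2⟫_ℂ

/-- Injectivity of `ι` and density of its range make `g` single-valued; this is what justifies the
passage from `g` to `g.toLinearPMap`. -/
lemma IsFormGraph.graph_eq (h : IsClosedForm ι A) (hg : IsFormGraph ι A g) :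
    g.toLinearPMap.graph = g := by
  refine g.toLinearPMap_graph_eq ?_
  rintro ⟨u, w⟩ hp hu
  obtain ⟨x, hx, hxy⟩ := (hg _).mp hp
  simp only at hu hx hxy ⊢
  have hx0 : x = 0 := h.injective (by rw [hx, hu, map_zero])
  have hd : Dense (Set.range ι) := h.denseRange
  refine hd.eq_zero_of_inner_right (𝕜 := ℂ) ?_
  rintro _ ⟨y, rfl⟩
  have := hxy y
  rw [hx0, map_zero, inner_zero_right] at this
  exact this.symm

lemma IsFormGraph.eigenspaceOf_eq (h : IsClosedForm ι A) (hg : IsFormGraph ι A g) (z : ℂ) :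
    eigenspaceOf g.toLinearPMap z =
      (LinearMap.ker (shiftedForm ι A z).toLinearMap).map ι.toLinearMap := by
  ext u
  have key : u ∈ eigenspaceOf g.toLinearPMap z ↔ (u, z • u) ∈ g := by
    have hge : (u, z • u) ∈ g ↔ (u, z • u) ∈ g.toLinearPMap.graph := by rw [hg.graph_eq h]
    rw [hge, LinearPMap.mem_graph_iff]
    constructor
    · rintro ⟨v, hv, rfl⟩
      refine ⟨v, rfl, ?_⟩
      have : g.toLinearPMap v - z • (v : H) = 0 := hv
      exact sub_eq_zero.mp this
    · rintro ⟨v, rfl, hv⟩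
      refine ⟨v, ?_, rfl⟩
      show g.toLinearPMap v - z • (v : H) = 0
      rw [hv, sub_self]
  rw [key, hg]
  constructor
  · rintro ⟨x, hx, hxy⟩
    simp only at hx hxy
    refine ⟨x, mem_ker_shiftedForm.mpr fun y => ?_, hx⟩
    rw [hxy y, inner_smul_right, hx]
  · rintro ⟨x, hx, rfl⟩
    exact ⟨x, rfl, fun y => by
      rw [mem_ker_shiftedForm.mp hx y, inner_smul_right]; rfl⟩

lemma IsFormGraph.iSup_eigenspaceOf (h : IsClosedForm ι A) (hg : IsFormGraph ι A g) (S : Set ℝ) :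
    (⨆ (x : ℝ) (_ : x ∈ S), eigenspaceOf g.toLinearPMap (x : ℂ)) =
      (eigenSpan ι A S).map ι.toLinearMap := by
  simp only [eigenSpan, Submodule.map_iSup, hg.eigenspaceOf_eq h]

lemma IsFormGraph.rank_iSup_eigenspaceOf (h : IsClosedForm ι A) (hg : IsFormGraph ι A g)
    (S : Set ℝ) [FiniteDimensional ℂ (eigenSpan ι A S)] :
    Module.rank ℂ ↥(⨆ (x : ℝ) (_ : x ∈ S), eigenspaceOf g.toLinearPMap (x : ℂ)) =
      (Module.finrank ℂ (eigenSpan ι A S) : Cardinal) := by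
  rw [hg.iSup_eigenspaceOf h]
  have e := (Submodule.equivMapOfInjective ι.toLinearMap h.injective (eigenSpan ι A S))
  rw [← Module.finrank_eq_rank, e.finrank_eq]

/-- The resolvent is `ι ∘ (A - z ι†ι)⁻¹ ∘ ι†`. -/
lemma IsFormGraph.isResolventPoint (h : IsClosedForm ι A) (hg : IsFormGraph ι A g) {z : ℂ}
    (hz : Function.Bijective (shiftedForm ι A z)) : IsResolventPoint g.toLinearPMap z := by
  let e : V ≃L[ℂ] V := ContinuousLinearEquiv.ofBijective (shiftedForm ι A z)
    (LinearMap.ker_eq_bot.mpr hz.1) (LinearMap.range_eq_top.mpr hz.2)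
  have he : ∀ x, shiftedForm ι A z (e.symm x) = x := fun x => e.apply_symm_apply x
  have he' : ∀ x, e.symm (shiftedForm ι A z x) = x := fun x => e.symm_apply_apply x
  let R : H →L[ℂ] H := ι ∘L (e.symm : V →L[ℂ] V) ∘L ContinuousLinearMap.adjoint ι
  have hR : ∀ w, R w = ι (e.symm (ContinuousLinearMap.adjoint ι w)) := fun w => rfl
  have hgr : ∀ w, (R w, w + z • R w) ∈ g := by
    intro w
    rw [hg]
    refine ⟨e.symm (ContinuousLinearMap.adjoint ι w), rfl, fun y => ?_⟩
    have h1 := inner_shiftedForm ι A z y (e.symm (ContinuousLinearMap.adjoint ι w))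
    rw [he, ContinuousLinearMap.adjoint_inner_right] at h1
    rw [inner_add_right, inner_smul_right, hR, h1]
    ring
  refine ⟨R, fun w => ?_, fun u => ?_⟩
  · have h1 := hgr w
    rw [← hg.graph_eq h] at h1
    have h2 := LinearPMap.mem_domain_of_mem_graph h1
    refine ⟨h2, ?_⟩
    rw [← (LinearPMap.image_iff h2).mpr h1]
    simp
  · have h1 := g.toLinearPMap.mem_graph u
    rw [hg.graph_eq h, hg] at h1
    obtain ⟨x, hx, hxy⟩ := h1
    simp only at hx hxy
    have h2 : ContinuousLinearMap.adjoint ι (g.toLinearPMap u - z • (u : H))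
        = shiftedForm ι A z x := by
      apply ext_inner_left ℂ
      intro y
      rw [ContinuousLinearMap.adjoint_inner_right, inner_shiftedForm, hxy, inner_sub_right,
        inner_smul_right, hx]
    rw [hR, h2, he', hx]

/-- In the half-plane `Re z < c` the shifted form is coercive on `ker ℓ`, so by
`bijective_of_coercive_on_ker` a point of it is in the resolvent set as soon as it is not an
eigenvalue. Nonreal numbers are never eigenvalues, and the real eigenvalues below `c` are finitely
many. -/
lemma IsFormGraph.mem_discreteSpectrum (h : IsClosedForm ι A) (hg : IsFormGraph ι A g)
    {c : ℝ} {ℓ : V →L[ℂ] F} (hℓ : ∀ x, ℓ x = 0 → c * ‖ι x‖ ^ 2 ≤ (⟪x, A x⟫_ℂ).re) {r : ℝ}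
    (hr : r < c) (hr0 : LinearMap.ker (shiftedForm ι A (r : ℂ)).toLinearMap ≠ ⊥) :
    (r : ℂ) ∈ discreteSpectrum g.toLinearPMap := by
  have hfin := finiteDimensional_eigenSpan h hℓ
  have hne : eigenspaceOf g.toLinearPMap (r : ℂ) ≠ ⊥ := by
    rw [hg.eigenspaceOf_eq h]
    rw [Submodule.ne_bot_iff] at hr0 ⊢
    obtain ⟨x, hx, hx0⟩ := hr0
    exact ⟨ι x, ⟨x, hx, rfl⟩, fun h0 => hx0 (h.injective (by rw [h0, map_zero]))⟩
  have hspec : (r : ℂ) ∈ spectrumOf g.toLinearPMap := by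
    rintro ⟨R, -, hR⟩
    obtain ⟨u, ⟨v, hv, rfl⟩, hu0⟩ := Submodule.exists_mem_ne_zero_of_ne_bot hne
    have h1 := hR v
    have h2 : g.toLinearPMap v - (r : ℂ) • (v : H) = 0 := hv
    rw [h2, map_zero] at h1
    exact hu0 h1.symm
  refine ⟨hspec, ?_, hne, ?_⟩
  · have hF := (finite_eigenvalues h hℓ).subset (sdiff_subset (t := {r}))
    obtain ⟨ε, hε, hball⟩ := Metric.isOpen_iff.mp hF.isClosed.isOpen_compl r (by simp)
    refine ⟨min ε (c - r), lt_min hε (by linarith), ?_⟩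
    ext z
    simp only [mem_inter_iff, Metric.mem_ball, mem_singleton_iff]
    constructor
    · rintro ⟨hz, hzs⟩
      by_contra hzr
      apply hzs
      have hzre : |z.re - r| < min ε (c - r) := by
        refine lt_of_le_of_lt ?_ hz
        rw [dist_eq_norm]
        have := Complex.abs_re_le_norm (z - r)
        simpa using this
      have hzc : z.re < c := by
        have := (abs_lt.mp (hzre.trans_le (min_le_right _ _))).2
        linarith
      obtain ⟨δ, hδ, hco⟩ := coercive_shift h (fun x => le_rfl) hℓ hzc
      refine hg.isResolventPoint h (bijective_of_coercive_on_ker _ ℓ hδ hco ?_)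
      refine LinearMap.ker_eq_bot.mp ?_
      by_cases him : z.im = 0
      · have hzz : z = (z.re : ℂ) := Complex.ext rfl (by simp [him])
        have h1 : z.re ∈ Metric.ball r ε := by
          rw [Metric.mem_ball, Real.dist_eq]; exact hzre.trans_le (min_le_left _ _)
        have h2 := hball h1
        by_contra hcon
        rw [hzz] at hcon
        exact h2 ⟨⟨hzc, hcon⟩, fun h3 => hzr (by rw [hzz, show z.re = r from h3])⟩
      · exact ker_shiftedForm_eq_bot_of_im_ne h him
    · rintro rfl
      exact ⟨by simpa using ⟨hε, hr⟩, hspec⟩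
  · rw [hg.eigenspaceOf_eq h]
    have hle : LinearMap.ker (shiftedForm ι A (r : ℂ)).toLinearMap ≤ eigenSpan ι A (Iio c) :=
      le_biSup (fun x : ℝ => LinearMap.ker (shiftedForm ι A (x : ℂ)).toLinearMap)
          (show r ∈ Iio c from hr)
    have := Submodule.finiteDimensional_of_le hle
    infer_instance

lemma eigenSpan_Iio_eq_Iic {b c : ℝ} (hbc : b < c)
    (hno : ∀ r, b < r → r < c → LinearMap.ker (shiftedForm ι A (r : ℂ)).toLinearMap = ⊥) :
    eigenSpan ι A (Iio c) = eigenSpan ι A (Iic b) := by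
  refine le_antisymm (iSup₂_le fun r hr => ?_) (eigenSpan_mono fun r hr => lt_of_le_of_lt hr hbc)
  by_cases hrb : r ≤ b
  · exact le_biSup (fun x : ℝ => LinearMap.ker (shiftedForm ι A (x : ℂ)).toLinearMap)
          (show r ∈ Iic b from hrb)
  · rw [hno r (not_le.mp hrb) hr]; exact bot_le

/-- A gap in the eigenvalues above `b`. -/
lemma exists_gap (h : IsClosedForm ι A) {b c : ℝ} (hbc : b < c) {ℓ : V →L[ℂ] F}
    (hℓ : ∀ x, ℓ x = 0 → c * ‖ι x‖ ^ 2 ≤ (⟪x, A x⟫_ℂ).re) :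
    ∃ c', b < c' ∧ c' ≤ c ∧ eigenSpan ι A (Iio c') = eigenSpan ι A (Iic b) := by
  have hF := (finite_eigenvalues h hℓ).subset (inter_subset_left (t := Ioi b))
  obtain ⟨ε, hε, hball⟩ := Metric.isOpen_iff.mp hF.isClosed.isOpen_compl b (by simp)
  refine ⟨min (b + ε) c, lt_min (by linarith) hbc, min_le_right _ _,
    eigenSpan_Iio_eq_Iic (lt_min (by linarith) hbc) fun r hbr hrc => ?_⟩
  have h1 : r ∈ Metric.ball b ε := by
    rw [Metric.mem_ball, Real.dist_eq, abs_lt]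
    have := hrc.trans_le (min_le_left _ _)
    constructor <;> linarith
  by_contra hcon
  exact hball h1 ⟨⟨hrc.trans_le (min_le_right _ _), hcon⟩, hbr⟩

/-- The coordinates of `ι x` along `ι W`, for a finite dimensional `W`. -/
lemma exists_functionals (ι : V →L[ℂ] H) (W : Submodule ℂ V) [FiniteDimensional ℂ W] :
    ∃ ℓ : V →L[ℂ] (Fin (Module.finrank ℂ W) → ℂ),
      ∀ x, ℓ x = 0 → ∀ w ∈ W, ⟪ι w, ι x⟫_ℂ = 0 := by
  let e := Module.finBasis ℂ W
  refine ⟨ContinuousLinearMap.pi fun i => (innerSL ℂ (ι (e i))) ∘L ι, fun x hx w hw => ?_⟩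
  have h1 : ∀ i, ⟪ι (e i), ι x⟫_ℂ = 0 := fun i => congrFun hx i
  let N : Submodule ℂ V := LinearMap.ker ((innerSL ℂ (ι x)).toLinearMap ∘ₗ ι.toLinearMap)
  have h2 : (⊤ : Submodule ℂ W) ≤ N.comap W.subtype := by
    rw [← e.span_eq, Submodule.span_le]
    rintro _ ⟨i, rfl⟩
    show ⟪ι x, ι (e i)⟫_ℂ = 0
    rw [← inner_conj_symm, h1, map_zero]
  have h3 : ⟪ι x, ι w⟫_ℂ = 0 := h2 (show (⟨w, hw⟩ : W) ∈ ⊤ from trivial)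
  rw [← inner_conj_symm, h3, map_zero]

lemma exists_mem_ne_zero_of_finrank_lt {E : Submodule ℂ V} [FiniteDimensional ℂ E]
    {m : ℕ} (hm : m < Module.finrank ℂ E) (ℓ : V →L[ℂ] (Fin m → ℂ)) :
    ∃ x ∈ E, x ≠ 0 ∧ ℓ x = 0 := by
  have : LinearMap.ker (ℓ.toLinearMap.domRestrict E) ≠ ⊥ :=
    LinearMap.ker_ne_bot_of_finrank_lt (by simpa using hm)
  obtain ⟨x, hx, hx0⟩ := Submodule.exists_mem_ne_zero_of_ne_bot this
  exact ⟨x, x.2, fun h0 => hx0 (Subtype.ext h0), hx⟩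

/-- The min-max principle: a trial space of dimension `n` below `b` and a bound from below by
`c > b` on the kernel of finitely many functionals give the `n`th eigenvalue. -/
theorem IsFormGraph.exists_nth_eigenvalue (h : IsClosedForm ι A) (hg : IsFormGraph ι A g)
    {b c : ℝ} (hbc : b < c) {ℓ : V →L[ℂ] F}
    (hℓ : ∀ x, ℓ x = 0 → c * ‖ι x‖ ^ 2 ≤ (⟪x, A x⟫_ℂ).re) {n : ℕ} (hn : 1 ≤ n)
    {E : Submodule ℂ V} [FiniteDimensional ℂ E] (hE : n ≤ Module.finrank ℂ E)
    (hEb : ∀ x ∈ E, (⟪x, A x⟫_ℂ).re ≤ b * ‖ι x‖ ^ 2) :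
    ∃ lam ≤ b, IsNthEigenvalue g.toLinearPMap n lam ∧
      (lam : ℂ) ∈ discreteSpectrum g.toLinearPMap ∧
      FiniteDimensional ℂ (eigenSpan ι A (Iic lam)) ∧
      n ≤ Module.finrank ℂ (eigenSpan ι A (Iic lam)) ∧
      ∃ m < n, ∃ ℓ' : V →L[ℂ] (Fin m → ℂ), ∀ x, ℓ' x = 0 → lam * ‖ι x‖ ^ 2 ≤ (⟪x, A x⟫_ℂ).re := by
  have hfin := finiteDimensional_eigenSpan h hℓ
  have hfd : ∀ S ⊆ Iio c, FiniteDimensional ℂ (eigenSpan ι A S) := fun S hS =>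
    Submodule.finiteDimensional_of_le (eigenSpan_mono hS)
  have hIic : ∀ r < c, FiniteDimensional ℂ (eigenSpan ι A (Iic r)) := fun r hr =>
    hfd _ fun x hx => lt_of_le_of_lt hx hr
  have hIio : ∀ r ≤ c, FiniteDimensional ℂ (eigenSpan ι A (Iio r)) := fun r hr =>
    hfd _ fun x hx => lt_of_lt_of_le hx hr
  -- at least `n` eigenvalues are at most `b`
  have hnb : n ≤ Module.finrank ℂ (eigenSpan ι A (Iic b)) := by
    by_contra! hlt
    -- If there were fewer than `n` eigenvalues up to `b`, some nonzero vector of `E` would be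
    -- orthogonal to all their eigenvectors. The form would be at least `c' > b` there, against the
    -- bound on `E`.
    obtain ⟨c', hbc', hc'c, hgap⟩ := exists_gap h hbc hℓ
    have := hIic b hbc
    obtain ⟨ℓ', hℓ'⟩ := exists_functionals ι (eigenSpan ι A (Iic b))
    obtain ⟨x, hxE, hx0, hx⟩ := exists_mem_ne_zero_of_finrank_lt (hlt.trans_le hE) ℓ'
    have h1 := form_ge_of_orthogonal h (c := c') (ℓ := ℓ)
      (fun y hy => le_trans (mul_le_mul_of_nonneg_right hc'c (sq_nonneg _)) (hℓ y hy)) (x := x)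
      (fun w hw => hℓ' x hx w (hgap ▸ hw))
    have h2 := hEb x hxE
    have h3 : 0 < ‖ι x‖ ^ 2 := by
      have : ι x ≠ 0 := fun h0 => hx0 (h.injective (by rw [h0, map_zero]))
      positivity
    nlinarith
  -- the first level at which `n` is reached
  set S : Set ℝ := {r | r ≤ b ∧ LinearMap.ker (shiftedForm ι A (r : ℂ)).toLinearMap ≠ ⊥ ∧
    n ≤ Module.finrank ℂ (eigenSpan ι A (Iic r))} with hS
  -- Lowering the level `r` to the largest eigenvalue not above it does not change the span, so a
  -- level that reaches `n` may be taken to be an eigenvalue.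
  have hev : ∀ r ≤ b, n ≤ Module.finrank ℂ (eigenSpan ι A (Iic r)) → ∃ s ∈ S, s ≤ r := by
    intro r hrb hr
    have hF : {s : ℝ | s ≤ r ∧
        LinearMap.ker (shiftedForm ι A (s : ℂ)).toLinearMap ≠ ⊥}.Finite :=
      (finite_eigenvalues h hℓ).subset fun s hs => ⟨by have := hs.1; linarith, hs.2⟩
    have hFne : {s : ℝ | s ≤ r ∧
        LinearMap.ker (shiftedForm ι A (s : ℂ)).toLinearMap ≠ ⊥}.Nonempty := by
      by_contra hemp
      have h0 : eigenSpan ι A (Iic r) = ⊥ := by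
        rw [eigenSpan, iSup₂_eq_bot]
        intro s hs
        by_contra hcon
        exact hemp ⟨s, hs, hcon⟩
      rw [h0, finrank_bot] at hr
      omega
    obtain ⟨s, hs, hmax⟩ := hF.exists_maximalFor id _ hFne
    refine ⟨s, ⟨hs.1.trans hrb, hs.2, ?_⟩, hs.1⟩
    have : eigenSpan ι A (Iic r) = eigenSpan ι A (Iic s) := by
      refine le_antisymm (iSup₂_le fun t ht => ?_) (eigenSpan_mono (Iic_subset_Iic.mpr hs.1))
      by_cases hts : t ≤ s
      · exact le_biSup (fun x : ℝ => LinearMap.ker (shiftedForm ι A (x : ℂ)).toLinearMap)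
          (show t ∈ Iic s from hts)
      · by_cases h0 : LinearMap.ker (shiftedForm ι A (t : ℂ)).toLinearMap = ⊥
        · rw [h0]; exact bot_le
        · exact absurd (hmax ⟨ht, h0⟩ (not_le.mp hts).le) hts
    rwa [this] at hr
  have hSF : S.Finite := (finite_eigenvalues h hℓ).subset fun s hs =>
    ⟨lt_of_le_of_lt hs.1 hbc, hs.2.1⟩
  obtain ⟨s0, hs0, -⟩ := hev b le_rfl hnb
  obtain ⟨lam, hlam, hmin⟩ := hSF.exists_minimalFor id _ ⟨s0, hs0⟩
  obtain ⟨hlb, hne, hge⟩ := hlam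
  have hlc : lam < c := lt_of_le_of_lt hlb hbc
  have i1 := hIic lam hlc
  have i2 := hIio lam hlc.le
  -- Otherwise the largest eigenvalue strictly below `lam` would already reach `n`, against the
  -- minimality of `lam`.
  have hlt : Module.finrank ℂ (eigenSpan ι A (Iio lam)) < n := by
    by_contra! hcon
    have hF : {s : ℝ | s < lam ∧
        LinearMap.ker (shiftedForm ι A (s : ℂ)).toLinearMap ≠ ⊥}.Finite :=
      (finite_eigenvalues h hℓ).subset fun s hs => ⟨by have := hs.1; linarith, hs.2⟩
    rcases eq_empty_or_nonempty {s : ℝ | s < lam ∧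
        LinearMap.ker (shiftedForm ι A (s : ℂ)).toLinearMap ≠ ⊥} with hemp | hne'
    · have h0 : eigenSpan ι A (Iio lam) = ⊥ := by
        rw [eigenSpan, iSup₂_eq_bot]
        intro s hs
        by_contra hcon
        exact (eq_empty_iff_forall_notMem.mp hemp) s ⟨hs, hcon⟩
      rw [h0, finrank_bot] at hcon
      omega
    · obtain ⟨s, hs, hmax⟩ := hF.exists_maximalFor id _ hne'
      have hgap : eigenSpan ι A (Iio lam) = eigenSpan ι A (Iic s) := by
        refine eigenSpan_Iio_eq_Iic hs.1 fun r hsr hrl => ?_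
        by_contra h0
        exact absurd (hmax ⟨hrl, h0⟩ hsr.le) (not_le.mpr hsr)
      rw [hgap] at hcon
      obtain ⟨t, htS, hts⟩ := hev s (hs.1.le.trans hlb) hcon
      have h1 : lam ≤ t := hmin htS (hts.trans hs.1.le)
      have := hs.1
      linarith
  refine ⟨lam, hlb, ⟨?_, ?_⟩, hg.mem_discreteSpectrum h hℓ hlc hne, i1, hge, ?_⟩
  · have := hg.rank_iSup_eigenspaceOf h (Iio lam)
    refine lt_of_eq_of_lt this ?_
    exact_mod_cast hlt
  · have := hg.rank_iSup_eigenspaceOf h (Iic lam)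
    refine le_of_le_of_eq ?_ this.symm
    exact_mod_cast hge
  · obtain ⟨ℓ', hℓ'⟩ := exists_functionals ι (eigenSpan ι A (Iio lam))
    refine ⟨_, hlt, ℓ', fun x hx => form_ge_of_orthogonal h (ℓ := ℓ) (fun y hy =>
      le_trans (mul_le_mul_of_nonneg_right hlc.le (sq_nonneg _)) (hℓ y hy)) (hℓ' x hx)⟩

/-- A bound from below on the kernel of fewer than `n` functionals bounds the `n`th eigenvalue. -/
lemma le_of_finrank_eigenSpan (h : IsClosedForm ι A) {n m : ℕ} (hm : m < n) {lam c : ℝ}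
    [FiniteDimensional ℂ (eigenSpan ι A (Iic lam))]
    (hn : n ≤ Module.finrank ℂ (eigenSpan ι A (Iic lam))) {ℓ : V →L[ℂ] (Fin m → ℂ)}
    (hℓ : ∀ x, ℓ x = 0 → c * ‖ι x‖ ^ 2 ≤ (⟪x, A x⟫_ℂ).re) : c ≤ lam := by
  obtain ⟨x, hxE, hx0, hx⟩ := exists_mem_ne_zero_of_finrank_lt (hm.trans_le hn) ℓ
  have h1 := hℓ x hx
  have h2 := form_le_of_mem_eigenSpan_Iic h.symm hxE
  have h3 : 0 < ‖ι x‖ ^ 2 := by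
    have : ι x ≠ 0 := fun h0 => hx0 (h.injective (by rw [h0, map_zero]))
    positivity
  exact le_of_mul_le_mul_right (h1.trans h2) h3

end FormOperator

end StrongDelta

end

noncomputable section

namespace StrongDelta

/-! ### The form of the comparison operator -/

section General

variable {α : Type*} [MeasurableSpace α] {μ : Measure α}

lemma norm_sq_eq_integral_norm_sq (f : Lp ℂ 2 μ) : ‖f‖ ^ 2 = ∫ x, ‖f x‖ ^ 2 ∂μ := by
  have h : ⟪f, f⟫_ℂ = ((‖f‖ ^ 2 : ℝ) : ℂ) := by
    rw [inner_self_eq_norm_sq_to_K]; norm_cast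
  have h2 : ⟪f, f⟫_ℂ = ∫ x, ((‖f x‖ ^ 2 : ℝ) : ℂ) ∂μ := by
    rw [L2.inner_def]
    refine integral_congr_ae (Filter.Eventually.of_forall fun x => ?_)
    simp only
    rw [inner_self_eq_norm_sq_to_K]
    norm_cast
  rw [h, integral_complex_ofReal] at h2
  exact_mod_cast h2

lemma inner_eq_integral (f g : Lp ℂ 2 μ) :
    ⟪f, g⟫_ℂ = ∫ x, starRingEnd ℂ (f x) * g x ∂μ := by
  rw [L2.inner_def]
  refine integral_congr_ae (Filter.Eventually.of_forall fun x => ?_)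
  simp only [RCLike.inner_apply]
  ring

lemma integrable_norm_sq (f : Lp ℂ 2 μ) : Integrable (fun x => ‖f x‖ ^ 2) μ :=
  (Lp.memLp f).integrable_norm_pow (by norm_num)

end General

/-- Fubini's theorem on the square, split along the diagonal. This is integration by parts for
primitives of functions that are merely integrable. -/
lemma integral_mul_primitive_add {L : ℝ} {f g : ℝ → ℂ} (hf : IntegrableOn f (Ioo 0 L))
    (hg : IntegrableOn g (Ioo 0 L)) :
    (∫ t in Ioo 0 L, f t * ∫ s in Ioo 0 t, g s) + (∫ t in Ioo 0 L, (∫ s in Ioo 0 t, f s) * g t)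
      = (∫ t in Ioo 0 L, f t) * ∫ t in Ioo 0 L, g t := by
  set μ := (volume : Measure ℝ).restrict (Ioo 0 L) with hμ
  have hind : ∀ (k : ℝ → ℂ) (t : ℝ), t ∈ Ioo 0 L →
      ∫ s in Ioo 0 t, k s = ∫ s, (if s < t then k s else 0) ∂μ := by
    intro k t ht
    have : (fun s => if s < t then k s else 0) = (Iio t).indicator k := by
      ext s; simp [indicator_apply]
    rw [this, integral_indicator measurableSet_Iio, hμ, Measure.restrict_restrict measurableSet_Iio]
    congr 2
    ext s
    simp only [mem_inter_iff, mem_Iio, mem_Ioo]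
    constructor
    · rintro ⟨h1, h2⟩; exact ⟨h2, h1, h2.trans ht.2⟩
    · rintro ⟨h1, h2, _⟩; exact ⟨h2, h1⟩
  have hfg : Integrable (fun p : ℝ × ℝ => f p.1 * g p.2) (μ.prod μ) := Integrable.mul_prod hf hg
  have hms : MeasurableSet {p : ℝ × ℝ | p.2 < p.1} := measurableSet_lt measurable_snd measurable_fst
  have hF1 : Integrable (Function.uncurry fun t s => if s < t then f t * g s else 0)
      (μ.prod μ) := by
    refine (hfg.indicator hms).congr (Filter.Eventually.of_forall fun p => ?_)
    simp [Function.uncurry, indicator_apply]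
  have hms' : MeasurableSet {p : ℝ × ℝ | p.1 ≤ p.2} := measurableSet_le measurable_fst measurable_snd
  have hF2 : Integrable (Function.uncurry fun t s => if t ≤ s then f t * g s else 0)
      (μ.prod μ) := by
    refine (hfg.indicator hms').congr (Filter.Eventually.of_forall fun p => ?_)
    simp [Function.uncurry, indicator_apply]
  have e1 : (∫ t in Ioo 0 L, f t * ∫ s in Ioo 0 t, g s)
      = ∫ t, ∫ s, (if s < t then f t * g s else 0) ∂μ ∂μ := by
    refine setIntegral_congr_fun measurableSet_Ioo fun t ht => ?_
    rw [hind g t ht, ← integral_const_mul]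
    refine integral_congr_ae (Filter.Eventually.of_forall fun s => ?_)
    simp
  have e2 : (∫ s in Ioo 0 L, (∫ t in Ioo 0 s, f t) * g s)
      = ∫ t, ∫ s, (if t ≤ s then f t * g s else 0) ∂μ ∂μ := by
    rw [integral_integral_swap hF2]
    refine setIntegral_congr_fun measurableSet_Ioo fun s hs => ?_
    rw [hind f s hs, ← integral_mul_const]
    -- The primitive runs over `t < s` but the region is `t ≤ s`; the diagonal is a null set on each
    -- line.
    have hne : ∀ᵐ t ∂μ, t ≠ s := by
      rw [hμ]; exact ae_restrict_of_ae (Measure.ae_ne volume s)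
    refine integral_congr_ae ?_
    filter_upwards [hne] with t ht
    by_cases h : t < s
    · simp [h, h.le]
    · simp [h, (lt_of_le_of_ne (not_lt.mp h) ht.symm)]
  rw [e1, e2, integral_integral hF1, integral_integral hF2]
  refine (integral_add hF1 hF2).symm.trans ?_
  rw [← integral_prod_mul]
  refine integral_congr_ae (Filter.Eventually.of_forall fun p => ?_)
  by_cases h : p.2 < p.1
  · simp [Function.uncurry, h]
  · simp [Function.uncurry, h, not_lt.mp h]

section OneDim

variable {L : ℝ}

/-- Pairs `(c, g)`, standing for the function `t ↦ c + ∫₀ᵗ g` in `H¹((0, L))`. -/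
abbrev H1Interval (L : ℝ) : Type := WithLp 2 (ℂ × L2P (Ioo 0 L))

lemma measure_ne_top_restrict (L : ℝ) (s : Set ℝ) :
    (volume.restrict (Ioo 0 L)) s ≠ ⊤ := measure_ne_top _ _

/-- The value at `t`. -/
def evalAt (L t : ℝ) : H1Interval L →L[ℂ] ℂ :=
  WithLp.fstL 2 ℂ ℂ (L2P (Ioo 0 L)) +
    (innerSL ℂ (indicatorConstLp 2 (measurableSet_Ioo (a := 0) (b := t))
      (measure_ne_top_restrict L _) (1 : ℂ))) ∘L WithLp.sndL 2 ℂ ℂ (L2P (Ioo 0 L))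

lemma integrableOn_L2P (g : L2P (Ioo 0 L)) : IntegrableOn g (Ioo 0 L) :=
  (Lp.memLp g).integrable (by norm_num)

lemma evalAt_apply {t : ℝ} (ht : t ≤ L) (y : H1Interval L) :
    evalAt L t y = y.fst + ∫ s in Ioo 0 t, y.snd s := by
  have : evalAt L t y = y.fst + ⟪indicatorConstLp 2 (measurableSet_Ioo (a := 0) (b := t))
      (measure_ne_top_restrict L _) (1 : ℂ), y.snd⟫_ℂ := rfl
  rw [this, L2.inner_indicatorConstLp_one, Measure.restrict_restrict measurableSet_Ioo,
    inter_eq_left.mpr (Ioo_subset_Ioo_right ht)]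

@[simp] lemma evalAt_zero (hL : 0 ≤ L) (y : H1Interval L) : evalAt L 0 y = y.fst := by
  rw [evalAt_apply hL]; simp

/-- Cauchy–Schwarz against the indicator function of the interval; the resulting Hölder continuity
of exponent `1/2` is the source of all pointwise bounds in `H1Interval L`. -/
lemma norm_setIntegral_le (g : L2P (Ioo 0 L)) {s t : ℝ} (hst : s ≤ t) (hs : 0 ≤ s) (ht : t ≤ L) :
    ‖∫ r in Ioo s t, g r‖ ≤ Real.sqrt (t - s) * ‖g‖ := by
  have hsub : Ioo s t ⊆ Ioo 0 L := Ioo_subset_Ioo hs ht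
  have h1 : ∫ r in Ioo s t, g r = ⟪indicatorConstLp 2 (measurableSet_Ioo (a := s) (b := t))
      (measure_ne_top_restrict L _) (1 : ℂ), g⟫_ℂ := by
    rw [L2.inner_indicatorConstLp_one, Measure.restrict_restrict measurableSet_Ioo,
      inter_eq_left.mpr hsub]
  rw [h1]
  refine (norm_inner_le_norm _ _).trans (mul_le_mul_of_nonneg_right ?_ (norm_nonneg _))
  refine norm_indicatorConstLp_le.trans (le_of_eq ?_)
  rw [measureReal_def, Measure.restrict_apply measurableSet_Ioo, inter_eq_left.mpr hsub,
    Real.volume_Ioo, ENNReal.toReal_ofReal (by linarith), norm_one, one_mul, Real.sqrt_eq_rpow]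
  norm_num

lemma evalAt_sub {s t : ℝ} (hs : 0 ≤ s) (hst : s ≤ t) (ht : t ≤ L) (y : H1Interval L) :
    evalAt L t y - evalAt L s y = ∫ r in Ioo s t, y.snd r := by
  have hi : ∀ a b, 0 ≤ a → a ≤ b → b ≤ L → IntervalIntegrable y.snd volume a b := by
    intro a b ha hab hb
    rw [intervalIntegrable_iff_integrableOn_Ioo_of_le hab]
    exact (integrableOn_L2P y.snd).mono_set (Ioo_subset_Ioo ha hb)
  rw [evalAt_apply ht, evalAt_apply (hst.trans ht), add_sub_add_left_eq_sub,
    ← integral_Ioc_eq_integral_Ioo, ← integral_Ioc_eq_integral_Ioo, ← integral_Ioc_eq_integral_Ioo,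
    ← intervalIntegral.integral_of_le (hs.trans hst), ← intervalIntegral.integral_of_le hs,
    ← intervalIntegral.integral_of_le hst]
  rw [sub_eq_iff_eq_add, add_comm]
  exact (intervalIntegral.integral_add_adjacent_intervals (hi 0 s le_rfl hs (hst.trans ht))
    (hi s t hs hst ht)).symm

lemma norm_evalAt_sub_le {s t : ℝ} (hs : s ∈ Icc 0 L) (ht : t ∈ Icc 0 L) (y : H1Interval L) :
    ‖evalAt L t y - evalAt L s y‖ ≤ Real.sqrt |t - s| * ‖y.snd‖ := by
  rcases le_total s t with h | h
  · rw [evalAt_sub hs.1 h ht.2, abs_of_nonneg (by linarith)]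
    exact norm_setIntegral_le _ h hs.1 ht.2
  · rw [norm_sub_rev, evalAt_sub ht.1 h hs.2, abs_of_nonpos (by linarith), neg_sub]
    exact norm_setIntegral_le _ h ht.1 hs.2

lemma continuousOn_evalAt (y : H1Interval L) :
    ContinuousOn (fun t => evalAt L t y) (Icc 0 L) := by
  intro s hs
  rw [ContinuousWithinAt, tendsto_iff_norm_sub_tendsto_zero]
  have hlim : Filter.Tendsto (fun t => Real.sqrt |t - s| * ‖y.snd‖) (nhdsWithin s (Icc 0 L))
      (nhds 0) := by
    have : Continuous fun t => Real.sqrt |t - s| * ‖y.snd‖ := by fun_prop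
    have h := this.tendsto s
    simp only [sub_self, abs_zero, Real.sqrt_zero, zero_mul] at h
    exact h.mono_left nhdsWithin_le_nhds
  refine squeeze_zero' (Filter.Eventually.of_forall fun t => norm_nonneg _) ?_ hlim
  filter_upwards [self_mem_nhdsWithin] with t ht
  exact norm_evalAt_sub_le hs ht y

lemma norm_evalAt_le (hL : 0 ≤ L) {t : ℝ} (ht : t ∈ Icc 0 L) (y : H1Interval L) :
    ‖evalAt L t y‖ ≤ ‖y.fst‖ + Real.sqrt L * ‖y.snd‖ := by
  have h1 := norm_evalAt_sub_le (left_mem_Icc.mpr hL) ht y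
  rw [evalAt_zero hL, sub_zero] at h1
  have h2 : Real.sqrt |t| ≤ Real.sqrt L :=
    Real.sqrt_le_sqrt (by rw [abs_of_nonneg ht.1]; exact ht.2)
  have h3 : ‖evalAt L t y‖ ≤ ‖evalAt L t y - y.fst‖ + ‖y.fst‖ := by
    simpa using norm_add_le (evalAt L t y - y.fst) y.fst
  nlinarith [norm_nonneg y.snd]

lemma memLp_mul_evalAt (hL : 0 ≤ L) (w : C(ℝ, ℝ)) (y : H1Interval L) :
    MemLp (fun t => (w t : ℂ) * evalAt L t y) 2 (volume.restrict (Ioo 0 L)) := by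
  have hc : ContinuousOn (fun t => (w t : ℂ) * evalAt L t y) (Icc 0 L) :=
    ((Complex.continuous_ofReal.comp w.continuous).continuousOn).mul (continuousOn_evalAt y)
  obtain ⟨C, hC⟩ := isCompact_Icc.exists_bound_of_continuousOn hc
  refine MemLp.of_bound ((hc.mono Ioo_subset_Icc_self).aestronglyMeasurable measurableSet_Ioo) C ?_
  filter_upwards [ae_restrict_mem measurableSet_Ioo] with t ht
  exact hC t (Ioo_subset_Icc_self ht)

lemma norm_le_of_bound_Ioo (hL : 0 ≤ L) {f : L2P (Ioo 0 L)} {C : ℝ} (hC : 0 ≤ C)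
    (h : ∀ᵐ t ∂(volume.restrict (Ioo 0 L)), ‖f t‖ ≤ C) : ‖f‖ ≤ Real.sqrt L * C := by
  refine (Lp.norm_le_of_ae_bound hC h).trans (le_of_eq ?_)
  congr 1
  rw [measureUnivNNReal, ENNReal.coe_toNNReal_eq_toReal, Measure.restrict_apply_univ,
    Real.volume_Ioo, ENNReal.toReal_ofReal (by linarith), Real.sqrt_eq_rpow]
  norm_num

/-- Multiplication of the function `t ↦ c + ∫₀ᵗ g` by a weight, as a map into `L²`. -/
def weightedEmbedding (hL : 0 ≤ L) (w : C(ℝ, ℝ)) : H1Interval L →L[ℂ] L2P (Ioo 0 L) :=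
  LinearMap.mkContinuousOfExistsBound
    { toFun := fun y => (memLp_mul_evalAt hL w y).toLp _
      map_add' := fun y z => by
        rw [← MemLp.toLp_add]
        congr 1
        ext t
        simp [mul_add]
      map_smul' := fun a y => by
        rw [RingHom.id_apply, ← MemLp.toLp_const_smul]
        congr 1
        ext t
        simp [mul_left_comm] }
    (by
      obtain ⟨M, hM⟩ := isCompact_Icc.exists_bound_of_continuousOn
        (w.continuous.continuousOn (s := Icc 0 L))
      have hM0 : 0 ≤ M := (norm_nonneg _).trans (hM 0 (left_mem_Icc.mpr hL))
      refine ⟨Real.sqrt L * (M * (1 + Real.sqrt L)), fun y => ?_⟩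
      rw [mul_assoc]
      refine norm_le_of_bound_Ioo hL (by positivity) ?_
      filter_upwards [(memLp_mul_evalAt hL w y).coeFn_toLp, ae_restrict_mem measurableSet_Ioo]
        with t h1 ht
      have ht' := Ioo_subset_Icc_self ht
      have h1' : ‖((memLp_mul_evalAt hL w y).toLp _ : L2P (Ioo 0 L)) t‖
          = ‖w t‖ * ‖evalAt L t y‖ := by
        rw [h1, norm_mul, Complex.norm_real]
      refine (le_of_eq h1').trans ?_
      have h2 := norm_evalAt_le hL ht' y
      have h3 := hM t ht'
      have h4 : ‖y.fst‖ ≤ ‖y‖ := WithLp.norm_fst_le _ y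
      have h5 : ‖y.snd‖ ≤ ‖y‖ := WithLp.norm_snd_le _ y
      have h6 : ‖evalAt L t y‖ ≤ (1 + Real.sqrt L) * ‖y‖ := by
        nlinarith [Real.sqrt_nonneg L]
      rw [mul_assoc]
      exact mul_le_mul h3 h6 (norm_nonneg _) hM0)

lemma coeFn_weightedEmbedding (hL : 0 ≤ L) (w : C(ℝ, ℝ)) (y : H1Interval L) :
    weightedEmbedding hL w y =ᵐ[volume.restrict (Ioo 0 L)] fun t => (w t : ℂ) * evalAt L t y :=
  (memLp_mul_evalAt hL w y).coeFn_toLp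

end OneDim

end StrongDelta

end

/-! ### The closed form of the comparison operator on quasi-periodic functions. -/

noncomputable section

namespace StrongDelta

section SubHilbert

variable {X : Type*} [NormedAddCommGroup X] [InnerProductSpace ℂ X]

/-- A subspace of a Hilbert space, as a Hilbert space of its own. -/
def SubHilbert (K : Submodule ℂ X) : Type _ := K

instance (K : Submodule ℂ X) : NormedAddCommGroup (SubHilbert K) :=
  inferInstanceAs (NormedAddCommGroup K)

instance (K : Submodule ℂ X) : InnerProductSpace ℂ (SubHilbert K) :=
  inferInstanceAs (InnerProductSpace ℂ K)

/-- The inclusion. -/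
def SubHilbert.incl (K : Submodule ℂ X) : SubHilbert K →L[ℂ] X := K.subtypeL

/-- The element of `SubHilbert K` given by an element of `K`. -/
def SubHilbert.mk {K : Submodule ℂ X} (x : X) (hx : x ∈ K) : SubHilbert K := (⟨x, hx⟩ : K)

@[simp] lemma SubHilbert.incl_mk {K : Submodule ℂ X} (x : X) (hx : x ∈ K) :
    SubHilbert.incl K (SubHilbert.mk x hx) = x := rfl

lemma SubHilbert.incl_mem {K : Submodule ℂ X} (x : SubHilbert K) : SubHilbert.incl K x ∈ K :=
  (show K from x).2

lemma SubHilbert.incl_injective (K : Submodule ℂ X) : Function.Injective (SubHilbert.incl K) :=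
  Subtype.val_injective

lemma SubHilbert.completeSpace [CompleteSpace X] {K : Submodule ℂ X} (hK : IsClosed (K : Set X)) :
    CompleteSpace (SubHilbert K) :=
  hK.completeSpace_coe

/-- A linear map into `X` with values in `K`, as a map into `SubHilbert K`. -/
def SubHilbert.lift {E : Type*} [AddCommGroup E] [Module ℂ E] {K : Submodule ℂ X} (f : E →ₗ[ℂ] X)
    (hf : ∀ c, f c ∈ K) : E →ₗ[ℂ] SubHilbert K :=
  f.codRestrict K hf

end SubHilbert

section OneDimForm

variable {L : ℝ}

lemma memLp_of_continuousOn {f : ℝ → ℂ} (hf : ContinuousOn f (Icc 0 L)) :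
    MemLp f 2 (volume.restrict (Ioo 0 L)) := by
  obtain ⟨C, hC⟩ := isCompact_Icc.exists_bound_of_continuousOn hf
  refine MemLp.of_bound ((hf.mono Ioo_subset_Icc_self).aestronglyMeasurable measurableSet_Ioo) C ?_
  filter_upwards [ae_restrict_mem measurableSet_Ioo] with t ht
  exact hC t (Ioo_subset_Icc_self ht)

/-- The element of `H¹((0, L))` given by a differentiable function. -/
def ofDeriv (L : ℝ) (f f' : ℝ → ℂ) (hf' : ContinuousOn f' (Icc 0 L)) : H1Interval L :=
  WithLp.toLp 2 (f 0, (memLp_of_continuousOn hf').toLp f')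

lemma ofDeriv_fst (f f' : ℝ → ℂ) (hf' : ContinuousOn f' (Icc 0 L)) :
    (ofDeriv L f f' hf').fst = f 0 := rfl

lemma coeFn_ofDeriv_snd (f f' : ℝ → ℂ) (hf' : ContinuousOn f' (Icc 0 L)) :
    (ofDeriv L f f' hf').snd =ᵐ[volume.restrict (Ioo 0 L)] f' :=
  (memLp_of_continuousOn hf').coeFn_toLp

lemma evalAt_ofDeriv {f f' : ℝ → ℂ} (hf' : ContinuousOn f' (Icc 0 L))
    (hf : ∀ t ∈ Icc 0 L, HasDerivWithinAt f (f' t) (Icc 0 L) t) {t : ℝ} (ht : t ∈ Icc 0 L) :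
    evalAt L t (ofDeriv L f f' hf') = f t := by
  rw [evalAt_apply ht.2, ofDeriv_fst]
  have h1 : ∫ s in Ioo 0 t, (ofDeriv L f f' hf').snd s = ∫ s in Ioo 0 t, f' s :=
    integral_congr_ae (ae_restrict_of_ae_restrict_of_subset (Ioo_subset_Ioo_right ht.2)
      (coeFn_ofDeriv_snd f f' hf'))
  have hsub : Icc 0 t ⊆ Icc 0 L := Icc_subset_Icc_right ht.2
  rw [h1, ← integral_Ioc_eq_integral_Ioo, ← intervalIntegral.integral_of_le ht.1,
    intervalIntegral.integral_eq_sub_of_hasDerivAt_of_le ht.1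
      (fun s hs => ((hf s (hsub hs)).continuousWithinAt.mono hsub))
      (fun s hs => (hf s (hsub (Ioo_subset_Icc_self hs))).hasDerivAt
        (Icc_mem_nhds hs.1 (hs.2.trans_le ht.2)))
      ((hf'.mono hsub).intervalIntegrable_of_Icc ht.1)]
  ring

/-- The left side is the integral of the derivative of `ȳ z`. -/
lemma inner_by_parts (hL : 0 ≤ L) (y z : H1Interval L) :
    ⟪y.snd, weightedEmbedding hL 1 z⟫_ℂ + ⟪weightedEmbedding hL 1 y, z.snd⟫_ℂ
      = starRingEnd ℂ (evalAt L L y) * evalAt L L z - starRingEnd ℂ y.fst * z.fst := by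
  have hy := integrableOn_L2P y.snd
  have hz := integrableOn_L2P z.snd
  have hyc : IntegrableOn (fun t => starRingEnd ℂ (y.snd t)) (Ioo 0 L) :=
    (LinearIsometryEquiv.integrable_comp_iff Complex.conjLIE).mpr hy
  have e1 : ⟪y.snd, weightedEmbedding hL 1 z⟫_ℂ
      = ∫ t in Ioo 0 L, (starRingEnd ℂ (y.snd t) * z.fst +
          starRingEnd ℂ (y.snd t) * ∫ s in Ioo 0 t, z.snd s) := by
    rw [inner_eq_integral]
    refine integral_congr_ae ?_
    filter_upwards [coeFn_weightedEmbedding hL 1 z, ae_restrict_mem measurableSet_Ioo] with t h ht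
    rw [h, evalAt_apply ht.2.le]
    simp [mul_add]
  have e2 : ⟪weightedEmbedding hL 1 y, z.snd⟫_ℂ
      = ∫ t in Ioo 0 L, (starRingEnd ℂ y.fst * z.snd t +
          (∫ s in Ioo 0 t, starRingEnd ℂ (y.snd s)) * z.snd t) := by
    rw [inner_eq_integral]
    refine integral_congr_ae ?_
    filter_upwards [coeFn_weightedEmbedding hL 1 y, ae_restrict_mem measurableSet_Ioo] with t h ht
    rw [h, evalAt_apply ht.2.le]
    simp [add_mul, integral_conj]
  have hcont : ∀ (k : L2P (Ioo 0 L)), ContinuousOn (fun t => ∫ s in Ioo 0 t, k s) (Icc 0 L) := by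
    intro k
    refine (continuousOn_evalAt (WithLp.toLp 2 ((0 : ℂ), k))).congr fun t ht => ?_
    simp only
    rw [evalAt_apply ht.2]
    simp
  have hmul : ∀ {f : ℝ → ℂ} {k : ℝ → ℂ}, IntegrableOn f (Ioo 0 L) → ContinuousOn k (Icc 0 L) →
      IntegrableOn (fun t => f t * k t) (Ioo 0 L) := by
    intro f k hf hk
    rw [← integrableOn_Icc_iff_integrableOn_Ioo] at hf ⊢
    exact hf.mul_continuousOn hk isCompact_Icc
  have i1 := hmul hyc (hcont z.snd)
  have i2 : IntegrableOn (fun t => (∫ s in Ioo 0 t, starRingEnd ℂ (y.snd s)) * z.snd t)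
      (Ioo 0 L) := by
    have := hmul hz (Complex.continuous_conj.comp_continuousOn (hcont y.snd))
    refine this.congr (Filter.Eventually.of_forall fun t => ?_)
    simp only [Function.comp_apply, integral_conj, mul_comm]
  rw [e1, e2, integral_add (hyc.mul_const _) i1, integral_add (hz.const_mul _) i2,
    integral_mul_const, integral_const_mul]
  have key := integral_mul_primitive_add hyc hz
  have hy' : ∫ t in Ioo 0 L, starRingEnd ℂ (y.snd t) = starRingEnd ℂ (∫ t in Ioo 0 L, y.snd t) :=
    integral_conj
  rw [evalAt_apply le_rfl, evalAt_apply le_rfl, map_add, ← hy']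
  linear_combination key

/-- The functions in `H¹((0, L))` with `h(L) = e^{iθ} h(0)`. -/
def quasiPeriodic (L θ : ℝ) : Submodule ℂ (H1Interval L) :=
  LinearMap.ker (evalAt L L - Complex.exp (Complex.I * θ) •
    WithLp.fstL 2 ℂ ℂ (L2P (Ioo 0 L))).toLinearMap

lemma mem_quasiPeriodic {θ : ℝ} {y : H1Interval L} :
    y ∈ quasiPeriodic L θ ↔ evalAt L L y = Complex.exp (Complex.I * θ) * y.fst := by
  rw [quasiPeriodic, LinearMap.mem_ker]
  exact sub_eq_zero

/-- The form domain of the comparison operator. -/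
abbrev ComparisonDomain (L θ : ℝ) : Type := SubHilbert (quasiPeriodic L θ)

instance (L θ : ℝ) : CompleteSpace (ComparisonDomain L θ) :=
  SubHilbert.completeSpace (ContinuousLinearMap.isClosed_ker (evalAt L L -
    Complex.exp (Complex.I * θ) • WithLp.fstL 2 ℂ ℂ (L2P (Ioo 0 L))))

/-- The embedding of the form domain of the comparison operator into `L²`. -/
def comparisonEmbedding (hL : 0 ≤ L) (θ : ℝ) : ComparisonDomain L θ →L[ℂ] L2P (Ioo 0 L) :=
  weightedEmbedding hL 1 ∘L SubHilbert.incl _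

/-- The form `∫ |h'|² - ∫ w² |h|²` of the comparison operator. -/
def comparisonForm (hL : 0 ≤ L) (w : C(ℝ, ℝ)) (θ : ℝ) :
    ComparisonDomain L θ →L[ℂ] ComparisonDomain L θ :=
  let D : ComparisonDomain L θ →L[ℂ] L2P (Ioo 0 L) :=
    WithLp.sndL 2 ℂ ℂ (L2P (Ioo 0 L)) ∘L SubHilbert.incl _
  let S : ComparisonDomain L θ →L[ℂ] L2P (Ioo 0 L) :=
    weightedEmbedding hL w ∘L SubHilbert.incl _
  ContinuousLinearMap.adjoint D ∘L D - ContinuousLinearMap.adjoint S ∘L S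

lemma inner_comparisonForm (hL : 0 ≤ L) (w : C(ℝ, ℝ)) (θ : ℝ) (x y : ComparisonDomain L θ) :
    ⟪x, comparisonForm hL w θ y⟫_ℂ =
      ⟪(SubHilbert.incl _ x).snd, (SubHilbert.incl _ y).snd⟫_ℂ
      - ⟪weightedEmbedding hL w (SubHilbert.incl _ x),
          weightedEmbedding hL w (SubHilbert.incl _ y)⟫_ℂ := by
  simp only [comparisonForm, sub_apply, ContinuousLinearMap.comp_apply,
    inner_sub_right, ContinuousLinearMap.adjoint_inner_right]
  rfl

lemma re_inner_comparisonForm (hL : 0 ≤ L) (w : C(ℝ, ℝ)) (θ : ℝ) (x : ComparisonDomain L θ) :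
    (⟪x, comparisonForm hL w θ x⟫_ℂ).re = ‖(SubHilbert.incl _ x).snd‖ ^ 2
      - ‖weightedEmbedding hL w (SubHilbert.incl _ x)‖ ^ 2 := by
  rw [inner_comparisonForm, inner_self_eq_norm_sq_to_K, inner_self_eq_norm_sq_to_K]
  norm_cast

lemma inner_weightedEmbedding (hL : 0 ≤ L) (w : C(ℝ, ℝ)) (x y : H1Interval L) :
    ⟪weightedEmbedding hL w x, weightedEmbedding hL w y⟫_ℂ
      = ⟪weightedEmbedding hL 1 x, weightedEmbedding hL (w * w) y⟫_ℂ := by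
  rw [inner_eq_integral, inner_eq_integral]
  refine integral_congr_ae ?_
  filter_upwards [coeFn_weightedEmbedding hL w x, coeFn_weightedEmbedding hL w y,
    coeFn_weightedEmbedding hL 1 x, coeFn_weightedEmbedding hL (w * w) y] with t h1 h2 h3 h4
  rw [h1, h2, h3, h4]
  simp only [map_mul, Complex.conj_ofReal, ContinuousMap.mul_apply, ContinuousMap.one_apply,
    Complex.ofReal_one, Complex.ofReal_mul, map_one]
  ring

lemma norm_sq_weightedEmbedding_le (hL : 0 ≤ L) {w : C(ℝ, ℝ)} {M : ℝ}
    (hM : ∀ t ∈ Icc 0 L, |w t| ≤ M) (y : H1Interval L) :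
    ‖weightedEmbedding hL w y‖ ^ 2 ≤ M ^ 2 * ‖weightedEmbedding hL 1 y‖ ^ 2 := by
  rw [norm_sq_eq_integral_norm_sq, norm_sq_eq_integral_norm_sq, ← integral_const_mul]
  refine integral_mono_ae (integrable_norm_sq _) ((integrable_norm_sq _).const_mul _) ?_
  filter_upwards [coeFn_weightedEmbedding hL w y, coeFn_weightedEmbedding hL 1 y,
    ae_restrict_mem measurableSet_Ioo] with t h1 h2 ht
  rw [h1, h2]
  simp only [norm_mul, Complex.norm_real, mul_pow, ContinuousMap.one_apply, norm_one, one_pow,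
    one_mul, Real.norm_eq_abs]
  exact mul_le_mul_of_nonneg_right
    (pow_le_pow_left₀ (abs_nonneg _) (hM t (Ioo_subset_Icc_self ht)) 2) (sq_nonneg _)

/-- Square `|y(0)| ≤ |y(t)| + √L ‖y'‖` and average over `t`. The estimate gives coercivity of the
one-dimensional form and, on horizontal segments, the trace inequality on the side of the strip. -/
lemma norm_sq_fst_le (hL : 0 < L) (y : H1Interval L) :
    ‖y.fst‖ ^ 2 ≤ 2 / L * ‖weightedEmbedding hL.le 1 y‖ ^ 2 + 2 * L * ‖y.snd‖ ^ 2 := by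
  have h : L * ‖y.fst‖ ^ 2 ≤ 2 * ‖weightedEmbedding hL.le 1 y‖ ^ 2 + L * (2 * L * ‖y.snd‖ ^ 2) := by
    have hvol : ∀ c : ℝ, ∫ _ in Ioo 0 L, c = L * c := fun c => by
      simp [hL.le]
    rw [← hvol, ← hvol, norm_sq_eq_integral_norm_sq (weightedEmbedding hL.le 1 y),
      ← integral_const_mul, ← integral_add ((integrable_norm_sq _).const_mul _)
        (integrable_const _)]
    refine integral_mono_ae (integrable_const _)
      (((integrable_norm_sq _).const_mul _).add (integrable_const _)) ?_
    filter_upwards [coeFn_weightedEmbedding hL.le 1 y, ae_restrict_mem measurableSet_Ioo]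
      with t h1 ht
    have h2 := norm_evalAt_sub_le (left_mem_Icc.mpr hL.le) (Ioo_subset_Icc_self ht) y
    rw [evalAt_zero hL.le, sub_zero, abs_of_pos ht.1] at h2
    have h3 : ‖y.fst‖ ≤ ‖evalAt L t y‖ + Real.sqrt L * ‖y.snd‖ := by
      have e := norm_sub_norm_le y.fst (evalAt L t y)
      rw [norm_sub_rev] at e
      have := Real.sqrt_le_sqrt ht.2.le
      nlinarith [norm_nonneg y.snd]
    have h4 : ‖weightedEmbedding hL.le 1 y t‖ = ‖evalAt L t y‖ := by rw [h1]; simp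
    simp only [h4]
    have h5 := Real.sq_sqrt hL.le
    calc ‖y.fst‖ ^ 2 ≤ (‖evalAt L t y‖ + Real.sqrt L * ‖y.snd‖) ^ 2 :=
          pow_le_pow_left₀ (norm_nonneg _) h3 2
      _ ≤ 2 * ‖evalAt L t y‖ ^ 2 + 2 * (Real.sqrt L * ‖y.snd‖) ^ 2 := by
          nlinarith [sq_nonneg (‖evalAt L t y‖ - Real.sqrt L * ‖y.snd‖)]
      _ = 2 * ‖evalAt L t y‖ ^ 2 + 2 * L * ‖y.snd‖ ^ 2 := by rw [mul_pow, h5]; ring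
  have h2 : ‖y.fst‖ ^ 2 ≤ (2 * ‖weightedEmbedding hL.le 1 y‖ ^ 2
      + L * (2 * L * ‖y.snd‖ ^ 2)) / L := by
    rw [le_div_iff₀ hL]; linarith
  refine h2.trans (le_of_eq ?_)
  field_simp

/-- A continuous function that vanishes almost everywhere vanishes, and then so does its derivative
by Lebesgue's differentiation theorem. -/
lemma weightedEmbedding_one_injective (hL : 0 < L) :
    Function.Injective (weightedEmbedding hL.le 1) := by
  rw [injective_iff_map_eq_zero]
  intro y hy
  have h0 : ∀ t ∈ Icc 0 L, evalAt L t y = 0 := by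
    have hae : (fun t => evalAt L t y) =ᵐ[volume.restrict (Icc 0 L)] fun _ => 0 := by
      rw [← Measure.restrict_congr_set Ioo_ae_eq_Icc]
      have h1 := coeFn_weightedEmbedding hL.le 1 y
      rw [hy] at h1
      filter_upwards [h1, Lp.coeFn_zero ℂ 2 (volume.restrict (Ioo 0 L))] with t e1 e2
      rw [e2] at e1
      simpa using e1.symm
    exact Measure.eqOn_Icc_of_ae_eq volume hL.ne hae (continuousOn_evalAt y) continuousOn_const
  have hfst : y.fst = 0 := by rw [← evalAt_zero hL.le y]; exact h0 0 (left_mem_Icc.mpr hL.le)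
  have hii : IntervalIntegrable y.snd volume 0 L := by
    rw [intervalIntegrable_iff_integrableOn_Ioo_of_le hL.le]; exact integrableOn_L2P _
  have hsnd : y.snd = 0 := by
    refine Lp.ext ?_
    have h2 := hii.ae_hasDerivAt_integral
    filter_upwards [ae_restrict_of_ae h2, ae_restrict_mem measurableSet_Ioo,
      Lp.coeFn_zero ℂ 2 (volume.restrict (Ioo 0 L))] with t h3 ht hz
    rw [hz]
    have h4 := h3 (by rw [uIcc_of_le hL.le]; exact Ioo_subset_Icc_self ht) 0 left_mem_uIcc
    have h5 : HasDerivAt (fun x => ∫ t in (0 : ℝ)..x, y.snd t) 0 t := by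
      refine (hasDerivAt_const t (0 : ℂ)).congr_of_eventuallyEq ?_
      filter_upwards [Ioo_mem_nhds ht.1 ht.2] with s hs
      have h6 := h0 s (Ioo_subset_Icc_self hs)
      rw [evalAt_apply hs.2.le, hfst, zero_add] at h6
      rw [intervalIntegral.integral_of_le hs.1.le, integral_Ioc_eq_integral_Ioo, h6]
    exact h4.unique h5
  exact (WithLp.ofLp_injective 2) (Prod.ext hfst hsnd)

/-- Functions supported inside `(0, L)` satisfy the quasi-periodic condition for every `θ`; they
provide the density of the form domain. -/
lemma exists_smooth_quasiPeriodic (hL : 0 < L) (θ : ℝ) {φ : ℝ → ℝ} (hφ : ContDiff ℝ ∞ φ)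
    (hs : tsupport φ ⊆ Ioo 0 L) :
    ∃ x : ComparisonDomain L θ, comparisonEmbedding hL.le θ x
      =ᵐ[volume.restrict (Ioo 0 L)] fun t => (φ t : ℂ) := by
  have hd : ∀ t, HasDerivAt (fun t => (φ t : ℂ)) ((deriv φ t : ℝ) : ℂ) t := fun t =>
    (hφ.differentiable (by simp) t).hasDerivAt.ofReal_comp
  have hc : Continuous fun t => ((deriv φ t : ℝ) : ℂ) :=
    Complex.continuous_ofReal.comp (hφ.continuous_deriv (by simp))
  have hz : ∀ t, t ∉ Ioo 0 L → φ t = 0 := fun t ht => image_eq_zero_of_notMem_tsupport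
    fun h => ht (hs h)
  have hev : ∀ t ∈ Icc 0 L, evalAt L t (ofDeriv L _ _ hc.continuousOn) = φ t := fun t ht =>
    evalAt_ofDeriv hc.continuousOn (fun t _ => (hd t).hasDerivWithinAt) ht
  refine ⟨SubHilbert.mk (ofDeriv L (fun t => (φ t : ℂ)) _ hc.continuousOn) ?_, ?_⟩
  · rw [mem_quasiPeriodic, hev L (right_mem_Icc.mpr hL.le), ofDeriv_fst, hz L (by simp),
      hz 0 (by simp)]
    simp
  · filter_upwards [coeFn_weightedEmbedding hL.le 1 (ofDeriv L (fun t => (φ t : ℂ)) _ hc.continuousOn),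
      ae_restrict_mem measurableSet_Ioo] with t h1 ht
    refine h1.trans ?_
    have := hev t (Ioo_subset_Icc_self ht)
    rw [this]
    simp

lemma denseRange_comparisonEmbedding (hL : 0 < L) (θ : ℝ) :
    DenseRange (comparisonEmbedding hL.le θ) := by
  have h : (LinearMap.range (comparisonEmbedding hL.le θ).toLinearMap).topologicalClosure = ⊤ := by
    rw [Submodule.topologicalClosure_eq_top_iff, Submodule.eq_bot_iff]
    intro u hu
    have hloc : LocallyIntegrableOn u (Ioo 0 L) volume :=
      (integrableOn_L2P u).locallyIntegrableOn
    have key : ∀ᵐ t ∂(volume : Measure ℝ), t ∈ Ioo 0 L → u t = 0 := by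
      refine isOpen_Ioo.ae_eq_zero_of_integral_contDiff_smul_eq_zero hloc ?_
      intro φ hφ _ hs
      obtain ⟨x, hx⟩ := exists_smooth_quasiPeriodic hL θ hφ hs
      have h1 : ⟪comparisonEmbedding hL.le θ x, u⟫_ℂ = 0 := hu _ ⟨x, rfl⟩
      rw [inner_eq_integral] at h1
      have h2 : ∫ t, φ t • u t = ∫ t in Ioo 0 L, φ t • u t := by
        refine (setIntegral_eq_integral_of_forall_compl_eq_zero fun t ht => ?_).symm
        rw [image_eq_zero_of_notMem_tsupport fun h => ht (hs h), zero_smul]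
      rw [h2, ← h1]
      refine integral_congr_ae ?_
      filter_upwards [hx] with t ht
      rw [ht, Complex.conj_ofReal, Complex.real_smul]
    refine Lp.ext ?_
    filter_upwards [(ae_restrict_iff' measurableSet_Ioo).mpr key,
      Lp.coeFn_zero ℂ 2 (volume.restrict (Ioo 0 L))] with t h1 h2
    rw [h1, h2]; rfl
  have := Submodule.dense_iff_topologicalClosure_eq_top.mpr h
  exact this

lemma exists_abs_le_of_continuous (w : C(ℝ, ℝ)) (L : ℝ) :
    ∃ M ≥ 0, ∀ t ∈ Icc 0 L, |w t| ≤ M := by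
  obtain ⟨M, hM⟩ := isCompact_Icc.exists_bound_of_continuousOn
    (w.continuous.continuousOn (s := Icc 0 L))
  exact ⟨max M 0, le_max_right _ _, fun t ht => (hM t ht).trans (le_max_left _ _)⟩

lemma isClosedForm_comparison (hL : 0 < L) (w : C(ℝ, ℝ)) (θ : ℝ) :
    IsClosedForm (comparisonEmbedding hL.le θ) (comparisonForm hL.le w θ) where
  symm x y := by
    rw [← inner_conj_symm, inner_comparisonForm, inner_comparisonForm, map_sub, inner_conj_symm,
      inner_conj_symm]
  coercive := by
    obtain ⟨M, hM0, hM⟩ := exists_abs_le_of_continuous w L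
    refine ⟨1 / (1 + 2 * L), by positivity, M ^ 2 + 2 / L, fun x => ?_⟩
    rw [re_inner_comparisonForm]
    have h1 := norm_sq_weightedEmbedding_le hL.le hM (SubHilbert.incl _ x)
    have h2 := norm_sq_fst_le hL (SubHilbert.incl _ x)
    have h3 : ‖x‖ ^ 2 = ‖(SubHilbert.incl _ x).fst‖ ^ 2 + ‖(SubHilbert.incl _ x).snd‖ ^ 2 :=
      WithLp.prod_norm_sq_eq_of_L2 (SubHilbert.incl _ x)
    have h4 : comparisonEmbedding hL.le θ x = weightedEmbedding hL.le 1 (SubHilbert.incl _ x) := rfl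
    rw [h3, h4]
    set a := ‖(SubHilbert.incl _ x).fst‖ ^ 2
    set b := ‖(SubHilbert.incl _ x).snd‖ ^ 2
    set e := ‖weightedEmbedding hL.le 1 (SubHilbert.incl _ x)‖ ^ 2 with he
    have he0 : 0 ≤ e := sq_nonneg _
    have h5 : 1 / (1 + 2 * L) * (a + b) ≤ b + 2 / L * e := by
      rw [div_mul_eq_mul_div, one_mul, div_le_iff₀ (by positivity)]
      have : 0 ≤ 2 / L * e * (2 * L) := by positivity
      nlinarith
    linarith
  injective := (weightedEmbedding_one_injective hL).comp (SubHilbert.incl_injective _)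
  denseRange := denseRange_comparisonEmbedding hL θ

end OneDimForm

end StrongDelta

end

/-! ### Identification of the comparison operator, and its growth on kernels of point evaluations.
-/

noncomputable section

namespace StrongDelta

section OneDimOperator

variable {L : ℝ}

lemma conj_exp_mul_exp (θ : ℝ) :
    starRingEnd ℂ (Complex.exp (Complex.I * θ)) * Complex.exp (Complex.I * θ) = 1 := by
  rw [← Complex.exp_conj, ← Complex.exp_add]
  simp

lemma hasDerivWithinAt_evalAt {y : H1Interval L} {f₁ : ℝ → ℂ} (hf₁ : ContinuousOn f₁ (Icc 0 L))
    (hy : y.snd =ᵐ[volume.restrict (Ioo 0 L)] f₁) {t : ℝ} (ht : t ∈ Icc 0 L) :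
    HasDerivWithinAt (fun t => evalAt L t y) (f₁ t) (Icc 0 L) t := by
  have hL : 0 ≤ L := ht.1.trans ht.2
  set k : ℝ → ℂ := IccExtend hL ((Icc 0 L).domRestrict f₁) with hk
  have hkc : Continuous k := (continuousOn_iff_continuous_domRestrict.mp hf₁).Icc_extend'
  have hke : ∀ s ∈ Icc 0 L, k s = f₁ s := fun s hs => IccExtend_of_mem hL _ hs
  have h1 : HasDerivAt (fun t => y.fst + ∫ s in (0 : ℝ)..t, k s) (k t) t :=
    (intervalIntegral.integral_hasDerivAt_right (hkc.intervalIntegrable _ _)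
      (hkc.stronglyMeasurableAtFilter _ _) hkc.continuousAt).const_add _
  rw [← hke t ht]
  refine h1.hasDerivWithinAt.congr_of_mem (fun s hs => ?_) ht
  rw [evalAt_apply hs.2, intervalIntegral.integral_of_le hs.1, integral_Ioc_eq_integral_Ioo]
  congr 1
  refine integral_congr_ae ?_
  filter_upwards [ae_restrict_of_ae_restrict_of_subset (Ioo_subset_Ioo_right hs.2) hy,
    ae_restrict_mem measurableSet_Ioo] with r h1 hr
  rw [h1, hke r ⟨hr.1.le, hr.2.le.trans hs.2⟩]

lemma comparisonEmbedding_apply (hL : 0 ≤ L) (θ : ℝ) (x : ComparisonDomain L θ) :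
    comparisonEmbedding hL θ x = weightedEmbedding hL 1 (SubHilbert.incl _ x) := rfl

set_option maxHeartbeats 800000 in
/-- The operator associated with the form has the domain `H²` with the quasi-periodic conditions.
The second half records the regularity of its elements. -/
lemma comparisonGraph_of_form (hL : 0 < L) {γ : ℝ → ℝ} {w : C(ℝ, ℝ)} (hw : ∀ t, w t = γ t / 2)
    (θ : ℝ) {p : L2P (Ioo 0 L) × L2P (Ioo 0 L)} {x : ComparisonDomain L θ}
    (hx : comparisonEmbedding hL.le θ x = p.1)
    (h : ∀ y, ⟪y, comparisonForm hL.le w θ x⟫_ℂ = ⟪comparisonEmbedding hL.le θ y, p.2⟫_ℂ) :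
    p ∈ comparisonGraph γ L θ ∧
      ∃ f₁ : ℝ → ℂ, ContinuousOn f₁ (Icc 0 L) ∧
        (SubHilbert.incl _ x).snd =ᵐ[volume.restrict (Ioo 0 L)] f₁ := by
  set X : H1Interval L := SubHilbert.incl _ x with hX
  set e := Complex.exp (Complex.I * θ) with he
  set r : L2P (Ioo 0 L) := p.2 + weightedEmbedding hL.le (w * w) X with hr
  -- The expected equation is `X'' = -r`. The primitive `z0` of `-r` should therefore differ from
  -- `X'` by a constant, and `d` is this difference.
  set z0 : H1Interval L := WithLp.toLp 2 ((0 : ℂ), -r) with hz0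
  set d : L2P (Ioo 0 L) := X.snd - weightedEmbedding hL.le 1 z0 with hd
  have key : ∀ y : H1Interval L, y ∈ quasiPeriodic L θ →
      ⟪y.snd, d⟫_ℂ = -(starRingEnd ℂ (evalAt L L y) * evalAt L L z0) := by
    intro y hy
    have h1 := h (SubHilbert.mk y hy)
    rw [inner_comparisonForm, SubHilbert.incl_mk, comparisonEmbedding_apply, SubHilbert.incl_mk,
      inner_weightedEmbedding] at h1
    have h2 := inner_by_parts hL.le y z0
    have h3 : ⟪weightedEmbedding hL.le 1 y, z0.snd⟫_ℂ
        = -(⟪weightedEmbedding hL.le 1 y, p.2⟫_ℂ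
          + ⟪weightedEmbedding hL.le 1 y, weightedEmbedding hL.le (w * w) X⟫_ℂ) := by
      rw [← inner_add_right, ← inner_neg_right]
      rfl
    rw [h3, ← h1] at h2
    have h4 : z0.fst = 0 := rfl
    rw [h4, mul_zero, sub_zero] at h2
    rw [hd, inner_sub_right, ← h2]
    ring
  set one : L2P (Ioo 0 L) := indicatorConstLp 2 (measurableSet_Ioo (a := 0) (b := L))
      (measure_ne_top_restrict L _) (1 : ℂ) with hone
  have hone_in : ∀ k : L2P (Ioo 0 L), ⟪one, k⟫_ℂ = evalAt L L (WithLp.toLp 2 ((0 : ℂ), k)) := by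
    intro k
    rw [hone, L2.inner_indicatorConstLp_one, evalAt_apply le_rfl,
      Measure.restrict_restrict measurableSet_Ioo, inter_self]
    simp
  have hone_one : ⟪one, one⟫_ℂ = L := by
    rw [hone, L2.inner_indicatorConstLp_one_indicatorConstLp_one, measureReal_def, inter_self,
      Measure.restrict_apply measurableSet_Ioo, inter_self, Real.volume_Ioo,
      ENNReal.toReal_ofReal (by linarith)]
    simp
  have hone_ae : one =ᵐ[volume.restrict (Ioo 0 L)] fun _ => 1 := by
    filter_upwards [indicatorConstLp_coeFn (p := 2) (hs := measurableSet_Ioo (a := 0) (b := L))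
      (hμs := measure_ne_top_restrict L _) (c := (1 : ℂ)), ae_restrict_mem measurableSet_Ioo]
      with t h1 ht
    rw [h1, indicator_of_mem ht]
  have hLc : (L : ℂ) ≠ 0 := by exact_mod_cast hL.ne'
  set m : ℂ := ⟪one, d⟫_ℂ / L with hm
  -- The du Bois-Reymond argument: `d` is orthogonal to every `k` of mean zero, because the
  -- primitive of such a `k` vanishes at both ends and is an admissible test function. Hence `d` is
  -- constant.
  have hdm : d = m • one := by
    set k := d - m • one with hk
    have h1 : ⟪one, k⟫_ℂ = 0 := by
      rw [hk, inner_sub_right, inner_smul_right, hone_one, hm]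
      field_simp
      simp
    have h2 : ⟪k, d⟫_ℂ = 0 := by
      have h3 := hone_in k
      rw [h1] at h3
      have := key (WithLp.toLp 2 ((0 : ℂ), k)) (by
        rw [mem_quasiPeriodic, ← h3]
        simp)
      rw [← h3] at this
      simpa using this
    have h4 : ⟪k, k⟫_ℂ = 0 := by
      conv_lhs => rw [show k = d - m • one from hk]
      rw [← hk, inner_sub_left, inner_smul_left, h1, ← inner_conj_symm d k, h2]
      simp
    have h5 : k = 0 := inner_self_eq_zero.mp h4
    rw [hk, sub_eq_zero] at h5
    exact h5
  set z : H1Interval L := WithLp.toLp 2 (m, -r) with hz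
  have hzt : ∀ t, evalAt L t z = m + evalAt L t z0 := by
    intro t
    have : z = WithLp.toLp 2 (m, (0 : L2P (Ioo 0 L))) + z0 := by
      rw [hz, hz0, ← WithLp.toLp_add]; simp
    rw [this, map_add]
    congr 1
    simp [evalAt]
  have hXsnd : X.snd =ᵐ[volume.restrict (Ioo 0 L)] fun t => evalAt L t z := by
    have h1 : X.snd = weightedEmbedding hL.le 1 z0 + m • one := by
      rw [← hdm, hd]; abel
    rw [h1]
    filter_upwards [Lp.coeFn_add (weightedEmbedding hL.le 1 z0) (m • one),
      Lp.coeFn_smul m one, hone_ae, coeFn_weightedEmbedding hL.le 1 z0] with t e1 e2 e3 e4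
    rw [e1, Pi.add_apply, e2, Pi.smul_apply, e3, e4, hzt, ContinuousMap.one_apply,
      Complex.ofReal_one, one_mul, smul_eq_mul, mul_one, add_comm]
  have hcz := continuousOn_evalAt z
  refine ⟨⟨fun t => evalAt L t X, fun t => evalAt L t z, -r, ?_,
    fun t ht => hasDerivWithinAt_evalAt hcz hXsnd ht, fun t ht => ?_, ?_, ?_, ?_⟩, _, hcz, hXsnd⟩
  · rw [← hx, comparisonEmbedding_apply]
    filter_upwards [coeFn_weightedEmbedding hL.le 1 X] with t h1
    rw [h1]; simp
  · simp only
    rw [evalAt_zero hL.le, evalAt_apply ht.2]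
    rfl
  · simp only
    rw [evalAt_zero hL.le]
    exact mem_quasiPeriodic.mp (SubHilbert.incl_mem x)
  · simp only
    rw [evalAt_zero hL.le, hzt]
    show m + evalAt L L z0 = e * m
    -- The affine function from `1` to `e^{iθ}`: the one test direction with nonzero boundary values
    -- yields the boundary condition on the derivative.
    set y : H1Interval L := WithLp.toLp 2 ((1 : ℂ), ((e - 1) / L) • one) with hy
    have hyL : evalAt L L y = e := by
      have h1 : y = WithLp.toLp 2 ((1 : ℂ), (0 : L2P (Ioo 0 L)))
          + WithLp.toLp 2 ((0 : ℂ), ((e - 1) / L) • one) := by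
        rw [← WithLp.toLp_add]; simp [hy]
      rw [h1, map_add, ← hone_in, inner_smul_right, hone_one, div_mul_cancel₀ _ hLc]
      simp [evalAt]
    have h2 := key y (by rw [mem_quasiPeriodic, hyL, hy, ← he]; simp)
    rw [hyL, hdm] at h2
    have h3 : ⟪y.snd, m • one⟫_ℂ = m * starRingEnd ℂ (e - 1) := by
      show ⟪((e - 1) / (L : ℂ)) • one, m • one⟫_ℂ = _
      rw [inner_smul_left, inner_smul_right, hone_one, map_div₀, Complex.conj_ofReal]
      field_simp
    rw [h3, map_sub, map_one] at h2
    have h4 := conj_exp_mul_exp θ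
    rw [← he] at h4
    linear_combination e * h2 - (evalAt L L z0 + m) * h4
  · filter_upwards [Lp.coeFn_neg r, Lp.coeFn_add p.2 (weightedEmbedding hL.le (w * w) X),
      coeFn_weightedEmbedding hL.le (w * w) X] with t e1 e2 e3
    rw [e1, Pi.neg_apply, hr, e2, Pi.add_apply, e3]
    simp only [ContinuousMap.mul_apply, hw]
    push_cast
    ring

/-- One inclusion is the regularity statement `comparisonGraph_of_form`. In the other, integration
by parts leaves boundary terms at `0` and `L` that cancel because `|e^{iθ}| = 1`. -/
lemma isFormGraph_comparison (hL : 0 < L) {γ : ℝ → ℝ} {w : C(ℝ, ℝ)} (hw : ∀ t, w t = γ t / 2)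
    (θ : ℝ) : IsFormGraph (comparisonEmbedding hL.le θ) (comparisonForm hL.le w θ)
      (comparisonGraph γ L θ) := by
  intro p
  refine ⟨?_, fun ⟨x, hx, h⟩ => (comparisonGraph_of_form hL hw θ hx h).1⟩
  rintro ⟨f, f₁, g, h1, h2, h3, h4, h5, h6⟩
  set z : H1Interval L := WithLp.toLp 2 (f₁ 0, g) with hz
  have hzt : ∀ t ∈ Icc 0 L, evalAt L t z = f₁ t := fun t ht => by
    rw [evalAt_apply ht.2, h3 t ht]
    rfl
  have hc : ContinuousOn f₁ (Icc 0 L) :=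
    (continuousOn_evalAt z).congr fun t ht => (hzt t ht).symm
  set X := ofDeriv L f f₁ hc with hX
  have hXt : ∀ t ∈ Icc 0 L, evalAt L t X = f t := fun t ht => evalAt_ofDeriv hc h2 ht
  have hL' : L ∈ Icc 0 L := right_mem_Icc.mpr hL.le
  have hXm : X ∈ quasiPeriodic L θ := by
    rw [mem_quasiPeriodic, hXt L hL', h4]; rfl
  have hXs : X.snd = weightedEmbedding hL.le 1 z := by
    refine Lp.ext ?_
    filter_upwards [coeFn_ofDeriv_snd f f₁ hc, coeFn_weightedEmbedding hL.le 1 z,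
      ae_restrict_mem measurableSet_Ioo] with t e1 e2 ht
    rw [e1, e2, hzt t (Ioo_subset_Icc_self ht)]
    simp
  refine ⟨SubHilbert.mk X hXm, ?_, fun y => ?_⟩
  · rw [comparisonEmbedding_apply, SubHilbert.incl_mk]
    refine Lp.ext ?_
    filter_upwards [h1, coeFn_weightedEmbedding hL.le 1 X, ae_restrict_mem measurableSet_Ioo]
      with t e1 e2 ht
    rw [e1, e2, hXt t (Ioo_subset_Icc_self ht)]
    simp
  · rw [inner_comparisonForm, SubHilbert.incl_mk, comparisonEmbedding_apply,
      inner_weightedEmbedding, hXs]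
    set Y := SubHilbert.incl _ y with hY
    have hYm : evalAt L L Y = Complex.exp (Complex.I * θ) * Y.fst :=
      mem_quasiPeriodic.mp (SubHilbert.incl_mem y)
    have e1 := inner_by_parts hL.le Y z
    have e2 : p.2 = -g - weightedEmbedding hL.le (w * w) X := by
      refine Lp.ext ?_
      filter_upwards [h6, Lp.coeFn_sub (-g) (weightedEmbedding hL.le (w * w) X), Lp.coeFn_neg g,
        coeFn_weightedEmbedding hL.le (w * w) X, ae_restrict_mem measurableSet_Ioo]
        with t a1 a2 a3 a4 ht
      rw [a1, a2, Pi.sub_apply, a3, a4, hXt t (Ioo_subset_Icc_self ht), Pi.neg_apply]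
      simp only [ContinuousMap.mul_apply, hw]
      push_cast
      ring
    have e3 : z.snd = g := rfl
    have e4 : z.fst = f₁ 0 := rfl
    rw [hYm, hzt L hL', h5, map_mul, e3, e4] at e1
    rw [e2, inner_sub_right, inner_neg_right]
    linear_combination e1 + (starRingEnd ℂ Y.fst * f₁ 0) * conj_exp_mul_exp θ

/-- Functions vanishing at the points `jL/m` satisfy a Poincaré inequality. -/
lemma norm_sq_le_of_evalAt_eq_zero (hL : 0 < L) {m : ℕ} (hm : 0 < m) {y : H1Interval L}
    (hy : ∀ j : Fin m, evalAt L (j * L / m) y = 0) :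
    ‖weightedEmbedding hL.le 1 y‖ ^ 2 ≤ L ^ 2 / m * ‖y.snd‖ ^ 2 := by
  have hm' : (0 : ℝ) < m := by exact_mod_cast hm
  have hpt : ∀ t ∈ Ioo 0 L, ‖evalAt L t y‖ ^ 2 ≤ L / m * ‖y.snd‖ ^ 2 := by
    intro t ht
    -- The index of the last grid point to the left of `t`, at distance at most `L / m`.
    set j : ℕ := ⌊t * m / L⌋₊ with hj
    have h0 : 0 ≤ t * m / L := by have := ht.1; positivity
    have hj1 : (j : ℝ) ≤ t * m / L := Nat.floor_le h0
    have hj2 : t * m / L < j + 1 := Nat.lt_floor_add_one _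
    have hjm : j < m := by
      have : (j : ℝ) < m := by
        refine lt_of_le_of_lt hj1 ?_
        rw [div_lt_iff₀ hL]; nlinarith [ht.2]
      exact_mod_cast this
    have hz := hy ⟨j, hjm⟩
    simp only at hz
    have a1 : (j : ℝ) * L / m ≤ t := by
      rw [le_div_iff₀ hL] at hj1
      rw [div_le_iff₀ hm']; linarith
    have a2 : t - (j : ℝ) * L / m ≤ L / m := by
      rw [div_lt_iff₀ hL] at hj2
      rw [sub_le_iff_le_add, ← add_div, le_div_iff₀ hm']; nlinarith
    have h1 := norm_evalAt_sub_le (s := (j : ℝ) * L / m) (t := t) (L := L)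
      ⟨by positivity, a1.trans ht.2.le⟩ (Ioo_subset_Icc_self ht) y
    rw [hz, sub_zero, abs_of_nonneg (by linarith)] at h1
    calc ‖evalAt L t y‖ ^ 2 ≤ (Real.sqrt (t - (j : ℝ) * L / m) * ‖y.snd‖) ^ 2 :=
          pow_le_pow_left₀ (norm_nonneg _) h1 2
      _ = (t - (j : ℝ) * L / m) * ‖y.snd‖ ^ 2 := by
          rw [mul_pow, Real.sq_sqrt (by linarith)]
      _ ≤ L / m * ‖y.snd‖ ^ 2 := mul_le_mul_of_nonneg_right a2 (sq_nonneg _)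
  rw [norm_sq_eq_integral_norm_sq]
  have hconst : L ^ 2 / m * ‖y.snd‖ ^ 2 = ∫ _ in Ioo 0 L, L / m * ‖y.snd‖ ^ 2 := by
    simp [hL.le]; ring
  rw [hconst]
  refine integral_mono_ae (integrable_norm_sq _) (integrable_const _) ?_
  filter_upwards [coeFn_weightedEmbedding hL.le 1 y, ae_restrict_mem measurableSet_Ioo] with t h1 ht
  have : ‖weightedEmbedding hL.le 1 y t‖ = ‖evalAt L t y‖ := by rw [h1]; simp
  rw [this]
  exact hpt t ht

/-- The form is large on the kernel of many functionals, uniformly in `θ`. -/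
lemma comparisonForm_ge (hL : 0 < L) (w : C(ℝ, ℝ)) {M : ℝ} (hM : ∀ t ∈ Icc 0 L, |w t| ≤ M)
    (θ : ℝ) {m : ℕ} (hm : 0 < m) :
    ∃ ℓ : ComparisonDomain L θ →L[ℂ] (Fin m → ℂ), ∀ x, ℓ x = 0 →
      (m / L ^ 2 - M ^ 2) * ‖comparisonEmbedding hL.le θ x‖ ^ 2
        ≤ (⟪x, comparisonForm hL.le w θ x⟫_ℂ).re := by
  -- The functionals are the values at the `m` points `jL/m`, `0 ≤ j < m`.
  refine ⟨ContinuousLinearMap.pi fun j => evalAt L (j * L / m) ∘L SubHilbert.incl _,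
    fun x hx => ?_⟩
  have h1 := norm_sq_le_of_evalAt_eq_zero hL hm (y := SubHilbert.incl _ x)
    (fun j => congrFun hx j)
  have h2 := norm_sq_weightedEmbedding_le hL.le hM (SubHilbert.incl _ x)
  rw [re_inner_comparisonForm, comparisonEmbedding_apply]
  have hm' : (0 : ℝ) < m := by exact_mod_cast hm
  have h3 : m / L ^ 2 * ‖weightedEmbedding hL.le 1 (SubHilbert.incl _ x)‖ ^ 2
      ≤ ‖(SubHilbert.incl _ x).snd‖ ^ 2 := by
    refine (mul_le_mul_of_nonneg_left h1 (by positivity)).trans (le_of_eq ?_)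
    field_simp
  linarith

end OneDimOperator

end StrongDelta

end

/-! ### Existence, bounds and variational description of the comparison eigenvalues. -/

noncomputable section

namespace StrongDelta

section OneDimEigenvalues

variable {L : ℝ}

/-- The oscillating step functions `1` on `(2jδ, (2j+1)δ)`, `-1` on `((2j+1)δ, (2j+2)δ)`. -/
def stepFn (L δ : ℝ) (j : ℕ) : L2P (Ioo 0 L) :=
  indicatorConstLp 2 (measurableSet_Ioo (a := (2 * j : ℕ) * δ) (b := ((2 * j : ℕ) + 1) * δ))
      (measure_ne_top_restrict L _) (1 : ℂ) -
    indicatorConstLp 2 (measurableSet_Ioo (a := (2 * j + 1 : ℕ) * δ) (b := ((2 * j + 1 : ℕ) + 1) * δ))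
      (measure_ne_top_restrict L _) (1 : ℂ)

lemma measureReal_Ioo_inter {δ : ℝ} (hδ : 0 < δ) (i j : ℕ) (hi : ((i : ℝ) + 1) * δ ≤ L) :
    (volume.restrict (Ioo 0 L)).real (Ioo (i * δ) ((i + 1) * δ) ∩ Ioo (j * δ) ((j + 1) * δ))
      = if i = j then δ else 0 := by
  rw [measureReal_def, Measure.restrict_apply (measurableSet_Ioo.inter measurableSet_Ioo)]
  split_ifs with h
  · subst h
    rw [inter_self, inter_eq_left.mpr (Ioo_subset_Ioo (by positivity) hi), Real.volume_Ioo,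
      ENNReal.toReal_ofReal (by nlinarith)]
    ring
  · have : Ioo (i * δ) ((i + 1) * δ) ∩ Ioo (j * δ) ((j + 1) * δ) = ∅ := by
      rw [eq_empty_iff_forall_notMem]
      rintro t ⟨⟨h1, h2⟩, h3, h4⟩
      rcases Nat.lt_or_gt_of_ne h with h | h
      · have : ((i : ℝ) + 1) ≤ j := by exact_mod_cast h
        nlinarith
      · have : ((j : ℝ) + 1) ≤ i := by exact_mod_cast h
        nlinarith
    rw [this, empty_inter, measure_empty, ENNReal.toReal_zero]

/-- All intervals involved are disjoint. The orthogonality makes the primitives, which are tent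
functions with disjoint supports, span a trial space of the required dimension. -/
lemma inner_stepFn {δ : ℝ} (hδ : 0 < δ) (i j : ℕ) (hi : ((2 * i + 1 : ℕ) + 1) * δ ≤ L) :
    ⟪stepFn L δ i, stepFn L δ j⟫_ℂ = if i = j then (2 * δ : ℂ) else 0 := by
  have hi' : (((2 * i : ℕ) : ℝ) + 1) * δ ≤ L := by push_cast at hi ⊢; nlinarith
  simp only [stepFn, inner_sub_left, inner_sub_right,
    L2.inner_indicatorConstLp_one_indicatorConstLp_one]
  have h1 : ¬ (2 * i = 2 * j + 1) := by omega
  have h2 : ¬ (2 * i + 1 = 2 * j) := by omega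
  rw [measureReal_Ioo_inter hδ _ _ hi', measureReal_Ioo_inter hδ _ _ hi',
    measureReal_Ioo_inter hδ _ _ hi, measureReal_Ioo_inter hδ _ _ hi, if_neg h1, if_neg h2]
  by_cases h : i = j
  · subst h; simp; ring
  · have h3 : ¬ (2 * i = 2 * j) := by omega
    have h4 : ¬ (2 * i + 1 = 2 * j + 1) := by omega
    rw [if_neg h3, if_neg h4, if_neg h]; simp

/-- The positive and the negative half cancel. The primitive that starts at `0` thus ends at `0` and
is quasi-periodic for every `θ`, which is why one trial space serves all `θ`. -/
lemma evalAt_stepFn {δ : ℝ} (hδ : 0 < δ) (j : ℕ) (hj : ((2 * j + 1 : ℕ) + 1) * δ ≤ L) :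
    evalAt L L (WithLp.toLp 2 ((0 : ℂ), stepFn L δ j)) = 0 := by
  have hj' : (((2 * j : ℕ) : ℝ) + 1) * δ ≤ L := by push_cast at hj ⊢; nlinarith
  have h1 : evalAt L L (WithLp.toLp 2 ((0 : ℂ), stepFn L δ j)) =
      (0 : ℂ) + ⟪indicatorConstLp 2 (measurableSet_Ioo (a := 0) (b := L))
      (measure_ne_top_restrict L _) (1 : ℂ), stepFn L δ j⟫_ℂ := rfl
  have hm : ∀ k : ℕ, ((k : ℝ) + 1) * δ ≤ L → (volume.restrict (Ioo 0 L)).real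
      (Ioo 0 L ∩ Ioo (k * δ) ((k + 1) * δ)) = δ := by
    intro k hk
    have h2 := measureReal_Ioo_inter hδ k k hk
    rw [if_pos rfl, inter_self] at h2
    rw [inter_eq_right.mpr (Ioo_subset_Ioo (by positivity) hk), h2]
  rw [h1, stepFn, inner_sub_right, L2.inner_indicatorConstLp_one_indicatorConstLp_one,
    L2.inner_indicatorConstLp_one_indicatorConstLp_one, hm _ hj', hm _ hj]
  simp

/-- Trial spaces of any dimension on which the form is bounded, uniformly in `θ`. -/
lemma exists_trial_space (hL : 0 < L) (n : ℕ) : ∃ b : ℝ, ∀ θ : ℝ,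
    ∃ E : Submodule ℂ (ComparisonDomain L θ), FiniteDimensional ℂ E ∧ n ≤ Module.finrank ℂ E ∧
      ∀ x ∈ E, ‖(SubHilbert.incl _ x).snd‖ ^ 2 ≤ b * ‖comparisonEmbedding hL.le θ x‖ ^ 2 := by
  rcases Nat.eq_zero_or_pos n with rfl | hn
  · exact ⟨0, fun θ => ⟨⊥, inferInstance, by simp, fun x hx => by
      rw [(Submodule.mem_bot ℂ).mp hx]; simp⟩⟩
  -- The `n` tents have width `2δ` each and fill the interval exactly.
  set δ := L / (2 * n) with hδd
  have hn' : (0 : ℝ) < n := by exact_mod_cast hn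
  have hδ : 0 < δ := by positivity
  have hle : ∀ j : Fin n, ((2 * (j : ℕ) + 1 : ℕ) + 1) * δ ≤ L := by
    intro j
    have h1 : ((j : ℕ) : ℝ) + 1 ≤ n := by exact_mod_cast j.2
    have h2 : L = 2 * n * δ := by rw [hδd]; field_simp
    push_cast
    rw [h2]
    nlinarith
  let v : Fin n → L2P (Ioo 0 L) := fun j => stepFn L δ j
  have hv : LinearIndependent ℂ v := by
    refine linearIndependent_of_ne_zero_of_inner_eq_zero (𝕜 := ℂ) (fun j h0 => ?_)
      fun i j hij => ?_
    · have h1 := inner_stepFn hδ j j (hle j)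
      rw [if_pos rfl, show stepFn L δ j = 0 from h0, inner_zero_left] at h1
      have h2 : (2 * δ : ℂ) ≠ 0 := by exact_mod_cast (by positivity : (2 * δ : ℝ) ≠ 0)
      exact h2 h1.symm
    · exact (inner_stepFn hδ i j (hle i)).trans (if_neg fun h => hij (Fin.ext h))
  let incl0 : L2P (Ioo 0 L) →ₗ[ℂ] H1Interval L :=
    { toFun := fun k => WithLp.toLp 2 ((0 : ℂ), k)
      map_add' := fun k l => by rw [← WithLp.toLp_add]; simp
      map_smul' := fun a k => by rw [RingHom.id_apply, ← WithLp.toLp_smul]; simp }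
  let Ψ : (Fin n → ℂ) →ₗ[ℂ] H1Interval L := incl0 ∘ₗ Fintype.linearCombination ℂ v
  have hΨinj : Function.Injective Ψ := by
    have h1 : Function.Injective incl0 := fun k l h => congrArg WithLp.snd h
    exact h1.comp (hv.fintypeLinearCombination_injective)
  have hΨ0 : ∀ c, (Ψ c).fst = 0 := fun c => rfl
  have hΨL : ∀ c, evalAt L L (Ψ c) = 0 := by
    intro c
    show evalAt L L (incl0 (Fintype.linearCombination ℂ v c)) = 0
    rw [Fintype.linearCombination_apply, map_sum, map_sum]
    refine Finset.sum_eq_zero fun j _ => ?_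
    rw [map_smul, map_smul]
    have : evalAt L L (incl0 (v j)) = 0 := evalAt_stepFn hδ j (hle j)
    rw [this, smul_zero]
  have hmem : ∀ θ c, Ψ c ∈ quasiPeriodic L θ := fun θ c => by
    rw [mem_quasiPeriodic, hΨL, hΨ0, mul_zero]
  let Ξ : (Fin n → ℂ) →ₗ[ℂ] L2P (Ioo 0 L) := (weightedEmbedding hL.le 1).toLinearMap ∘ₗ Ψ
  have hΞ : LinearMap.ker Ξ = ⊥ :=
    LinearMap.ker_eq_bot.mpr ((weightedEmbedding_one_injective hL).comp hΨinj)
  -- On a finite-dimensional space the injective map `Ξ` is bounded below. The space and the map do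
  -- not involve `θ`, so neither does the resulting bound.
  obtain ⟨K, -, hK⟩ := Ξ.exists_antilipschitzWith hΞ
  have hK' : ∀ c, ‖c‖ ≤ K * ‖Ξ c‖ := fun c => by
    have := hK.le_mul_dist c 0
    simpa using this
  let Ψc := LinearMap.toContinuousLinearMap Ψ
  refine ⟨(‖Ψc‖ * K) ^ 2, fun θ => ?_⟩
  let Ψθ : (Fin n → ℂ) →ₗ[ℂ] ComparisonDomain L θ := SubHilbert.lift Ψ (hmem θ)
  have hΨθ : Function.Injective Ψθ := fun c d h => hΨinj (by
    have := congrArg (SubHilbert.incl _) h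
    exact this)
  refine ⟨LinearMap.range Ψθ, inferInstance, ?_, ?_⟩
  · rw [LinearMap.finrank_range_of_inj hΨθ]; simp
  · rintro _ ⟨c, rfl⟩
    have e1 : SubHilbert.incl _ (Ψθ c) = Ψ c := rfl
    have e2 : comparisonEmbedding hL.le θ (Ψθ c) = Ξ c := rfl
    rw [e1, e2, ← mul_pow]
    refine pow_le_pow_left₀ (norm_nonneg _) ?_ 2
    have h1 : ‖(Ψ c).snd‖ ≤ ‖Ψ c‖ := WithLp.norm_snd_le _ _
    have h2 : ‖Ψ c‖ ≤ ‖Ψc‖ * ‖c‖ := Ψc.le_opNorm c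
    calc ‖(Ψ c).snd‖ ≤ ‖Ψc‖ * ‖c‖ := h1.trans h2
      _ ≤ ‖Ψc‖ * (K * ‖Ξ c‖) := mul_le_mul_of_nonneg_left (hK' c) (norm_nonneg _)
      _ = ‖Ψc‖ * K * ‖Ξ c‖ := by ring

/-- The elements of the form domain that are continuously differentiable up to the boundary. -/
def regularElements (L θ : ℝ) : Submodule ℂ (ComparisonDomain L θ) where
  carrier := {x | ∃ f₁ : ℝ → ℂ, ContinuousOn f₁ (Icc 0 L) ∧
    (SubHilbert.incl _ x).snd =ᵐ[volume.restrict (Ioo 0 L)] f₁}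
  zero_mem' := ⟨0, continuousOn_const, Lp.coeFn_zero _ _ _⟩
  add_mem' := by
    rintro x y ⟨f, hf, hfx⟩ ⟨g, hg, hgy⟩
    refine ⟨f + g, hf.add hg, ?_⟩
    filter_upwards [Lp.coeFn_add (SubHilbert.incl _ x).snd (SubHilbert.incl _ y).snd, hfx, hgy]
      with t h1 h2 h3
    rw [map_add]
    refine h1.trans ?_
    rw [Pi.add_apply, h2, h3, Pi.add_apply]
  smul_mem' := by
    rintro a x ⟨f, hf, hfx⟩
    refine ⟨a • f, hf.const_smul a, ?_⟩
    filter_upwards [Lp.coeFn_smul a (SubHilbert.incl _ x).snd, hfx] with t h1 h2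
    rw [map_smul]
    refine h1.trans ?_
    rw [Pi.smul_apply, h2, Pi.smul_apply]

/-- Trial functions on the strip must be continuously differentiable in order to have an explicit
gradient and trace; spans of eigenfunctions have the needed regularity. -/
lemma eigenSpan_le_regularElements (hL : 0 < L) {γ : ℝ → ℝ} {w : C(ℝ, ℝ)}
    (hw : ∀ t, w t = γ t / 2) (θ : ℝ) (S : Set ℝ) :
    eigenSpan (comparisonEmbedding hL.le θ) (comparisonForm hL.le w θ) S
      ≤ regularElements L θ := by
  refine iSup₂_le fun r _ x hx => ?_
  have h1 := mem_ker_shiftedForm.mp hx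
  exact (comparisonGraph_of_form hL hw θ (x := x)
    (p := (comparisonEmbedding hL.le θ x, (r : ℂ) • comparisonEmbedding hL.le θ x)) rfl
    (fun y => by rw [h1 y, inner_smul_right])).2

/-- The eigenvalues of the comparison operator and their variational description. -/
theorem exists_comparison_eigenvalues (hL : 0 < L) {γ : ℝ → ℝ} {w : C(ℝ, ℝ)}
    (hw : ∀ t, w t = γ t / 2) {M : ℝ} (hM : ∀ t ∈ Icc 0 L, |w t| ≤ M) {n : ℕ} (hn : 1 ≤ n) :
    ∃ b : ℝ, ∀ θ : ℝ, ∃ mu ≤ b, IsNthEigenvalue (comparisonOperator γ L θ) n mu ∧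
      (∃ E : Submodule ℂ (ComparisonDomain L θ), FiniteDimensional ℂ E ∧
        n ≤ Module.finrank ℂ E ∧ E ≤ regularElements L θ ∧
        ∀ x ∈ E, (⟪x, comparisonForm hL.le w θ x⟫_ℂ).re
          ≤ mu * ‖comparisonEmbedding hL.le θ x‖ ^ 2) ∧
      (∃ m < n, ∃ ℓ : ComparisonDomain L θ →L[ℂ] (Fin m → ℂ), ∀ x, ℓ x = 0 →
        mu * ‖comparisonEmbedding hL.le θ x‖ ^ 2 ≤ (⟪x, comparisonForm hL.le w θ x⟫_ℂ).re) ∧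
      ∀ m : ℕ, 0 < m → m < n → m / L ^ 2 - M ^ 2 ≤ mu := by
  obtain ⟨b, hb⟩ := exists_trial_space hL n
  refine ⟨b, fun θ => ?_⟩
  obtain ⟨E, hEf, hEn, hE⟩ := hb θ
  have hcl := isClosedForm_comparison hL w θ
  have hgr := isFormGraph_comparison hL hw θ
  -- So many point evaluations that the lower bound `(N + 1) / L ^ 2 - M ^ 2` on their common kernel
  -- exceeds the upper bound `b`.
  obtain ⟨N, hN⟩ := exists_nat_gt ((b + M ^ 2) * L ^ 2)
  have hNpos : (0 : ℝ) < (N + 1 : ℕ) := by positivity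
  obtain ⟨ℓ, hℓ⟩ := comparisonForm_ge hL w hM θ (m := N + 1) (by omega)
  have hbc : b < ((N + 1 : ℕ) : ℝ) / L ^ 2 - M ^ 2 := by
    rw [lt_sub_iff_add_lt, lt_div_iff₀ (by positivity)]
    push_cast
    linarith
  obtain ⟨mu, hmub, hnth, -, hfd, hfr, hlow⟩ := hgr.exists_nth_eigenvalue hcl hbc hℓ hn hEn
    (fun x hx => by
      rw [re_inner_comparisonForm]
      linarith [hE x hx, sq_nonneg ‖weightedEmbedding hL.le w (SubHilbert.incl _ x)‖])
  refine ⟨mu, hmub, hnth, ⟨_, hfd, hfr, eigenSpan_le_regularElements hL hw θ _, fun x hx =>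
    form_le_of_mem_eigenSpan_Iic hcl.symm hx⟩, hlow, fun m hm hmn => ?_⟩
  obtain ⟨ℓ', hℓ'⟩ := comparisonForm_ge hL w hM θ hm
  exact le_of_finrank_eigenSpan hcl hmn hfr hℓ'

end OneDimEigenvalues

end StrongDelta

end

/-! ### Weak derivatives and traces on the strip; closedness of the form domain. -/

noncomputable section

namespace StrongDelta

section Sobolev

variable {Ω : Set (ℝ × ℝ)} {v : ℝ × ℝ}

lemma continuous_integral_mul {ψ : ℝ × ℝ → ℂ} (hψ : Continuous ψ) (hc : HasCompactSupport ψ) :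
    Continuous fun f : L2 Ω => ∫ x in Ω, f x * ψ x := by
  have hm : MemLp (fun x => starRingEnd ℂ (ψ x)) 2 (volume.restrict Ω) :=
    (Complex.continuous_conj.comp hψ).memLp_of_hasCompactSupport
      (hc.comp_left (g := starRingEnd ℂ) (map_zero _))
  have h : (fun f : L2 Ω => ∫ x in Ω, f x * ψ x) = fun f => ⟪hm.toLp _, f⟫_ℂ := by
    funext f
    rw [inner_eq_integral]
    refine integral_congr_ae ?_
    filter_upwards [hm.coeFn_toLp] with x hx
    rw [hx, Complex.conj_conj, mul_comm]
  rw [h]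
  exact continuous_const.inner continuous_id

lemma isClosed_hasWeakDeriv (Ω : Set (ℝ × ℝ)) (v : ℝ × ℝ) :
    IsClosed {p : L2 Ω × L2 Ω | HasWeakDeriv Ω v p.1 p.2} := by
  simp only [HasWeakDeriv, ofPred_forall]
  refine isClosed_iInter fun φ => isClosed_iInter fun hφ => isClosed_iInter fun hc =>
    isClosed_iInter fun _ => ?_
  have hd : Continuous fun x => fderiv ℝ φ x v :=
    (hφ.continuous_fderiv (by simp)).clm_apply continuous_const
  exact isClosed_eq ((continuous_integral_mul hd (hc.fderiv_apply ℝ v)).comp continuous_fst)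
    ((continuous_integral_mul hφ.continuous hc).comp continuous_snd).neg

lemma isClosed_H1 (Ω : Set (ℝ × ℝ)) : IsClosed (H1 Ω : Set (L2 Ω × L2 Ω × L2 Ω)) :=
  ((isClosed_hasWeakDeriv Ω (1, 0)).preimage
      (continuous_fst.prodMk (continuous_fst.comp continuous_snd))).inter
    ((isClosed_hasWeakDeriv Ω (0, 1)).preimage
      (continuous_fst.prodMk (continuous_snd.comp continuous_snd)))

/-- The fundamental lemma of the calculus of variations. It shows that the gradient in the data of
an element is determined by the function, and with `v = 0` it is also a criterion for `g = 0`. -/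
lemma HasWeakDeriv.eq_zero (hΩ : IsOpen Ω) {g : L2 Ω} (h : HasWeakDeriv Ω v 0 g) : g = 0 := by
  have hloc : LocallyIntegrableOn g Ω volume := by
    intro x hx
    refine ⟨Metric.closedBall x 1 ∩ Ω, ?_, ?_⟩
    · exact Filter.inter_mem (mem_nhdsWithin_of_mem_nhds (Metric.closedBall_mem_nhds x one_pos))
        self_mem_nhdsWithin
    · rw [IntegrableOn, ← Measure.restrict_restrict measurableSet_closedBall]
      haveI : IsFiniteMeasure ((volume.restrict Ω).restrict (Metric.closedBall x 1)) :=
        ⟨by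
          rw [Measure.restrict_apply_univ]
          exact (Measure.restrict_apply_le _ _).trans_lt
            (isCompact_closedBall x 1).measure_lt_top⟩
      exact ((Lp.memLp g).restrict _).integrable (by norm_num)
  have key : ∀ᵐ x ∂(volume : Measure (ℝ × ℝ)), x ∈ Ω → g x = 0 := by
    refine hΩ.ae_eq_zero_of_integral_contDiff_smul_eq_zero hloc ?_
    intro φ hφ hc hs
    have hsupp : tsupport (fun x => (φ x : ℂ)) ⊆ Ω :=
      (closure_mono fun x hx => by
        simp only [Function.mem_support, ne_eq, Complex.ofReal_eq_zero] at hx ⊢; exact hx).trans hs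
    have h1 := h (fun x => (φ x : ℂ)) (Complex.ofRealCLM.contDiff.comp hφ)
      (hc.comp_left (g := fun t : ℝ => (t : ℂ)) Complex.ofReal_zero) hsupp
    have h0 : ∀ ψ : ℝ × ℝ → ℂ, ∫ x in Ω, (0 : L2 Ω) x * ψ x = 0 := fun ψ => by
      rw [← integral_zero (ℝ × ℝ) ℂ (μ := volume.restrict Ω)]
      refine integral_congr_ae ?_
      filter_upwards [Lp.coeFn_zero ℂ 2 (volume.restrict Ω)] with x hx
      rw [hx]; simp
    rw [h0, eq_comm, neg_eq_zero] at h1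
    have h2 : ∫ x, φ x • g x = ∫ x in Ω, φ x • g x := by
      refine (setIntegral_eq_integral_of_forall_compl_eq_zero fun t ht => ?_).symm
      rw [image_eq_zero_of_notMem_tsupport fun h => ht (hs h), zero_smul]
    rw [h2, ← h1]
    refine integral_congr_ae (Filter.Eventually.of_forall fun x => ?_)
    simp only [Complex.real_smul, mul_comm]
  refine Lp.ext ?_
  filter_upwards [(ae_restrict_iff' hΩ.measurableSet).mpr key,
    Lp.coeFn_zero ℂ 2 (volume.restrict Ω)] with t h1 h2
  rw [h1, h2]; rfl

/-- Smooth compactly supported functions have their classical derivatives as weak derivatives. -/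
lemma hasWeakDeriv_of_contDiff {φ : ℝ × ℝ → ℂ} (hφ : ContDiff ℝ 1 φ)
    {f g : L2 Ω} (hf : f =ᵐ[volume.restrict Ω] φ)
    (hg : g =ᵐ[volume.restrict Ω] fun x => fderiv ℝ φ x v) : HasWeakDeriv Ω v f g := by
  intro ψ hψ hψc hs
  have c1 : Continuous fun x => fderiv ℝ φ x v :=
    (hφ.continuous_fderiv (by simp)).clm_apply continuous_const
  have c2 : Continuous fun x => fderiv ℝ ψ x v :=
    (hψ.continuous_fderiv (by simp)).clm_apply continuous_const
  have hψ0 : ∀ x ∉ Ω, ψ x = 0 := fun x hx => image_eq_zero_of_notMem_tsupport fun h => hx (hs h)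
  have hψ1 : ∀ x ∉ Ω, fderiv ℝ ψ x v = 0 := fun x hx => by
    rw [image_eq_zero_of_notMem_tsupport fun h => hx (hs (tsupport_fderiv_subset ℝ h))]
    rfl
  have e1 : ∫ x in Ω, f x * fderiv ℝ ψ x v = ∫ x, φ x * fderiv ℝ ψ x v := by
    rw [← setIntegral_eq_integral_of_forall_compl_eq_zero (s := Ω)
      (f := fun x => φ x * fderiv ℝ ψ x v) fun x hx => by rw [hψ1 x hx, mul_zero]]
    refine integral_congr_ae ?_
    filter_upwards [hf] with x hx
    rw [hx]
  have e2 : ∫ x in Ω, g x * ψ x = ∫ x, fderiv ℝ φ x v * ψ x := by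
    rw [← setIntegral_eq_integral_of_forall_compl_eq_zero (s := Ω)
      (f := fun x => fderiv ℝ φ x v * ψ x) fun x hx => by rw [hψ0 x hx, mul_zero]]
    refine integral_congr_ae ?_
    filter_upwards [hg] with x hx
    rw [hx]
  rw [e1, e2]
  refine integral_mul_fderiv_eq_neg_fderiv_mul_of_integrable ?_ ?_ ?_
    (fun x _ => hφ.differentiable (by simp) x) (fun x _ => hψ.differentiable (by simp) x)
  · exact (c1.mul hψ.continuous).integrable_of_hasCompactSupport hψc.mul_left
  · exact (hφ.continuous.mul c2).integrable_of_hasCompactSupport (hψc.fderiv_apply ℝ v).mul_left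
  · exact (hφ.continuous.mul hψ.continuous).integrable_of_hasCompactSupport hψc.mul_left

lemma fst_mem_H1_of_mem_traceGraph {c : ℝ → ℝ × ℝ} {I : Set ℝ}
    {p : (L2 Ω × L2 Ω × L2 Ω) × L2P I} (hp : p ∈ traceGraph Ω c I) : p.1 ∈ H1 Ω := by
  have : (traceGraph Ω c I : Set ((L2 Ω × L2 Ω × L2 Ω) × L2P I)) ⊆ Prod.fst ⁻¹' (H1 Ω : Set (L2 Ω × L2 Ω × L2 Ω)) := by
    refine closure_minimal ?_ ((isClosed_H1 Ω).preimage continuous_fst)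
    rintro q ⟨φ, hφ, -, h1, h2, h3, -⟩
    have hφ1 : ContDiff ℝ 1 φ := hφ.of_le (by exact_mod_cast le_top)
    exact ⟨hasWeakDeriv_of_contDiff hφ1 h1 h2, hasWeakDeriv_of_contDiff hφ1 h1 h3⟩
  exact this hp

/-- A quadratic inequality between data of smooth functions extends to the trace graph. -/
lemma traceGraph_induction {c : ℝ → ℝ × ℝ} {I : Set ℝ} {F : (L2 Ω × L2 Ω × L2 Ω) × L2P I → ℝ}
    (hF : Continuous F) (h : ∀ p ∈ restrictionGraph Ω c I, 0 ≤ F p)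
    {p : (L2 Ω × L2 Ω × L2 Ω) × L2P I} (hp : p ∈ traceGraph Ω c I) : 0 ≤ F p :=
  closure_minimal (s := (restrictionGraph Ω c I : Set ((L2 Ω × L2 Ω × L2 Ω) × L2P I)))
    (t := {p | 0 ≤ F p}) (fun p hp => h p hp)
    (isClosed_le continuous_const hF) hp

lemma volume_restrict_strip (k : ℝ) :
    (volume : Measure (ℝ × ℝ)).restrict (strip k) = (volume.restrict (Ioo 0 k)).prod volume := by
  rw [strip, Measure.volume_eq_prod, ← Measure.prod_restrict, Measure.restrict_univ]

lemma integrable_norm_sq_of_hasCompactSupport {α : Type*} [TopologicalSpace α] [MeasurableSpace α]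
    [OpensMeasurableSpace α] [SecondCountableTopology α] {μ : Measure α}
    [IsFiniteMeasureOnCompacts μ] {φ : α → ℂ}
    (hφ : Continuous φ) (hc : HasCompactSupport φ) : Integrable (fun x => ‖φ x‖ ^ 2) μ :=
  (memLp_two_iff_integrable_sq_norm hφ.aestronglyMeasurable).mp (hφ.memLp_of_hasCompactSupport hc)

/-- The one-dimensional estimate `norm_sq_fst_le` on each horizontal segment, integrated over its
height. -/
lemma norm_sq_left_trace_le_of_contDiff {k : ℝ} (hk : 0 < k) {φ : ℝ × ℝ → ℂ}
    (hφ : ContDiff ℝ 1 φ) (hc : HasCompactSupport φ) :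
    ∫ y, ‖φ (0, y)‖ ^ 2 ≤ 2 / k * (∫ x in strip k, ‖φ x‖ ^ 2)
      + 2 * k * ∫ x in strip k, ‖fderiv ℝ φ x (1, 0)‖ ^ 2 := by
  have c1 : Continuous fun x => fderiv ℝ φ x (1, 0) :=
    (hφ.continuous_fderiv (by simp)).clm_apply continuous_const
  have i0 : Integrable (fun x => ‖φ x‖ ^ 2) ((volume.restrict (Ioo 0 k)).prod volume) := by
    rw [← volume_restrict_strip]
    exact (integrable_norm_sq_of_hasCompactSupport hφ.continuous hc).restrict
  have i1 : Integrable (fun x => ‖fderiv ℝ φ x (1, 0)‖ ^ 2)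
      ((volume.restrict (Ioo 0 k)).prod volume) := by
    rw [← volume_restrict_strip]
    exact (integrable_norm_sq_of_hasCompactSupport c1 (hc.fderiv_apply ℝ (1, 0))).restrict
  rw [volume_restrict_strip, integral_prod_symm _ i0, integral_prod_symm _ i1, ← integral_const_mul,
    ← integral_const_mul, ← integral_add (i0.integral_prod_right.const_mul _)
      (i1.integral_prod_right.const_mul _)]
  have hemb : Topology.IsClosedEmbedding (fun y : ℝ => ((0 : ℝ), y)) :=
    Topology.IsClosedEmbedding.of_continuous_injective_isClosedMap (by fun_prop)
      (fun a b h => (Prod.mk.inj h).2) (isClosedMap_prodMk_left 0)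
  refine integral_mono ?_ ((i0.integral_prod_right.const_mul _).add
    (i1.integral_prod_right.const_mul _)) fun y => ?_
  · exact integrable_norm_sq_of_hasCompactSupport (hφ.continuous.comp hemb.continuous)
      (hc.comp_isClosedEmbedding hemb)
  have hcy : Continuous fun x : ℝ => fderiv ℝ φ (x, y) (1, 0) := c1.comp (by fun_prop)
  have hd : ∀ x : ℝ, HasDerivAt (fun x => φ (x, y)) (fderiv ℝ φ (x, y) (1, 0)) x := fun x => by
    have h1 : HasFDerivAt φ (fderiv ℝ φ (x, y)) (x, y) :=
      (hφ.differentiable (by simp) _).hasFDerivAt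
    exact h1.comp_hasDerivAt x ((hasDerivAt_id x).prodMk (hasDerivAt_const x y))
  have key := norm_sq_fst_le hk (ofDeriv k (fun x => φ (x, y)) _ hcy.continuousOn)
  rw [ofDeriv_fst, norm_sq_eq_integral_norm_sq, norm_sq_eq_integral_norm_sq] at key
  refine key.trans (le_of_eq ?_)
  congr 2
  · refine integral_congr_ae ?_
    filter_upwards [coeFn_weightedEmbedding hk.le 1 (ofDeriv k (fun x => φ (x, y)) _
      hcy.continuousOn), ae_restrict_mem measurableSet_Ioo] with x h1 hx
    rw [h1, evalAt_ofDeriv hcy.continuousOn (fun t _ => (hd t).hasDerivWithinAt)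
      (Ioo_subset_Icc_self hx)]
    simp
  · refine integral_congr_ae ?_
    filter_upwards [coeFn_ofDeriv_snd (fun x => φ (x, y)) _ hcy.continuousOn] with x h1
    rw [h1]

lemma norm_sq_congr {α : Type*} [MeasurableSpace α] {μ : Measure α} {f : Lp ℂ 2 μ} {g : α → ℂ}
    (h : f =ᵐ[μ] g) : ‖f‖ ^ 2 = ∫ x, ‖g x‖ ^ 2 ∂μ := by
  rw [norm_sq_eq_integral_norm_sq]
  exact integral_congr_ae (h.mono fun x hx => by simp only [hx])

lemma norm_sq_left_trace_le {k : ℝ} (hk : 0 < k)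
    {p : (L2 (strip k) × L2 (strip k) × L2 (strip k)) × L2P univ}
    (hp : p ∈ traceGraph (strip k) (fun y => (0, y)) univ) :
    ‖p.2‖ ^ 2 ≤ 2 / k * ‖p.1.1‖ ^ 2 + 2 * k * ‖p.1.2.1‖ ^ 2 := by
  have key : ∀ q ∈ restrictionGraph (strip k) (fun y => (0, y)) univ,
      0 ≤ 2 / k * ‖q.1.1‖ ^ 2 + 2 * k * ‖q.1.2.1‖ ^ 2 - ‖q.2‖ ^ 2 := by
    rintro q ⟨φ, hφ, hc, h1, h2, -, h4⟩
    have e1 := norm_sq_congr h1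
    have e2 := norm_sq_congr h2
    have e4 := norm_sq_congr h4
    have h5 := norm_sq_left_trace_le_of_contDiff hk (hφ.of_le (by exact_mod_cast le_top)) hc
    rw [← e1, ← e2] at h5
    rw [setIntegral_univ] at e4
    linarith
  have hcont : Continuous fun q : (L2 (strip k) × L2 (strip k) × L2 (strip k)) × L2P univ =>
      2 / k * ‖q.1.1‖ ^ 2 + 2 * k * ‖q.1.2.1‖ ^ 2 - ‖q.2‖ ^ 2 :=
    ((continuous_const.mul ((continuous_fst.comp continuous_fst).norm.pow 2)).add
      (continuous_const.mul ((continuous_fst.comp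
        (continuous_snd.comp continuous_fst)).norm.pow 2))).sub (continuous_snd.norm.pow 2)
  linarith [traceGraph_induction hcont key hp]

lemma isOpen_strip (k : ℝ) : IsOpen (strip k) := isOpen_Ioo.prod isOpen_univ

/-- If `T₀` is the graph of a bounded operator, then the elements of its domain that satisfy a
boundary condition formulated with a second closed graph form a closed set. -/
lemma isClosed_boundary_condition {E G : Type*} [NormedAddCommGroup E] [NormedSpace ℂ E]
    [CompleteSpace E] [NormedAddCommGroup G] [NormedSpace ℂ G] [CompleteSpace G]
    {T₀ T₁ : Submodule ℂ (E × G)} (h₀ : IsClosed (T₀ : Set (E × G)))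
    (h₁ : IsClosed (T₁ : Set (E × G))) {C : ℝ} (hC : ∀ p ∈ T₀, ‖p.2‖ ≤ C * ‖p.1‖) (e : ℂ) :
    IsClosed {p : E | ∃ g : G, (p, g) ∈ T₀ ∧ (p, e • g) ∈ T₁} := by
  set Z : Set (E × G) := T₀ ∩ (fun q : E × G => (q.1, e • q.2)) ⁻¹' T₁ with hZ
  have hZc : IsClosed Z :=
    h₀.inter (h₁.preimage (continuous_fst.prodMk (continuous_snd.const_smul e)))
  haveI : CompleteSpace Z := hZc.completeSpace_coe
  -- On the closed set `Z` the second component is controlled by the first, so the projection to `E`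
  -- is bounded below and its image is closed.
  have hanti : AntilipschitzWith (1 + C).toNNReal (fun x : Z => (x : E × G).1) := by
    refine AntilipschitzWith.of_le_mul_dist fun x y => ?_
    have h1 := hC _ (sub_mem x.2.1 y.2.1)
    rw [Prod.fst_sub, Prod.snd_sub, ← dist_eq_norm, ← dist_eq_norm] at h1
    have h2 : dist x y = max (dist x.1.1 y.1.1) (dist x.1.2 y.1.2) := rfl
    rw [h2]
    have h3 : 1 + C ≤ ((1 + C).toNNReal : ℝ) := Real.le_coe_toNNReal _
    have h4 : (0 : ℝ) ≤ ((1 + C).toNNReal : ℝ) := NNReal.coe_nonneg _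
    have h5 : 0 ≤ dist x.1.1 y.1.1 := dist_nonneg
    have h6 : 0 ≤ dist x.1.2 y.1.2 := dist_nonneg
    have h7 : (1 + C) * dist x.1.1 y.1.1 ≤ ((1 + C).toNNReal : ℝ) * dist x.1.1 y.1.1 :=
      mul_le_mul_of_nonneg_right h3 h5
    exact max_le (by linarith) (by linarith)
  have hr := hanti.isClosed_range (uniformContinuous_fst.comp uniformContinuous_subtype_val)
  convert hr using 1
  ext p
  constructor
  · rintro ⟨g, h3, h4⟩
    exact ⟨⟨(p, g), h3, h4⟩, rfl⟩
  · rintro ⟨⟨⟨q, g⟩, h3, h4⟩, rfl⟩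
    exact ⟨g, h3, h4⟩

lemma norm_left_trace_le {k : ℝ} (hk : 0 < k)
    {p : (L2 (strip k) × L2 (strip k) × L2 (strip k)) × L2P univ}
    (hp : p ∈ traceGraph (strip k) (fun y => (0, y)) univ) :
    ‖p.2‖ ≤ (1 + 2 / k + 2 * k) * ‖p.1‖ := by
  have h1 := norm_sq_left_trace_le hk hp
  have a1 : ‖p.1.1‖ ≤ ‖p.1‖ := norm_fst_le _
  have a2 : ‖p.1.2.1‖ ≤ ‖p.1‖ := (norm_fst_le _).trans (norm_snd_le _)
  have b1 := pow_le_pow_left₀ (norm_nonneg _) a1 2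
  have b2 := pow_le_pow_left₀ (norm_nonneg _) a2 2
  generalize ‖p.1‖ = r at *
  generalize ‖p.1.1‖ ^ 2 = s at *
  generalize ‖p.1.2.1‖ ^ 2 = t at *
  have hr : 0 ≤ r := (norm_nonneg _).trans a1
  have hk' : 0 < 2 / k := by positivity
  generalize 2 / k = l at *
  refine abs_le_of_sq_le_sq' (h1.trans ?_) (by positivity) |>.2
  calc l * s + 2 * k * t ≤ l * r ^ 2 + 2 * k * r ^ 2 := by gcongr
    _ = (l + 2 * k) * r ^ 2 := by ring
    _ ≤ (1 + l + 2 * k) ^ 2 * r ^ 2 := by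
      refine mul_le_mul_of_nonneg_right ?_ (sq_nonneg r)
      nlinarith [mul_pos hk' hk]
    _ = _ := by ring

/-- The trace on the curve is recorded as a coordinate, which makes its condition closed at once.
The boundary condition hides the trace `g` behind an existential quantifier and is closed because
the trace on the left side is bounded by the `H¹` norm. -/
lemma isClosed_formDomain (Γ : ℝ → ℝ × ℝ) (L : ℝ) {k₁ : ℝ} (hk : 0 < k₁) (k₂ θ : ℝ) :
    IsClosed (formDomain Γ L k₁ k₂ θ :
      Set ((L2 (strip k₁) × L2 (strip k₁) × L2 (strip k₁)) × L2P (Ioo 0 L))) := by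
  have h := isClosed_boundary_condition (Submodule.isClosed_topologicalClosure _)
    (Submodule.isClosed_topologicalClosure
      (restrictionGraph (strip k₁) (fun y => (k₁, k₂ + y)) univ))
    (fun _ => norm_left_trace_le hk) (Complex.exp (Complex.I * θ))
  exact ((isClosed_H1 _).preimage continuous_fst).inter
    ((Submodule.isClosed_topologicalClosure _).inter (h.preimage continuous_fst))

end Sobolev

end StrongDelta

end

/-! ### The fiber operator as the operator of a closed form. -/

noncomputable section

namespace StrongDelta

/-- The Hilbert space `L²(Ω)³ ⊕ L²(I)` that contains the data `(u, ∂u/∂x, ∂u/∂y, u|_Γ)`. -/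
abbrev DataSpace (Ω : Set (ℝ × ℝ)) (I : Set ℝ) : Type :=
  WithLp 2 (L2 Ω × WithLp 2 (L2 Ω × WithLp 2 (L2 Ω × L2P I)))

namespace DataSpace

variable (Ω : Set (ℝ × ℝ)) (I : Set ℝ)

/-- The function `u`. -/
def val : DataSpace Ω I →L[ℂ] L2 Ω := WithLp.fstL 2 ℂ _ _

/-- The derivative `∂u/∂x`. -/
def dx : DataSpace Ω I →L[ℂ] L2 Ω := WithLp.fstL 2 ℂ _ _ ∘L WithLp.sndL 2 ℂ _ _

/-- The derivative `∂u/∂y`. -/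
def dy : DataSpace Ω I →L[ℂ] L2 Ω :=
  WithLp.fstL 2 ℂ _ _ ∘L WithLp.sndL 2 ℂ _ _ ∘L WithLp.sndL 2 ℂ _ _

/-- The trace `u|_Γ`. -/
def trace : DataSpace Ω I →L[ℂ] L2P I :=
  WithLp.sndL 2 ℂ _ _ ∘L WithLp.sndL 2 ℂ _ _ ∘L WithLp.sndL 2 ℂ _ _

/-- The data as an element of the plain product. -/
def toProd : DataSpace Ω I →L[ℂ] (L2 Ω × L2 Ω × L2 Ω) × L2P I :=
  ((val Ω I).prod ((dx Ω I).prod (dy Ω I))).prod (trace Ω I)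

/-- The inverse of `toProd`. -/
def ofProd : ((L2 Ω × L2 Ω × L2 Ω) × L2P I) →ₗ[ℂ] DataSpace Ω I where
  toFun p := WithLp.toLp 2 (p.1.1, WithLp.toLp 2 (p.1.2.1, WithLp.toLp 2 (p.1.2.2, p.2)))
  map_add' _ _ := rfl
  map_smul' _ _ := rfl

variable {Ω I}

lemma norm_sq_eq (x : DataSpace Ω I) :
    ‖x‖ ^ 2 = ‖val Ω I x‖ ^ 2 + ‖dx Ω I x‖ ^ 2 + ‖dy Ω I x‖ ^ 2 + ‖trace Ω I x‖ ^ 2 := by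
  rw [WithLp.prod_norm_sq_eq_of_L2, WithLp.prod_norm_sq_eq_of_L2 x.snd,
    WithLp.prod_norm_sq_eq_of_L2 x.snd.snd, ← add_assoc, ← add_assoc]
  rfl

end DataSpace

section Fiber

variable (Γ : ℝ → ℝ × ℝ) (L k₁ k₂ θ : ℝ)

/-- The form domain of the fiber operator, as a subspace of a Hilbert space. -/
def fiberSubspace : Submodule ℂ (DataSpace (strip k₁) (Ioo 0 L)) :=
  (formDomain Γ L k₁ k₂ θ).comap (DataSpace.toProd (strip k₁) (Ioo 0 L)).toLinearMap

/-- The form domain of the fiber operator, as a Hilbert space. -/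
abbrev FiberDomain : Type := SubHilbert (fiberSubspace Γ L k₁ k₂ θ)

lemma completeSpace_fiberDomain (hk : 0 < k₁) : CompleteSpace (FiberDomain Γ L k₁ k₂ θ) :=
  SubHilbert.completeSpace ((isClosed_formDomain Γ L hk k₂ θ).preimage
    (DataSpace.toProd (strip k₁) (Ioo 0 L)).continuous)

/-- The data of an element of the form domain. -/
def fiberData : FiberDomain Γ L k₁ k₂ θ →L[ℂ]
    (L2 (strip k₁) × L2 (strip k₁) × L2 (strip k₁)) × L2P (Ioo 0 L) :=
  DataSpace.toProd _ _ ∘L SubHilbert.incl _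

lemma fiberData_mem (x : FiberDomain Γ L k₁ k₂ θ) :
    fiberData Γ L k₁ k₂ θ x ∈ formDomain Γ L k₁ k₂ θ :=
  SubHilbert.incl_mem x

/-- The embedding of the form domain into `L²`. -/
def fiberEmbedding : FiberDomain Γ L k₁ k₂ θ →L[ℂ] L2 (strip k₁) :=
  DataSpace.val _ _ ∘L SubHilbert.incl _

lemma fiberEmbedding_apply (x : FiberDomain Γ L k₁ k₂ θ) :
    fiberEmbedding Γ L k₁ k₂ θ x = (fiberData Γ L k₁ k₂ θ x).1.1 := rfl

variable {Γ L k₁ k₂ θ} in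
/-- The element of the form domain with given data. -/
def ofData (p : (L2 (strip k₁) × L2 (strip k₁) × L2 (strip k₁)) × L2P (Ioo 0 L))
    (hp : p ∈ formDomain Γ L k₁ k₂ θ) : FiberDomain Γ L k₁ k₂ θ :=
  SubHilbert.mk (DataSpace.ofProd _ _ p) hp

lemma fiberData_ofData (p : (L2 (strip k₁) × L2 (strip k₁) × L2 (strip k₁)) × L2P (Ioo 0 L))
    (hp : p ∈ formDomain Γ L k₁ k₂ θ) : fiberData Γ L k₁ k₂ θ (ofData p hp) = p := rfl

lemma norm_sq_fiberDomain (x : FiberDomain Γ L k₁ k₂ θ) :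
    ‖x‖ ^ 2 = ‖(fiberData Γ L k₁ k₂ θ x).1.1‖ ^ 2 + ‖(fiberData Γ L k₁ k₂ θ x).1.2.1‖ ^ 2
      + ‖(fiberData Γ L k₁ k₂ θ x).1.2.2‖ ^ 2 + ‖(fiberData Γ L k₁ k₂ θ x).2‖ ^ 2 :=
  DataSpace.norm_sq_eq (SubHilbert.incl _ x)

lemma exists_fiberForm (hk : 0 < k₁) (β : ℝ) :
    ∃ A : FiberDomain Γ L k₁ k₂ θ →L[ℂ] FiberDomain Γ L k₁ k₂ θ, ∀ x y, ⟪x, A y⟫_ℂ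
      = deltaForm β (fiberData Γ L k₁ k₂ θ x) (fiberData Γ L k₁ k₂ θ y) := by
  haveI := completeSpace_fiberDomain Γ L k₁ k₂ θ hk
  set X : FiberDomain Γ L k₁ k₂ θ →L[ℂ] L2 (strip k₁) := DataSpace.dx _ _ ∘L SubHilbert.incl _
  set Y : FiberDomain Γ L k₁ k₂ θ →L[ℂ] L2 (strip k₁) := DataSpace.dy _ _ ∘L SubHilbert.incl _
  set T : FiberDomain Γ L k₁ k₂ θ →L[ℂ] L2P (Ioo 0 L) := DataSpace.trace _ _ ∘L SubHilbert.incl _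
  refine ⟨ContinuousLinearMap.adjoint X ∘L X + ContinuousLinearMap.adjoint Y ∘L Y
    - (β : ℂ) • (ContinuousLinearMap.adjoint T ∘L T), fun x y => ?_⟩
  simp only [sub_apply, add_apply, smul_apply,
    ContinuousLinearMap.comp_apply, inner_sub_right, inner_add_right, inner_smul_right,
    ContinuousLinearMap.adjoint_inner_right]
  rfl

variable {Γ L k₁ k₂ θ}

lemma isFormGraph_fiber {β : ℝ}
    {A : FiberDomain Γ L k₁ k₂ θ →L[ℂ] FiberDomain Γ L k₁ k₂ θ} (hA : ∀ x y, ⟪x, A y⟫_ℂ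
      = deltaForm β (fiberData Γ L k₁ k₂ θ x) (fiberData Γ L k₁ k₂ θ y)) :
    IsFormGraph (fiberEmbedding Γ L k₁ k₂ θ) A (fiberGraph Γ L k₁ k₂ β θ) := by
  intro p
  constructor
  · rintro ⟨u, hu, h1, h2⟩
    refine ⟨ofData u hu, h1, fun y => ?_⟩
    rw [hA]
    exact h2 _ (fiberData_mem _ _ _ _ _ y)
  · rintro ⟨x, h1, h2⟩
    refine ⟨fiberData Γ L k₁ k₂ θ x, fiberData_mem _ _ _ _ _ x, h1, fun v hv => ?_⟩
    have := h2 (ofData v hv)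
    rw [hA] at this
    exact this

lemma re_deltaForm_self {Ω : Set (ℝ × ℝ)} {I : Set ℝ} (β : ℝ)
    (u : (L2 Ω × L2 Ω × L2 Ω) × L2P I) :
    (deltaForm β u u).re = ‖u.1.2.1‖ ^ 2 + ‖u.1.2.2‖ ^ 2 - β * ‖u.2‖ ^ 2 := by
  rw [deltaForm, inner_self_eq_norm_sq_to_K, inner_self_eq_norm_sq_to_K,
    inner_self_eq_norm_sq_to_K]
  norm_cast
  simp only [Complex.sub_re, Complex.ofReal_re, Complex.re_ofReal_mul]
  rfl

lemma conj_deltaForm {Ω : Set (ℝ × ℝ)} {I : Set ℝ} (β : ℝ)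
    (u v : (L2 Ω × L2 Ω × L2 Ω) × L2P I) :
    starRingEnd ℂ (deltaForm β u v) = deltaForm β v u := by
  simp only [deltaForm, map_sub, map_add, map_mul, Complex.conj_ofReal]
  rw [inner_conj_symm, inner_conj_symm, inner_conj_symm]

lemma mem_restrictionGraph_of_contDiff {Ω : Set (ℝ × ℝ)} (hΩ : IsOpen Ω) {φ : ℝ × ℝ → ℂ}
    (hφ : ContDiff ℝ ∞ φ)
    (hc : HasCompactSupport φ) {p : L2 Ω × L2 Ω × L2 Ω}
    (h1 : p.1 =ᵐ[volume.restrict Ω] φ)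
    (h2 : p.2.1 =ᵐ[volume.restrict Ω] fun x => fderiv ℝ φ x (1, 0))
    (h3 : p.2.2 =ᵐ[volume.restrict Ω] fun x => fderiv ℝ φ x (0, 1)) {c : ℝ → ℝ × ℝ} {I : Set ℝ}
    {g : L2P I} (hg : g =ᵐ[volume.restrict I] fun t => φ (c t)) :
    (p, g) ∈ restrictionGraph Ω c I :=
  ⟨φ, hφ, hc, h1, h2, h3, hg⟩

/-- The first-order data of a compactly supported `C¹` function. -/
def gradData (Ω : Set (ℝ × ℝ)) {φ : ℝ × ℝ → ℂ} (hφ : ContDiff ℝ 1 φ) (hc : HasCompactSupport φ) :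
    L2 Ω × L2 Ω × L2 Ω :=
  ((hφ.continuous.memLp_of_hasCompactSupport hc (p := 2) (μ := volume.restrict Ω)).toLp φ,
    (((hφ.continuous_fderiv (by simp)).clm_apply continuous_const).memLp_of_hasCompactSupport
      (hc.fderiv_apply ℝ (1, 0)) (p := 2) (μ := volume.restrict Ω)).toLp
        (fun x => fderiv ℝ φ x (1, 0)),
    (((hφ.continuous_fderiv (by simp)).clm_apply continuous_const).memLp_of_hasCompactSupport
      (hc.fderiv_apply ℝ (0, 1)) (p := 2) (μ := volume.restrict Ω)).toLp
        (fun x => fderiv ℝ φ x (0, 1)))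

lemma coeFn_gradData_fst (Ω : Set (ℝ × ℝ)) {φ : ℝ × ℝ → ℂ} (hφ : ContDiff ℝ 1 φ)
    (hc : HasCompactSupport φ) : (gradData Ω hφ hc).1 =ᵐ[volume.restrict Ω] φ :=
  (hφ.continuous.memLp_of_hasCompactSupport hc).coeFn_toLp

lemma coeFn_gradData_dx (Ω : Set (ℝ × ℝ)) {φ : ℝ × ℝ → ℂ} (hφ : ContDiff ℝ 1 φ)
    (hc : HasCompactSupport φ) :
    (gradData Ω hφ hc).2.1 =ᵐ[volume.restrict Ω] fun x => fderiv ℝ φ x (1, 0) :=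
  (((hφ.continuous_fderiv (by simp)).clm_apply continuous_const).memLp_of_hasCompactSupport
    (hc.fderiv_apply ℝ (1, 0))).coeFn_toLp

lemma coeFn_gradData_dy (Ω : Set (ℝ × ℝ)) {φ : ℝ × ℝ → ℂ} (hφ : ContDiff ℝ 1 φ)
    (hc : HasCompactSupport φ) :
    (gradData Ω hφ hc).2.2 =ᵐ[volume.restrict Ω] fun x => fderiv ℝ φ x (0, 1) :=
  (((hφ.continuous_fderiv (by simp)).clm_apply continuous_const).memLp_of_hasCompactSupport
    (hc.fderiv_apply ℝ (0, 1))).coeFn_toLp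

lemma memLp_comp_curve {c : ℝ → ℝ × ℝ} (hc : Continuous c) {φ : ℝ × ℝ → ℂ} (hφ : Continuous φ)
    (L : ℝ) : MemLp (fun t => φ (c t)) 2 (volume.restrict (Ioo 0 L)) :=
  memLp_of_continuousOn (hφ.comp hc).continuousOn

/-- Smooth functions supported inside the strip have zero trace on both sides, hence satisfy the
boundary condition for every `θ`. -/
lemma denseRange_fiberEmbedding (hΓ : Continuous Γ) :
    DenseRange (fiberEmbedding Γ L k₁ k₂ θ) := by
  have h : (LinearMap.range (fiberEmbedding Γ L k₁ k₂ θ).toLinearMap).topologicalClosure = ⊤ := by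
    rw [Submodule.topologicalClosure_eq_top_iff, Submodule.eq_bot_iff]
    intro u hu
    -- Being a weak derivative of `0` in the direction `0` means vanishing integrals against all
    -- test functions, and this is what orthogonality to the form domain yields.
    refine HasWeakDeriv.eq_zero (v := (0, 0)) (isOpen_strip k₁) ?_
    intro ψ hψ hψc hs
    have hψ1 : ContDiff ℝ 1 ψ := hψ.of_le (by exact_mod_cast le_top)
    set φ : ℝ × ℝ → ℂ := fun x => starRingEnd ℂ (ψ x) with hφdef
    have hφ : ContDiff ℝ ∞ φ := Complex.conjCLE.contDiff.comp hψ
    have hφc : HasCompactSupport φ := hψc.comp_left (g := starRingEnd ℂ) (map_zero _)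
    have hφ1 : ContDiff ℝ 1 φ := hφ.of_le (by exact_mod_cast le_top)
    have hz : ∀ x ∉ strip k₁, φ x = 0 := fun x hx => by
      simp only [hφdef]
      rw [image_eq_zero_of_notMem_tsupport fun h => hx (hs h), map_zero]
    set t : L2P (Ioo 0 L) := (memLp_comp_curve hΓ hφ.continuous L).toLp _
    have hmem : (gradData (strip k₁) hφ1 hφc, t) ∈ formDomain Γ L k₁ k₂ θ := by
      have hgr : ∀ {c : ℝ → ℝ × ℝ} {I : Set ℝ} {g : L2P I},
          g =ᵐ[volume.restrict I] (fun t => φ (c t)) →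
          (gradData (strip k₁) hφ1 hφc, g) ∈ traceGraph (strip k₁) c I := fun hg =>
        Submodule.le_topologicalClosure _ (mem_restrictionGraph_of_contDiff (isOpen_strip k₁) hφ hφc
          (coeFn_gradData_fst _ hφ1 hφc) (coeFn_gradData_dx _ hφ1 hφc)
          (coeFn_gradData_dy _ hφ1 hφc) hg)
      have hT := hgr (c := Γ) (g := t) (MemLp.coeFn_toLp _)
      refine ⟨fst_mem_H1_of_mem_traceGraph hT, hT, 0, hgr ?_, hgr ?_⟩
      · filter_upwards [Lp.coeFn_zero ℂ 2 (volume.restrict univ)] with y hy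
        rw [hy, hz _ (by simp [strip])]
        rfl
      · rw [smul_zero]
        filter_upwards [Lp.coeFn_zero ℂ 2 (volume.restrict univ)] with y hy
        rw [hy, hz _ (by simp [strip])]
        rfl
    have h1 : ⟪(gradData (strip k₁) hφ1 hφc).1, u⟫_ℂ = 0 := hu _ ⟨ofData _ hmem, rfl⟩
    rw [inner_eq_integral] at h1
    have h2 : ∫ x in strip k₁, u x * ψ x = 0 := by
      rw [← h1]
      refine integral_congr_ae ?_
      filter_upwards [coeFn_gradData_fst (strip k₁) hφ1 hφc] with x hx
      rw [hx, hφdef, Complex.conj_conj, mul_comm]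
    rw [h2]
    simp [show ((0 : ℝ), (0 : ℝ)) = 0 from rfl]
  exact Submodule.dense_iff_topologicalClosure_eq_top.mpr h

/-- A trace inequality for `2β + 2` in place of `β` lets half of the gradient term absorb the
interaction and still bound the trace, which is part of the norm. For injectivity it shows that the
trace vanishes together with the function and its gradient. -/
lemma isClosedForm_fiber (hk : 0 < k₁) (hΓ : Continuous Γ) {β : ℝ} (hβ : 0 ≤ β) {C : ℝ}
    (hC : ∀ p ∈ traceGraph (strip k₁) Γ (Ioo 0 L),
      (2 * β + 2) * ‖p.2‖ ^ 2 ≤ ‖p.1.2.1‖ ^ 2 + ‖p.1.2.2‖ ^ 2 + C * ‖p.1.1‖ ^ 2)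
    {A : FiberDomain Γ L k₁ k₂ θ →L[ℂ] FiberDomain Γ L k₁ k₂ θ} (hA : ∀ x y, ⟪x, A y⟫_ℂ
      = deltaForm β (fiberData Γ L k₁ k₂ θ x) (fiberData Γ L k₁ k₂ θ y)) :
    IsClosedForm (fiberEmbedding Γ L k₁ k₂ θ) A where
  symm x y := by
    rw [← inner_conj_symm, hA, hA, conj_deltaForm]
  coercive := by
    refine ⟨1 / 2, by norm_num, C / 2 + 1 / 2, fun x => ?_⟩
    have h1 := hC _ (fiberData_mem _ _ _ _ _ x).2.1
    rw [hA, re_deltaForm_self, norm_sq_fiberDomain, fiberEmbedding_apply]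
    linarith [sq_nonneg ‖(fiberData Γ L k₁ k₂ θ x).2‖]
  injective := by
    rw [injective_iff_map_eq_zero]
    intro x hx
    rw [fiberEmbedding_apply] at hx
    have h0 := fiberData_mem _ _ _ _ _ x
    have h1 := h0.1.1
    have h2 := h0.1.2
    rw [hx] at h1 h2
    have e1 := h1.eq_zero (isOpen_strip k₁)
    have e2 := h2.eq_zero (isOpen_strip k₁)
    have h3 := hC _ h0.2.1
    rw [hx, e1, e2] at h3
    simp only [norm_zero] at h3
    have h4 : ‖x‖ ^ 2 = 0 := by
      rw [norm_sq_fiberDomain, hx, e1, e2]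
      simp only [norm_zero]
      nlinarith [sq_nonneg ‖(fiberData Γ L k₁ k₂ θ x).2‖]
    simpa using h4
  denseRange := denseRange_fiberEmbedding hΓ

end Fiber

end StrongDelta

end

/-! ### Approximation of compactly supported `C¹` functions by smooth ones. -/

noncomputable section

namespace StrongDelta

section Mollify

open scoped Convolution

/-- A compactly supported `C¹` function is a `C¹` limit of smooth functions with supports in a fixed
compact set. -/
lemma exists_smooth_approx {F : ℝ × ℝ → ℂ} (hF : ContDiff ℝ 1 F) (hc : HasCompactSupport F)
    {ε : ℝ} (hε : 0 < ε) :
    ∃ G : ℝ × ℝ → ℂ, ContDiff ℝ ∞ G ∧ (∀ x ∉ Metric.cthickening 1 (tsupport F), G x = 0) ∧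
      (∀ x, ‖G x - F x‖ ≤ ε) ∧ ∀ x, ‖fderiv ℝ G x - fderiv ℝ F x‖ ≤ ε := by
  obtain ⟨δ₁, hδ₁, h₁⟩ := Metric.uniformContinuous_iff.mp
    (hc.uniformContinuous_of_continuous hF.continuous) ε hε
  have hF' : Continuous (fderiv ℝ F) := hF.continuous_fderiv (by simp)
  obtain ⟨δ₂, hδ₂, h₂⟩ := Metric.uniformContinuous_iff.mp
    ((hc.fderiv ℝ).uniformContinuous_of_continuous hF') ε hε
  -- The minimum with `1` keeps the support of the mollified function in the thickening by `1`; the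
  -- other two control the function and its derivative.
  set r := min 1 (min δ₁ δ₂) with hr
  have hr0 : 0 < r := by positivity
  let φ : ContDiffBump (0 : ℝ × ℝ) := ⟨r / 2, r, by positivity, by linarith⟩
  set n := φ.normed volume with hn
  have hnl : LocallyIntegrable n volume := φ.continuous_normed.locallyIntegrable
  set G := n ⋆[ContinuousLinearMap.lsmul ℝ ℝ, volume] F with hG
  have hball : ∀ {δ : ℝ}, r ≤ δ → ∀ x y : ℝ × ℝ, y ∈ Metric.ball x φ.rOut → dist y x < δ :=
    fun h x y hy => (Metric.mem_ball.mp hy).trans_le h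
  refine ⟨G, ?_, ?_, ?_, ?_⟩
  · exact φ.hasCompactSupport_normed.contDiff_convolution_left _ φ.contDiff_normed
      hF.continuous.locallyIntegrable
  · intro x hx
    by_contra hne
    refine hx ?_
    obtain ⟨a, ha, b, hb, rfl⟩ := support_convolution_subset (ContinuousLinearMap.lsmul ℝ ℝ)
      (Function.mem_support.mpr hne)
    rw [φ.support_normed_eq] at ha
    refine Metric.mem_cthickening_of_dist_le (a + b) b 1 _ (subset_tsupport _ hb) ?_
    rw [dist_eq_norm, add_sub_cancel_right]
    have h3 := mem_ball_zero_iff.mp ha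
    exact (h3.trans_le (min_le_left 1 _)).le
  · intro x
    rw [← dist_eq_norm]
    exact φ.dist_normed_convolution_le hF.continuous.aestronglyMeasurable
      fun y hy => (h₁ (hball ((min_le_right _ _).trans (min_le_left _ _)) x y hy)).le
  · intro x
    have hd := (hc.hasFDerivAt_convolution_right (ContinuousLinearMap.lsmul ℝ ℝ) hnl hF x).fderiv
    have he : (n ⋆[(ContinuousLinearMap.lsmul ℝ ℝ).precompR (ℝ × ℝ), volume] fderiv ℝ F) x
        = (n ⋆[ContinuousLinearMap.lsmul ℝ ℝ, volume] fderiv ℝ F) x := by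
      simp only [convolution]
      refine integral_congr_ae (Filter.Eventually.of_forall fun t => ?_)
      exact ContinuousLinearMap.ext fun v => rfl
    rw [hG, hd, he, ← dist_eq_norm]
    exact φ.dist_normed_convolution_le hF'.aestronglyMeasurable
      fun y hy => (h₂ (hball ((min_le_right _ _).trans (min_le_right _ _)) x y hy)).le

lemma norm_sub_le_of_bound {α : Type*} [MeasurableSpace α] {μ : Measure α} {f g : Lp ℂ 2 μ}
    {F G : α → ℂ} (hf : f =ᵐ[μ] F) (hg : g =ᵐ[μ] G) {K : Set α} (hK : MeasurableSet K)
    (hμ : μ K < ⊤) {ε : ℝ} (hε : 0 ≤ ε) (hb : ∀ x ∈ K, ‖F x - G x‖ ≤ ε)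
    (h0 : ∀ x ∉ K, F x - G x = 0) : ‖f - g‖ ≤ ε * Real.sqrt (μ.real K) := by
  refine abs_le_of_sq_le_sq' ?_ (by positivity) |>.2
  have h1 : (f - g : Lp ℂ 2 μ) =ᵐ[μ] fun x => F x - G x := by
    filter_upwards [Lp.coeFn_sub f g, hf, hg] with x h1 h2 h3
    rw [h1, Pi.sub_apply, h2, h3]
  rw [norm_sq_congr h1, mul_pow, Real.sq_sqrt measureReal_nonneg]
  have h2 : ∫ x, ‖F x - G x‖ ^ 2 ∂μ ≤ ∫ x, K.indicator (fun _ => ε ^ 2) x ∂μ := by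
    refine integral_mono_of_nonneg (Filter.Eventually.of_forall fun x => by positivity)
      ((integrable_indicator_iff hK).mpr (integrableOn_const hμ.ne)) ?_
    refine Filter.Eventually.of_forall fun x => ?_
    by_cases hx : x ∈ K
    · simp only [indicator_of_mem hx]
      exact pow_le_pow_left₀ (norm_nonneg _) (hb x hx) 2
    · simp only [indicator_of_notMem hx, h0 x hx]
      simp
  refine h2.trans (le_of_eq ?_)
  rw [integral_indicator hK, setIntegral_const, smul_eq_mul, mul_comm]

/-- Trace graphs are closures of restrictions of smooth functions, whereas trial functions built
from curvilinear coordinates are only `C¹`. Mollification converges uniformly with first derivatives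
and with supports in a fixed compact set, hence in `L²`, also along curves that meet compact sets in
finite length, such as vertical lines. -/
lemma mem_traceGraph_of_contDiff_one (Ω : Set (ℝ × ℝ)) {F : ℝ × ℝ → ℂ} (hF : ContDiff ℝ 1 F)
    (hc : HasCompactSupport F) {c : ℝ → ℝ × ℝ} (hcc : Continuous c) {I : Set ℝ}
    (hI : ∀ K : Set (ℝ × ℝ), IsCompact K → volume.restrict I (c ⁻¹' K) < ⊤) {t : L2P I}
    (ht : t =ᵐ[volume.restrict I] fun s => F (c s)) :
    (gradData Ω hF hc, t) ∈ traceGraph Ω c I := by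
  set K := Metric.cthickening 1 (tsupport F) with hK
  have hKc : IsCompact K := hc.isCompact.cthickening
  have hKm : MeasurableSet K := hKc.isClosed.measurableSet
  have hFK : ∀ x ∉ K, F x = 0 := fun x hx => image_eq_zero_of_notMem_tsupport
    fun h => hx (Metric.self_subset_cthickening _ h)
  have hFK' : ∀ x ∉ K, fderiv ℝ F x = 0 := fun x hx => image_eq_zero_of_notMem_tsupport
    fun h => hx (Metric.self_subset_cthickening _ (tsupport_fderiv_subset ℝ h))
  have hΩK : (volume.restrict Ω) K < ⊤ := (Measure.restrict_apply_le _ _).trans_lt hKc.measure_lt_top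
  set M := Real.sqrt ((volume.restrict Ω).real K) + Real.sqrt ((volume.restrict I).real (c ⁻¹' K))
    with hM
  have hM0 : 0 ≤ M := by positivity
  change _ ∈ closure (restrictionGraph Ω c I : Set ((L2 Ω × L2 Ω × L2 Ω) × L2P I))
  rw [Metric.mem_closure_iff]
  intro ε hε
  set η := ε / (2 * (M + 1)) with hη
  have hη0 : 0 < η := by positivity
  have hηM : η * M < ε := by
    rw [hη, div_mul_eq_mul_div, div_lt_iff₀ (by positivity)]
    nlinarith
  obtain ⟨G, hG, hGK, hG0, hG1⟩ := exists_smooth_approx hF hc hη0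
  have hGc : HasCompactSupport G := HasCompactSupport.intro hKc hGK
  have hG' : ContDiff ℝ 1 G := hG.of_le (by exact_mod_cast le_top)
  have hGK' : ∀ x ∉ K, fderiv ℝ G x = 0 := fun x hx => by
    refine image_eq_zero_of_notMem_tsupport fun h => hx ?_
    have : tsupport G ⊆ K := closure_minimal (fun y hy => by
      by_contra hy'; exact hy (hGK y hy')) hKc.isClosed
    exact this (tsupport_fderiv_subset ℝ h)
  have hGt : MemLp (fun s => G (c s)) 2 (volume.restrict I) := by
    obtain ⟨B, hB⟩ := hKc.exists_bound_of_continuousOn hG.continuous.continuousOn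
    have hmeas : MeasurableSet (c ⁻¹' K) := hcc.measurable hKm
    have h1 : (fun s => G (c s)) = (c ⁻¹' K).indicator fun s => G (c s) := by
      funext s
      by_cases hs : c s ∈ K
      · rw [indicator_of_mem (by exact hs)]
      · rw [indicator_of_notMem (by exact hs), hGK _ hs]
    rw [h1, memLp_indicator_iff_restrict hmeas]
    haveI : IsFiniteMeasure ((volume.restrict I).restrict (c ⁻¹' K)) :=
      ⟨by rw [Measure.restrict_apply_univ]; exact hI K hKc⟩
    refine MemLp.of_bound (hG.continuous.comp hcc).aestronglyMeasurable B ?_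
    filter_upwards [ae_restrict_mem hmeas] with s hs
    exact hB _ hs
  refine ⟨(gradData Ω hG' hGc, hGt.toLp _), ⟨G, hG, hGc, coeFn_gradData_fst _ hG' hGc,
    coeFn_gradData_dx _ hG' hGc, coeFn_gradData_dy _ hG' hGc, hGt.coeFn_toLp⟩, ?_⟩
  have hΩle : ∀ {f g : L2 Ω} {P Q : ℝ × ℝ → ℂ}, f =ᵐ[volume.restrict Ω] P →
      g =ᵐ[volume.restrict Ω] Q → (∀ x, ‖P x - Q x‖ ≤ η) → (∀ x ∉ K, P x - Q x = 0) →
      ‖f - g‖ < ε := by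
    intro f g P Q h1 h2 h3 h4
    refine (norm_sub_le_of_bound h1 h2 hKm hΩK hη0.le (fun x _ => h3 x) h4).trans_lt
      (lt_of_le_of_lt ?_ hηM)
    exact mul_le_mul_of_nonneg_left (le_add_of_nonneg_right (Real.sqrt_nonneg _)) hη0.le
  have hdir : ∀ (v : ℝ × ℝ), ‖v‖ ≤ 1 → ∀ x, ‖fderiv ℝ F x v - fderiv ℝ G x v‖ ≤ η := by
    intro v hv x
    rw [← sub_apply]
    refine (ContinuousLinearMap.le_opNorm _ _).trans ?_
    rw [norm_sub_rev]
    calc _ ≤ η * 1 := mul_le_mul (hG1 x) hv (norm_nonneg _) hη0.le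
      _ = η := mul_one _
  rw [dist_eq_norm, Prod.norm_def, Prod.norm_def, Prod.norm_def]
  refine max_lt (max_lt ?_ (max_lt ?_ ?_)) ?_
  · exact hΩle (coeFn_gradData_fst _ hF hc) (coeFn_gradData_fst _ hG' hGc)
      (fun x => by rw [norm_sub_rev]; exact hG0 x)
      (fun x hx => by rw [hFK x hx, hGK x hx, sub_zero])
  · exact hΩle (coeFn_gradData_dx _ hF hc) (coeFn_gradData_dx _ hG' hGc)
      (hdir _ (by simp)) (fun x hx => by rw [hFK' x hx, hGK' x hx, sub_self])
  · exact hΩle (coeFn_gradData_dy _ hF hc) (coeFn_gradData_dy _ hG' hGc)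
      (hdir _ (by simp)) (fun x hx => by rw [hFK' x hx, hGK' x hx, sub_self])
  · refine (norm_sub_le_of_bound ht hGt.coeFn_toLp (hcc.measurable hKm) (hI K hKc) hη0.le
      (fun s _ => by rw [norm_sub_rev]; exact hG0 _)
      (fun s hs => by rw [hFK _ hs, hGK _ hs, sub_zero])).trans_lt (lt_of_le_of_lt ?_ hηM)
    exact mul_le_mul_of_nonneg_left (le_add_of_nonneg_left (Real.sqrt_nonneg _)) hη0.le

lemma mem_traceGraph_curve (Ω : Set (ℝ × ℝ)) {F : ℝ × ℝ → ℂ} (hF : ContDiff ℝ 1 F)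
    (hc : HasCompactSupport F) {c : ℝ → ℝ × ℝ} (hcc : Continuous c) {L : ℝ}
    {t : L2P (Ioo 0 L)} (ht : t =ᵐ[volume.restrict (Ioo 0 L)] fun s => F (c s)) :
    (gradData Ω hF hc, t) ∈ traceGraph Ω c (Ioo 0 L) :=
  mem_traceGraph_of_contDiff_one Ω hF hc hcc (fun _ _ => measure_lt_top _ _) ht

lemma mem_traceGraph_vertical (Ω : Set (ℝ × ℝ)) {F : ℝ × ℝ → ℂ} (hF : ContDiff ℝ 1 F)
    (hc : HasCompactSupport F) (k₁ k₂ : ℝ)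
    {t : L2P univ} (ht : t =ᵐ[volume.restrict univ] fun y => F (k₁, k₂ + y)) :
    (gradData Ω hF hc, t) ∈ traceGraph Ω (fun y => (k₁, k₂ + y)) univ := by
  refine mem_traceGraph_of_contDiff_one Ω hF hc (by fun_prop) (fun K hK => ?_) ht
  rw [Measure.restrict_univ]
  have h1 : (fun y : ℝ => (k₁, k₂ + y)) ⁻¹' K ⊆ (fun x : ℝ × ℝ => x.2 - k₂) '' K := by
    intro y hy
    exact ⟨_, hy, by simp⟩
  exact (measure_mono h1).trans_lt (hK.image (by fun_prop)).measure_lt_top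

end Mollify

end StrongDelta

end

/-! ### The curve in normalized coordinates and the periodic tube around it. -/

noncomputable section

namespace StrongDelta

/-- The curvilinear coordinates of a curve `N` whose tangent is `(cos α, sin α)`. -/
def tubeCoord (N : ℝ → ℝ × ℝ) (α : ℝ → ℝ) (p : ℝ × ℝ) : ℝ × ℝ :=
  ((N p.1).1 - p.2 * Real.sin (α p.1), (N p.1).2 + p.2 * Real.cos (α p.1))

/-- A curve `N` with tangent angle `α` and curvature `γ = -α'` that is invariant under the
translation by `(k₁, k₂)`, together with a half-width `a` for which the curvilinear coordinates
are injective. -/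
structure IsTube (N : ℝ → ℝ × ℝ) (α γ γ' : ℝ → ℝ) (L k₁ k₂ a G : ℝ) : Prop where
  L_pos : 0 < L
  k_pos : 0 < k₁
  a_pos : 0 < a
  one_le : 1 ≤ G
  small : a * G ≤ 1 / 8
  hasDerivAt_fst : ∀ s, HasDerivAt (fun t => (N t).1) (Real.cos (α s)) s
  hasDerivAt_snd : ∀ s, HasDerivAt (fun t => (N t).2) (Real.sin (α s)) s
  hasDerivAt_angle : ∀ s, HasDerivAt α (-γ s) s
  hasDerivAt_curvature : ∀ s, HasDerivAt γ (γ' s) s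
  continuous_deriv : Continuous γ'
  curve_zero : N 0 = 0
  angle_zero : α 0 = 0
  curve_add : ∀ s, N (s + L) = N s + (k₁, k₂)
  angle_add : ∀ s, α (s + L) = α s
  curvature_add : ∀ s, γ (s + L) = γ s
  curvature_le : ∀ s, |γ s| ≤ G
  deriv_le : ∀ s, |γ' s| ≤ G
  injOn : InjOn (tubeCoord N α) (Ico 0 L ×ˢ Ioo (-a) a)
  maps : MapsTo (tubeCoord N α) (Ioo 0 L ×ˢ Ioo (-a) a) (strip k₁)

section Curve

lemma exists_bound_of_periodic {f : ℝ → ℝ} (hf : Continuous f) {L : ℝ} (hL : 0 < L)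
    (hp : ∀ s, f (s + L) = f s) : ∃ C, ∀ s, |f s| ≤ C := by
  obtain ⟨C, hC⟩ := isCompact_Icc.exists_bound_of_continuousOn (hf.continuousOn (s := Icc 0 L))
  refine ⟨C, fun s => ?_⟩
  obtain ⟨y, hy, e⟩ := Function.Periodic.exists_mem_Ico₀ (f := f) hp hL s
  rw [e]
  exact hC y (Ico_subset_Icc_self hy)

/-- Frenet equations of the normalized curve. -/
lemma hasDerivAt_normalized {Γ : ℝ → ℝ × ℝ} (hΓ : ContDiff ℝ 2 Γ)
    (hunit : ∀ s, deriv (fun t => (Γ t).1) s ^ 2 + deriv (fun t => (Γ t).2) s ^ 2 = 1)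
    (hγ : Continuous (signedCurvature Γ)) (s : ℝ) :
    HasDerivAt (fun t => (normalized Γ t).1)
      (Real.cos (-∫ u in (0 : ℝ)..s, signedCurvature Γ u)) s ∧
    HasDerivAt (fun t => (normalized Γ t).2)
      (Real.sin (-∫ u in (0 : ℝ)..s, signedCurvature Γ u)) s := by
  set x : ℝ → ℝ := fun t => (Γ t).1 with hx
  set y : ℝ → ℝ := fun t => (Γ t).2 with hy
  have hx2 : ContDiff ℝ 2 x := contDiff_fst.comp hΓ
  have hy2 : ContDiff ℝ 2 y := contDiff_snd.comp hΓ
  have hx1 : ∀ s, HasDerivAt x (deriv x s) s := fun s =>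
    (hx2.differentiable (by simp) s).hasDerivAt
  have hy1 : ∀ s, HasDerivAt y (deriv y s) s := fun s =>
    (hy2.differentiable (by simp) s).hasDerivAt
  have hxx : ∀ s, HasDerivAt (deriv x) (deriv (deriv x) s) s := fun s =>
    (((contDiff_succ_iff_deriv (n := 1)).mp hx2).2.2.differentiable (by simp) s).hasDerivAt
  have hyy : ∀ s, HasDerivAt (deriv y) (deriv (deriv y) s) s := fun s =>
    (((contDiff_succ_iff_deriv (n := 1)).mp hy2).2.2.differentiable (by simp) s).hasDerivAt
  have hun : ∀ s, deriv x s ^ 2 + deriv y s ^ 2 = 1 := hunit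
  have hort : ∀ s, deriv x s * deriv (deriv x) s + deriv y s * deriv (deriv y) s = 0 := by
    intro s
    have h1 := ((hxx s).pow 2).add ((hyy s).pow 2)
    have h2 : (deriv x ^ 2 + deriv y ^ 2) = fun _ => (1 : ℝ) := funext hun
    rw [h2] at h1
    have h3 := h1.unique (hasDerivAt_const s (1 : ℝ))
    simp only [Nat.cast_ofNat, Nat.add_one_sub_one, pow_one] at h3
    linarith
  set κ := signedCurvature Γ with hκ
  have hκs : ∀ s, κ s = deriv (deriv x) s * deriv y s - deriv (deriv y) s * deriv x s := fun s => rfl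
  -- The tangent has constant length, so its derivative is orthogonal to it; with the definition of
  -- `κ` this gives the Frenet equations.
  have fx : ∀ s, deriv (deriv x) s = κ s * deriv y s := fun s => by
    rw [hκs]; linear_combination (-deriv (deriv x) s) * hun s + deriv x s * hort s
  have fy : ∀ s, deriv (deriv y) s = -(κ s * deriv x s) := fun s => by
    rw [hκs]; linear_combination (-deriv (deriv y) s) * hun s + deriv y s * hort s
  set α : ℝ → ℝ := fun s => -∫ u in (0 : ℝ)..s, κ u with hα
  have hαd : ∀ s, HasDerivAt α (-κ s) s := fun s =>
    (intervalIntegral.integral_hasDerivAt_right (hγ.intervalIntegrable _ _)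
      hγ.aestronglyMeasurable.stronglyMeasurableAtFilter hγ.continuousAt).neg
  set c := deriv x 0 with hc
  set d := deriv y 0 with hd
  set P : ℝ → ℝ := fun s => c * deriv x s + d * deriv y s with hP
  set Q : ℝ → ℝ := fun s => -d * deriv x s + c * deriv y s with hQ
  have hPd : ∀ s, HasDerivAt P (κ s * Q s) s := fun s => by
    refine (((hxx s).const_mul c).add ((hyy s).const_mul d)).congr_deriv ?_
    rw [fx, fy, hQ]; ring
  have hQd : ∀ s, HasDerivAt Q (-(κ s * P s)) s := fun s => by
    refine (((hxx s).const_mul (-d)).add ((hyy s).const_mul c)).congr_deriv ?_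
    rw [fx, fy, hP]; ring
  -- The rotated tangent `(P, Q)` and `(cos α, sin α)` solve the same linear system with the same
  -- initial value; the squared distance of the two solutions is constant.
  set D : ℝ → ℝ := fun s => (P s - Real.cos (α s)) ^ 2 + (Q s - Real.sin (α s)) ^ 2 with hD
  have hDd : ∀ s, HasDerivAt D 0 s := fun s => by
    refine ((((hPd s).sub (hαd s).cos).pow 2).add
      (((hQd s).sub (hαd s).sin).pow 2)).congr_deriv ?_
    simp
    ring
  have hD0 : D 0 = 0 := by
    have h0 : α 0 = 0 := by simp [hα]
    have e1 : P 0 = 1 := by rw [hP]; simp only; rw [← hc, ← hd, ← hun 0]; ring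
    have e2 : Q 0 = 0 := by rw [hQ]; simp only; rw [← hc, ← hd]; ring
    simp only [hD]
    rw [h0, e1, e2]; simp
  have hDs : D s = 0 := by
    rw [← hD0]
    exact is_const_of_deriv_eq_zero (fun s => (hDd s).differentiableAt) (fun s => (hDd s).deriv) s 0
  have hPs : P s = Real.cos (α s) := by
    have := (add_eq_zero_iff_of_nonneg (sq_nonneg _) (sq_nonneg _)).mp hDs
    exact sub_eq_zero.mp (pow_eq_zero_iff (two_ne_zero) |>.mp this.1)
  have hQs : Q s = Real.sin (α s) := by
    have := (add_eq_zero_iff_of_nonneg (sq_nonneg _) (sq_nonneg _)).mp hDs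
    exact sub_eq_zero.mp (pow_eq_zero_iff (two_ne_zero) |>.mp this.2)
  constructor
  · change HasDerivAt _ (Real.cos (α s)) s
    rw [← hPs]
    exact (((hx1 s).sub_const (x 0)).const_mul c).add (((hy1 s).sub_const (y 0)).const_mul d)
  · change HasDerivAt _ (Real.sin (α s)) s
    rw [← hQs]
    exact (((hx1 s).sub_const (x 0)).const_mul (-d)).add (((hy1 s).sub_const (y 0)).const_mul c)

/-- The vanishing mean of the curvature makes the tangent angle `L`-periodic. The displacement of
the curve over one period is then constant, and its value at `0` is `(K₁, K₂)`. -/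
lemma exists_isTube {Γ : ℝ → ℝ × ℝ} (hΓ : ContDiff ℝ 2 Γ)
    (hunit : ∀ s, deriv (fun t => (Γ t).1) s ^ 2 + deriv (fun t => (Γ t).2) s ^ 2 = 1)
    (hA1 : ContDiff ℝ 2 (signedCurvature Γ)) {L : ℝ} (hL : 0 < L)
    (hA2 : ∀ s, signedCurvature Γ (s + L) = signedCurvature Γ s)
    (hA3 : ∫ t in (0 : ℝ)..L, signedCurvature Γ t = 0)
    (hA4 : 0 < K₁ (signedCurvature Γ) L)
    (hA5 : ∃ a₀ : ℝ, 0 < a₀ ∧ ∀ a ∈ Set.Ioo (0 : ℝ) a₀,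
      Set.InjOn (tubeMap (normalized Γ)) (Set.Ico 0 L ×ˢ Set.Ioo (-a) a) ∧
      tubeMap (normalized Γ) '' (Set.Ioo 0 L ×ˢ Set.Ioo (-a) a) ⊆
        strip (K₁ (signedCurvature Γ) L)) :
    ∃ α γ' a G, IsTube (normalized Γ) α (signedCurvature Γ) γ' L (K₁ (signedCurvature Γ) L)
      (K₂ (signedCurvature Γ) L) a G := by
  set γ := signedCurvature Γ with hγ
  have hγc : Continuous γ := hA1.continuous
  have hN := hasDerivAt_normalized hΓ hunit hγc
  set α : ℝ → ℝ := fun s => -∫ u in (0 : ℝ)..s, γ u with hα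
  have hαd : ∀ s, HasDerivAt α (-γ s) s := fun s =>
    (intervalIntegral.integral_hasDerivAt_right (hγc.intervalIntegrable _ _)
      hγc.aestronglyMeasurable.stronglyMeasurableAtFilter hγc.continuousAt).neg
  have hαc : Continuous α := continuous_iff_continuousAt.mpr fun s => (hαd s).continuousAt
  have hγd : ∀ s, HasDerivAt γ (deriv γ s) s := fun s =>
    (hA1.differentiable (by simp) s).hasDerivAt
  have hγ'c : Continuous (deriv γ) := hA1.continuous_deriv (by simp)
  have hγ'p : ∀ s, deriv γ (s + L) = deriv γ s := fun s => by
    have h1 := (hγd (s + L)).comp_add_const s L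
    have h2 : (fun x => γ (x + L)) = γ := funext hA2
    rw [h2] at h1
    exact h1.unique (hγd s)
  obtain ⟨C₁, hC₁⟩ := exists_bound_of_periodic hγc hL hA2
  obtain ⟨C₂, hC₂⟩ := exists_bound_of_periodic hγ'c hL hγ'p
  obtain ⟨a₀, ha₀, hA⟩ := hA5
  set G := max 1 (max C₁ C₂) with hG
  have hG1 : 1 ≤ G := le_max_left _ _
  -- Half of `a₀` stays strictly inside the admissible range; `a ≤ 1 / (8G)` keeps the Jacobian `1 +
  -- uγ` within `1/8` of `1`.
  set a := min (a₀ / 2) (1 / (8 * G)) with ha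
  have hapos : 0 < a := by positivity
  have hatube := hA a ⟨hapos, (min_le_left _ _).trans_lt (by linarith)⟩
  have hcoord : tubeMap (normalized Γ) = tubeCoord (normalized Γ) α := by
    funext p
    simp only [tubeMap, tubeCoord]
    rw [(hN p.1).1.deriv, (hN p.1).2.deriv]
  rw [hcoord] at hatube
  have hα0 : α 0 = 0 := by simp [hα]
  have hαp : ∀ s, α (s + L) = α s := by
    intro s
    simp only [hα]
    have h1 := intervalIntegral.integral_add_adjacent_intervals (μ := volume)
      (hγc.intervalIntegrable 0 L) (hγc.intervalIntegrable L (s + L))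
    have h2 : ∫ u in L..(s + L), γ u = ∫ u in (0 : ℝ)..s, γ u := by
      have h3 := intervalIntegral.integral_comp_add_right (a := 0) (b := s) γ L
      rw [zero_add] at h3
      rw [← h3]
      exact intervalIntegral.integral_congr fun u _ => hA2 u
    rw [← h1, hA3, h2, zero_add]
  have hN0 : normalized Γ 0 = 0 := by simp [normalized]
  have hcos : ∀ s, (normalized Γ (s + L)).1 = (normalized Γ s).1 + K₁ γ L := by
    intro s
    have h1 := is_const_of_deriv_eq_zero
      (f := fun s => (normalized Γ (s + L)).1 - (normalized Γ s).1)
      (fun s => (((hN (s + L)).1.comp_add_const s L).sub (hN s).1).differentiableAt)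
      (fun s => (((hN (s + L)).1.comp_add_const s L).sub (hN s).1).deriv.trans
        (sub_eq_zero.mpr (congrArg Real.cos (hαp s)))) s 0
    have h2 := intervalIntegral.integral_eq_sub_of_hasDerivAt (a := 0) (b := L)
      (fun s _ => (hN s).1) ((Real.continuous_cos.comp hαc).intervalIntegrable _ _)
    have h3 : K₁ γ L = (normalized Γ L).1 - (normalized Γ 0).1 := h2
    simp only [zero_add] at h1
    linarith
  have hsin : ∀ s, (normalized Γ (s + L)).2 = (normalized Γ s).2 + K₂ γ L := by
    intro s
    have h1 := is_const_of_deriv_eq_zero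
      (f := fun s => (normalized Γ (s + L)).2 - (normalized Γ s).2)
      (fun s => (((hN (s + L)).2.comp_add_const s L).sub (hN s).2).differentiableAt)
      (fun s => (((hN (s + L)).2.comp_add_const s L).sub (hN s).2).deriv.trans
        (sub_eq_zero.mpr (congrArg Real.sin (hαp s)))) s 0
    have h2 := intervalIntegral.integral_eq_sub_of_hasDerivAt (a := 0) (b := L)
      (fun s _ => (hN s).2) ((Real.continuous_sin.comp hαc).intervalIntegrable _ _)
    have h3 : K₂ γ L = (normalized Γ L).2 - (normalized Γ 0).2 := h2
    simp only [zero_add] at h1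
    linarith
  refine ⟨α, deriv γ, a, G, ?_⟩
  exact
    { L_pos := hL
      k_pos := hA4
      a_pos := hapos
      one_le := hG1
      small := by
        have h1 : a ≤ 1 / (8 * G) := min_le_right _ _
        calc a * G ≤ 1 / (8 * G) * G := mul_le_mul_of_nonneg_right h1 (by linarith)
          _ = 1 / 8 := by field_simp
      hasDerivAt_fst := fun s => (hN s).1
      hasDerivAt_snd := fun s => (hN s).2
      hasDerivAt_angle := hαd
      hasDerivAt_curvature := hγd
      continuous_deriv := hγ'c
      curve_zero := hN0
      angle_zero := hα0
      curve_add := fun s => Prod.ext (hcos s) (hsin s)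
      angle_add := hαp
      curvature_add := hA2
      curvature_le := fun s => (hC₁ s).trans ((le_max_left _ _).trans (le_max_right _ _))
      deriv_le := fun s => (hC₂ s).trans ((le_max_right _ _).trans (le_max_right _ _))
      injOn := hatube.1
      maps := mapsTo_iff_image_subset.mpr hatube.2 }

end Curve

namespace IsTube

variable {N : ℝ → ℝ × ℝ} {α γ γ' : ℝ → ℝ} {L k₁ k₂ a G : ℝ}

lemma continuous_curvature (h : IsTube N α γ γ' L k₁ k₂ a G) : Continuous γ :=
  continuous_iff_continuousAt.mpr fun s => (h.hasDerivAt_curvature s).continuousAt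

lemma continuous_angle (h : IsTube N α γ γ' L k₁ k₂ a G) : Continuous α :=
  continuous_iff_continuousAt.mpr fun s => (h.hasDerivAt_angle s).continuousAt

lemma continuous_curve (h : IsTube N α γ γ' L k₁ k₂ a G) : Continuous N :=
  (continuous_iff_continuousAt.mpr fun s => (h.hasDerivAt_fst s).continuousAt).prodMk
    (continuous_iff_continuousAt.mpr fun s => (h.hasDerivAt_snd s).continuousAt)

lemma abs_mul_curvature_le (h : IsTube N α γ γ' L k₁ k₂ a G) {u : ℝ} (hu : u ∈ Icc (-a) a)
    (s : ℝ) : |u * γ s| ≤ 1 / 8 := by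
  rw [abs_mul]
  exact (mul_le_mul (abs_le.mpr hu) (h.curvature_le s) (abs_nonneg _) h.a_pos.le).trans h.small

lemma jacobian_pos (h : IsTube N α γ γ' L k₁ k₂ a G) {u : ℝ} (hu : u ∈ Icc (-a) a)
    (s : ℝ) : 0 < 1 + u * γ s := by
  have := (abs_le.mp (h.abs_mul_curvature_le hu s)).1
  linarith

lemma tubeCoord_add (h : IsTube N α γ γ' L k₁ k₂ a G) (s u : ℝ) :
    tubeCoord N α (s + L, u) = tubeCoord N α (s, u) + (k₁, k₂) := by
  simp only [tubeCoord, h.curve_add, h.angle_add, Prod.mk_add_mk, Prod.fst_add, Prod.snd_add]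
  ext <;> simp <;> ring

lemma tubeCoord_zero (h : IsTube N α γ γ' L k₁ k₂ a G) (u : ℝ) :
    tubeCoord N α (0, u) = (0, u) := by
  simp [tubeCoord, h.curve_zero, h.angle_zero]

lemma tubeCoord_right (h : IsTube N α γ γ' L k₁ k₂ a G) (u : ℝ) :
    tubeCoord N α (L, u) = (k₁, k₂ + u) := by
  have := h.tubeCoord_add 0 u
  rw [zero_add, h.tubeCoord_zero] at this
  rw [this]
  ext <;> simp [add_comm]

lemma tubeCoord_curve (s : ℝ) : tubeCoord N α (s, 0) = N s := by
  simp [tubeCoord]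

/-- The derivative of the curvilinear coordinates. -/
def _root_.StrongDelta.tubeDeriv (α γ : ℝ → ℝ) (p : ℝ × ℝ) : ℝ × ℝ →L[ℝ] ℝ × ℝ :=
  (Matrix.toLin (.finTwoProd ℝ) (.finTwoProd ℝ)
    !![(1 + p.2 * γ p.1) * Real.cos (α p.1), -Real.sin (α p.1);
      (1 + p.2 * γ p.1) * Real.sin (α p.1), Real.cos (α p.1)]).toContinuousLinearMap

lemma _root_.StrongDelta.tubeDeriv_apply (α γ : ℝ → ℝ) (p v : ℝ × ℝ) :
    tubeDeriv α γ p v = ((1 + p.2 * γ p.1) * Real.cos (α p.1) * v.1 - Real.sin (α p.1) * v.2,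
      (1 + p.2 * γ p.1) * Real.sin (α p.1) * v.1 + Real.cos (α p.1) * v.2) := by
  rw [tubeDeriv, Matrix.toLin_finTwoProd_toContinuousLinearMap]
  ext <;> simp [sub_eq_add_neg]

lemma _root_.StrongDelta.det_tubeDeriv (α γ : ℝ → ℝ) (p : ℝ × ℝ) :
    (tubeDeriv α γ p).det = 1 + p.2 * γ p.1 := by
  unfold tubeDeriv
  simp only [LinearMap.det_toContinuousLinearMap, LinearMap.det_toLin, Matrix.det_fin_two_of]
  linear_combination (1 + p.2 * γ p.1) * Real.cos_sq_add_sin_sq (α p.1)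

lemma hasFDerivAt_tubeCoord (h : IsTube N α γ γ' L k₁ k₂ a G) (p : ℝ × ℝ) :
    HasFDerivAt (tubeCoord N α) (tubeDeriv α γ p) p := by
  have e1 := (h.hasDerivAt_fst p.1).comp_hasFDerivAt p (hasFDerivAt_fst (𝕜 := ℝ) (p := p))
  have e2 := (h.hasDerivAt_snd p.1).comp_hasFDerivAt p (hasFDerivAt_fst (𝕜 := ℝ) (p := p))
  have e3 := (h.hasDerivAt_angle p.1).comp_hasFDerivAt p (hasFDerivAt_fst (𝕜 := ℝ) (p := p))
  have e4 := e1.sub ((hasFDerivAt_snd (𝕜 := ℝ) (p := p)).mul e3.sin)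
  have e5 := e2.add ((hasFDerivAt_snd (𝕜 := ℝ) (p := p)).mul e3.cos)
  refine (e4.prodMk e5).congr_fderiv (ContinuousLinearMap.ext fun v => ?_)
  rw [tubeDeriv_apply]
  ext <;> simp <;> ring

lemma continuous_tubeDeriv_apply (h : IsTube N α γ γ' L k₁ k₂ a G) (v : ℝ × ℝ) :
    Continuous fun p => tubeDeriv α γ p v := by
  have h1 := h.continuous_angle
  have h2 := h.continuous_curvature
  simp only [tubeDeriv_apply]
  fun_prop

lemma contDiff_tubeCoord (h : IsTube N α γ γ' L k₁ k₂ a G) : ContDiff ℝ 1 (tubeCoord N α) := by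
  have h1 : ContDiff ℝ 1 γ := contDiff_one_iff_deriv.mpr
    ⟨fun s => (h.hasDerivAt_curvature s).differentiableAt, by
      rw [funext fun s => (h.hasDerivAt_curvature s).deriv]; exact h.continuous_deriv⟩
  have h2 : ContDiff ℝ 1 α := contDiff_one_iff_deriv.mpr
    ⟨fun s => (h.hasDerivAt_angle s).differentiableAt, by
      rw [funext fun s => (h.hasDerivAt_angle s).deriv]; exact h.continuous_curvature.neg⟩
  have h3 : ContDiff ℝ 1 fun s => (N s).1 := contDiff_one_iff_deriv.mpr
    ⟨fun s => (h.hasDerivAt_fst s).differentiableAt, by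
      rw [funext fun s => (h.hasDerivAt_fst s).deriv]
      exact Real.continuous_cos.comp h.continuous_angle⟩
  have h4 : ContDiff ℝ 1 fun s => (N s).2 := contDiff_one_iff_deriv.mpr
    ⟨fun s => (h.hasDerivAt_snd s).differentiableAt, by
      rw [funext fun s => (h.hasDerivAt_snd s).deriv]
      exact Real.continuous_sin.comp h.continuous_angle⟩
  exact ((h3.comp contDiff_fst).sub (contDiff_snd.mul (Real.contDiff_sin.comp
    (h2.comp contDiff_fst)))).prodMk ((h4.comp contDiff_fst).add (contDiff_snd.mul
      (Real.contDiff_cos.comp (h2.comp contDiff_fst))))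

/-- Subtracting the linear drift leaves an `L`-periodic function of `s`. -/
lemma tubeCoord_add_int (h : IsTube N α γ γ' L k₁ k₂ a G) (s u : ℝ) (n : ℤ) :
    tubeCoord N α (s + n * L, u) = tubeCoord N α (s, u) + ((n : ℝ) * k₁, (n : ℝ) * k₂) := by
  have hL := h.L_pos.ne'
  have hp : Function.Periodic
      (fun s => tubeCoord N α (s, u) - (s / L * k₁, s / L * k₂)) L := by
    intro s
    simp only [h.tubeCoord_add, add_div, div_self hL]
    ext <;> simp <;> ring
  have := hp.int_mul n s
  rw [sub_eq_iff_eq_add] at this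
  rw [this]
  ext <;> simp <;> field_simp <;> ring

lemma fst_tubeCoord_mem (h : IsTube N α γ γ' L k₁ k₂ a G) {s u : ℝ} (hs : s ∈ Ico 0 L)
    (hu : u ∈ Ioo (-a) a) : (tubeCoord N α (s, u)).1 ∈ Ico 0 k₁ := by
  rcases eq_or_lt_of_le hs.1 with h0 | h0
  · rw [← h0, h.tubeCoord_zero]; exact ⟨le_rfl, h.k_pos⟩
  · exact Ioo_subset_Ico_self (h.maps (x := (s, u)) ⟨⟨h0, hs.2⟩, hu⟩).1

/-- The curvilinear coordinates are injective on the whole periodic tube. -/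
lemma injOn_univ (h : IsTube N α γ γ' L k₁ k₂ a G) :
    InjOn (tubeCoord N α) (univ ×ˢ Ioo (-a) a) := by
  rintro ⟨s, u⟩ ⟨-, hu⟩ ⟨t, v⟩ ⟨-, hv⟩ he
  obtain ⟨m, hm, -⟩ := existsUnique_sub_zsmul_mem_Ico h.L_pos s 0
  obtain ⟨n, hn, -⟩ := existsUnique_sub_zsmul_mem_Ico h.L_pos t 0
  simp only [zsmul_eq_mul, zero_add] at hm hn
  have e1 := h.tubeCoord_add_int (s - m * L) u m
  have e2 := h.tubeCoord_add_int (t - n * L) v n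
  rw [sub_add_cancel] at e1 e2
  have x1 := h.fst_tubeCoord_mem hm hu
  have x2 := h.fst_tubeCoord_mem hn hv
  -- The first coordinate tells the period cell apart: points of the basic cell have first
  -- coordinate in `[0, k₁)`, and each period adds `k₁`.
  have hmn : m = n := by
    have hx : (tubeCoord N α (s - m * L, u)).1 + m * k₁
        = (tubeCoord N α (t - n * L, v)).1 + n * k₁ := by
      have := congrArg Prod.fst he
      rw [e1, e2] at this
      simpa using this
    have b1 : (m - n : ℝ) * k₁ < 1 * k₁ := by linarith [x1.1, x2.2]
    have b2 : (n - m : ℝ) * k₁ < 1 * k₁ := by linarith [x2.1, x1.2]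
    have c1 := lt_of_mul_lt_mul_right b1 h.k_pos.le
    have c2 := lt_of_mul_lt_mul_right b2 h.k_pos.le
    have d1 : m - n < 1 := by exact_mod_cast c1
    have d2 : n - m < 1 := by exact_mod_cast c2
    omega
  subst hmn
  rw [e1, e2] at he
  have h3 := h.injOn (x₁ := (s - m * L, u)) (x₂ := (t - m * L, v)) ⟨hm, hu⟩ ⟨hn, hv⟩
    (add_right_cancel he)
  have h4 := Prod.mk.inj h3
  rw [h4.2, sub_left_injective h4.1]

lemma fst_tubeCoord_lt (h : IsTube N α γ γ' L k₁ k₂ a G) {s u : ℝ} (hs : s ∈ Ico (-L) 0)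
    (hu : u ∈ Ioo (-a) a) : (tubeCoord N α (s, u)).1 < 0 := by
  have h1 := h.fst_tubeCoord_mem (s := s + L) ⟨by linarith [hs.1], by linarith [hs.2]⟩ hu
  rw [h.tubeCoord_add] at h1
  have := h1.2
  simp only [Prod.fst_add] at this
  linarith

end IsTube

end StrongDelta

end

/-! ### The transverse Robin problem on `[-a, a]`. -/

noncomputable section

namespace StrongDelta

section Transverse

/-- The strength `κ` for which the Robin condition at `0` is satisfied by the transverse ground
state of energy `-k²`. -/
def robinStrength (a k : ℝ) : ℝ :=
  k * (1 - 3 * Real.exp (-2 * k * a)) / (1 + 3 * Real.exp (-2 * k * a))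

/-- The transverse ground state on `[0, a]`. -/
def halfProfile (a k u : ℝ) : ℝ := Real.exp (-k * u) + 3 * Real.exp (-2 * k * a + k * u)

/-- Its derivative. -/
def halfProfileDeriv (a k u : ℝ) : ℝ :=
  -k * Real.exp (-k * u) + 3 * k * Real.exp (-2 * k * a + k * u)

lemma hasDerivAt_halfProfile (a k u : ℝ) :
    HasDerivAt (halfProfile a k) (halfProfileDeriv a k u) u := by
  have h1 : HasDerivAt (fun u => Real.exp (-k * u)) (Real.exp (-k * u) * (-k * 1)) u :=
    ((hasDerivAt_id u).const_mul (-k)).exp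
  have h2 : HasDerivAt (fun u => Real.exp (-2 * k * a + k * u))
      (Real.exp (-2 * k * a + k * u) * (k * 1)) u :=
    (((hasDerivAt_id u).const_mul k).const_add _).exp
  refine (h1.add (h2.const_mul 3)).congr_deriv ?_
  rw [halfProfileDeriv]; ring

lemma hasDerivAt_halfProfileDeriv (a k u : ℝ) :
    HasDerivAt (halfProfileDeriv a k) (k ^ 2 * halfProfile a k u) u := by
  have h1 : HasDerivAt (fun u => Real.exp (-k * u)) (Real.exp (-k * u) * (-k * 1)) u :=
    ((hasDerivAt_id u).const_mul (-k)).exp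
  have h2 : HasDerivAt (fun u => Real.exp (-2 * k * a + k * u))
      (Real.exp (-2 * k * a + k * u) * (k * 1)) u :=
    (((hasDerivAt_id u).const_mul k).const_add _).exp
  refine ((h1.const_mul (-k)).add (h2.const_mul (3 * k))).congr_deriv ?_
  rw [halfProfile]; ring

lemma halfProfile_zero_pos (a k : ℝ) : 0 < halfProfile a k 0 := by
  rw [halfProfile]; positivity

lemma halfProfileDeriv_zero (a k : ℝ) :
    halfProfileDeriv a k 0 = -robinStrength a k * halfProfile a k 0 := by
  have h : (1 + 3 * Real.exp (-2 * k * a)) ≠ 0 := by positivity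
  simp only [halfProfileDeriv, halfProfile, robinStrength, mul_zero, Real.exp_zero, add_zero]
  field_simp
  ring

/-- The coefficient `3` in the profile is there for this. A positive logarithmic derivative at the
end of the interval adds the term `k / 2 * g a ^ 2` to the lower bound, which later absorbs the
boundary terms due to the curvature. -/
lemma halfProfileDeriv_right (a k : ℝ) :
    halfProfileDeriv a k a = k / 2 * halfProfile a k a := by
  have h : -2 * k * a + k * a = -k * a := by ring
  rw [halfProfileDeriv, halfProfile, h]; ring

lemma continuous_halfProfile (a k : ℝ) : Continuous (halfProfile a k) := by
  unfold halfProfile; fun_prop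

lemma continuous_halfProfileDeriv (a k : ℝ) : Continuous (halfProfileDeriv a k) := by
  unfold halfProfileDeriv; fun_prop

/-- Subtract from `g` the multiple of the ground state with the same value at `0`. The remainder `v`
vanishes at `0`, and its own energy is completed to the square `(v' - (k/2) v)²`, which leaves the
surplus `(3/4) k² ∫ v²`: a spectral gap. -/
lemma half_robin_inequality {a k : ℝ} (ha : 0 ≤ a) {g g' : ℝ → ℝ}
    (hg : ∀ u ∈ Icc 0 a, HasDerivAt g (g' u) u) (hg' : ContinuousOn g' (Icc 0 a)) :
    k / 2 * g a ^ 2 + robinStrength a k * g 0 ^ 2 + 3 / 4 * k ^ 2 *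
      (∫ u in (0 : ℝ)..a, (g u - g 0 / halfProfile a k 0 * halfProfile a k u) ^ 2)
    ≤ (∫ u in (0 : ℝ)..a, g' u ^ 2) + k ^ 2 * ∫ u in (0 : ℝ)..a, g u ^ 2 := by
  set p := halfProfile a k with hp
  set p' := halfProfileDeriv a k with hp'
  set c := g 0 / p 0 with hc
  have hpc : Continuous p := continuous_halfProfile a k
  have hpc' : Continuous p' := continuous_halfProfileDeriv a k
  have hgc : ContinuousOn g (Icc 0 a) := fun u hu => (hg u hu).continuousAt.continuousWithinAt
  set v : ℝ → ℝ := fun u => g u - c * p u with hv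
  set v' : ℝ → ℝ := fun u => g' u - c * p' u with hv'
  have hvd : ∀ u ∈ Icc 0 a, HasDerivAt v (v' u) u := fun u hu =>
    (hg u hu).sub ((hasDerivAt_halfProfile a k u).const_mul c)
  have hvc : ContinuousOn v (Icc 0 a) := fun u hu => (hvd u hu).continuousAt.continuousWithinAt
  have hvc' : ContinuousOn v' (Icc 0 a) := hg'.sub (hpc'.continuousOn.const_smul c)
  -- The primitive of the difference of the two integrands; its end values are the boundary term and
  -- the Robin term at `0`.
  set W : ℝ → ℝ := fun u => 2 * c * (p' u * v u) + c ^ 2 * (p u * p' u) + k / 2 * v u ^ 2 with hW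
  set W' : ℝ → ℝ := fun u => g' u ^ 2 + k ^ 2 * g u ^ 2 - 3 / 4 * k ^ 2 * v u ^ 2
    - (v' u - k / 2 * v u) ^ 2 with hW'
  have hWd : ∀ u ∈ Icc 0 a, HasDerivAt W (W' u) u := by
    intro u hu
    refine (((((hasDerivAt_halfProfileDeriv a k u).mul (hvd u hu)).const_mul (2 * c)).add
      (((hasDerivAt_halfProfile a k u).mul (hasDerivAt_halfProfileDeriv a k u)).const_mul
        (c ^ 2))).add (((hvd u hu).pow 2).const_mul (k / 2))).congr_deriv ?_
    simp only [hW', hv', hv, ← hp, ← hp']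
    push_cast
    ring
  have hWc' : ContinuousOn W' (Icc 0 a) := by
    refine ContinuousOn.sub (ContinuousOn.sub ((hg'.pow 2).add ((hgc.pow 2).const_smul (k ^ 2)))
      ((hvc.pow 2).const_smul (3 / 4 * k ^ 2))) ((hvc'.sub (hvc.const_smul (k / 2))).pow 2)
  have ii : ∀ {F : ℝ → ℝ}, ContinuousOn F (Icc 0 a) → IntervalIntegrable F volume 0 a :=
    fun h => h.intervalIntegrable_of_Icc ha
  have hftc := intervalIntegral.integral_eq_sub_of_hasDerivAt
    (fun u hu => hWd u (by rwa [uIcc_of_le ha] at hu)) (ii hWc')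
  have hsum : ∫ u in (0 : ℝ)..a, W' u = (∫ u in (0 : ℝ)..a, g' u ^ 2)
      + k ^ 2 * (∫ u in (0 : ℝ)..a, g u ^ 2) - 3 / 4 * k ^ 2 * (∫ u in (0 : ℝ)..a, v u ^ 2)
      - ∫ u in (0 : ℝ)..a, (v' u - k / 2 * v u) ^ 2 := by
    rw [hW', intervalIntegral.integral_sub, intervalIntegral.integral_sub,
      intervalIntegral.integral_add, intervalIntegral.integral_const_mul,
      intervalIntegral.integral_const_mul]
    · exact ii (hg'.pow 2)
    · exact ii ((hgc.pow 2).const_smul (k ^ 2))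
    · exact ii ((hg'.pow 2).add ((hgc.pow 2).const_smul (k ^ 2)))
    · exact ii ((hvc.pow 2).const_smul (3 / 4 * k ^ 2))
    · exact ii (((hg'.pow 2).add ((hgc.pow 2).const_smul (k ^ 2))).sub
        ((hvc.pow 2).const_smul (3 / 4 * k ^ 2)))
    · exact ii ((hvc'.sub (hvc.const_smul (k / 2))).pow 2)
  have hnn : 0 ≤ ∫ u in (0 : ℝ)..a, (v' u - k / 2 * v u) ^ 2 :=
    intervalIntegral.integral_nonneg ha fun u _ => sq_nonneg _
  have hp0 : p 0 ≠ 0 := (halfProfile_zero_pos a k).ne'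
  have hv0 : v 0 = 0 := by simp only [hv, hc]; field_simp; ring
  have hg0 : g 0 = c * p 0 := by rw [hc]; field_simp
  have hWa : W a = k / 2 * g a ^ 2 := by
    have e : p' a = k / 2 * p a := halfProfileDeriv_right a k
    simp only [hW, hv, e]; ring
  have hW0 : W 0 = -(robinStrength a k * g 0 ^ 2) := by
    have e : p' 0 = -robinStrength a k * p 0 := halfProfileDeriv_zero a k
    simp only [hW, hv0, e, hg0]; ring
  rw [hsum, hWa, hW0] at hftc
  linarith

lemma integral_symm_interval {a : ℝ} (ha : 0 ≤ a) {F : ℝ → ℝ} (hF : ContinuousOn F (Icc (-a) a)) :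
    ∫ u in -a..a, F u = (∫ u in (0 : ℝ)..a, F u) + ∫ u in (0 : ℝ)..a, F (-u) := by
  have h1 := intervalIntegral.integral_comp_neg (a := 0) (b := a) F
  rw [neg_zero] at h1
  rw [h1, add_comm, intervalIntegral.integral_add_adjacent_intervals]
  · exact (hF.mono (Icc_subset_Icc_right ha)).intervalIntegrable_of_Icc (by linarith)
  · exact (hF.mono (Icc_subset_Icc_left (by linarith))).intervalIntegrable_of_Icc ha

lemma hasDerivAt_comp_neg {g : ℝ → ℝ} {c u : ℝ} (h : HasDerivAt g c (-u)) :
    HasDerivAt (fun u => g (-u)) (-c) u := by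
  have h1 : HasDerivAt (fun u => g (-u)) (c * -1) u := h.comp u (hasDerivAt_neg u)
  rwa [mul_neg_one] at h1

lemma robin_inequality {a k : ℝ} (ha : 0 ≤ a) {g g' : ℝ → ℝ}
    (hg : ∀ u ∈ Icc (-a) a, HasDerivAt g (g' u) u) (hg' : ContinuousOn g' (Icc (-a) a)) :
    k / 2 * (g a ^ 2 + g (-a) ^ 2) + 2 * robinStrength a k * g 0 ^ 2 + 3 / 4 * k ^ 2 *
      (∫ u in -a..a, (g u - g 0 / halfProfile a k 0 * halfProfile a k |u|) ^ 2)
    ≤ (∫ u in -a..a, g' u ^ 2) + k ^ 2 * ∫ u in -a..a, g u ^ 2 := by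
  have hgc : ContinuousOn g (Icc (-a) a) := fun u hu => (hg u hu).continuousAt.continuousWithinAt
  have hneg : ∀ {u : ℝ}, u ∈ Icc 0 a → -u ∈ Icc (-a) a := fun hu =>
    ⟨neg_le_neg hu.2, by linarith [hu.1]⟩
  have h1 := half_robin_inequality (k := k) ha (g := g) (g' := g')
    (fun u hu => hg u ⟨by linarith [hu.1], hu.2⟩) (hg'.mono (Icc_subset_Icc_left (by linarith)))
  have h2 := half_robin_inequality (k := k) ha (g := fun u => g (-u)) (g' := fun u => -g' (-u))
    (fun u hu => hasDerivAt_comp_neg (hg (-u) (hneg hu)))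
    ((hg'.comp continuousOn_id.neg fun u hu => hneg hu).neg)
  simp only [neg_zero, neg_sq] at h2
  have hpc : Continuous fun u => halfProfile a k |u| := (continuous_halfProfile a k).comp
    continuous_abs
  rw [integral_symm_interval ha (F := fun u => g' u ^ 2) (hg'.pow 2),
    integral_symm_interval ha (F := fun u => g u ^ 2) (hgc.pow 2),
    integral_symm_interval ha (F := fun u =>
      (g u - g 0 / halfProfile a k 0 * halfProfile a k |u|) ^ 2)
      ((hgc.sub (continuousOn_const.mul hpc.continuousOn)).pow 2)]
  have e1 : ∫ u in (0 : ℝ)..a, (g u - g 0 / halfProfile a k 0 * halfProfile a k |u|) ^ 2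
      = ∫ u in (0 : ℝ)..a, (g u - g 0 / halfProfile a k 0 * halfProfile a k u) ^ 2 :=
    intervalIntegral.integral_congr fun u hu => by
      rw [uIcc_of_le ha] at hu
      simp only [abs_of_nonneg hu.1]
  have e2 : ∫ u in (0 : ℝ)..a, (g (-u) - g 0 / halfProfile a k 0 * halfProfile a k |-u|) ^ 2
      = ∫ u in (0 : ℝ)..a, (g (-u) - g 0 / halfProfile a k 0 * halfProfile a k u) ^ 2 :=
    intervalIntegral.integral_congr fun u hu => by
      rw [uIcc_of_le ha] at hu
      simp only [abs_neg, abs_of_nonneg hu.1]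
  rw [e1, e2]
  linarith

lemma integral_exp_neg_mul {b a : ℝ} (hb : b ≠ 0) :
    ∫ u in (0 : ℝ)..a, Real.exp (-b * u) = (1 - Real.exp (-b * a)) / b := by
  have h := intervalIntegral.integral_eq_sub_of_hasDerivAt (a := 0) (b := a)
    (f := fun u => -Real.exp (-b * u) / b) (f' := fun u => Real.exp (-b * u))
    (fun u _ => by
      refine ((((hasDerivAt_id u).const_mul (-b)).exp).neg.div_const b).congr_deriv ?_
      simp; field_simp) ((by fun_prop : Continuous fun u => Real.exp (-b * u)).intervalIntegrable _ _)
  rw [h]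
  simp
  ring

lemma integral_mul_exp_neg_le {b a : ℝ} (hb : 0 < b) (ha : 0 ≤ a) :
    ∫ u in (0 : ℝ)..a, u * Real.exp (-b * u) ≤ 1 / b ^ 2 := by
  have h := intervalIntegral.integral_eq_sub_of_hasDerivAt (a := 0) (b := a)
    (f := fun u => -((u / b + 1 / b ^ 2) * Real.exp (-b * u))) (f' := fun u => u * Real.exp (-b * u))
    (fun u _ => by
      refine ((((hasDerivAt_id u).div_const b).add_const (1 / b ^ 2)).mul
        (((hasDerivAt_id u).const_mul (-b)).exp)).neg.congr_deriv ?_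
      simp; field_simp; ring)
      ((by fun_prop : Continuous fun u => u * Real.exp (-b * u)).intervalIntegrable _ _)
  rw [h]
  have : 0 ≤ (a / b + 1 / b ^ 2) * Real.exp (-b * a) := by positivity
  simp at this ⊢
  linarith

/-- The normalized transverse ground state and the resulting lower bound for the transverse
energy. -/
lemma exists_transverse_profile {a k : ℝ} (ha : 0 < a) (hk : 0 < k) (hka : 1 ≤ 2 * k * a) :
    ∃ χ : ℝ → ℝ, Continuous χ ∧ ∫ u in -a..a, χ u ^ 2 = 1 ∧
      ∫ u in -a..a, |u| * χ u ^ 2 ≤ 16 / k ∧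
      ∀ g g' : ℝ → ℝ, (∀ u ∈ Icc (-a) a, HasDerivAt g (g' u) u) → ContinuousOn g' (Icc (-a) a) →
        k / 2 * (g a ^ 2 + g (-a) ^ 2) + 2 * robinStrength a k * g 0 ^ 2
          - k ^ 2 * (∫ u in -a..a, χ u * g u) ^ 2
          - k ^ 2 / 4 * ((∫ u in -a..a, g u ^ 2) - (∫ u in -a..a, χ u * g u) ^ 2)
        ≤ ∫ u in -a..a, g' u ^ 2 := by
  set ψ : ℝ → ℝ := fun u => halfProfile a k |u| with hψ
  have hψc : Continuous ψ := (continuous_halfProfile a k).comp continuous_abs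
  have ii : ∀ {F : ℝ → ℝ}, ContinuousOn F (Icc (-a) a) → IntervalIntegrable F volume (-a) a :=
    fun h => h.intervalIntegrable_of_Icc (by linarith)
  have hle : -a ≤ a := by linarith
  set n := ∫ u in -a..a, ψ u ^ 2 with hn
  -- Each half of the interval contributes at least `∫ e^{-2ku}`, which is at least `1 / (4k)`
  -- because `2ka ≥ 1`.
  have hlow : 1 / (2 * k) ≤ n := by
    rw [hn, integral_symm_interval ha.le (F := fun u => ψ u ^ 2) (hψc.pow 2).continuousOn]
    have e : ∀ F : ℝ → ℝ, (∀ u ∈ Icc 0 a, Real.exp (-(2 * k) * u) ≤ F u) → Continuous F →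
        1 / (4 * k) ≤ ∫ u in (0 : ℝ)..a, F u := by
      intro F hF hFc
      have h1 := intervalIntegral.integral_mono_on (μ := volume) ha.le
        ((by fun_prop : Continuous fun u => Real.exp (-(2 * k) * u)).intervalIntegrable 0 a)
        (hFc.intervalIntegrable 0 a) hF
      rw [integral_exp_neg_mul (by positivity)] at h1
      refine le_trans ?_ h1
      have h2 : Real.exp (-(2 * k) * a) ≤ 1 / 2 := by
        have h3 : Real.exp (-(2 * k) * a) ≤ Real.exp (-1) := Real.exp_le_exp.mpr (by linarith)
        refine h3.trans ?_
        rw [Real.exp_neg, inv_eq_one_div]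
        exact one_div_le_one_div_of_le (by norm_num) (by linarith [Real.add_one_le_exp (1 : ℝ)])
      rw [div_le_div_iff₀ (by positivity) (by positivity)]
      nlinarith
    have hge : ∀ u ∈ Icc 0 a, Real.exp (-(2 * k) * u) ≤ ψ u ^ 2 := by
      intro u hu
      have h1 : Real.exp (-k * u) ≤ ψ u := by
        simp only [hψ, halfProfile, abs_of_nonneg hu.1]
        linarith [Real.exp_pos (-2 * k * a + k * u)]
      calc Real.exp (-(2 * k) * u) = Real.exp (-k * u) ^ 2 := by
            rw [← Real.exp_nat_mul]; congr 1; push_cast; ring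
        _ ≤ _ := pow_le_pow_left₀ (Real.exp_pos _).le h1 2
    have h1 := e _ hge (hψc.pow 2)
    have h2 := e (fun u => ψ (-u) ^ 2) (fun u hu => by
      simpa only [hψ, abs_neg] using hge u hu) ((hψc.comp continuous_neg).pow 2)
    have h3 : 1 / (2 * k) = 1 / (4 * k) + 1 / (4 * k) := by field_simp; norm_num
    have h4 : ∫ u in (0 : ℝ)..a, (ψ ^ 2) u = ∫ u in (0 : ℝ)..a, ψ u ^ 2 := rfl
    linarith
  have hn0 : 0 < n := lt_of_lt_of_le (by positivity) hlow
  have hm : ∫ u in -a..a, |u| * ψ u ^ 2 ≤ 8 / k ^ 2 := by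
    have hcont : Continuous fun u => |u| * ψ u ^ 2 := continuous_abs.mul (hψc.pow 2)
    rw [integral_symm_interval ha.le hcont.continuousOn]
    have e : ∀ F : ℝ → ℝ, (∀ u ∈ Icc 0 a, F u ≤ 16 * (u * Real.exp (-(2 * k) * u))) →
        Continuous F → ∫ u in (0 : ℝ)..a, F u ≤ 4 / k ^ 2 := by
      intro F hF hFc
      have h1 := intervalIntegral.integral_mono_on (μ := volume) ha.le (hFc.intervalIntegrable 0 a)
        ((by fun_prop : Continuous fun u => 16 * (u * Real.exp (-(2 * k) * u))).intervalIntegrable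
          0 a) hF
      rw [intervalIntegral.integral_const_mul] at h1
      have h2 := integral_mul_exp_neg_le (b := 2 * k) (by positivity) ha.le
      refine h1.trans ((mul_le_mul_of_nonneg_left h2 (by norm_num)).trans (le_of_eq ?_))
      field_simp; norm_num
    have hub : ∀ u ∈ Icc 0 a, |u| * ψ u ^ 2 ≤ 16 * (u * Real.exp (-(2 * k) * u)) := by
      intro u hu
      -- The growing exponential, reflected at `a`, is at most the decaying one on `[0, a]`.
      have h1 : ψ u ≤ 4 * Real.exp (-k * u) := by
        simp only [hψ, halfProfile, abs_of_nonneg hu.1]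
        have : Real.exp (-2 * k * a + k * u) ≤ Real.exp (-k * u) :=
          Real.exp_le_exp.mpr (by nlinarith [hu.2])
        linarith
      have h0 : 0 ≤ ψ u := by simp only [hψ, halfProfile]; positivity
      have h2 := pow_le_pow_left₀ h0 h1 2
      have h3 : (4 * Real.exp (-k * u)) ^ 2 = 16 * Real.exp (-(2 * k) * u) := by
        rw [mul_pow, ← Real.exp_nat_mul, show ((2 : ℕ) : ℝ) * (-k * u) = -(2 * k) * u by
          push_cast; ring]
        norm_num
      rw [abs_of_nonneg hu.1]
      rw [h3] at h2
      nlinarith [hu.1]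
    have h1 := e _ hub hcont
    have h2 := e (fun u => |-u| * ψ (-u) ^ 2) (fun u hu => by
      simpa only [hψ, abs_neg] using hub u hu) (hcont.comp continuous_neg)
    have h3 : 8 / k ^ 2 = 4 / k ^ 2 + 4 / k ^ 2 := by ring
    linarith
  have hs : Real.sqrt n ≠ 0 := (Real.sqrt_pos.mpr hn0).ne'
  have hsq : Real.sqrt n ^ 2 = n := Real.sq_sqrt hn0.le
  set χ : ℝ → ℝ := fun u => ψ u / Real.sqrt n with hχ
  have hχc : Continuous χ := hψc.div_const _
  have hχ1 : ∫ u in -a..a, χ u ^ 2 = 1 := by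
    simp only [hχ, div_pow, hsq]
    rw [intervalIntegral.integral_div, ← hn, div_self hn0.ne']
  refine ⟨χ, hχc, hχ1, ?_, ?_⟩
  · simp only [hχ, div_pow, hsq, ← mul_div_assoc]
    rw [intervalIntegral.integral_div, div_le_iff₀ hn0]
    refine hm.trans ?_
    calc 8 / k ^ 2 = 16 / k * (1 / (2 * k)) := by field_simp; norm_num
      _ ≤ 16 / k * n := mul_le_mul_of_nonneg_left hlow (by positivity)
  · intro g g' hg hg'
    have h1 := robin_inequality (k := k) ha.le hg hg'
    have hgc : ContinuousOn g (Icc (-a) a) := fun u hu => (hg u hu).continuousAt.continuousWithinAt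
    set c := g 0 / halfProfile a k 0 * Real.sqrt n with hc
    have h2 : ∫ u in -a..a, (g u - g 0 / halfProfile a k 0 * halfProfile a k |u|) ^ 2
        = (∫ u in -a..a, g u ^ 2) - 2 * c * (∫ u in -a..a, χ u * g u) + c ^ 2 := by
      have e : ∀ u, (g u - g 0 / halfProfile a k 0 * halfProfile a k |u|) ^ 2
          = g u ^ 2 - 2 * c * (χ u * g u) + c ^ 2 * χ u ^ 2 := by
        intro u
        have e1 : g 0 / halfProfile a k 0 * halfProfile a k |u| = c * χ u := by
          simp only [hc, hχ, hψ]; field_simp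
        rw [e1]; ring
      simp only [e]
      rw [intervalIntegral.integral_add, intervalIntegral.integral_sub,
        intervalIntegral.integral_const_mul, intervalIntegral.integral_const_mul, hχ1, mul_one]
      · exact ii (hgc.pow 2)
      · exact ii ((hχc.continuousOn.mul hgc).const_smul (2 * c))
      · exact ii ((hgc.pow 2).sub ((hχc.continuousOn.mul hgc).const_smul (2 * c)))
      · exact ii ((hχc.continuousOn.pow 2).const_smul (c ^ 2))
    rw [h2] at h1
    -- The distance of `g` to any multiple of `χ` is at least its distance to the projection on `χ`;
    -- the orthogonal part then costs `-k² + (3/4)k² = -k²/4`.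
    nlinarith [mul_nonneg (sq_nonneg k) (sq_nonneg (c - ∫ u in -a..a, χ u * g u))]

end Transverse

end StrongDelta

end

/-! ### Lower bound for the energy on one fiber of the tube. -/

noncomputable section

namespace StrongDelta

section FiberBound

variable {a k G c d : ℝ}

lemma intervalIntegrable_symm (ha : 0 < a) {F : ℝ → ℝ} (h : ContinuousOn F (Icc (-a) a)) :
    IntervalIntegrable F volume (-a) a :=
  h.intervalIntegrable_of_Icc (by linarith)

/-- Cauchy–Schwarz inequality with the weight `1 - D|u|`. -/
lemma weighted_cauchy_schwarz (ha : 0 < a) {D m : ℝ} (hD : 0 ≤ D) (hDa : a * D ≤ 1 / 2)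
    {χ : ℝ → ℝ} (hχ : Continuous χ) (h1 : ∫ u in -a..a, χ u ^ 2 = 1)
    (h2 : ∫ u in -a..a, |u| * χ u ^ 2 ≤ m) {f : ℝ → ℝ} (hf : ContinuousOn f (Icc (-a) a)) :
    (1 - 2 * D * m) * (∫ u in -a..a, χ u * f u) ^ 2
      ≤ ∫ u in -a..a, (1 - D * |u|) * f u ^ 2 := by
  set H := ∫ u in -a..a, χ u * f u with hH
  have hc : ContinuousOn χ (Icc (-a) a) := hχ.continuousOn
  have hcf := hc.mul hf
  have ha' : ContinuousOn (fun u : ℝ => |u|) (Icc (-a) a) := continuous_abs.continuousOn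
  -- With `x = D|u| ≤ 1/2`, complete the square pointwise: `(1 - x) f² ≥ 2Hχf - H²χ²/(1 - x) ≥ 2Hχf
  -- - (1 + 2x) H²χ²`. Integration turns the first term into `2H²`.
  have key : ∫ u in -a..a, (2 * H * (χ u * f u) - (H ^ 2 * χ u ^ 2
      + 2 * D * H ^ 2 * (|u| * χ u ^ 2))) ≤ ∫ u in -a..a, (1 - D * |u|) * f u ^ 2 := by
    refine intervalIntegral.integral_mono_on (by linarith) ?_ ?_ fun u hu => ?_
    · exact intervalIntegrable_symm ha ((continuousOn_const.mul hcf).sub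
        ((continuousOn_const.mul (hc.pow 2)).add (continuousOn_const.mul (ha'.mul (hc.pow 2)))))
    · exact intervalIntegrable_symm ha
        ((continuousOn_const.sub (continuousOn_const.mul ha')).mul (hf.pow 2))
    · have hu' : |u| ≤ a := abs_le.mpr hu
      have hx0 : 0 ≤ D * |u| := by positivity
      have hx1 : D * |u| ≤ 1 / 2 := by nlinarith
      set x := D * |u| with hx
      have e : 2 * D * H ^ 2 * (|u| * χ u ^ 2) = 2 * x * (H * χ u) ^ 2 := by rw [hx]; ring
      rw [e]
      have hw : 0 < 1 - x := by linarith
      have h3 : 0 ≤ ((1 - x) * f u - H * χ u) ^ 2 / (1 - x) := by positivity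
      have h4 : ((1 - x) * f u - H * χ u) ^ 2 / (1 - x)
          = (1 - x) * f u ^ 2 - 2 * (H * χ u) * f u + (H * χ u) ^ 2 / (1 - x) := by
        field_simp; ring
      have h5 : (H * χ u) ^ 2 / (1 - x) ≤ (1 + 2 * x) * (H * χ u) ^ 2 := by
        rw [div_le_iff₀ hw]
        nlinarith [sq_nonneg (H * χ u), mul_nonneg (mul_nonneg hx0 (by linarith : 0 ≤ 1 - 2 * x))
          (sq_nonneg (H * χ u))]
      nlinarith
  rw [intervalIntegral.integral_sub, intervalIntegral.integral_add,
    intervalIntegral.integral_const_mul, intervalIntegral.integral_const_mul,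
    intervalIntegral.integral_const_mul, h1, ← hH] at key
  · have h6 : 2 * D * H ^ 2 * (∫ u in -a..a, |u| * χ u ^ 2) ≤ 2 * D * H ^ 2 * m :=
      mul_le_mul_of_nonneg_left h2 (by positivity)
    nlinarith
  · exact intervalIntegrable_symm ha (continuousOn_const.mul (hc.pow 2))
  · exact intervalIntegrable_symm ha (continuousOn_const.mul (ha'.mul (hc.pow 2)))
  · exact intervalIntegrable_symm ha (continuousOn_const.mul hcf)
  · exact intervalIntegrable_symm ha
      ((continuousOn_const.mul (hc.pow 2)).add (continuousOn_const.mul (ha'.mul (hc.pow 2))))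

/-- Split `g = Hχ + (g - Hχ)`. The first part is concentrated near `0` and has a small moment; for
the second the crude bound `|u| ≤ a` suffices, since its energy lies far above. -/
lemma moment_le (ha : 0 < a) {m : ℝ}
    {χ : ℝ → ℝ} (hχ : Continuous χ) (h1 : ∫ u in -a..a, χ u ^ 2 = 1)
    (h2 : ∫ u in -a..a, |u| * χ u ^ 2 ≤ m) {g : ℝ → ℝ} (hg : ContinuousOn g (Icc (-a) a)) :
    ∫ u in -a..a, |u| * g u ^ 2 ≤ 2 * m * (∫ u in -a..a, χ u * g u) ^ 2
      + 2 * a * ((∫ u in -a..a, g u ^ 2) - (∫ u in -a..a, χ u * g u) ^ 2) := by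
  set H := ∫ u in -a..a, χ u * g u with hH
  have hc : ContinuousOn χ (Icc (-a) a) := hχ.continuousOn
  have hcg := hc.mul hg
  have ha' : ContinuousOn (fun u : ℝ => |u|) (Icc (-a) a) := continuous_abs.continuousOn
  have i1 : IntervalIntegrable (fun u => 2 * H ^ 2 * (|u| * χ u ^ 2)) volume (-a) a :=
    intervalIntegrable_symm ha (continuousOn_const.mul (ha'.mul (hc.pow 2)))
  have i2 : IntervalIntegrable (fun u => 2 * a * g u ^ 2) volume (-a) a :=
    intervalIntegrable_symm ha (continuousOn_const.mul (hg.pow 2))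
  have i3 : IntervalIntegrable (fun u => 4 * a * H * (χ u * g u)) volume (-a) a :=
    intervalIntegrable_symm ha (continuousOn_const.mul hcg)
  have i4 : IntervalIntegrable (fun u => 2 * a * H ^ 2 * χ u ^ 2) volume (-a) a :=
    intervalIntegrable_symm ha (continuousOn_const.mul (hc.pow 2))
  have key : ∫ u in -a..a, |u| * g u ^ 2 ≤ ∫ u in -a..a, (2 * H ^ 2 * (|u| * χ u ^ 2)
      + (2 * a * g u ^ 2 - 4 * a * H * (χ u * g u) + 2 * a * H ^ 2 * χ u ^ 2)) := by
    refine intervalIntegral.integral_mono_on (by linarith)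
      (intervalIntegrable_symm ha (ha'.mul (hg.pow 2))) (i1.add ((i2.sub i3).add i4)) fun u hu => ?_
    have hu' : |u| ≤ a := abs_le.mpr hu
    have h3 := mul_nonneg (abs_nonneg u) (sq_nonneg (g u - 2 * H * χ u))
    have h4 := mul_nonneg (sub_nonneg.mpr hu') (sq_nonneg (g u - H * χ u))
    nlinarith
  rw [intervalIntegral.integral_add i1 ((i2.sub i3).add i4),
    intervalIntegral.integral_add (i2.sub i3) i4, intervalIntegral.integral_sub i2 i3,
    intervalIntegral.integral_const_mul, intervalIntegral.integral_const_mul,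
    intervalIntegral.integral_const_mul, intervalIntegral.integral_const_mul, h1, ← hH] at key
  have h5 : 2 * H ^ 2 * (∫ u in -a..a, |u| * χ u ^ 2) ≤ 2 * H ^ 2 * m :=
    mul_le_mul_of_nonneg_left h2 (by positivity)
  nlinarith

lemma abs_mul_le_of_small (hG : 1 ≤ G) (hs : a * G ≤ 1 / 8) (hc : |c| ≤ G)
    {u : ℝ} (hu : u ∈ Icc (-a) a) : |u * c| ≤ G * |u| ∧ G * |u| ≤ 1 / 8 := by
  have hu' : |u| ≤ a := abs_le.mpr hu
  rw [abs_mul]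
  exact ⟨by nlinarith [abs_nonneg u], by nlinarith⟩

/-- Pointwise lower bound for the longitudinal energy. -/
lemma longitudinal_le {x J b g gs : ℝ} (hx0 : 0 ≤ x) (hx : x ≤ 1 / 8) (hJ0 : 0 < J)
    (hJ : J ≤ 1 + x) (hb : |b| ≤ x) :
    (1 - 3 * x) * gs ^ 2 - x * g ^ 2 ≤ (gs - b * g) ^ 2 / J ^ 2 := by
  have h1 : (1 - x) * gs ^ 2 - x * g ^ 2 ≤ (gs - b * g) ^ 2 := by
    obtain ⟨b1, b2⟩ := abs_le.mp hb
    nlinarith [mul_nonneg (sub_nonneg.mpr b2) (sq_nonneg (gs + g)),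
      mul_nonneg (by linarith : 0 ≤ x + b) (sq_nonneg (gs - g)), sq_nonneg (b * g)]
  have h2 : (1 - 2 * x) * (gs - b * g) ^ 2 ≤ (gs - b * g) ^ 2 / J ^ 2 := by
    rw [le_div_iff₀ (by positivity)]
    have h3 : J ^ 2 * (1 - 2 * x) ≤ 1 := by
      have : J ^ 2 ≤ (1 + x) ^ 2 := pow_le_pow_left₀ hJ0.le hJ 2
      nlinarith [sq_nonneg x, mul_nonneg hx0 (sq_nonneg x)]
    nlinarith [sq_nonneg (gs - b * g)]
  refine le_trans ?_ h2
  refine le_trans ?_ (mul_le_mul_of_nonneg_left h1 (by linarith : 0 ≤ 1 - 2 * x))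
  nlinarith [mul_nonneg (sq_nonneg x) (sq_nonneg gs), mul_nonneg (sq_nonneg x) (sq_nonneg g)]

lemma inv_sq_le {x J : ℝ} (hx0 : 0 ≤ x) (hx : x ≤ 1 / 8) (hJ : 1 - x ≤ J) :
    1 / J ^ 2 ≤ 1 + 3 * x := by
  have hJ0 : 0 < J := by linarith
  rw [div_le_iff₀ (by positivity)]
  have : (1 - x) ^ 2 ≤ J ^ 2 := pow_le_pow_left₀ (by linarith) hJ 2
  nlinarith [mul_nonneg hx0 (sq_nonneg x), mul_nonneg hx0 (by linarith : 0 ≤ 1 - 5 * x)]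

/-- With `r² = 1 + uc` the left side is the squared derivative of `g = r f`. The term `c² / (4 r⁴)`
produces the attractive potential `-γ²/4`, and `c f f'` is a total derivative. -/
lemma transverse_identity {r : ℝ} (hr : r ≠ 0) (c f f' : ℝ) :
    (r * f' + c / (2 * r) * f) ^ 2
      = r ^ 2 * f' ^ 2 + c * (f * f') + c ^ 2 / 4 * (1 / (r ^ 2) ^ 2) * (r * f) ^ 2 := by
  field_simp
  ring

lemma longitudinal_identity {r : ℝ} (hr : r ≠ 0) (e f fs : ℝ) :
    r * fs + e / (2 * r) * f - e / (2 * r ^ 2) * (r * f) = r * fs := by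
  field_simp
  ring

lemma jacobian_bounds (hG : 1 ≤ G) (hs : a * G ≤ 1 / 8) (hc : |c| ≤ G) {u : ℝ}
    (hu : u ∈ Icc (-a) a) : 7 / 8 ≤ 1 + u * c ∧ |u * c| ≤ G * |u| ∧ G * |u| ≤ 1 / 8 := by
  obtain ⟨e1, e2⟩ := abs_mul_le_of_small hG hs hc hu
  exact ⟨by linarith [(abs_le.mp (e1.trans e2)).1], e1, e2⟩

lemma sqrt_jacobian (hG : 1 ≤ G) (hs : a * G ≤ 1 / 8) (hc : |c| ≤ G) {u : ℝ}
    (hu : u ∈ Icc (-a) a) :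
    0 < Real.sqrt (1 + u * c) ∧ Real.sqrt (1 + u * c) ^ 2 = 1 + u * c := by
  have := (jacobian_bounds hG hs hc hu).1
  exact ⟨Real.sqrt_pos.mpr (by linarith), Real.sq_sqrt (by linarith)⟩

lemma continuousOn_sqrt_jacobian (a c : ℝ) :
    ContinuousOn (fun u => Real.sqrt (1 + u * c)) (Icc (-a) a) := by fun_prop

lemma continuousOn_div_sqrt_jacobian (hG : 1 ≤ G) (hs : a * G ≤ 1 / 8) (hc : |c| ≤ G)
    {e : ℝ → ℝ} (he : Continuous e) :
    ContinuousOn (fun u => e u / (2 * Real.sqrt (1 + u * c))) (Icc (-a) a) :=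
  he.continuousOn.div (continuousOn_const.mul (continuousOn_sqrt_jacobian a c)) fun u hu =>
    mul_ne_zero two_ne_zero (sqrt_jacobian hG hs hc hu).1.ne'

lemma hasDerivAt_sqrt_jacobian_mul (hG : 1 ≤ G) (hs : a * G ≤ 1 / 8) (hc : |c| ≤ G)
    {f f' : ℝ → ℝ} {u : ℝ} (hu : u ∈ Icc (-a) a) (hf : HasDerivAt f (f' u) u) :
    HasDerivAt (fun u => Real.sqrt (1 + u * c) * f u)
      (Real.sqrt (1 + u * c) * f' u + c / (2 * Real.sqrt (1 + u * c)) * f u) u := by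
  have e1 : HasDerivAt (fun u => 1 + u * c) c u := by
    simpa using ((hasDerivAt_id u).mul_const c).const_add 1
  refine ((e1.sqrt (by linarith [(jacobian_bounds hG hs hc hu).1])).mul hf).congr_deriv ?_
  ring

/-- The transverse energy on a fiber of the tube. -/
lemma transverse_energy_ge (ha : 0 < a) (hG : 1 ≤ G) (hs : a * G ≤ 1 / 8) (hc : |c| ≤ G)
    {f f' : ℝ → ℝ} (hf : ∀ u ∈ Icc (-a) a, HasDerivAt f (f' u) u)
    (hf' : ContinuousOn f' (Icc (-a) a)) :
    (∫ u in -a..a, (Real.sqrt (1 + u * c) * f' u + c / (2 * Real.sqrt (1 + u * c)) * f u) ^ 2)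
      - c ^ 2 / 4 * (∫ u in -a..a, (Real.sqrt (1 + u * c) * f u) ^ 2)
      - G ^ 3 * (∫ u in -a..a, |u| * (Real.sqrt (1 + u * c) * f u) ^ 2)
      - c / 2 * (f a ^ 2 - f (-a) ^ 2)
      ≤ ∫ u in -a..a, (1 + u * c) * f' u ^ 2 := by
  have hle : -a ≤ a := by linarith
  have hfc : ContinuousOn f (Icc (-a) a) := fun u hu => (hf u hu).continuousAt.continuousWithinAt
  have hgc := (continuousOn_sqrt_jacobian a c).mul hfc
  have hgc' := ((continuousOn_sqrt_jacobian a c).mul hf').add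
    ((continuousOn_div_sqrt_jacobian hG hs hc (continuous_const (y := c))).mul hfc)
  have habs : ContinuousOn (fun u : ℝ => |u|) (Icc (-a) a) := continuous_abs.continuousOn
  -- The cross term of `transverse_identity` is the derivative of `(c/2) f²` and leaves only
  -- boundary values.
  have hbd : ∫ u in -a..a, c * (f u * f' u) = c / 2 * (f a ^ 2 - f (-a) ^ 2) := by
    have := intervalIntegral.integral_eq_sub_of_hasDerivAt (a := -a) (b := a)
      (f := fun u => c / 2 * f u ^ 2) (f' := fun u => c * (f u * f' u))
      (fun u hu => by
        rw [uIcc_of_le hle] at hu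
        refine (((hf u hu).pow 2).const_mul (c / 2)).congr_deriv ?_
        push_cast; ring) (intervalIntegrable_symm ha (continuousOn_const.mul (hfc.mul hf')))
    rw [this]; ring
  have i1 : IntervalIntegrable (fun u => (Real.sqrt (1 + u * c) * f' u
      + c / (2 * Real.sqrt (1 + u * c)) * f u) ^ 2) volume (-a) a :=
    intervalIntegrable_symm ha (hgc'.pow 2)
  have i2 : IntervalIntegrable (fun u => c ^ 2 / 4 * (Real.sqrt (1 + u * c) * f u) ^ 2)
      volume (-a) a := intervalIntegrable_symm ha (continuousOn_const.mul (hgc.pow 2))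
  have i3 : IntervalIntegrable (fun u => G ^ 3 * (|u| * (Real.sqrt (1 + u * c) * f u) ^ 2))
      volume (-a) a := intervalIntegrable_symm ha (continuousOn_const.mul (habs.mul (hgc.pow 2)))
  have i4 : IntervalIntegrable (fun u => c * (f u * f' u)) volume (-a) a :=
    intervalIntegrable_symm ha (continuousOn_const.mul (hfc.mul hf'))
  have i5 : IntervalIntegrable (fun u => (1 + u * c) * f' u ^ 2) volume (-a) a :=
    intervalIntegrable_symm ha (ContinuousOn.mul (by fun_prop) (hf'.pow 2))
  rw [← hbd, ← intervalIntegral.integral_const_mul, ← intervalIntegral.integral_const_mul,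
    ← intervalIntegral.integral_sub i1 i2, ← intervalIntegral.integral_sub (i1.sub i2) i3,
    ← intervalIntegral.integral_sub ((i1.sub i2).sub i3) i4]
  refine intervalIntegral.integral_mono_on hle (((i1.sub i2).sub i3).sub i4) i5 fun u hu => ?_
  obtain ⟨j1, j2, j3⟩ := jacobian_bounds hG hs hc hu
  obtain ⟨r0, r2⟩ := sqrt_jacobian hG hs hc hu
  have e1 := transverse_identity r0.ne' c (f u) (f' u)
  rw [r2] at e1
  have hx0 : 0 ≤ G * |u| := by positivity
  have e2 : 1 / (1 + u * c) ^ 2 ≤ 1 + 3 * (G * |u|) :=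
    inv_sq_le hx0 j3 (by linarith [(abs_le.mp j2).1])
  have q1 : c ^ 2 / 4 * (1 / (1 + u * c) ^ 2) ≤ c ^ 2 / 4 * (1 + 3 * (G * |u|)) :=
    mul_le_mul_of_nonneg_left e2 (by positivity)
  have q2 : c ^ 2 ≤ G ^ 2 := sq_le_sq' (abs_le.mp hc).1 (abs_le.mp hc).2
  have q3 : c ^ 2 / 4 * (3 * (G * |u|)) ≤ G ^ 2 * (G * |u|) :=
    by nlinarith [mul_le_mul_of_nonneg_right q2 hx0, mul_nonneg (sq_nonneg G) hx0]
  have q4 : c ^ 2 / 4 * (1 / (1 + u * c) ^ 2) ≤ c ^ 2 / 4 + G ^ 3 * |u| := by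
    have : G ^ 2 * (G * |u|) = G ^ 3 * |u| := by ring
    linarith
  have := mul_le_mul_of_nonneg_right q4 (sq_nonneg (Real.sqrt (1 + u * c) * f u))
  rw [e1]
  linarith

/-- The longitudinal energy on a fiber of the tube. -/
lemma longitudinal_energy_ge (ha : 0 < a) (hG : 1 ≤ G) (hs : a * G ≤ 1 / 8) (hc : |c| ≤ G)
    (hd : |d| ≤ G) {f fs : ℝ → ℝ} (hfc : ContinuousOn f (Icc (-a) a))
    (hfs : ContinuousOn fs (Icc (-a) a)) :
    (∫ u in -a..a, (1 - 3 * G * |u|) *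
        (Real.sqrt (1 + u * c) * fs u + u * d / (2 * Real.sqrt (1 + u * c)) * f u) ^ 2)
      - G * (∫ u in -a..a, |u| * (Real.sqrt (1 + u * c) * f u) ^ 2)
      ≤ ∫ u in -a..a, (1 + u * c)⁻¹ * fs u ^ 2 := by
  have hle : -a ≤ a := by linarith
  have hgc := (continuousOn_sqrt_jacobian a c).mul hfc
  have hgsc := ((continuousOn_sqrt_jacobian a c).mul hfs).add
    ((continuousOn_div_sqrt_jacobian hG hs hc (continuous_id.mul_const d)).mul hfc)
  have habs : ContinuousOn (fun u : ℝ => |u|) (Icc (-a) a) := continuous_abs.continuousOn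
  have i1 : IntervalIntegrable (fun u => (1 - 3 * G * |u|) *
      (Real.sqrt (1 + u * c) * fs u + u * d / (2 * Real.sqrt (1 + u * c)) * f u) ^ 2)
      volume (-a) a := intervalIntegrable_symm ha
    ((continuousOn_const.sub (continuousOn_const.mul habs)).mul (hgsc.pow 2))
  have i2 : IntervalIntegrable (fun u => G * (|u| * (Real.sqrt (1 + u * c) * f u) ^ 2))
      volume (-a) a := intervalIntegrable_symm ha (continuousOn_const.mul (habs.mul (hgc.pow 2)))
  have i3 : IntervalIntegrable (fun u => (1 + u * c)⁻¹ * fs u ^ 2) volume (-a) a := by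
    refine intervalIntegrable_symm ha (ContinuousOn.mul (ContinuousOn.inv₀ (by fun_prop)
      fun u hu => ?_) (hfs.pow 2))
    have := (jacobian_bounds hG hs hc hu).1
    linarith
  rw [← intervalIntegral.integral_const_mul, ← intervalIntegral.integral_sub i1 i2]
  refine intervalIntegral.integral_mono_on hle (i1.sub i2) i3 fun u hu => ?_
  obtain ⟨j1, j2, j3⟩ := jacobian_bounds hG hs hc hu
  obtain ⟨r0, r2⟩ := sqrt_jacobian hG hs hc hu
  have hJ0 : 0 < (1 + u * c) := by linarith
  have hx0 : 0 ≤ G * |u| := by positivity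
  have hb : |u * d / (2 * (1 + u * c))| ≤ G * |u| := by
    rw [abs_div, abs_mul, abs_of_pos (by linarith : 0 < 2 * (1 + u * c)), div_le_iff₀ (by linarith)]
    have : |u| * |d| ≤ |u| * G := mul_le_mul_of_nonneg_left hd (abs_nonneg u)
    nlinarith
  have key := longitudinal_le (g := Real.sqrt (1 + u * c) * f u)
    (gs := Real.sqrt (1 + u * c) * fs u + u * d / (2 * Real.sqrt (1 + u * c)) * f u) hx0 j3 hJ0
    (by linarith [(abs_le.mp j2).2]) hb
  have e1 := longitudinal_identity r0.ne' (u * d) (f u) (fs u)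
  rw [r2] at e1
  rw [e1, mul_pow _ (fs u), r2] at key
  have e2 : (1 + u * c) * fs u ^ 2 / (1 + u * c) ^ 2 = (1 + u * c)⁻¹ * fs u ^ 2 := by
    field_simp
  rw [e2] at key
  linarith

/-- In the application `h` and `hl` are the projections on `χ` of `g` and of its longitudinal
derivative, `n` is the squared norm of `g` and `m` its first moment, `A` and `B` are the two
energies, `R` is the boundary term. The number `100` is crude: it has to dominate `2 · 3 · 16 = 96`
from the longitudinal weight and `2 · 2 · 16 = 64` from the moment. -/
lemma fiber_arithmetic {h hl n m A B E S R c k : ℝ} (hG : 1 ≤ G)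
    (ha8 : a ≤ 1 / 8) (hc : |c| ≤ G) (hk0 : 0 < k)
    (hvar : 0 ≤ n - h ^ 2)
    (hcs : (1 - 2 * (3 * G) * (16 / k)) * hl ^ 2 ≤ S)
    (hmom : m ≤ 2 * (16 / k) * h ^ 2 + 2 * a * (n - h ^ 2))
    (hS : S - G * m ≤ A) (hT : E - c ^ 2 / 4 * n - G ^ 3 * m - R ≤ B) :
    (1 - 100 * G ^ 3 / k) * hl ^ 2 + E - R - c ^ 2 / 4 * h ^ 2 - 100 * G ^ 3 / k * h ^ 2
      - 100 * G ^ 3 * (n - h ^ 2) ≤ A + B := by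
  have q2 : c ^ 2 ≤ G ^ 2 := sq_le_sq' (abs_le.mp hc).1 (abs_le.mp hc).2
  have hGG2 : G ^ 2 ≤ G ^ 3 := by nlinarith [sq_nonneg G]
  have hGG : G ≤ G ^ 3 := by nlinarith
  have t1 : (1 - 100 * G ^ 3 / k) * hl ^ 2 ≤ (1 - 2 * (3 * G) * (16 / k)) * hl ^ 2 := by
    refine mul_le_mul_of_nonneg_right ?_ (sq_nonneg _)
    have : 2 * (3 * G) * (16 / k) ≤ 100 * G ^ 3 / k := by
      rw [← mul_div_assoc]
      exact div_le_div_of_nonneg_right (by linarith) hk0.le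
    linarith
  have t2 : (G ^ 3 + G) * m ≤ 100 * G ^ 3 / k * h ^ 2 + G ^ 3 * (n - h ^ 2) := by
    have p1 : 0 ≤ G ^ 3 + G := by positivity
    refine (mul_le_mul_of_nonneg_left hmom p1).trans ?_
    have p2 : (G ^ 3 + G) * (2 * (16 / k) * h ^ 2) ≤ 100 * G ^ 3 / k * h ^ 2 := by
      rw [← mul_assoc]
      refine mul_le_mul_of_nonneg_right ?_ (sq_nonneg _)
      rw [← mul_div_assoc, ← mul_div_assoc]
      exact div_le_div_of_nonneg_right (by linarith) hk0.le
    have p3 : (G ^ 3 + G) * (2 * a * (n - h ^ 2)) ≤ G ^ 3 * (n - h ^ 2) := by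
      rw [← mul_assoc]
      refine mul_le_mul_of_nonneg_right ?_ hvar
      nlinarith
    linarith
  have t3 : c ^ 2 / 4 * n ≤ c ^ 2 / 4 * h ^ 2 + G ^ 3 * (n - h ^ 2) := by
    have : c ^ 2 / 4 * (n - h ^ 2) ≤ G ^ 3 * (n - h ^ 2) :=
      mul_le_mul_of_nonneg_right (by linarith [sq_nonneg G]) hvar
    linarith
  have t4 : 0 ≤ G ^ 3 * (n - h ^ 2) := mul_nonneg (by positivity) hvar
  linarith

/-- Lower bound for the energy on a fiber of the tube in terms of the projection to the
transverse ground state. -/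
lemma fiber_lower_bound (ha : 0 < a) (hG : 1 ≤ G) (hs : a * G ≤ 1 / 8) (hc : |c| ≤ G)
    (hd : |d| ≤ G) (hk : 2 * G ≤ k) {χ : ℝ → ℝ} (hχ : Continuous χ)
    (h1 : ∫ u in -a..a, χ u ^ 2 = 1) (h2 : ∫ u in -a..a, |u| * χ u ^ 2 ≤ 16 / k)
    (h3 : ∀ g g' : ℝ → ℝ, (∀ u ∈ Icc (-a) a, HasDerivAt g (g' u) u) →
      ContinuousOn g' (Icc (-a) a) →
        k / 2 * (g a ^ 2 + g (-a) ^ 2) + 2 * robinStrength a k * g 0 ^ 2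
          - k ^ 2 * (∫ u in -a..a, χ u * g u) ^ 2
          - k ^ 2 / 4 * ((∫ u in -a..a, g u ^ 2) - (∫ u in -a..a, χ u * g u) ^ 2)
        ≤ ∫ u in -a..a, g' u ^ 2)
    {f f' fs g gs : ℝ → ℝ} (hf : ∀ u ∈ Icc (-a) a, HasDerivAt f (f' u) u)
    (hf' : ContinuousOn f' (Icc (-a) a)) (hfs : ContinuousOn fs (Icc (-a) a))
    (hg : g = fun u => Real.sqrt (1 + u * c) * f u)
    (hgs : gs = fun u => Real.sqrt (1 + u * c) * fs u
      + u * d / (2 * Real.sqrt (1 + u * c)) * f u) :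
    (1 - 100 * G ^ 3 / k) * (∫ u in -a..a, χ u * gs u) ^ 2
      - c ^ 2 / 4 * (∫ u in -a..a, χ u * g u) ^ 2
      - (k ^ 2 + 100 * G ^ 3 / k) * (∫ u in -a..a, χ u * g u) ^ 2
      - (k ^ 2 / 4 + 100 * G ^ 3) *
        ((∫ u in -a..a, g u ^ 2) - (∫ u in -a..a, χ u * g u) ^ 2)
    ≤ (∫ u in -a..a, ((1 + u * c)⁻¹ * fs u ^ 2 + (1 + u * c) * f' u ^ 2))
      - 2 * robinStrength a k * f 0 ^ 2 := by
  have hle : -a ≤ a := by linarith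
  have hk0 : 0 < k := by linarith
  have hfc : ContinuousOn f (Icc (-a) a) := fun u hu => (hf u hu).continuousAt.continuousWithinAt
  have hT := transverse_energy_ge ha hG hs hc hf hf'
  have hS := longitudinal_energy_ge ha hG hs hc hd hfc hfs
  have hgc : ContinuousOn g (Icc (-a) a) := by
    rw [hg]; exact (continuousOn_sqrt_jacobian a c).mul hfc
  have hgsc : ContinuousOn gs (Icc (-a) a) := by
    rw [hgs]
    exact ((continuousOn_sqrt_jacobian a c).mul hfs).add
      ((continuousOn_div_sqrt_jacobian hG hs hc (continuous_id.mul_const d)).mul hfc)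
  have ht := h3 g _ (fun u hu => by
    rw [hg]; exact hasDerivAt_sqrt_jacobian_mul hG hs hc hu (hf u hu))
    (((continuousOn_sqrt_jacobian a c).mul hf').add
      ((continuousOn_div_sqrt_jacobian hG hs hc (continuous_const (y := c))).mul hfc))
  have hcs := weighted_cauchy_schwarz ha (D := 3 * G) (by linarith) (by linarith) hχ h1 h2 hgsc
  have hmom := moment_le ha hχ h1 h2 hgc
  -- Bessel's inequality, as the case `D = 0` of the weighted Cauchy–Schwarz inequality.
  have hvar : 0 ≤ (∫ u in -a..a, g u ^ 2) - (∫ u in -a..a, χ u * g u) ^ 2 := by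
    have := weighted_cauchy_schwarz ha (D := 0) le_rfl (by simp) hχ h1 h2 hgc
    simp only [mul_zero, zero_mul, sub_zero, one_mul] at this
    linarith
  have hend : ∀ u ∈ Icc (-a) a, |c| / 2 * f u ^ 2 ≤ k / 2 * g u ^ 2 := by
    intro u hu
    have h0 := (jacobian_bounds hG hs hc hu).1
    simp only [hg]
    rw [mul_pow, (sqrt_jacobian hG hs hc hu).2]
    have h4 : |c| / 2 ≤ k / 2 * (1 + u * c) := by nlinarith
    have := mul_le_mul_of_nonneg_right h4 (sq_nonneg (f u))
    linarith
  have hea := hend a ⟨hle, le_rfl⟩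
  have hem := hend (-a) ⟨le_rfl, hle⟩
  -- The boundary term caused by the curvature is absorbed by the one gained from the Robin
  -- condition; this is where `2G ≤ k` enters.
  have hbd : c / 2 * (f a ^ 2 - f (-a) ^ 2) ≤ k / 2 * (g a ^ 2 + g (-a) ^ 2) := by
    have b1 := mul_le_mul_of_nonneg_right (le_abs_self c) (sq_nonneg (f a))
    have b2 := mul_le_mul_of_nonneg_right (neg_abs_le c) (sq_nonneg (f (-a)))
    linarith
  have hg0 : g 0 = f 0 := by rw [hg]; simp
  have iA : IntervalIntegrable (fun u => (1 + u * c)⁻¹ * fs u ^ 2) volume (-a) a := by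
    refine intervalIntegrable_symm ha (ContinuousOn.mul (ContinuousOn.inv₀ (by fun_prop)
      fun u hu => ?_) (hfs.pow 2))
    have := (jacobian_bounds hG hs hc hu).1
    linarith
  have iB : IntervalIntegrable (fun u => (1 + u * c) * f' u ^ 2) volume (-a) a :=
    intervalIntegrable_symm ha (ContinuousOn.mul (by fun_prop) (hf'.pow 2))
  rw [intervalIntegral.integral_add iA iB]
  have hT' : (∫ u in -a..a, (Real.sqrt (1 + u * c) * f' u
        + c / (2 * Real.sqrt (1 + u * c)) * f u) ^ 2)
      - c ^ 2 / 4 * (∫ u in -a..a, g u ^ 2) - G ^ 3 * (∫ u in -a..a, |u| * g u ^ 2)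
      - c / 2 * (f a ^ 2 - f (-a) ^ 2) ≤ ∫ u in -a..a, (1 + u * c) * f' u ^ 2 := by
    simp only [hg]; exact hT
  have hS' : (∫ u in -a..a, (1 - 3 * G * |u|) * gs u ^ 2) - G * (∫ u in -a..a, |u| * g u ^ 2)
      ≤ ∫ u in -a..a, (1 + u * c)⁻¹ * fs u ^ 2 := by
    simp only [hg, hgs]; exact hS
  have key := fiber_arithmetic hG (by nlinarith) hc hk0 hvar hcs hmom hS' hT'
  rw [hg0] at ht
  change _ ≤ ∫ u in -a..a, (Real.sqrt (1 + u * c) * f' u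
        + c / (2 * Real.sqrt (1 + u * c)) * f u) ^ 2 at ht
  generalize (∫ u in -a..a, χ u * g u) ^ 2 = X at *
  generalize (∫ u in -a..a, g u ^ 2) = Y at *
  linarith

end FiberBound

end StrongDelta

end

/-! ### Complex-valued functions, parametric integrals and the change to curvilinear coordinates. -/

noncomputable section

namespace StrongDelta

section ComplexFiber

variable {a k G c d : ℝ}

lemma norm_sq_eq_re_add_im (z : ℂ) : ‖z‖ ^ 2 = z.re ^ 2 + z.im ^ 2 := by
  rw [← Complex.normSq_eq_norm_sq, Complex.normSq_apply]; ring

lemma intervalIntegral_re {F : ℝ → ℂ} {a b : ℝ} (hF : IntervalIntegrable F volume a b) :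
    (∫ u in a..b, F u).re = ∫ u in a..b, (F u).re :=
  (Complex.reCLM.intervalIntegral_comp_comm hF).symm

lemma intervalIntegral_im {F : ℝ → ℂ} {a b : ℝ} (hF : IntervalIntegrable F volume a b) :
    (∫ u in a..b, F u).im = ∫ u in a..b, (F u).im :=
  (Complex.imCLM.intervalIntegral_comp_comm hF).symm

/-- Complex version of `fiber_lower_bound`. -/
lemma fiber_lower_bound_complex (ha : 0 < a) (hG : 1 ≤ G) (hs : a * G ≤ 1 / 8) (hc : |c| ≤ G)
    (hd : |d| ≤ G) (hk : 2 * G ≤ k) {χ : ℝ → ℝ} (hχ : Continuous χ)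
    (h1 : ∫ u in -a..a, χ u ^ 2 = 1) (h2 : ∫ u in -a..a, |u| * χ u ^ 2 ≤ 16 / k)
    (h3 : ∀ g g' : ℝ → ℝ, (∀ u ∈ Icc (-a) a, HasDerivAt g (g' u) u) →
      ContinuousOn g' (Icc (-a) a) →
        k / 2 * (g a ^ 2 + g (-a) ^ 2) + 2 * robinStrength a k * g 0 ^ 2
          - k ^ 2 * (∫ u in -a..a, χ u * g u) ^ 2
          - k ^ 2 / 4 * ((∫ u in -a..a, g u ^ 2) - (∫ u in -a..a, χ u * g u) ^ 2)
        ≤ ∫ u in -a..a, g' u ^ 2)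
    {f f' fs g gs : ℝ → ℂ} (hf : ∀ u ∈ Icc (-a) a, HasDerivAt f (f' u) u)
    (hf' : ContinuousOn f' (Icc (-a) a)) (hfs : ContinuousOn fs (Icc (-a) a))
    (hg : ∀ u, g u = (Real.sqrt (1 + u * c) : ℂ) * f u)
    (hgs : ∀ u, gs u = (Real.sqrt (1 + u * c) : ℂ) * fs u
      + ((u * d / (2 * Real.sqrt (1 + u * c)) : ℝ) : ℂ) * f u) :
    (1 - 100 * G ^ 3 / k) * ‖∫ u in -a..a, (χ u : ℂ) * gs u‖ ^ 2
      - c ^ 2 / 4 * ‖∫ u in -a..a, (χ u : ℂ) * g u‖ ^ 2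
      - (k ^ 2 + 100 * G ^ 3 / k) * ‖∫ u in -a..a, (χ u : ℂ) * g u‖ ^ 2
      - (k ^ 2 / 4 + 100 * G ^ 3) *
        ((∫ u in -a..a, (1 + u * c) * ‖f u‖ ^ 2) - ‖∫ u in -a..a, (χ u : ℂ) * g u‖ ^ 2)
    ≤ (∫ u in -a..a, ((1 + u * c)⁻¹ * ‖fs u‖ ^ 2 + (1 + u * c) * ‖f' u‖ ^ 2))
      - 2 * robinStrength a k * ‖f 0‖ ^ 2 := by
  have hfc : ContinuousOn f (Icc (-a) a) := fun u hu => (hf u hu).continuousAt.continuousWithinAt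
  have hgc : ContinuousOn g (Icc (-a) a) := by
    rw [funext hg]
    exact (Complex.continuous_ofReal.comp_continuousOn (continuousOn_sqrt_jacobian a c)).mul hfc
  have hgsc : ContinuousOn gs (Icc (-a) a) := by
    rw [funext hgs]
    exact ((Complex.continuous_ofReal.comp_continuousOn (continuousOn_sqrt_jacobian a c)).mul
      hfs).add ((Complex.continuous_ofReal.comp_continuousOn
        (continuousOn_div_sqrt_jacobian hG hs hc (continuous_id.mul_const d))).mul hfc)
  have hχc : ContinuousOn (fun u => (χ u : ℂ)) (Icc (-a) a) :=
    (Complex.continuous_ofReal.comp hχ).continuousOn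
  have hle : -a ≤ a := by linarith
  have iG : IntervalIntegrable (fun u => (χ u : ℂ) * g u) volume (-a) a :=
    (hχc.mul hgc).intervalIntegrable_of_Icc hle
  have iS : IntervalIntegrable (fun u => (χ u : ℂ) * gs u) volume (-a) a :=
    (hχc.mul hgsc).intervalIntegrable_of_Icc hle
  have hre := fiber_lower_bound ha hG hs hc hd hk hχ h1 h2 h3
    (f := fun u => (f u).re) (f' := fun u => (f' u).re) (fs := fun u => (fs u).re)
    (fun u hu => Complex.reCLM.hasFDerivAt.comp_hasDerivAt u (hf u hu))
    (Complex.continuous_re.comp_continuousOn hf') (Complex.continuous_re.comp_continuousOn hfs)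
    rfl rfl
  have him := fiber_lower_bound ha hG hs hc hd hk hχ h1 h2 h3
    (f := fun u => (f u).im) (f' := fun u => (f' u).im) (fs := fun u => (fs u).im)
    (fun u hu => Complex.imCLM.hasFDerivAt.comp_hasDerivAt u (hf u hu))
    (Complex.continuous_im.comp_continuousOn hf') (Complex.continuous_im.comp_continuousOn hfs)
    rfl rfl
  have e1 : ‖∫ u in -a..a, (χ u : ℂ) * g u‖ ^ 2
      = (∫ u in -a..a, χ u * (Real.sqrt (1 + u * c) * (f u).re)) ^ 2
        + (∫ u in -a..a, χ u * (Real.sqrt (1 + u * c) * (f u).im)) ^ 2 := by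
    rw [norm_sq_eq_re_add_im, intervalIntegral_re iG, intervalIntegral_im iG]
    simp only [hg, Complex.re_ofReal_mul, Complex.im_ofReal_mul]
  have e2 : ‖∫ u in -a..a, (χ u : ℂ) * gs u‖ ^ 2
      = (∫ u in -a..a, χ u * (Real.sqrt (1 + u * c) * (fs u).re
          + u * d / (2 * Real.sqrt (1 + u * c)) * (f u).re)) ^ 2
        + (∫ u in -a..a, χ u * (Real.sqrt (1 + u * c) * (fs u).im
          + u * d / (2 * Real.sqrt (1 + u * c)) * (f u).im)) ^ 2 := by
    rw [norm_sq_eq_re_add_im, intervalIntegral_re iS, intervalIntegral_im iS]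
    simp only [hgs, Complex.re_ofReal_mul, Complex.im_ofReal_mul, Complex.add_re, Complex.add_im]
  have cre := Complex.continuous_re.comp_continuousOn hfc
  have cim := Complex.continuous_im.comp_continuousOn hfc
  have hrc := continuousOn_sqrt_jacobian a c
  have hJc : ContinuousOn (fun u => 1 + u * c) (Icc (-a) a) := by fun_prop
  have hJi : ContinuousOn (fun u => (1 + u * c)⁻¹) (Icc (-a) a) := hJc.inv₀ fun u hu => by
    have := (jacobian_bounds hG hs hc hu).1
    linarith
  have e3 : ∫ u in -a..a, (1 + u * c) * ‖f u‖ ^ 2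
      = (∫ u in -a..a, (Real.sqrt (1 + u * c) * (f u).re) ^ 2)
        + ∫ u in -a..a, (Real.sqrt (1 + u * c) * (f u).im) ^ 2 := by
    rw [← intervalIntegral.integral_add
      (intervalIntegrable_symm ha (F := fun u => (Real.sqrt (1 + u * c) * (f u).re) ^ 2)
        ((hrc.mul cre).pow 2))
      (intervalIntegrable_symm ha (F := fun u => (Real.sqrt (1 + u * c) * (f u).im) ^ 2)
        ((hrc.mul cim).pow 2))]
    refine intervalIntegral.integral_congr fun u hu => ?_
    rw [uIcc_of_le hle] at hu
    simp only [mul_pow, (sqrt_jacobian hG hs hc hu).2, norm_sq_eq_re_add_im]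
    ring
  have e4 : ∫ u in -a..a, ((1 + u * c)⁻¹ * ‖fs u‖ ^ 2 + (1 + u * c) * ‖f' u‖ ^ 2)
      = (∫ u in -a..a, ((1 + u * c)⁻¹ * (fs u).re ^ 2 + (1 + u * c) * (f' u).re ^ 2))
        + ∫ u in -a..a, ((1 + u * c)⁻¹ * (fs u).im ^ 2 + (1 + u * c) * (f' u).im ^ 2) := by
    rw [← intervalIntegral.integral_add
      (intervalIntegrable_symm ha (F := fun u => (1 + u * c)⁻¹ * (fs u).re ^ 2
        + (1 + u * c) * (f' u).re ^ 2)
        ((hJi.mul ((Complex.continuous_re.comp_continuousOn hfs).pow 2)).add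
          (hJc.mul ((Complex.continuous_re.comp_continuousOn hf').pow 2))))
      (intervalIntegrable_symm ha (F := fun u => (1 + u * c)⁻¹ * (fs u).im ^ 2
        + (1 + u * c) * (f' u).im ^ 2)
        ((hJi.mul ((Complex.continuous_im.comp_continuousOn hfs).pow 2)).add
          (hJc.mul ((Complex.continuous_im.comp_continuousOn hf').pow 2))))]
    refine intervalIntegral.integral_congr fun u _ => ?_
    simp only [norm_sq_eq_re_add_im]
    ring
  rw [e1, e2, e3, e4, norm_sq_eq_re_add_im (f 0)]
  linarith

end ComplexFiber

section Parametric

variable {a : ℝ} {F F' : ℝ → ℝ → ℂ}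

/-- The integrands divide by `√(1 + uγ)` and are continuous only for `u` in `[-a, a]`. Clamping `u`
makes them globally continuous without changing the integrals. -/
lemma continuous_clamp (ha : 0 ≤ a)
    (hF : ContinuousOn (Function.uncurry F) (univ ×ˢ Icc (-a) a)) :
    Continuous (Function.uncurry fun s u => F s (projIcc (-a) a (by linarith) u)) := by
  have h1 : Continuous fun p : ℝ × ℝ => (p.1, (projIcc (-a) a (by linarith) p.2 : ℝ)) :=
    continuous_fst.prodMk (continuous_subtype_val.comp (continuous_projIcc.comp continuous_snd))
  exact hF.comp_continuous h1 fun p => ⟨mem_univ _, Subtype.mem _⟩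

lemma integral_clamp (ha : 0 ≤ a) (s : ℝ) :
    ∫ u in -a..a, F s (projIcc (-a) a (by linarith) u) = ∫ u in -a..a, F s u := by
  refine intervalIntegral.integral_congr fun u hu => ?_
  rw [uIcc_of_le (by linarith)] at hu
  simp only [projIcc_of_mem _ hu]

lemma continuous_integral_param (ha : 0 ≤ a)
    (hF : ContinuousOn (Function.uncurry F) (univ ×ˢ Icc (-a) a)) :
    Continuous fun s => ∫ u in -a..a, F s u := by
  have := intervalIntegral.continuous_parametric_intervalIntegral_of_continuous (μ := volume)
    (a₀ := -a) (continuous_clamp ha hF) (continuous_const (y := a))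
  simpa only [integral_clamp ha] using this

lemma hasDerivAt_integral_param (ha : 0 ≤ a)
    (hF : ContinuousOn (Function.uncurry F) (univ ×ˢ Icc (-a) a))
    (hF' : ContinuousOn (Function.uncurry F') (univ ×ˢ Icc (-a) a))
    (hd : ∀ s, ∀ u ∈ Icc (-a) a, HasDerivAt (fun s => F s u) (F' s u) s) (s : ℝ) :
    HasDerivAt (fun s => ∫ u in -a..a, F s u) (∫ u in -a..a, F' s u) s := by
  have hle : -a ≤ a := by linarith
  obtain ⟨C, hC⟩ := ((isCompact_closedBall s 1).prod (isCompact_Icc (a := -a) (b := a))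
    ).exists_bound_of_continuousOn (hF'.mono (prod_mono (subset_univ _) subset_rfl))
  have hsl : ∀ {F : ℝ → ℝ → ℂ}, ContinuousOn (Function.uncurry F) (univ ×ˢ Icc (-a) a) → ∀ s,
      ContinuousOn (F s) (Icc (-a) a) := fun h s =>
    h.comp (continuousOn_const.prodMk continuousOn_id) fun u hu => ⟨mem_univ _, hu⟩
  have hsub : uIoc (-a) a ⊆ Icc (-a) a := by
    rw [uIoc_of_le hle]; exact Ioc_subset_Icc_self
  refine (intervalIntegral.hasDerivAt_integral_of_dominated_loc_of_deriv_le
    (bound := fun _ => C) (Metric.closedBall_mem_nhds s one_pos) ?_ ?_ ?_ ?_ ?_ ?_).2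
  · exact Filter.Eventually.of_forall fun x =>
      ((hsl hF x).mono hsub).aestronglyMeasurable measurableSet_uIoc
  · exact (hsl hF s).intervalIntegrable_of_Icc hle
  · exact ((hsl hF' s).mono hsub).aestronglyMeasurable measurableSet_uIoc
  · exact Filter.Eventually.of_forall fun u hu x hx => hC (x, u) ⟨hx, hsub hu⟩
  · exact continuous_const.intervalIntegrable _ _
  · exact Filter.Eventually.of_forall fun u hu x _ => hd x u (hsub hu)

end Parametric

section Pullback

/-- The longitudinal derivative of `φ` in the curvilinear coordinates. -/
def pullS (N : ℝ → ℝ × ℝ) (α γ : ℝ → ℝ) (φ : ℝ × ℝ → ℂ) (p : ℝ × ℝ) : ℂ :=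
  fderiv ℝ φ (tubeCoord N α p) (tubeDeriv α γ p (1, 0))

/-- The transverse derivative of `φ` in the curvilinear coordinates. -/
def pullU (N : ℝ → ℝ × ℝ) (α γ : ℝ → ℝ) (φ : ℝ × ℝ → ℂ) (p : ℝ × ℝ) : ℂ :=
  fderiv ℝ φ (tubeCoord N α p) (tubeDeriv α γ p (0, 1))

namespace IsTube

variable {N : ℝ → ℝ × ℝ} {α γ γ' : ℝ → ℝ} {L k₁ k₂ a G : ℝ} {φ : ℝ × ℝ → ℂ}

lemma continuous_tubeCoord (h : IsTube N α γ γ' L k₁ k₂ a G) : Continuous (tubeCoord N α) :=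
  h.contDiff_tubeCoord.continuous

lemma continuous_pullS (h : IsTube N α γ γ' L k₁ k₂ a G) (hφ : ContDiff ℝ 1 φ) :
    Continuous (pullS N α γ φ) :=
  ((hφ.continuous_fderiv (by simp)).comp h.continuous_tubeCoord).clm_apply
    (h.continuous_tubeDeriv_apply _)

lemma continuous_pullU (h : IsTube N α γ γ' L k₁ k₂ a G) (hφ : ContDiff ℝ 1 φ) :
    Continuous (pullU N α γ φ) :=
  ((hφ.continuous_fderiv (by simp)).comp h.continuous_tubeCoord).clm_apply
    (h.continuous_tubeDeriv_apply _)

lemma hasFDerivAt_pull (h : IsTube N α γ γ' L k₁ k₂ a G) (hφ : ContDiff ℝ 1 φ) (p : ℝ × ℝ) :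
    HasFDerivAt (fun p => φ (tubeCoord N α p))
      ((fderiv ℝ φ (tubeCoord N α p)).comp (tubeDeriv α γ p)) p :=
  HasFDerivAt.comp p (hφ.differentiable (by simp) _).hasFDerivAt (h.hasFDerivAt_tubeCoord p)

lemma hasDerivAt_pull_s (h : IsTube N α γ γ' L k₁ k₂ a G) (hφ : ContDiff ℝ 1 φ) (s u : ℝ) :
    HasDerivAt (fun s => φ (tubeCoord N α (s, u))) (pullS N α γ φ (s, u)) s := by
  have := HasFDerivAt.comp_hasDerivAt (f := fun s => (s, u)) s (h.hasFDerivAt_pull hφ (s, u))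
    ((hasDerivAt_id s).prodMk (hasDerivAt_const s u))
  exact this

lemma hasDerivAt_pull_u (h : IsTube N α γ γ' L k₁ k₂ a G) (hφ : ContDiff ℝ 1 φ) (s u : ℝ) :
    HasDerivAt (fun u => φ (tubeCoord N α (s, u))) (pullU N α γ φ (s, u)) u := by
  have := HasFDerivAt.comp_hasDerivAt (f := fun u => (s, u)) u (h.hasFDerivAt_pull hφ (s, u))
    ((hasDerivAt_const u s).prodMk (hasDerivAt_id u))
  exact this

/-- The gradient in curvilinear coordinates. -/
lemma jacobian_mul_norm_grad (h : IsTube N α γ γ' L k₁ k₂ a G) {p : ℝ × ℝ}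
    (hp : p.2 ∈ Icc (-a) a) :
    (1 + p.2 * γ p.1) * (‖fderiv ℝ φ (tubeCoord N α p) (1, 0)‖ ^ 2
        + ‖fderiv ℝ φ (tubeCoord N α p) (0, 1)‖ ^ 2)
      = (1 + p.2 * γ p.1)⁻¹ * ‖pullS N α γ φ p‖ ^ 2
        + (1 + p.2 * γ p.1) * ‖pullU N α γ φ p‖ ^ 2 := by
  have hJ := (h.jacobian_pos hp p.1).ne'
  set D := fderiv ℝ φ (tubeCoord N α p) with hD
  have hv : ∀ x y : ℝ, D (x, y) = x • D (1, 0) + y • D (0, 1) := fun x y => by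
    rw [← map_smul, ← map_smul, ← map_add]; simp
  have e1 : pullS N α γ φ p = ((1 + p.2 * γ p.1 : ℝ) : ℂ) *
      ((Real.cos (α p.1) : ℂ) * D (1, 0) + (Real.sin (α p.1) : ℂ) * D (0, 1)) := by
    rw [pullS, tubeDeriv_apply, ← hD, hv]
    simp only [mul_one, mul_zero, sub_zero, add_zero, Complex.real_smul]
    push_cast
    ring
  have e2 : pullU N α γ φ p = -(Real.sin (α p.1) : ℂ) * D (1, 0)
      + (Real.cos (α p.1) : ℂ) * D (0, 1) := by
    rw [pullU, tubeDeriv_apply, ← hD, hv]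
    simp only [mul_one, mul_zero, zero_sub, zero_add, Complex.real_smul]
    push_cast
    ring
  have hcs := Real.cos_sq_add_sin_sq (α p.1)
  have key : ‖(Real.cos (α p.1) : ℂ) * D (1, 0) + (Real.sin (α p.1) : ℂ) * D (0, 1)‖ ^ 2
      + ‖-(Real.sin (α p.1) : ℂ) * D (1, 0) + (Real.cos (α p.1) : ℂ) * D (0, 1)‖ ^ 2
      = ‖D (1, 0)‖ ^ 2 + ‖D (0, 1)‖ ^ 2 := by
    simp only [norm_sq_eq_re_add_im, Complex.add_re, Complex.add_im, Complex.re_ofReal_mul,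
      Complex.im_ofReal_mul, ← Complex.ofReal_neg]
    linear_combination ((D (1, 0)).re ^ 2 + (D (1, 0)).im ^ 2 + (D (0, 1)).re ^ 2
      + (D (0, 1)).im ^ 2) * hcs
  rw [e2, ← key, e1, norm_mul, mul_pow, Complex.norm_real, Real.norm_eq_abs, sq_abs]
  field_simp

/-- Integration over the tube in curvilinear coordinates. -/
lemma setIntegral_tube (h : IsTube N α γ γ' L k₁ k₂ a G) {g : ℝ × ℝ → ℝ} (hg : Continuous g) :
    ∫ x in tubeCoord N α '' (Ioo 0 L ×ˢ Ioo (-a) a), g x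
      = ∫ s in Ioo 0 L, ∫ u in -a..a, (1 + u * γ s) * g (tubeCoord N α (s, u)) := by
  have ha := h.a_pos
  have hinj : InjOn (tubeCoord N α) (Ioo 0 L ×ˢ Ioo (-a) a) :=
    h.injOn_univ.mono (prod_mono (subset_univ _) subset_rfl)
  rw [integral_image_eq_integral_abs_det_fderiv_smul volume
    (measurableSet_Ioo.prod measurableSet_Ioo)
    (fun p _ => (h.hasFDerivAt_tubeCoord p).hasFDerivWithinAt) hinj]
  have hcont : Continuous fun p : ℝ × ℝ => (1 + p.2 * γ p.1) * g (tubeCoord N α p) :=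
    (continuous_const.add (continuous_snd.mul (h.continuous_curvature.comp continuous_fst))).mul
      (hg.comp h.continuous_tubeCoord)
  have hint : IntegrableOn (fun p : ℝ × ℝ => (1 + p.2 * γ p.1) * g (tubeCoord N α p))
      (Ioo 0 L ×ˢ Ioo (-a) a) (volume.prod volume) := by
    refine IntegrableOn.mono_set (t := Icc 0 L ×ˢ Icc (-a) a) ?_
      (prod_mono Ioo_subset_Icc_self Ioo_subset_Icc_self)
    exact hcont.continuousOn.integrableOn_compact (isCompact_Icc.prod isCompact_Icc)
  rw [Measure.volume_eq_prod] at *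
  have e : ∫ p in Ioo 0 L ×ˢ Ioo (-a) a, |(tubeDeriv α γ p).det| • g (tubeCoord N α p)
      ∂(volume.prod volume)
      = ∫ p in Ioo 0 L ×ˢ Ioo (-a) a, (1 + p.2 * γ p.1) * g (tubeCoord N α p)
        ∂(volume.prod volume) := by
    refine setIntegral_congr_fun (measurableSet_Ioo.prod measurableSet_Ioo) fun p hp => ?_
    simp only [det_tubeDeriv, smul_eq_mul]
    rw [abs_of_pos (h.jacobian_pos (Ioo_subset_Icc_self hp.2) p.1)]
  rw [e, setIntegral_prod _ hint]
  refine integral_congr_ae (Filter.Eventually.of_forall fun s => ?_)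
  simp only
  rw [intervalIntegral.integral_of_le (by linarith), integral_Ioc_eq_integral_Ioo]

lemma image_tube_subset (h : IsTube N α γ γ' L k₁ k₂ a G) :
    tubeCoord N α '' (Ioo 0 L ×ˢ Ioo (-a) a) ⊆ strip k₁ := h.maps.image_subset

/-- The part of the strip outside the tube is discarded: for the energy this is harmless since the
gradient term is nonnegative and the interaction lives on the curve. -/
lemma setIntegral_tube_le (h : IsTube N α γ γ' L k₁ k₂ a G) {g : ℝ × ℝ → ℝ} (hg : Continuous g)
    (hc : HasCompactSupport g) (h0 : ∀ x, 0 ≤ g x) :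
    ∫ s in Ioo 0 L, ∫ u in -a..a, (1 + u * γ s) * g (tubeCoord N α (s, u))
      ≤ ∫ x in strip k₁, g x := by
  rw [← h.setIntegral_tube hg]
  exact setIntegral_mono_set (hg.integrable_of_hasCompactSupport hc).integrableOn
    (Filter.Eventually.of_forall h0) (Filter.Eventually.of_forall h.image_tube_subset)

end IsTube

end Pullback

end StrongDelta

end

/-! ### Projection of a function on the strip to the transverse ground state. -/

noncomputable section

namespace StrongDelta

/-- A normalized transverse profile for which the transverse energy is bounded below. -/
structure IsProfile (a k : ℝ) (χ : ℝ → ℝ) : Prop where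
  continuous : Continuous χ
  normalized : ∫ u in -a..a, χ u ^ 2 = 1
  moment : ∫ u in -a..a, |u| * χ u ^ 2 ≤ 16 / k
  energy : ∀ g g' : ℝ → ℝ, (∀ u ∈ Icc (-a) a, HasDerivAt g (g' u) u) →
    ContinuousOn g' (Icc (-a) a) →
      k / 2 * (g a ^ 2 + g (-a) ^ 2) + 2 * robinStrength a k * g 0 ^ 2
        - k ^ 2 * (∫ u in -a..a, χ u * g u) ^ 2
        - k ^ 2 / 4 * ((∫ u in -a..a, g u ^ 2) - (∫ u in -a..a, χ u * g u) ^ 2)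
      ≤ ∫ u in -a..a, g' u ^ 2

lemma exists_isProfile {a k : ℝ} (ha : 0 < a) (hk : 0 < k) (hka : 1 ≤ 2 * k * a) :
    ∃ χ, IsProfile a k χ := by
  obtain ⟨χ, h1, h2, h3, h4⟩ := exists_transverse_profile ha hk hka
  exact ⟨χ, h1, h2, h3, h4⟩

/-- The projection of `φ` to the transverse profile `χ`. -/
def proj (N : ℝ → ℝ × ℝ) (α γ : ℝ → ℝ) (a : ℝ) (χ : ℝ → ℝ) (φ : ℝ × ℝ → ℂ) (s : ℝ) : ℂ :=
  ∫ u in -a..a, (χ u : ℂ) * ((Real.sqrt (1 + u * γ s) : ℂ) * φ (tubeCoord N α (s, u)))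

/-- The derivative of `proj`. -/
def projDeriv (N : ℝ → ℝ × ℝ) (α γ γ' : ℝ → ℝ) (a : ℝ) (χ : ℝ → ℝ) (φ : ℝ × ℝ → ℂ) (s : ℝ) : ℂ :=
  ∫ u in -a..a, (χ u : ℂ) * ((Real.sqrt (1 + u * γ s) : ℂ) * pullS N α γ φ (s, u)
    + ((u * γ' s / (2 * Real.sqrt (1 + u * γ s)) : ℝ) : ℂ) * φ (tubeCoord N α (s, u)))

lemma integral_mono_combination {X : Type*} {m : MeasurableSpace X} {μ : Measure X}
    {f₁ f₂ f₃ f₄ f₅ f₆ : X → ℝ} {c₁ c₃ c₄ c₆ : ℝ} (i1 : Integrable f₁ μ) (i2 : Integrable f₂ μ)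
    (i3 : Integrable f₃ μ) (i4 : Integrable f₄ μ) (i5 : Integrable f₅ μ) (i6 : Integrable f₆ μ)
    (h : ∀ x, c₁ * f₁ x - f₂ x - c₃ * f₃ x - c₄ * (f₄ x - f₃ x) ≤ f₅ x - c₆ * f₆ x) :
    c₁ * ∫ x, f₁ x ∂μ - (∫ x, f₂ x ∂μ) - c₃ * (∫ x, f₃ x ∂μ)
      - c₄ * ((∫ x, f₄ x ∂μ) - ∫ x, f₃ x ∂μ) ≤ (∫ x, f₅ x ∂μ) - c₆ * ∫ x, f₆ x ∂μ := by
  have a1 : Integrable (fun x => c₁ * f₁ x) μ := i1.const_mul c₁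
  have a3 : Integrable (fun x => c₃ * f₃ x) μ := i3.const_mul c₃
  have a4 : Integrable (fun x => f₄ x - f₃ x) μ := i4.sub i3
  have a4' : Integrable (fun x => c₄ * (f₄ x - f₃ x)) μ := a4.const_mul c₄
  have a6 : Integrable (fun x => c₆ * f₆ x) μ := i6.const_mul c₆
  have b1 : Integrable (fun x => c₁ * f₁ x - f₂ x) μ := a1.sub i2
  have b2 : Integrable (fun x => c₁ * f₁ x - f₂ x - c₃ * f₃ x) μ := b1.sub a3
  have b3 : Integrable (fun x => c₁ * f₁ x - f₂ x - c₃ * f₃ x - c₄ * (f₄ x - f₃ x)) μ := b2.sub a4'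
  have b4 : Integrable (fun x => f₅ x - c₆ * f₆ x) μ := i5.sub a6
  have key := integral_mono b3 b4 h
  rw [integral_sub b2 a4', integral_sub b1 a3, integral_sub a1 i2, integral_sub i5 a6,
    integral_const_mul, integral_const_mul, integral_const_mul, integral_const_mul,
    integral_sub i4 i3] at key
  exact key

namespace IsTube

variable {N : ℝ → ℝ × ℝ} {α γ γ' : ℝ → ℝ} {L k₁ k₂ a G k : ℝ} {χ : ℝ → ℝ} {φ : ℝ × ℝ → ℂ}

lemma continuous_sqrt (h : IsTube N α γ γ' L k₁ k₂ a G) :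
    Continuous fun p : ℝ × ℝ => Real.sqrt (1 + p.2 * γ p.1) :=
  Real.continuous_sqrt.comp
    (continuous_const.add (continuous_snd.mul (h.continuous_curvature.comp continuous_fst)))

lemma continuousOn_div_sqrt (h : IsTube N α γ γ' L k₁ k₂ a G) :
    ContinuousOn (fun p : ℝ × ℝ => p.2 * γ' p.1 / (2 * Real.sqrt (1 + p.2 * γ p.1)))
      (univ ×ˢ Icc (-a) a) := by
  refine ContinuousOn.div (continuous_snd.mul (h.continuous_deriv.comp continuous_fst)).continuousOn
    (continuous_const.mul h.continuous_sqrt).continuousOn fun p hp => ?_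
  exact mul_ne_zero two_ne_zero (Real.sqrt_pos.mpr (h.jacobian_pos hp.2 p.1)).ne'

lemma continuousOn_proj_integrand (h : IsTube N α γ γ' L k₁ k₂ a G) (hχ : Continuous χ)
    (hφ : Continuous φ) :
    ContinuousOn (Function.uncurry fun s u =>
      (χ u : ℂ) * ((Real.sqrt (1 + u * γ s) : ℂ) * φ (tubeCoord N α (s, u))))
      (univ ×ˢ Icc (-a) a) :=
  ((Complex.continuous_ofReal.comp (hχ.comp continuous_snd)).mul
    ((Complex.continuous_ofReal.comp h.continuous_sqrt).mul
      (hφ.comp h.continuous_tubeCoord))).continuousOn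

lemma continuousOn_projDeriv_integrand (h : IsTube N α γ γ' L k₁ k₂ a G) (hχ : Continuous χ)
    (hφ : ContDiff ℝ 1 φ) :
    ContinuousOn (Function.uncurry fun s u =>
      (χ u : ℂ) * ((Real.sqrt (1 + u * γ s) : ℂ) * pullS N α γ φ (s, u)
        + ((u * γ' s / (2 * Real.sqrt (1 + u * γ s)) : ℝ) : ℂ) * φ (tubeCoord N α (s, u))))
      (univ ×ˢ Icc (-a) a) :=
  (Complex.continuous_ofReal.comp (hχ.comp continuous_snd)).continuousOn.mul
    (((Complex.continuous_ofReal.comp h.continuous_sqrt).mul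
      (h.continuous_pullS hφ)).continuousOn.add
      ((Complex.continuous_ofReal.comp_continuousOn h.continuousOn_div_sqrt).mul
        (hφ.continuous.comp h.continuous_tubeCoord).continuousOn))

lemma hasDerivAt_proj (h : IsTube N α γ γ' L k₁ k₂ a G) (hχ : Continuous χ)
    (hφ : ContDiff ℝ 1 φ) (s : ℝ) :
    HasDerivAt (proj N α γ a χ φ) (projDeriv N α γ γ' a χ φ s) s := by
  refine hasDerivAt_integral_param h.a_pos.le (h.continuousOn_proj_integrand hχ hφ.continuous)
    (h.continuousOn_projDeriv_integrand hχ hφ) (fun s u hu => ?_) s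
  have e1 : HasDerivAt (fun s => 1 + u * γ s) (u * γ' s) s :=
    ((h.hasDerivAt_curvature s).const_mul u).const_add 1
  have e2 := (e1.sqrt (h.jacobian_pos hu s).ne').ofReal_comp
  refine ((e2.mul (h.hasDerivAt_pull_s hφ s u)).const_mul (χ u : ℂ)).congr_deriv ?_
  ring

lemma continuous_projDeriv (h : IsTube N α γ γ' L k₁ k₂ a G) (hχ : Continuous χ)
    (hφ : ContDiff ℝ 1 φ) : Continuous (projDeriv N α γ γ' a χ φ) :=
  continuous_integral_param h.a_pos.le (h.continuousOn_projDeriv_integrand hχ hφ)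

lemma continuous_proj (h : IsTube N α γ γ' L k₁ k₂ a G) (hχ : Continuous χ)
    (hφ : Continuous φ) : Continuous (proj N α γ a χ φ) :=
  continuous_integral_param h.a_pos.le (h.continuousOn_proj_integrand hχ hφ)

/-- The projection is a contraction on every fiber. -/
lemma norm_sq_proj_le (h : IsTube N α γ γ' L k₁ k₂ a G) (hχ : IsProfile a k χ)
    (hφ : Continuous φ) (s : ℝ) :
    ‖proj N α γ a χ φ s‖ ^ 2
      ≤ ∫ u in -a..a, (1 + u * γ s) * ‖φ (tubeCoord N α (s, u))‖ ^ 2 := by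
  have ha := h.a_pos
  have hsl : Continuous fun u => φ (tubeCoord N α (s, u)) :=
    hφ.comp (h.continuous_tubeCoord.comp (by fun_prop))
  have hr : Continuous fun u => Real.sqrt (1 + u * γ s) := by fun_prop
  have hi : IntervalIntegrable (fun u => (χ u : ℂ) * ((Real.sqrt (1 + u * γ s) : ℂ) *
      φ (tubeCoord N α (s, u)))) volume (-a) a :=
    ((Complex.continuous_ofReal.comp hχ.continuous).mul
      ((Complex.continuous_ofReal.comp hr).mul hsl)).intervalIntegrable _ _
  have c1 : Continuous fun u => Real.sqrt (1 + u * γ s) * (φ (tubeCoord N α (s, u))).re :=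
    hr.mul (Complex.continuous_re.comp hsl)
  have c2 : Continuous fun u => Real.sqrt (1 + u * γ s) * (φ (tubeCoord N α (s, u))).im :=
    hr.mul (Complex.continuous_im.comp hsl)
  have w1 := weighted_cauchy_schwarz ha (D := 0) le_rfl (by simp) hχ.continuous hχ.normalized
    hχ.moment c1.continuousOn
  have w2 := weighted_cauchy_schwarz ha (D := 0) le_rfl (by simp) hχ.continuous hχ.normalized
    hχ.moment c2.continuousOn
  simp only [mul_zero, zero_mul, sub_zero, one_mul] at w1 w2
  rw [proj, norm_sq_eq_re_add_im, intervalIntegral_re hi, intervalIntegral_im hi]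
  simp only [Complex.re_ofReal_mul, Complex.im_ofReal_mul]
  refine (add_le_add w1 w2).trans (le_of_eq ?_)
  have i1 : IntervalIntegrable (fun u => (Real.sqrt (1 + u * γ s) *
      (φ (tubeCoord N α (s, u))).re) ^ 2) volume (-a) a := (c1.pow 2).intervalIntegrable _ _
  have i2 : IntervalIntegrable (fun u => (Real.sqrt (1 + u * γ s) *
      (φ (tubeCoord N α (s, u))).im) ^ 2) volume (-a) a := (c2.pow 2).intervalIntegrable _ _
  rw [← intervalIntegral.integral_add i1 i2]
  refine intervalIntegral.integral_congr fun u hu => ?_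
  rw [uIcc_of_le (by linarith)] at hu
  simp only [mul_pow, Real.sq_sqrt (h.jacobian_pos hu s).le, norm_sq_eq_re_add_im]
  ring

/-- The sum of squares in `fiber_lower_bound_complex` is the Cartesian gradient weighted by the
Jacobian, so the bound can be integrated over the tube. -/
lemma fiber_bound (h : IsTube N α γ γ' L k₁ k₂ a G) (hk : 2 * G ≤ k) (hχ : IsProfile a k χ)
    (hφ : ContDiff ℝ 1 φ) (s : ℝ) :
    (1 - 100 * G ^ 3 / k) * ‖projDeriv N α γ γ' a χ φ s‖ ^ 2
      - ‖((γ s / 2 : ℝ) : ℂ) * proj N α γ a χ φ s‖ ^ 2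
      - (k ^ 2 + 100 * G ^ 3 / k) * ‖proj N α γ a χ φ s‖ ^ 2
      - (k ^ 2 / 4 + 100 * G ^ 3) *
        ((∫ u in -a..a, (1 + u * γ s) * ‖φ (tubeCoord N α (s, u))‖ ^ 2)
          - ‖proj N α γ a χ φ s‖ ^ 2)
    ≤ (∫ u in -a..a, (1 + u * γ s) * (‖fderiv ℝ φ (tubeCoord N α (s, u)) (1, 0)‖ ^ 2
        + ‖fderiv ℝ φ (tubeCoord N α (s, u)) (0, 1)‖ ^ 2))
      - 2 * robinStrength a k * ‖φ (N s)‖ ^ 2 := by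
  have ha := h.a_pos
  have key := fiber_lower_bound_complex ha h.one_le h.small (h.curvature_le s) (h.deriv_le s) hk
    hχ.continuous hχ.normalized hχ.moment hχ.energy
    (f := fun u => φ (tubeCoord N α (s, u))) (f' := fun u => pullU N α γ φ (s, u))
    (fs := fun u => pullS N α γ φ (s, u)) (fun u _ => h.hasDerivAt_pull_u hφ s u)
    ((h.continuous_pullU hφ).comp (by fun_prop)).continuousOn
    ((h.continuous_pullS hφ).comp (by fun_prop)).continuousOn (fun u => rfl) (fun u => rfl)
  have e1 : ∫ u in -a..a, (1 + u * γ s) * (‖fderiv ℝ φ (tubeCoord N α (s, u)) (1, 0)‖ ^ 2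
        + ‖fderiv ℝ φ (tubeCoord N α (s, u)) (0, 1)‖ ^ 2)
      = ∫ u in -a..a, ((1 + u * γ s)⁻¹ * ‖pullS N α γ φ (s, u)‖ ^ 2
        + (1 + u * γ s) * ‖pullU N α γ φ (s, u)‖ ^ 2) := by
    refine intervalIntegral.integral_congr fun u hu => ?_
    rw [uIcc_of_le (by linarith)] at hu
    exact h.jacobian_mul_norm_grad (p := (s, u)) hu
  have e2 : ‖((γ s / 2 : ℝ) : ℂ) * proj N α γ a χ φ s‖ ^ 2
      = γ s ^ 2 / 4 * ‖proj N α γ a χ φ s‖ ^ 2 := by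
    rw [norm_mul, Complex.norm_real, mul_pow, Real.norm_eq_abs, sq_abs]; ring
  rw [e1, e2]
  simp only [tubeCoord_curve] at key
  exact key

/-- The projection of `φ` as an element of `H¹((0, L))`. -/
def projH1 (h : IsTube N α γ γ' L k₁ k₂ a G) (hχ : Continuous χ) (hφ : ContDiff ℝ 1 φ) :
    H1Interval L :=
  ofDeriv L (proj N α γ a χ φ) (projDeriv N α γ γ' a χ φ) (h.continuous_projDeriv hχ hφ).continuousOn

lemma evalAt_projH1 (h : IsTube N α γ γ' L k₁ k₂ a G) (hχ : Continuous χ) (hφ : ContDiff ℝ 1 φ)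
    {t : ℝ} (ht : t ∈ Icc 0 L) :
    evalAt L t (h.projH1 hχ hφ) = proj N α γ a χ φ t :=
  evalAt_ofDeriv _ (fun t _ => (h.hasDerivAt_proj hχ hφ t).hasDerivWithinAt) ht

lemma coeFn_weightedEmbedding_projH1 (h : IsTube N α γ γ' L k₁ k₂ a G) (hχ : Continuous χ)
    (hφ : ContDiff ℝ 1 φ) (w : C(ℝ, ℝ)) :
    weightedEmbedding h.L_pos.le w (h.projH1 hχ hφ) =ᵐ[volume.restrict (Ioo 0 L)]
      fun t => (w t : ℂ) * proj N α γ a χ φ t := by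
  filter_upwards [coeFn_weightedEmbedding h.L_pos.le w (h.projH1 hχ hφ),
    ae_restrict_mem measurableSet_Ioo] with t h1 ht
  rw [h1, h.evalAt_projH1 hχ hφ (Ioo_subset_Icc_self ht)]

lemma integrableOn_of_continuous {g : ℝ → ℝ} (hg : Continuous g) (L : ℝ) :
    Integrable g (volume.restrict (Ioo 0 L)) :=
  (hg.continuousOn.integrableOn_compact isCompact_Icc).mono_set Ioo_subset_Icc_self

lemma continuous_integral_param_real {F : ℝ × ℝ → ℝ} (hF : Continuous F) :
    Continuous fun s => ∫ u in -a..a, F (s, u) :=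
  intervalIntegral.continuous_parametric_intervalIntegral_of_continuous (μ := volume)
    (f := fun s u => F (s, u)) (a₀ := -a) hF (continuous_const (y := a))

lemma continuous_jacobian_mul (h : IsTube N α γ γ' L k₁ k₂ a G) {g : ℝ × ℝ → ℝ}
    (hg : Continuous g) :
    Continuous fun p : ℝ × ℝ => (1 + p.2 * γ p.1) * g (tubeCoord N α p) :=
  (continuous_const.add (continuous_snd.mul (h.continuous_curvature.comp continuous_fst))).mul
    (hg.comp h.continuous_tubeCoord)

lemma norm_sq_embedding_projH1_le (h : IsTube N α γ γ' L k₁ k₂ a G) (hχ : IsProfile a k χ)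
    (hφ : ContDiff ℝ 1 φ) (hc : HasCompactSupport φ) :
    ‖weightedEmbedding h.L_pos.le 1 (h.projH1 hχ.continuous hφ)‖ ^ 2
      ≤ ∫ x in strip k₁, ‖φ x‖ ^ 2 := by
  rw [norm_sq_congr (h.coeFn_weightedEmbedding_projH1 hχ.continuous hφ 1)]
  simp only [ContinuousMap.one_apply, Complex.ofReal_one, one_mul]
  refine le_trans ?_ (h.setIntegral_tube_le (g := fun x => ‖φ x‖ ^ 2) (hφ.continuous.norm.pow 2)
    (hc.norm.comp_left (g := fun t : ℝ => t ^ 2) (by simp)) fun x => sq_nonneg _)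
  refine integral_mono (integrableOn_of_continuous
    ((h.continuous_proj hχ.continuous hφ.continuous).norm.pow 2) L) (integrableOn_of_continuous
      (continuous_integral_param_real (h.continuous_jacobian_mul (hφ.continuous.norm.pow 2))) L)
    fun s => h.norm_sq_proj_le hχ hφ.continuous s

/-- Lower bound for the energy of a smooth function in terms of its projection. -/
lemma smooth_lower_bound (h : IsTube N α γ γ' L k₁ k₂ a G) (hk : 2 * G ≤ k)
    (hχ : IsProfile a k χ) (hφ : ContDiff ℝ 1 φ) (hc : HasCompactSupport φ) {w : C(ℝ, ℝ)}
    (hw : ∀ t, w t = γ t / 2) :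
    (1 - 100 * G ^ 3 / k) * ‖(h.projH1 hχ.continuous hφ).snd‖ ^ 2
      - ‖weightedEmbedding h.L_pos.le w (h.projH1 hχ.continuous hφ)‖ ^ 2
      - (k ^ 2 + 100 * G ^ 3 / k) *
        ‖weightedEmbedding h.L_pos.le 1 (h.projH1 hχ.continuous hφ)‖ ^ 2
      - (k ^ 2 / 4 + 100 * G ^ 3) * ((∫ x in strip k₁, ‖φ x‖ ^ 2)
          - ‖weightedEmbedding h.L_pos.le 1 (h.projH1 hχ.continuous hφ)‖ ^ 2)
    ≤ (∫ x in strip k₁, ‖fderiv ℝ φ x (1, 0)‖ ^ 2) + (∫ x in strip k₁, ‖fderiv ℝ φ x (0, 1)‖ ^ 2)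
      - 2 * robinStrength a k * ∫ s in Ioo 0 L, ‖φ (N s)‖ ^ 2 := by
  have hG := h.one_le
  have hk0 : 0 < k := by linarith
  have c1 : Continuous fun x => fderiv ℝ φ x (1, 0) :=
    (hφ.continuous_fderiv (by simp)).clm_apply continuous_const
  have c2 : Continuous fun x => fderiv ℝ φ x (0, 1) :=
    (hφ.continuous_fderiv (by simp)).clm_apply continuous_const
  have n1 := norm_sq_congr (coeFn_ofDeriv_snd (L := L) (proj N α γ a χ φ)
    (projDeriv N α γ γ' a χ φ) (h.continuous_projDeriv hχ.continuous hφ).continuousOn)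
  have n2 := norm_sq_congr (h.coeFn_weightedEmbedding_projH1 hχ.continuous hφ w)
  have n3 := norm_sq_congr (h.coeFn_weightedEmbedding_projH1 hχ.continuous hφ 1)
  simp only [ContinuousMap.one_apply, Complex.ofReal_one, one_mul] at n3
  simp only [hw] at n2
  have hgr : (∫ s in Ioo 0 L, ∫ u in -a..a, (1 + u * γ s) *
      (‖fderiv ℝ φ (tubeCoord N α (s, u)) (1, 0)‖ ^ 2
        + ‖fderiv ℝ φ (tubeCoord N α (s, u)) (0, 1)‖ ^ 2))
      ≤ (∫ x in strip k₁, ‖fderiv ℝ φ x (1, 0)‖ ^ 2)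
        + (∫ x in strip k₁, ‖fderiv ℝ φ x (0, 1)‖ ^ 2) := by
    rw [← integral_add (integrable_norm_sq_of_hasCompactSupport c1
      (hc.fderiv_apply ℝ (1, 0))).restrict (integrable_norm_sq_of_hasCompactSupport c2
      (hc.fderiv_apply ℝ (0, 1))).restrict]
    exact h.setIntegral_tube_le (g := fun x => ‖fderiv ℝ φ x (1, 0)‖ ^ 2
      + ‖fderiv ℝ φ x (0, 1)‖ ^ 2) ((c1.norm.pow 2).add (c2.norm.pow 2))
      (((hc.fderiv_apply ℝ (1, 0)).norm.comp_left (g := fun t : ℝ => t ^ 2) (by simp)).add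
        ((hc.fderiv_apply ℝ (0, 1)).norm.comp_left (g := fun t : ℝ => t ^ 2) (by simp)))
      fun x => by positivity
  have hva := h.setIntegral_tube_le (g := fun x => ‖φ x‖ ^ 2) (hφ.continuous.norm.pow 2)
    (hc.norm.comp_left (g := fun t : ℝ => t ^ 2) (by simp)) fun x => sq_nonneg _
  have i1 := integrableOn_of_continuous
    ((h.continuous_projDeriv hχ.continuous hφ).norm.pow 2) L
  have i3 := integrableOn_of_continuous
    ((h.continuous_proj hχ.continuous hφ.continuous).norm.pow 2) L
  have i2 : Integrable (fun s => ‖((γ s / 2 : ℝ) : ℂ) * proj N α γ a χ φ s‖ ^ 2)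
      (volume.restrict (Ioo 0 L)) := integrableOn_of_continuous
    (((Complex.continuous_ofReal.comp (h.continuous_curvature.div_const 2)).mul
      (h.continuous_proj hχ.continuous hφ.continuous)).norm.pow 2) L
  have i4 := integrableOn_of_continuous (continuous_integral_param_real (a := a)
    (h.continuous_jacobian_mul (g := fun x => ‖φ x‖ ^ 2) (hφ.continuous.norm.pow 2))) L
  have i5 := integrableOn_of_continuous (continuous_integral_param_real (a := a)
    (h.continuous_jacobian_mul (g := fun x => ‖fderiv ℝ φ x (1, 0)‖ ^ 2
      + ‖fderiv ℝ φ x (0, 1)‖ ^ 2) ((c1.norm.pow 2).add (c2.norm.pow 2)))) L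
  have i6 := integrableOn_of_continuous ((hφ.continuous.comp h.continuous_curve).norm.pow 2) L
  have key := integral_mono_combination i1 i2 i3 i4 i5 i6 fun s => h.fiber_bound hk hχ hφ s
  have hn1 : ‖(h.projH1 hχ.continuous hφ).snd‖ ^ 2
      = ∫ s in Ioo 0 L, ‖projDeriv N α γ γ' a χ φ s‖ ^ 2 := n1
  rw [hn1, n2, n3]
  simp only [Pi.pow_apply, Function.comp_apply] at key
  have hpos : 0 ≤ k ^ 2 / 4 + 100 * G ^ 3 := by positivity
  -- The squared norm over the tube enters with a negative coefficient, so it may be replaced by the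
  -- larger one over the strip.
  have := mul_le_mul_of_nonneg_left hva hpos
  linarith

end IsTube

end StrongDelta

end

/-! ### Linear structure of test functions and of the projection. -/

noncomputable section

namespace StrongDelta

lemma toLp_eq_add {X : Type*} {m : MeasurableSpace X} {μ : Measure X} {f g k : X → ℂ}
    (hk : MemLp k 2 μ) (hf : MemLp f 2 μ) (hg : MemLp g 2 μ) (h : ∀ x, k x = f x + g x) :
    hk.toLp k = hf.toLp f + hg.toLp g :=
  (MemLp.toLp_congr hk (hf.add hg) (Filter.Eventually.of_forall h)).trans (MemLp.toLp_add hf hg)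

lemma toLp_eq_smul {X : Type*} {m : MeasurableSpace X} {μ : Measure X} {f k : X → ℂ} {c : ℂ}
    (hk : MemLp k 2 μ) (hf : MemLp f 2 μ) (h : ∀ x, k x = c * f x) :
    hk.toLp k = c • hf.toLp f :=
  (MemLp.toLp_congr hk (hf.const_smul c) (Filter.Eventually.of_forall h)).trans
    (MemLp.toLp_const_smul c hf)

/-- The smooth compactly supported functions on the plane. -/
def testFunctions : Submodule ℂ (ℝ × ℝ → ℂ) where
  carrier := {φ | ContDiff ℝ ∞ φ ∧ HasCompactSupport φ}
  zero_mem' := ⟨contDiff_const, HasCompactSupport.zero⟩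
  add_mem' h h' := ⟨h.1.add h'.1, h.2.add h'.2⟩
  smul_mem' c _ h := ⟨contDiff_const.smul h.1, h.2.smul_left (f := fun _ => c)⟩

namespace testFunctions

variable (φ ψ : testFunctions)

lemma contDiff_one : ContDiff ℝ 1 (φ : ℝ × ℝ → ℂ) := φ.2.1.of_le (by exact_mod_cast le_top)

lemma fderiv_add_apply (x v : ℝ × ℝ) : fderiv ℝ ((φ + ψ : testFunctions) : ℝ × ℝ → ℂ) x v
    = fderiv ℝ (φ : ℝ × ℝ → ℂ) x v + fderiv ℝ (ψ : ℝ × ℝ → ℂ) x v := by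
  have := fderiv_add ((contDiff_one φ).differentiable (by simp) x)
    ((contDiff_one ψ).differentiable (by simp) x)
  rw [Submodule.coe_add, this]
  rfl

lemma fderiv_smul_apply (c : ℂ) (x v : ℝ × ℝ) :
    fderiv ℝ ((c • φ : testFunctions) : ℝ × ℝ → ℂ) x v = c * fderiv ℝ (φ : ℝ × ℝ → ℂ) x v := by
  have := fderiv_const_smul ((contDiff_one φ).differentiable (by simp) x) c
  rw [Submodule.coe_smul, this]
  rfl

lemma memLp (Ω : Set (ℝ × ℝ)) : MemLp (φ : ℝ × ℝ → ℂ) 2 (volume.restrict Ω) :=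
  (contDiff_one φ).continuous.memLp_of_hasCompactSupport φ.2.2

lemma memLp_fderiv (Ω : Set (ℝ × ℝ)) (v : ℝ × ℝ) :
    MemLp (fun x => fderiv ℝ (φ : ℝ × ℝ → ℂ) x v) 2 (volume.restrict Ω) :=
  (((contDiff_one φ).continuous_fderiv (by simp)).clm_apply
    continuous_const).memLp_of_hasCompactSupport (φ.2.2.fderiv_apply ℝ v)

/-- The first-order data of a test function. -/
def grad (Ω : Set (ℝ × ℝ)) : testFunctions →ₗ[ℂ] L2 Ω × L2 Ω × L2 Ω where
  toFun φ := gradData Ω (contDiff_one φ) φ.2.2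
  map_add' φ ψ := Prod.ext
    (toLp_eq_add (memLp (φ + ψ) Ω) (memLp φ Ω) (memLp ψ Ω) fun _ => rfl)
    (Prod.ext (toLp_eq_add (memLp_fderiv (φ + ψ) Ω _) (memLp_fderiv φ Ω _) (memLp_fderiv ψ Ω _)
      fun x => fderiv_add_apply φ ψ x _) (toLp_eq_add (memLp_fderiv (φ + ψ) Ω _)
        (memLp_fderiv φ Ω _) (memLp_fderiv ψ Ω _) fun x => fderiv_add_apply φ ψ x _))
  map_smul' c φ := Prod.ext
    (toLp_eq_smul (memLp (c • φ) Ω) (memLp φ Ω) fun _ => rfl)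
    (Prod.ext (toLp_eq_smul (memLp_fderiv (c • φ) Ω _) (memLp_fderiv φ Ω _)
      fun x => fderiv_smul_apply φ c x _) (toLp_eq_smul (memLp_fderiv (c • φ) Ω _)
        (memLp_fderiv φ Ω _) fun x => fderiv_smul_apply φ c x _))

end testFunctions

/-- The closure of the first-order data of the test functions. -/
def dataClosure (Ω : Set (ℝ × ℝ)) : Submodule ℂ (L2 Ω × L2 Ω × L2 Ω) :=
  (LinearMap.range (testFunctions.grad Ω)).topologicalClosure

lemma exists_of_mem_restrictionGraph {Ω : Set (ℝ × ℝ)} {c : ℝ → ℝ × ℝ} {I : Set ℝ}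
    {p : (L2 Ω × L2 Ω × L2 Ω) × L2P I} (hp : p ∈ restrictionGraph Ω c I) :
    ∃ φ : testFunctions, p.1 = testFunctions.grad Ω φ ∧
      p.2 =ᵐ[volume.restrict I] fun t => (φ : ℝ × ℝ → ℂ) (c t) := by
  obtain ⟨φ, hφ, hc, h1, h2, h3, h4⟩ := hp
  refine ⟨⟨φ, hφ, hc⟩, ?_, h4⟩
  have hφ1 : ContDiff ℝ 1 φ := hφ.of_le (by exact_mod_cast le_top)
  exact Prod.ext (Lp.ext (h1.trans (coeFn_gradData_fst Ω hφ1 hc).symm))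
    (Prod.ext (Lp.ext (h2.trans (coeFn_gradData_dx Ω hφ1 hc).symm))
      (Lp.ext (h3.trans (coeFn_gradData_dy Ω hφ1 hc).symm)))

lemma fst_mem_dataClosure {Ω : Set (ℝ × ℝ)} {c : ℝ → ℝ × ℝ} {I : Set ℝ}
    {p : (L2 Ω × L2 Ω × L2 Ω) × L2P I} (hp : p ∈ traceGraph Ω c I) : p.1 ∈ dataClosure Ω := by
  have h : Set.MapsTo Prod.fst (restrictionGraph Ω c I : Set ((L2 Ω × L2 Ω × L2 Ω) × L2P I))
      (LinearMap.range (testFunctions.grad Ω) : Set (L2 Ω × L2 Ω × L2 Ω)) := by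
    intro q hq
    obtain ⟨φ, h1, -⟩ := exists_of_mem_restrictionGraph hq
    exact ⟨φ, h1.symm⟩
  exact h.closure continuous_fst hp

/-- Limits along a sequence of smooth functions, as in `traceGraph_induction`, for inequalities that
also involve a continuous map `P` on the closure of the first-order data. The map depends only on
the first component, so one `P` can be used with several trace graphs. -/
lemma traceGraph_extension_induction {Ω : Set (ℝ × ℝ)} {c : ℝ → ℝ × ℝ} {I : Set ℝ} {Y : Type*}
    [TopologicalSpace Y] {P : dataClosure Ω → Y} (hP : Continuous P)
    {F : ((L2 Ω × L2 Ω × L2 Ω) × L2P I) × Y → ℝ} (hF : Continuous F)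
    (h : ∀ (φ : testFunctions) (t : L2P I) (hm : testFunctions.grad Ω φ ∈ dataClosure Ω),
      t =ᵐ[volume.restrict I] (fun s => (φ : ℝ × ℝ → ℂ) (c s)) →
        0 ≤ F ((testFunctions.grad Ω φ, t), P ⟨_, hm⟩))
    {p : (L2 Ω × L2 Ω × L2 Ω) × L2P I} (hp : p ∈ traceGraph Ω c I) :
    0 ≤ F (p, P ⟨p.1, fst_mem_dataClosure hp⟩) := by
  obtain ⟨q, hq, hlim⟩ := mem_closure_iff_seq_limit.mp
    (show p ∈ closure (restrictionGraph Ω c I : Set ((L2 Ω × L2 Ω × L2 Ω) × L2P I)) from hp)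
  have hq' : ∀ n, q n ∈ traceGraph Ω c I := fun n => Submodule.le_topologicalClosure _ (hq n)
  have l1 : Filter.Tendsto (fun n => (⟨(q n).1, fst_mem_dataClosure (hq' n)⟩ : dataClosure Ω))
      Filter.atTop (nhds ⟨p.1, fst_mem_dataClosure hp⟩) := by
    rw [tendsto_subtype_rng]
    exact (continuous_fst.tendsto p).comp hlim
  have l2 := (hP.tendsto _).comp l1
  have l3 := (hF.tendsto _).comp (hlim.prodMk_nhds l2)
  refine ge_of_tendsto' l3 fun n => ?_
  obtain ⟨φ, h1, h2⟩ := exists_of_mem_restrictionGraph (hq n)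
  have hm : testFunctions.grad Ω φ ∈ dataClosure Ω := h1 ▸ fst_mem_dataClosure (hq' n)
  have e := h φ (q n).2 hm h2
  have e2 : (⟨(q n).1, fst_mem_dataClosure (hq' n)⟩ : dataClosure Ω)
      = ⟨testFunctions.grad Ω φ, hm⟩ := Subtype.ext h1
  simp only [Function.comp_apply]
  rw [e2]
  have e3 : q n = (testFunctions.grad Ω φ, (q n).2) := Prod.ext h1 rfl
  rw [e3]
  exact e

namespace IsTube

variable {N : ℝ → ℝ × ℝ} {α γ γ' : ℝ → ℝ} {L k₁ k₂ a G k : ℝ} {χ : ℝ → ℝ} {φ ψ : ℝ × ℝ → ℂ}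

lemma intervalIntegrable_of_continuousOn_slice {F : ℝ → ℝ → ℂ} (ha : 0 < a)
    (hF : ContinuousOn (Function.uncurry F) (univ ×ˢ Icc (-a) a)) (s : ℝ) :
    IntervalIntegrable (F s) volume (-a) a := by
  refine ContinuousOn.intervalIntegrable_of_Icc (by linarith) ?_
  exact hF.comp (f := fun u => (s, u)) (by fun_prop) fun u hu => ⟨trivial, hu⟩

lemma proj_add (h : IsTube N α γ γ' L k₁ k₂ a G) (hχ : Continuous χ) (hφ : Continuous φ)
    (hψ : Continuous ψ) (s : ℝ) :
    proj N α γ a χ (φ + ψ) s = proj N α γ a χ φ s + proj N α γ a χ ψ s := by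
  rw [proj, proj, proj, ← intervalIntegral.integral_add
    (intervalIntegrable_of_continuousOn_slice h.a_pos (h.continuousOn_proj_integrand hχ hφ) s)
    (intervalIntegrable_of_continuousOn_slice h.a_pos (h.continuousOn_proj_integrand hχ hψ) s)]
  refine intervalIntegral.integral_congr fun u _ => ?_
  simp only [Pi.add_apply]
  ring

lemma proj_smul (c : ℂ) (s : ℝ) : proj N α γ a χ (c • φ) s = c * proj N α γ a χ φ s := by
  rw [proj, proj, ← intervalIntegral.integral_const_mul]
  refine intervalIntegral.integral_congr fun u _ => ?_
  simp only [Pi.smul_apply, smul_eq_mul]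
  ring

/-- Uniqueness of derivatives transfers linearity from `proj`, which avoids splitting the
differentiated integrand. -/
lemma projDeriv_add (h : IsTube N α γ γ' L k₁ k₂ a G) (hχ : Continuous χ) (hφ : ContDiff ℝ 1 φ)
    (hψ : ContDiff ℝ 1 ψ) (s : ℝ) :
    projDeriv N α γ γ' a χ (φ + ψ) s
      = projDeriv N α γ γ' a χ φ s + projDeriv N α γ γ' a χ ψ s :=
  (h.hasDerivAt_proj hχ (hφ.add hψ) s).unique
    (((h.hasDerivAt_proj hχ hφ s).add (h.hasDerivAt_proj hχ hψ s)).congr_of_eventuallyEq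
      (Filter.Eventually.of_forall fun s => h.proj_add hχ hφ.continuous hψ.continuous s))

lemma projDeriv_smul (h : IsTube N α γ γ' L k₁ k₂ a G) (hχ : Continuous χ) (hφ : ContDiff ℝ 1 φ)
    (c : ℂ) (s : ℝ) :
    projDeriv N α γ γ' a χ (c • φ) s = c * projDeriv N α γ γ' a χ φ s :=
  (h.hasDerivAt_proj hχ (contDiff_const.smul hφ) s).unique
    (((h.hasDerivAt_proj hχ hφ s).const_mul c).congr_of_eventuallyEq
      (Filter.Eventually.of_forall fun s => proj_smul c s))

lemma memLp_projDeriv (h : IsTube N α γ γ' L k₁ k₂ a G) (hχ : Continuous χ) (φ : testFunctions) :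
    MemLp (projDeriv N α γ γ' a χ φ) 2 (volume.restrict (Ioo 0 L)) :=
  memLp_of_continuousOn (h.continuous_projDeriv hχ (testFunctions.contDiff_one φ)).continuousOn

/-- The projection of test functions to `H¹((0, L))`. -/
def projMap (h : IsTube N α γ γ' L k₁ k₂ a G) (hχ : Continuous χ) :
    testFunctions →ₗ[ℂ] H1Interval L where
  toFun φ := h.projH1 hχ (testFunctions.contDiff_one φ)
  map_add' φ ψ := by
    refine congrArg (WithLp.toLp 2) (Prod.ext ?_ ?_)
    · exact h.proj_add hχ (testFunctions.contDiff_one φ).continuous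
        (testFunctions.contDiff_one ψ).continuous 0
    · exact toLp_eq_add (h.memLp_projDeriv hχ (φ + ψ)) (h.memLp_projDeriv hχ φ)
        (h.memLp_projDeriv hχ ψ) fun s => h.projDeriv_add hχ (testFunctions.contDiff_one φ)
          (testFunctions.contDiff_one ψ) s
  map_smul' c φ := by
    refine congrArg (WithLp.toLp 2) (Prod.ext ?_ ?_)
    · exact proj_smul c 0
    · exact toLp_eq_smul (h.memLp_projDeriv hχ (c • φ)) (h.memLp_projDeriv hχ φ)
        fun s => h.projDeriv_smul hχ (testFunctions.contDiff_one φ) c s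

end IsTube

end StrongDelta

end

/-! ### Extension of the projection to the form domain, and its boundary values. -/

noncomputable section

namespace StrongDelta

/-- The lower bound for the energy of a function with squared norm `m` whose projection is `y`. -/
def lowerForm {L : ℝ} (hL : 0 ≤ L) (w : C(ℝ, ℝ)) (G k : ℝ) (y : H1Interval L) (m : ℝ) : ℝ :=
  (1 - 100 * G ^ 3 / k) * ‖y.snd‖ ^ 2 - ‖weightedEmbedding hL w y‖ ^ 2
    - (k ^ 2 + 100 * G ^ 3 / k) * ‖weightedEmbedding hL 1 y‖ ^ 2
    - (k ^ 2 / 4 + 100 * G ^ 3) * (m - ‖weightedEmbedding hL 1 y‖ ^ 2)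

/-- All terms except the longitudinal one are bounded by the squared norm `m`. This cruder form
serves for the boundedness of the projection and for the trace inequality. -/
lemma le_lowerForm {L : ℝ} (hL : 0 ≤ L) {w : C(ℝ, ℝ)} {G k m : ℝ} (hG : 0 ≤ G) (hk : 0 < k)
    (hw : ∀ t ∈ Icc 0 L, |w t| ≤ G / 2) {y : H1Interval L}
    (hm : ‖weightedEmbedding hL 1 y‖ ^ 2 ≤ m) :
    (1 - 100 * G ^ 3 / k) * ‖y.snd‖ ^ 2
      - ((G / 2) ^ 2 + (k ^ 2 + 100 * G ^ 3 / k) + (k ^ 2 / 4 + 100 * G ^ 3)) * m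
      ≤ lowerForm hL w G k y m := by
  have h1 := norm_sq_weightedEmbedding_le hL hw y
  have p1 : 0 ≤ k ^ 2 + 100 * G ^ 3 / k := by positivity
  have p2 : 0 ≤ k ^ 2 / 4 + 100 * G ^ 3 := by positivity
  have h2 := mul_le_mul_of_nonneg_left hm p1
  have h3 := mul_le_mul_of_nonneg_left hm (sq_nonneg (G / 2))
  have h4 := mul_nonneg p2 (sq_nonneg ‖weightedEmbedding hL 1 y‖)
  rw [lowerForm]
  linarith

lemma continuous_lowerForm {L : ℝ} (hL : 0 ≤ L) (w : C(ℝ, ℝ)) (G k : ℝ) :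
    Continuous fun q : H1Interval L × ℝ => lowerForm hL w G k q.1 q.2 := by
  have c0 : Continuous fun q : H1Interval L × ℝ => q.1.snd :=
    (WithLp.sndL 2 ℂ ℂ (L2P (Ioo 0 L))).continuous.comp continuous_fst
  have c1 : Continuous fun q : H1Interval L × ℝ => weightedEmbedding hL w q.1 :=
    (weightedEmbedding hL w).continuous.comp continuous_fst
  have c2 : Continuous fun q : H1Interval L × ℝ => weightedEmbedding hL 1 q.1 :=
    (weightedEmbedding hL 1).continuous.comp continuous_fst
  exact (((continuous_const.mul (c0.norm.pow 2)).sub (c1.norm.pow 2)).sub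
    (continuous_const.mul (c2.norm.pow 2))).sub
      (continuous_const.mul (continuous_snd.sub (c2.norm.pow 2)))

namespace IsTube

variable {N : ℝ → ℝ × ℝ} {α γ γ' : ℝ → ℝ} {L k₁ k₂ a G k : ℝ} {χ : ℝ → ℝ} {w : C(ℝ, ℝ)}

lemma abs_half_curvature_le (h : IsTube N α γ γ' L k₁ k₂ a G) (hw : ∀ t, w t = γ t / 2) :
    ∀ t ∈ Icc 0 L, |w t| ≤ G / 2 := fun t _ => by
  rw [hw, abs_div, abs_two]
  have := h.curvature_le t
  linarith

lemma norm_sq_projMap_le (h : IsTube N α γ γ' L k₁ k₂ a G) (hχ : IsProfile a k χ)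
    (φ : testFunctions) :
    ‖weightedEmbedding h.L_pos.le 1 (h.projMap hχ.continuous φ)‖ ^ 2
      ≤ ‖(testFunctions.grad (strip k₁) φ).1‖ ^ 2 := by
  exact (h.norm_sq_embedding_projH1_le hχ (testFunctions.contDiff_one φ) φ.2.2).trans_eq
    (norm_sq_congr (coeFn_gradData_fst (strip k₁) (testFunctions.contDiff_one φ) φ.2.2)).symm

lemma lowerForm_projMap_le (h : IsTube N α γ γ' L k₁ k₂ a G) (hk : 2 * G ≤ k)
    (hχ : IsProfile a k χ) (hw : ∀ t, w t = γ t / 2) (φ : testFunctions) {t : L2P (Ioo 0 L)}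
    (ht : t =ᵐ[volume.restrict (Ioo 0 L)] fun s => (φ : ℝ × ℝ → ℂ) (N s)) :
    lowerForm h.L_pos.le w G k (h.projMap hχ.continuous φ)
        (‖(testFunctions.grad (strip k₁) φ).1‖ ^ 2)
      ≤ ‖(testFunctions.grad (strip k₁) φ).2.1‖ ^ 2 + ‖(testFunctions.grad (strip k₁) φ).2.2‖ ^ 2
        - 2 * robinStrength a k * ‖t‖ ^ 2 := by
  have hφ := testFunctions.contDiff_one φ
  have e1 := norm_sq_congr (coeFn_gradData_fst (strip k₁) hφ φ.2.2)
  have e2 := norm_sq_congr (coeFn_gradData_dx (strip k₁) hφ φ.2.2)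
  have e3 := norm_sq_congr (coeFn_gradData_dy (strip k₁) hφ φ.2.2)
  have e4 := norm_sq_congr ht
  have key := h.smooth_lower_bound hk hχ hφ φ.2.2 hw
  rw [← e1, ← e2, ← e3, ← e4] at key
  exact key

/-- The lower bound for the energy, read backwards, bounds the derivative of the projection by the
`H¹` norm of the function. For this `k ≥ 200 G³` keeps the longitudinal coefficient above `1/2`, and
a nonnegative Robin strength allows the trace term to be dropped. -/
lemma exists_norm_projMap_le (h : IsTube N α γ γ' L k₁ k₂ a G) (hk : 200 * G ^ 3 ≤ k)
    (hr : 0 ≤ robinStrength a k) (hχ : IsProfile a k χ) :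
    ∃ C, ∀ φ, ‖h.projMap hχ.continuous φ‖ ≤ C * ‖testFunctions.grad (strip k₁) φ‖ := by
  have hG := h.one_le
  have hG3 : G ≤ G ^ 3 := le_self_pow₀ hG (by norm_num)
  have hk0 : 0 < k := by linarith
  have hL := h.L_pos
  set w : C(ℝ, ℝ) := ⟨fun t => γ t / 2, h.continuous_curvature.div_const 2⟩ with hwdef
  have hw : ∀ t, w t = γ t / 2 := fun t => rfl
  set B := (G / 2) ^ 2 + (k ^ 2 + 100 * G ^ 3 / k) + (k ^ 2 / 4 + 100 * G ^ 3) with hB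
  have hB0 : 0 ≤ B := by positivity
  set D := 2 / L + (2 * L + 1) * (2 * (2 + B)) with hD
  have hD0 : 0 ≤ D := by positivity
  refine ⟨Real.sqrt D, fun φ => ?_⟩
  set y := h.projMap hχ.continuous φ with hy
  set g := testFunctions.grad (strip k₁) φ with hg
  have n1 : ‖g.1‖ ^ 2 ≤ ‖g‖ ^ 2 := by gcongr; exact norm_fst_le g
  have n2 : ‖g.2.1‖ ^ 2 ≤ ‖g‖ ^ 2 := by
    gcongr; exact (norm_fst_le g.2).trans (norm_snd_le g)
  have n3 : ‖g.2.2‖ ^ 2 ≤ ‖g‖ ^ 2 := by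
    gcongr; exact (norm_snd_le g.2).trans (norm_snd_le g)
  have b1 := h.norm_sq_projMap_le hχ φ
  have b2 := h.lowerForm_projMap_le (by linarith) hχ hw φ
    (t := (memLp_comp_curve h.continuous_curve φ.2.1.continuous L).toLp _) (MemLp.coeFn_toLp _)
  have b3 := le_lowerForm hL.le (by linarith) hk0 (h.abs_half_curvature_le hw) b1
  have hc : 1 / 2 ≤ 1 - 100 * G ^ 3 / k := by
    have : 100 * G ^ 3 / k ≤ 1 / 2 := by rw [div_le_iff₀ hk0]; linarith
    linarith
  have b4 := mul_le_mul_of_nonneg_right hc (sq_nonneg ‖y.snd‖)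
  have b5 := mul_nonneg (mul_nonneg zero_le_two hr)
    (sq_nonneg ‖(memLp_comp_curve h.continuous_curve φ.2.1.continuous L).toLp _‖)
  have b6 := mul_le_mul_of_nonneg_left n1 hB0
  have b7 : ‖y.snd‖ ^ 2 ≤ 2 * (2 + B) * ‖g‖ ^ 2 := by
    rw [← hy, ← hg, ← hB] at b3
    linarith
  have b8 := norm_sq_fst_le hL y
  have b9 : ‖y‖ ^ 2 ≤ D * ‖g‖ ^ 2 := by
    rw [WithLp.prod_norm_sq_eq_of_L2, hD]
    have c1 : 2 / L * ‖weightedEmbedding hL.le 1 y‖ ^ 2 ≤ 2 / L * ‖g‖ ^ 2 :=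
      mul_le_mul_of_nonneg_left (b1.trans n1) (by positivity)
    have c2 : (2 * L + 1) * ‖y.snd‖ ^ 2 ≤ (2 * L + 1) * (2 * (2 + B) * ‖g‖ ^ 2) :=
      mul_le_mul_of_nonneg_left b7 (by positivity)
    linarith
  refine le_of_sq_le_sq ?_ (by positivity)
  rw [mul_pow, Real.sq_sqrt hD0]
  exact b9

lemma exists_extension (h : IsTube N α γ γ' L k₁ k₂ a G) (hk : 200 * G ^ 3 ≤ k)
    (hr : 0 ≤ robinStrength a k) (hχ : IsProfile a k χ) :
    ∃ P : dataClosure (strip k₁) →L[ℂ] H1Interval L, ∀ φ hm,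
      P ⟨testFunctions.grad (strip k₁) φ, hm⟩ = h.projMap hχ.continuous φ := by
  set e : testFunctions →ₗ[ℂ] dataClosure (strip k₁) :=
    (testFunctions.grad (strip k₁)).codRestrict _ fun φ =>
      Submodule.le_topologicalClosure _ ⟨φ, rfl⟩ with he
  have hd : DenseRange e := by
    intro x
    rw [closure_subtype]
    have : Subtype.val '' range e = (LinearMap.range (testFunctions.grad (strip k₁)) :
        Set (L2 (strip k₁) × L2 (strip k₁) × L2 (strip k₁))) := by
      rw [← range_comp]; rfl
    rw [this]
    exact x.2
  exact ⟨(h.projMap hχ.continuous).extendOfNorm e, fun φ hm =>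
    LinearMap.extendOfNorm_eq hd (h.exists_norm_projMap_le hk hr hχ) φ⟩

/-- The trace inequality along the curve. -/
lemma trace_le (h : IsTube N α γ γ' L k₁ k₂ a G) (hk : 200 * G ^ 3 ≤ k)
    (hχ : IsProfile a k χ) :
    ∃ C, ∀ p ∈ traceGraph (strip k₁) N (Ioo 0 L),
      2 * robinStrength a k * ‖p.2‖ ^ 2 ≤ ‖p.1.2.1‖ ^ 2 + ‖p.1.2.2‖ ^ 2 + C * ‖p.1.1‖ ^ 2 := by
  have hG := h.one_le
  have hG3 : G ≤ G ^ 3 := le_self_pow₀ hG (by norm_num)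
  have hk0 : 0 < k := by linarith
  set w : C(ℝ, ℝ) := ⟨fun t => γ t / 2, h.continuous_curvature.div_const 2⟩ with hwdef
  have hw : ∀ t, w t = γ t / 2 := fun t => rfl
  refine ⟨(G / 2) ^ 2 + (k ^ 2 + 100 * G ^ 3 / k) + (k ^ 2 / 4 + 100 * G ^ 3), fun p hp => ?_⟩
  rw [← sub_nonneg]
  refine traceGraph_induction (F := fun p => ‖p.1.2.1‖ ^ 2 + ‖p.1.2.2‖ ^ 2
    + ((G / 2) ^ 2 + (k ^ 2 + 100 * G ^ 3 / k) + (k ^ 2 / 4 + 100 * G ^ 3)) * ‖p.1.1‖ ^ 2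
    - 2 * robinStrength a k * ‖p.2‖ ^ 2) (by fun_prop) (fun p hp => ?_) hp
  obtain ⟨φ, h1, h2⟩ := exists_of_mem_restrictionGraph hp
  have b1 := h.norm_sq_projMap_le hχ φ
  have b2 := h.lowerForm_projMap_le (by linarith) hχ hw φ h2
  have b3 := le_lowerForm h.L_pos.le (by linarith) hk0 (h.abs_half_curvature_le hw) b1
  have hc : 0 ≤ 1 - 100 * G ^ 3 / k := by
    have : 100 * G ^ 3 / k ≤ 1 := by rw [div_le_iff₀ hk0]; linarith
    linarith
  have b4 := mul_nonneg hc (sq_nonneg ‖(h.projMap hχ.continuous φ).snd‖)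
  rw [h1]
  linarith

/-- The function whose pairing with a trace on the boundary line gives the boundary value of the
projection is square integrable. -/
lemma memLp_boundaryWeight (hχ : Continuous χ) (a c : ℝ) :
    MemLp ((Ioc (-a) a).indicator fun u => ((χ u * Real.sqrt (1 + u * c) : ℝ) : ℂ)) 2
      (volume.restrict univ) := by
  rw [Measure.restrict_univ, memLp_indicator_iff_restrict measurableSet_Ioc]
  have hc : Continuous fun u => ((χ u * Real.sqrt (1 + u * c) : ℝ) : ℂ) :=
    Complex.continuous_ofReal.comp (hχ.mul (by fun_prop))
  obtain ⟨C, hC⟩ := isCompact_Icc.exists_bound_of_continuousOn (s := Icc (-a) a) hc.continuousOn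
  refine MemLp.of_bound hc.aestronglyMeasurable C ?_
  filter_upwards [ae_restrict_mem measurableSet_Ioc] with t ht
  exact hC t (Ioc_subset_Icc_self ht)

lemma inner_boundaryWeight (ha : 0 < a) (hχ : Continuous χ) {c : ℝ} {g : L2P univ} {f : ℝ → ℂ}
    (hg : g =ᵐ[volume.restrict univ] f) :
    ⟪(memLp_boundaryWeight hχ a c).toLp _, g⟫_ℂ
      = ∫ u in -a..a, (χ u : ℂ) * ((Real.sqrt (1 + u * c) : ℂ) * f u) := by
  rw [inner_eq_integral, intervalIntegral.integral_of_le (by linarith),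
    ← integral_indicator measurableSet_Ioc]
  have : ∀ F : ℝ → ℂ, ∫ u, F u = ∫ u in univ, F u := fun F => by rw [Measure.restrict_univ]
  rw [this]
  refine integral_congr_ae ?_
  filter_upwards [(memLp_boundaryWeight hχ a c).coeFn_toLp, hg] with u h1 h2
  rw [h1, h2]
  by_cases hu : u ∈ Ioc (-a) a
  · rw [indicator_of_mem hu, indicator_of_mem hu, Complex.conj_ofReal]
    push_cast
    ring
  · rw [indicator_of_notMem hu, indicator_of_notMem hu, map_zero, zero_mul]

lemma curvature_right (h : IsTube N α γ γ' L k₁ k₂ a G) : γ L = γ 0 := by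
  have := h.curvature_add 0
  rwa [zero_add] at this

/-- The fibers of the tube at `s = 0` and `s = L` lie on the two boundary lines, and the curvature
is the same there. Hence both end values of the projection are the pairing of the respective trace
with one and the same weight `b`, and the factor `e^{iθ}` is inherited. -/
lemma extension_mem_quasiPeriodic (h : IsTube N α γ γ' L k₁ k₂ a G) (hχ : Continuous χ)
    {P : dataClosure (strip k₁) →L[ℂ] H1Interval L}
    (hP : ∀ φ hm, P ⟨testFunctions.grad (strip k₁) φ, hm⟩ = h.projMap hχ φ) {θ : ℝ}
    {p : (L2 (strip k₁) × L2 (strip k₁) × L2 (strip k₁))} {g : L2P univ}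
    (h0 : (p, g) ∈ traceGraph (strip k₁) (fun y => (0, y)) univ)
    (h1 : (p, Complex.exp (Complex.I * θ) • g) ∈
      traceGraph (strip k₁) (fun y => (k₁, k₂ + y)) univ) :
    P ⟨p, fst_mem_dataClosure h0⟩ ∈ quasiPeriodic L θ := by
  set b : L2P univ := (memLp_boundaryWeight hχ a (γ 0)).toLp _ with hb
  have hL := h.L_pos
  have e0 : (P ⟨p, fst_mem_dataClosure h0⟩).fst = ⟪b, g⟫_ℂ := by
    -- An equality is passed to the limit as nonnegativity of minus the norm of the difference.
    have := traceGraph_extension_induction P.continuous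
      (F := fun q => -‖q.2.fst - ⟪b, q.1.2⟫_ℂ‖)
      (((((WithLp.fstL 2 ℂ ℂ (L2P (Ioo 0 L))).continuous.comp continuous_snd).sub
        ((innerSL ℂ b).continuous.comp (continuous_snd.comp continuous_fst))).norm).neg)
      (fun φ t hm ht => ?_) h0
    · simpa [sub_eq_zero] using this
    · simp only
      rw [hP, hb, inner_boundaryWeight h.a_pos hχ ht, neg_nonneg]
      refine le_of_eq (norm_eq_zero.mpr (sub_eq_zero.mpr ?_))
      have : (h.projMap hχ φ).fst = proj N α γ a χ φ 0 := rfl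
      rw [this, proj]
      simp only [h.tubeCoord_zero]
  have e1 : evalAt L L (P ⟨p, fst_mem_dataClosure h0⟩)
      = ⟪b, Complex.exp (Complex.I * θ) • g⟫_ℂ := by
    have := traceGraph_extension_induction P.continuous
      (F := fun q => -‖evalAt L L q.2 - ⟪b, q.1.2⟫_ℂ‖)
      (((((evalAt L L).continuous.comp continuous_snd).sub
        ((innerSL ℂ b).continuous.comp (continuous_snd.comp continuous_fst))).norm).neg)
      (fun φ t hm ht => ?_) h1
    · simpa [sub_eq_zero] using this
    · simp only
      rw [hP, hb, inner_boundaryWeight h.a_pos hχ ht, neg_nonneg]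
      refine le_of_eq (norm_eq_zero.mpr (sub_eq_zero.mpr ?_))
      refine (h.evalAt_projH1 hχ (testFunctions.contDiff_one φ)
        (right_mem_Icc.mpr hL.le)).trans ?_
      rw [proj]
      simp only [h.tubeCoord_right, h.curvature_right]
  rw [mem_quasiPeriodic, e0, e1, inner_smul_right]

/-- A bounded map from the form domain of the fiber operator to that of the comparison operator
which controls the energy from below. -/
lemma exists_projection (h : IsTube N α γ γ' L k₁ k₂ a G) (hk : 200 * G ^ 3 ≤ k)
    (hr : 0 ≤ robinStrength a k) (hχ : IsProfile a k χ) (hw : ∀ t, w t = γ t / 2) (θ : ℝ) :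
    ∃ Q : FiberDomain N L k₁ k₂ θ →L[ℂ] ComparisonDomain L θ, ∀ x,
      ‖comparisonEmbedding h.L_pos.le θ (Q x)‖ ^ 2 ≤ ‖fiberEmbedding N L k₁ k₂ θ x‖ ^ 2 ∧
      lowerForm h.L_pos.le w G k (SubHilbert.incl _ (Q x)) (‖fiberEmbedding N L k₁ k₂ θ x‖ ^ 2)
        ≤ ‖(fiberData N L k₁ k₂ θ x).1.2.1‖ ^ 2 + ‖(fiberData N L k₁ k₂ θ x).1.2.2‖ ^ 2
          - 2 * robinStrength a k * ‖(fiberData N L k₁ k₂ θ x).2‖ ^ 2 := by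
  have hG := h.one_le
  have hG3 : G ≤ G ^ 3 := le_self_pow₀ hG (by norm_num)
  obtain ⟨P, hP⟩ := h.exists_extension hk hr hχ
  have hm : ∀ x : FiberDomain N L k₁ k₂ θ, (fiberData N L k₁ k₂ θ x).1 ∈ dataClosure (strip k₁) :=
    fun x => fst_mem_dataClosure (fiberData_mem _ _ _ _ _ x).2.1
  set R : FiberDomain N L k₁ k₂ θ →L[ℂ] dataClosure (strip k₁) :=
    (ContinuousLinearMap.fst ℂ _ _ ∘L fiberData N L k₁ k₂ θ).codRestrict _ hm with hR
  have hq : ∀ x, P (R x) ∈ quasiPeriodic L θ := fun x => by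
    obtain ⟨g, h0, h1⟩ := (fiberData_mem _ _ _ _ _ x).2.2
    exact h.extension_mem_quasiPeriodic hχ.continuous hP h0 h1
  refine ⟨(P ∘L R).codRestrict (quasiPeriodic L θ) hq, fun x => ⟨?_, ?_⟩⟩
  · have := traceGraph_extension_induction P.continuous
      (F := fun q => ‖q.1.1.1‖ ^ 2 - ‖weightedEmbedding h.L_pos.le 1 q.2‖ ^ 2)
      ((by fun_prop : Continuous fun q : ((L2 (strip k₁) × L2 (strip k₁) × L2 (strip k₁)) ×
        L2P (Ioo 0 L)) × H1Interval L => ‖q.1.1.1‖ ^ 2).sub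
        (((weightedEmbedding h.L_pos.le 1).continuous.comp continuous_snd).norm.pow 2))
      (fun φ t hm ht => ?_) (fiberData_mem _ _ _ _ _ x).2.1
    · exact sub_nonneg.mp this
    · simp only
      rw [hP, sub_nonneg]
      exact h.norm_sq_projMap_le hχ φ
  · have := traceGraph_extension_induction P.continuous
      (F := fun q => (‖q.1.1.2.1‖ ^ 2 + ‖q.1.1.2.2‖ ^ 2 - 2 * robinStrength a k * ‖q.1.2‖ ^ 2)
        - lowerForm h.L_pos.le w G k q.2 (‖q.1.1.1‖ ^ 2))
      ((by fun_prop : Continuous fun q : ((L2 (strip k₁) × L2 (strip k₁) × L2 (strip k₁)) ×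
        L2P (Ioo 0 L)) × H1Interval L => ‖q.1.1.2.1‖ ^ 2 + ‖q.1.1.2.2‖ ^ 2
          - 2 * robinStrength a k * ‖q.1.2‖ ^ 2).sub
        ((continuous_lowerForm h.L_pos.le w G k).comp (continuous_snd.prodMk
          (by fun_prop : Continuous fun q : ((L2 (strip k₁) × L2 (strip k₁) × L2 (strip k₁)) ×
            L2P (Ioo 0 L)) × H1Interval L => ‖q.1.1.1‖ ^ 2))))
      (fun φ t hm ht => ?_) (fiberData_mem _ _ _ _ _ x).2.1
    · exact sub_nonneg.mp this
    · simp only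
      rw [hP, sub_nonneg]
      exact h.lowerForm_projMap_le (by linarith) hχ hw φ ht

end IsTube

end StrongDelta

end

/-! ### The lower bound for the fiber operator. -/

noncomputable section

namespace StrongDelta

/-- The strength falls short of `k` by at most `6k e^{-2ka}`, and the excess `β⁻²` of `k` over `β/2`
covers this for large `β`. The excess changes `k²` only by `O(1/β)`. -/
lemma le_two_mul_robinStrength {a β : ℝ} (ha : 0 < a) (hβ : 1 ≤ β) (hβa : 288 / a ^ 4 ≤ β) :
    β ≤ 2 * robinStrength a (β / 2 + (β ^ 2)⁻¹) := by
  have hβ0 : 0 < β := by linarith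
  set r := (β ^ 2)⁻¹ with hr
  have hr0 : 0 < r := by positivity
  have hr1 : r ≤ 1 := inv_le_one_of_one_le₀ (one_le_pow₀ hβ)
  set k := β / 2 + r with hk
  have hk0 : 0 < k := by positivity
  set e := Real.exp (-2 * k * a) with he
  have he0 : 0 < e := Real.exp_pos _
  have h1 : e ≤ 24 / (β * a) ^ 4 := by
    have h2 : (β * a) ^ 4 / 24 ≤ Real.exp (β * a) := by
      have := Real.pow_div_factorial_le_exp (β * a) (by positivity) 4
      simpa [Nat.factorial] using this
    have h3 : e ≤ Real.exp (-(β * a)) := by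
      rw [he]
      apply Real.exp_le_exp.mpr
      have : β ≤ 2 * k := by rw [hk]; linarith
      nlinarith
    have h4 : Real.exp (-(β * a)) ≤ ((β * a) ^ 4 / 24)⁻¹ := by
      rw [Real.exp_neg]
      exact inv_anti₀ (by positivity) h2
    rw [inv_div] at h4
    exact h3.trans h4
  have h5 : 6 * k * e ≤ r := by
    have hk2 : k ≤ 2 * β := by rw [hk]; linarith
    have h6 : β * (24 / (β * a) ^ 4) ≤ r / 12 := by
      have : β * (24 / (β * a) ^ 4) = 24 / a ^ 4 / β * r := by
        rw [hr]; field_simp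
      rw [this]
      have h7 : 24 / a ^ 4 / β ≤ 1 / 12 := by
        rw [div_le_iff₀ hβ0]
        have : 288 / a ^ 4 = 12 * (24 / a ^ 4) := by ring
        linarith
      nlinarith
    calc 6 * k * e ≤ 6 * (2 * β) * (24 / (β * a) ^ 4) := by gcongr
      _ = 12 * (β * (24 / (β * a) ^ 4)) := by ring
      _ ≤ r := by linarith
  have h6 : k - 6 * k * e ≤ robinStrength a k := by
    rw [robinStrength, ← he, le_div_iff₀ (by positivity)]
    nlinarith [mul_pos hk0 he0, mul_pos (mul_pos hk0 he0) he0]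
  linarith

namespace IsTube

variable {N : ℝ → ℝ × ℝ} {α γ γ' : ℝ → ℝ} {L k₁ k₂ a G : ℝ}

/-- The trace inequality holds with any prescribed constant on the trace: take the transverse
problem with a Robin strength far above `β`. -/
lemma exists_isClosedForm (h : IsTube N α γ γ' L k₁ k₂ a G) {β : ℝ} (hβ : 0 ≤ β) {θ : ℝ}
    {A : FiberDomain N L k₁ k₂ θ →L[ℂ] FiberDomain N L k₁ k₂ θ} (hA : ∀ x y, ⟪x, A y⟫_ℂ
      = deltaForm β (fiberData N L k₁ k₂ θ x) (fiberData N L k₁ k₂ θ y)) :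
    IsClosedForm (fiberEmbedding N L k₁ k₂ θ) A := by
  have ha := h.a_pos
  have hG := h.one_le
  set b := (2 * β + 2) + 288 / a ^ 4 + 400 * G ^ 3 + 2 / a with hb
  have h1 : 0 < 288 / a ^ 4 := by positivity
  have h2 : 0 < 400 * G ^ 3 := by positivity
  have h3 : 0 < 2 / a := by positivity
  have hb1 : 1 ≤ b := by linarith
  have hrob := le_two_mul_robinStrength ha hb1 (by linarith)
  set k := b / 2 + (b ^ 2)⁻¹ with hk
  have hr : 0 < (b ^ 2)⁻¹ := by positivity
  have hka : 1 ≤ 2 * k * a := by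
    have : 2 / a ≤ 2 * k := by linarith
    rw [div_le_iff₀ ha] at this
    linarith
  obtain ⟨χ, hχ⟩ := exists_isProfile ha (by linarith : 0 < k) hka
  obtain ⟨C, hC⟩ := h.trace_le (by linarith) hχ
  refine isClosedForm_fiber h.k_pos h.continuous_curve hβ (C := C) (fun p hp => ?_) hA
  refine le_trans ?_ (hC p hp)
  exact mul_le_mul_of_nonneg_right (by linarith) (sq_nonneg _)

/-- The hypothesis `hc` deals with the part along the transverse ground state, `hc'` with the
orthogonal part and the exterior of the tube, of squared norm `m - ‖y‖²`. -/
lemma lowerForm_ge {L : ℝ} (hL : 0 ≤ L) {w : C(ℝ, ℝ)} {G k m μ c : ℝ} (hG : 0 ≤ G) (hk : 0 < k)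
    (hw : ∀ t ∈ Icc 0 L, |w t| ≤ G / 2) {y : H1Interval L}
    (hm : ‖weightedEmbedding hL 1 y‖ ^ 2 ≤ m) (hδ : 100 * G ^ 3 / k ≤ 1)
    (hy : μ * ‖weightedEmbedding hL 1 y‖ ^ 2 ≤ ‖y.snd‖ ^ 2 - ‖weightedEmbedding hL w y‖ ^ 2)
    (hc : c ≤ (1 - 100 * G ^ 3 / k) * μ - 100 * G ^ 3 / k * (G ^ 2 / 4 + 1) - k ^ 2)
    (hc' : c ≤ -(k ^ 2 / 4 + 100 * G ^ 3)) : c * m ≤ lowerForm hL w G k y m := by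
  have h1 := norm_sq_weightedEmbedding_le hL hw y
  set δ := 100 * G ^ 3 / k with hδd
  have hδ0 : 0 ≤ δ := by positivity
  rw [lowerForm, ← hδd]
  have h2 := mul_le_mul_of_nonneg_left hy (sub_nonneg.mpr hδ)
  have h3 := mul_le_mul_of_nonneg_left h1 hδ0
  have h4 := mul_le_mul_of_nonneg_right hc (sq_nonneg ‖weightedEmbedding hL 1 y‖)
  have h5 := mul_le_mul_of_nonneg_right hc' (sub_nonneg.mpr hm)
  nlinarith

/-- Functionals are pulled back along the projection `Q`. On their kernel `Q x` satisfies the bound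
`μ`, and `lowerForm_ge` turns this into a bound for `x`; the number of functionals is preserved, as
the min-max principle requires. -/
lemma exists_functional (h : IsTube N α γ γ' L k₁ k₂ a G) (B : ℝ) :
    ∃ C ≥ 0, ∃ β₀ ≥ 1, ∀ β ≥ β₀, ∀ θ, ∀ A : FiberDomain N L k₁ k₂ θ →L[ℂ] FiberDomain N L k₁ k₂ θ,
      (∀ x y, ⟪x, A y⟫_ℂ
        = deltaForm β (fiberData N L k₁ k₂ θ x) (fiberData N L k₁ k₂ θ y)) →
      ∀ w : C(ℝ, ℝ), (∀ t, w t = γ t / 2) → ∀ μ : ℝ, |μ| ≤ B → ∀ (m : ℕ)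
        (ℓ : ComparisonDomain L θ →L[ℂ] (Fin m → ℂ)),
        (∀ x, ℓ x = 0 → μ * ‖comparisonEmbedding h.L_pos.le θ x‖ ^ 2
          ≤ (⟪x, comparisonForm h.L_pos.le w θ x⟫_ℂ).re) →
        ∃ ℓ' : FiberDomain N L k₁ k₂ θ →L[ℂ] (Fin m → ℂ), ∀ x, ℓ' x = 0 →
          (-(1 / 4) * β ^ 2 + μ - C / β) * ‖fiberEmbedding N L k₁ k₂ θ x‖ ^ 2
            ≤ (⟪x, A x⟫_ℂ).re := by
  have ha := h.a_pos
  have hG := h.one_le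
  set D := 200 * G ^ 3 with hD
  have hD0 : 0 < D := by positivity
  -- The summands of the threshold ensure in turn `β ≥ 1`, a Robin strength of at least `β/2`, `k ≥
  -- D`, `2ka ≥ 1`, and that `-β²/4 + μ` lies below the level `-(k²/4 + 100G³)` of the orthogonal
  -- part.
  refine ⟨D * (|B| + G ^ 2 / 4 + 1) + 2, by positivity,
    1 + 288 / a ^ 4 + 2 * D + 2 / a + 16 * (|B| + D + 1), ?_, ?_⟩
  · have : 0 < 288 / a ^ 4 + 2 * D + 2 / a + 16 * (|B| + D + 1) := by positivity
    linarith
  intro β hβ θ A hA w hw μ hμ m ℓ hℓ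
  have h1 : 0 < 288 / a ^ 4 := by positivity
  have h3 : 0 < 2 / a := by positivity
  have h4 := abs_nonneg B
  have hβ1 : 1 ≤ β := by linarith
  have hrob := le_two_mul_robinStrength ha hβ1 (by linarith)
  set r := (β ^ 2)⁻¹ with hr
  have hr0 : 0 < r := by positivity
  have hr1 : r ≤ 1 := inv_le_one_of_one_le₀ (one_le_pow₀ hβ1)
  set k := β / 2 + r with hk
  have hk0 : 0 < k := by positivity
  have hka : 1 ≤ 2 * k * a := by
    have : 2 / a ≤ 2 * k := by linarith
    rw [div_le_iff₀ ha] at this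
    linarith
  obtain ⟨χ, hχ⟩ := exists_isProfile ha hk0 hka
  obtain ⟨Q, hQ⟩ := h.exists_projection (by linarith) (by linarith) hχ hw θ
  refine ⟨ℓ ∘L Q, fun x hx => ?_⟩
  obtain ⟨q1, q2⟩ := hQ x
  have q3 := hℓ (Q x) hx
  rw [re_inner_comparisonForm] at q3
  have hδ : 100 * G ^ 3 / k ≤ D / β := by
    rw [div_le_div_iff₀ hk0 (by linarith)]
    rw [hD]
    nlinarith [pow_pos (by linarith : 0 < G) 3]
  have hδ1 : D / β ≤ 1 := by
    rw [div_le_iff₀ (by linarith)]; linarith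
  have hδ0 : 0 ≤ 100 * G ^ 3 / k := by positivity
  have hμB : |μ| ≤ |B| := hμ.trans (le_abs_self B)
  have hk2 : k ^ 2 ≤ β ^ 2 / 4 + 2 / β := by
    have e1 : k ^ 2 = β ^ 2 / 4 + β * r + r ^ 2 := by rw [hk]; ring
    have e2 : β * r = 1 / β := by rw [hr]; field_simp
    have e3 : r ^ 2 ≤ 1 / β := by
      rw [← e2]
      nlinarith
    rw [e1, e2]
    have : 2 / β = 1 / β + 1 / β := by ring
    linarith
  have hc : -(1 / 4) * β ^ 2 + μ - (D * (|B| + G ^ 2 / 4 + 1) + 2) / β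
      ≤ (1 - 100 * G ^ 3 / k) * μ - 100 * G ^ 3 / k * (G ^ 2 / 4 + 1) - k ^ 2 := by
    have e1 : 100 * G ^ 3 / k * (μ + (G ^ 2 / 4 + 1)) ≤ D / β * (|B| + G ^ 2 / 4 + 1) := by
      have : μ + (G ^ 2 / 4 + 1) ≤ |B| + G ^ 2 / 4 + 1 := by linarith [le_abs_self μ]
      exact (mul_le_mul_of_nonneg_left this hδ0).trans
        (mul_le_mul_of_nonneg_right hδ (by positivity))
    have e2 : (D * (|B| + G ^ 2 / 4 + 1) + 2) / β
        = D / β * (|B| + G ^ 2 / 4 + 1) + 2 / β := by ring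
    rw [e2]
    linarith
  have hc' : -(1 / 4) * β ^ 2 + μ - (D * (|B| + G ^ 2 / 4 + 1) + 2) / β
      ≤ -(k ^ 2 / 4 + 100 * G ^ 3) := by
    have e1 : 0 ≤ (D * (|B| + G ^ 2 / 4 + 1) + 2) / β := by positivity
    have e2 : 2 / β ≤ 2 := by rw [div_le_iff₀ (by linarith)]; linarith
    have e3 : 16 * (|B| + D + 1) * 1 ≤ β * β := mul_le_mul (by linarith) hβ1 (by norm_num) (by linarith)
    have e4 := le_abs_self μ
    nlinarith
  have key := lowerForm_ge h.L_pos.le (by linarith) hk0 (h.abs_half_curvature_le hw) q1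
    (hδ.trans hδ1) q3 hc hc'
  rw [hA, re_deltaForm_self]
  have e5 := mul_le_mul_of_nonneg_right hrob (sq_nonneg ‖(fiberData N L k₁ k₂ θ x).2‖)
  refine key.trans (q2.trans ?_)
  linarith

end IsTube

end StrongDelta

end

/-! ### Transverse trial functions. -/

noncomputable section

namespace StrongDelta

/-- A compactly supported transverse trial function for the coupling `2 κ`. -/
structure IsTrial (a κ C : ℝ) (ψ ψ' : ℝ → ℝ) : Prop where
  hasDerivAt : ∀ u, HasDerivAt ψ (ψ' u) u
  continuous_deriv : Continuous ψ'
  eq_zero : ∀ u, 3 * a / 4 ≤ |u| → ψ u = 0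
  norm_pos : 0 < ∫ u in -a..a, ψ u ^ 2
  moment : ∫ u in -a..a, |u| * ψ u ^ 2 ≤ C / κ * ∫ u in -a..a, ψ u ^ 2
  energy : (∫ u in -a..a, ψ' u ^ 2) - 2 * κ * ψ 0 ^ 2
    ≤ (-κ ^ 2 + C / κ) * ∫ u in -a..a, ψ u ^ 2

section Trial

variable {a κ ε M : ℝ} {χ χ' : ℝ → ℝ}

/-- A smooth substitute for `|u|`: the true ground state `e^{-κ|u|}` has a kink at `0`. -/
lemma hasDerivAt_sqrt_sq_add (hε : 0 < ε) (u : ℝ) :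
    HasDerivAt (fun u => Real.sqrt (u ^ 2 + ε ^ 2)) (u / Real.sqrt (u ^ 2 + ε ^ 2)) u := by
  have h : HasDerivAt (fun u : ℝ => u ^ 2 + ε ^ 2) (2 * u) u := by
    simpa using (hasDerivAt_pow 2 u).add_const (ε ^ 2)
  refine (h.sqrt (by positivity)).congr_deriv ?_
  field_simp

/-- Expand the square; the cross term `2κψψ'` integrates to the value at `0`. The energy defect is
thus a square that would vanish for `e^{-κu}`. -/
lemma integral_deriv_add_sq (ha : 0 ≤ a) {ψ ψ' : ℝ → ℝ} (hψ : ∀ u, HasDerivAt ψ (ψ' u) u)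
    (hψ' : Continuous ψ') (h0 : ψ a = 0) :
    (∫ u in 0..a, ψ' u ^ 2) - κ * ψ 0 ^ 2 + κ ^ 2 * (∫ u in 0..a, ψ u ^ 2)
      = ∫ u in 0..a, (ψ' u + κ * ψ u) ^ 2 := by
  have hc : Continuous ψ := continuous_iff_continuousAt.mpr fun u => (hψ u).continuousAt
  have h1 : ∫ u in 0..a, 2 * ψ u * ψ' u = -ψ 0 ^ 2 := by
    have hi : IntervalIntegrable (fun u => 2 * ψ u * ψ' u) volume 0 a :=
      ((continuous_const.mul hc).mul hψ').intervalIntegrable _ _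
    rw [intervalIntegral.integral_eq_sub_of_hasDerivAt (f := fun u => ψ u ^ 2)
      (fun u _ => ((hψ u).fun_pow 2).congr_deriv (by simp)) hi, h0]
    ring
  have i1 : IntervalIntegrable (fun u => ψ' u ^ 2) volume 0 a := (hψ'.pow 2).intervalIntegrable _ _
  have i2 : IntervalIntegrable (fun u => κ * (2 * ψ u * ψ' u)) volume 0 a :=
    (continuous_const.mul ((continuous_const.mul hc).mul hψ')).intervalIntegrable _ _
  have i3 : IntervalIntegrable (fun u => κ ^ 2 * ψ u ^ 2) volume 0 a :=
    (continuous_const.mul (hc.pow 2)).intervalIntegrable _ _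
  have i12 : IntervalIntegrable (fun u => ψ' u ^ 2 + κ * (2 * ψ u * ψ' u)) volume 0 a := i1.add i2
  have e : ∫ u in 0..a, (ψ' u + κ * ψ u) ^ 2
      = ∫ u in 0..a, (ψ' u ^ 2 + κ * (2 * ψ u * ψ' u) + κ ^ 2 * ψ u ^ 2) :=
    intervalIntegral.integral_congr fun u _ => by ring
  rw [e, intervalIntegral.integral_add i12 i3, intervalIntegral.integral_add i1 i2,
    intervalIntegral.integral_const_mul, intervalIntegral.integral_const_mul, h1]
  ring

/-- Here `f` is `ψ' + κψ`. Its first part comes from the cut-off, lives where `|u| ≥ a/2` and is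
exponentially small; its second comes from the smoothing, and `∫ (1 - u/√(u² + ε²)) ≤ ε`. -/
lemma integral_sq_le_of_smoothed (ha : 0 < a) (hε : 0 < ε) (hκ : 0 < κ)
    (hχ : ∀ u, χ u ∈ Icc (0 : ℝ) 1) (hχ' : ∀ u, |χ' u| ≤ M) (hχ0 : ∀ u, |u| < a / 2 → χ' u = 0)
    {f : ℝ → ℝ} (hf : Continuous f)
    (hfe : ∀ u, f u = (χ' u + κ * (1 - u / Real.sqrt (u ^ 2 + ε ^ 2)) * χ u)
      * Real.exp (-κ * Real.sqrt (u ^ 2 + ε ^ 2))) :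
    ∫ u in 0..a, f u ^ 2 ≤ 2 * M ^ 2 * a * Real.exp (-κ * a) + 2 * κ ^ 2 * ε := by
  have hm0 : ∀ u : ℝ, 0 < Real.sqrt (u ^ 2 + ε ^ 2) := fun u => Real.sqrt_pos.mpr (by positivity)
  have hmu : ∀ u : ℝ, u ≤ Real.sqrt (u ^ 2 + ε ^ 2) := fun u =>
    Real.le_sqrt_of_sq_le (by nlinarith [sq_nonneg ε])
  have hc1 : Continuous fun u : ℝ => 1 - u / Real.sqrt (u ^ 2 + ε ^ 2) :=
    continuous_const.sub (continuous_id.div (by fun_prop) fun u => (hm0 u).ne')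
  have hpt : ∀ u ∈ Icc 0 a, f u ^ 2 ≤ 2 * M ^ 2 * Real.exp (-κ * a)
      + 2 * κ ^ 2 * (1 - u / Real.sqrt (u ^ 2 + ε ^ 2)) := by
    intro u hu
    set m := Real.sqrt (u ^ 2 + ε ^ 2) with hm
    have hd : u / m ∈ Icc (0 : ℝ) 1 :=
      ⟨div_nonneg hu.1 (hm0 u).le, (div_le_one (hm0 u)).mpr (hmu u)⟩
    set e := Real.exp (-κ * m) with he
    have he0 : 0 < e := Real.exp_pos _
    have he1 : e ≤ 1 := Real.exp_le_one_iff.mpr (by have := mul_pos hκ (hm0 u); linarith)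
    have x1 : (χ' u * e) ^ 2 ≤ M ^ 2 * Real.exp (-κ * a) := by
      rcases lt_or_ge |u| (a / 2) with h | h
      · rw [hχ0 u h]; simp; positivity
      · rw [abs_of_nonneg hu.1] at h
        have h1 : e ^ 2 ≤ Real.exp (-κ * a) := by
          rw [he, ← Real.exp_nat_mul]
          apply Real.exp_le_exp.mpr
          have : a ≤ 2 * m := by linarith [hmu u]
          push_cast
          nlinarith
        have h2 : χ' u ^ 2 ≤ M ^ 2 := sq_le_sq' (by linarith [(abs_le.mp (hχ' u)).1])
          (abs_le.mp (hχ' u)).2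
        rw [mul_pow]
        exact mul_le_mul h2 h1 (sq_nonneg _) (sq_nonneg _)
    have x2 : (κ * (1 - u / m) * χ u * e) ^ 2 ≤ κ ^ 2 * (1 - u / m) := by
      have h1 : (1 - u / m) * (χ u * e) ^ 2 ≤ 1 := by
        have a1 : χ u * e ≤ 1 := mul_le_one₀ (hχ u).2 he0.le he1
        have a2 : 0 ≤ χ u * e := mul_nonneg (hχ u).1 he0.le
        exact mul_le_one₀ (by linarith [hd.1]) (sq_nonneg _) (pow_le_one₀ a2 a1)
      calc (κ * (1 - u / m) * χ u * e) ^ 2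
          = κ ^ 2 * (1 - u / m) * ((1 - u / m) * (χ u * e) ^ 2) := by ring
        _ ≤ κ ^ 2 * (1 - u / m) * 1 :=
            mul_le_mul_of_nonneg_left h1 (mul_nonneg (sq_nonneg _) (by linarith [hd.2]))
        _ = _ := mul_one _
    rw [hfe u]
    nlinarith [sq_nonneg (χ' u * e - κ * (1 - u / m) * χ u * e)]
  have i1 : IntervalIntegrable (fun _ : ℝ => 2 * M ^ 2 * Real.exp (-κ * a)) volume 0 a :=
    intervalIntegrable_const
  have i2 : IntervalIntegrable (fun u => 2 * κ ^ 2 * (1 - u / Real.sqrt (u ^ 2 + ε ^ 2)))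
    volume 0 a := (continuous_const.mul hc1).intervalIntegrable _ _
  have hle := intervalIntegral.integral_mono_on ha.le ((hf.pow 2).intervalIntegrable _ _)
    (i1.add i2) hpt
  have hftc : ∫ u in 0..a, (1 - u / Real.sqrt (u ^ 2 + ε ^ 2))
      = (a - Real.sqrt (a ^ 2 + ε ^ 2)) + ε := by
    rw [intervalIntegral.integral_eq_sub_of_hasDerivAt
      (f := fun u => u - Real.sqrt (u ^ 2 + ε ^ 2))
      (fun u _ => (hasDerivAt_id u).sub (hasDerivAt_sqrt_sq_add hε u))
      (hc1.intervalIntegrable _ _)]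
    simp [Real.sqrt_sq hε.le]
  refine hle.trans ?_
  rw [intervalIntegral.integral_add i1 i2, intervalIntegral.integral_const,
    intervalIntegral.integral_const_mul, hftc]
  have := hmu a
  have h2 : 2 * κ ^ 2 * (a - Real.sqrt (a ^ 2 + ε ^ 2) + ε) ≤ 2 * κ ^ 2 * ε := by
    apply mul_le_mul_of_nonneg_left _ (by positivity); linarith
  simp only [sub_zero, smul_eq_mul]
  linarith

lemma integral_even {F : ℝ → ℝ} (ha : 0 ≤ a) (hF : Continuous F) (he : ∀ u, F (-u) = F u) :
    ∫ u in -a..a, F u = 2 * ∫ u in 0..a, F u := by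
  rw [integral_symm_interval ha hF.continuousOn, intervalIntegral.integral_congr fun u _ => he u]
  ring

lemma integral_sq_ge_of_smoothed (ha : 0 < a) (hε : 0 < ε) (hκ : 0 < κ) (hκa : 1 ≤ κ * a)
    (hκε : κ * ε ≤ 1 / 4) {ψ : ℝ → ℝ} (hψ : Continuous ψ)
    (h : ∀ u ∈ Icc 0 (a / 2), ψ u = Real.exp (-κ * Real.sqrt (u ^ 2 + ε ^ 2))) :
    1 / (8 * κ) ≤ ∫ u in 0..a, ψ u ^ 2 := by
  have h1 : ∫ u in 0..(a / 2), ψ u ^ 2 ≤ ∫ u in 0..a, ψ u ^ 2 :=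
    intervalIntegral.integral_mono_interval le_rfl (by linarith) (by linarith)
      (Filter.Eventually.of_forall fun u => sq_nonneg _) ((hψ.pow 2).intervalIntegrable _ _)
  refine le_trans ?_ h1
  have h2 : ∫ u in 0..(a / 2), 1 / 2 * Real.exp (-(2 * κ) * u) ≤ ∫ u in 0..(a / 2), ψ u ^ 2 := by
    refine intervalIntegral.integral_mono_on (by linarith)
      ((by fun_prop : Continuous fun u => 1 / 2 * Real.exp (-(2 * κ) * u)).intervalIntegrable _ _)
      ((hψ.pow 2).intervalIntegrable _ _) fun u hu => ?_
    rw [h u hu, ← Real.exp_nat_mul]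
    have hm : Real.sqrt (u ^ 2 + ε ^ 2) ≤ u + ε :=
      Real.sqrt_le_iff.mpr ⟨by linarith [hu.1], by nlinarith [mul_nonneg hu.1 hε.le]⟩
    have h3 : Real.exp (-(1 / 2) + -(2 * κ) * u)
        ≤ Real.exp ((2 : ℕ) * (-κ * Real.sqrt (u ^ 2 + ε ^ 2))) := by
      apply Real.exp_le_exp.mpr
      push_cast
      nlinarith
    refine le_trans ?_ h3
    rw [Real.exp_add]
    refine mul_le_mul_of_nonneg_right ?_ (Real.exp_pos _).le
    linarith [Real.add_one_le_exp (-(1 / 2 : ℝ))]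
  refine le_trans ?_ h2
  rw [intervalIntegral.integral_const_mul, integral_exp_neg_mul (by positivity)]
  have h4 : Real.exp (-(2 * κ) * (a / 2)) ≤ 1 / 2 := by
    have e1 : Real.exp (-(2 * κ) * (a / 2)) = (Real.exp (κ * a))⁻¹ := by
      rw [← Real.exp_neg]; congr 1; ring
    rw [e1, one_div]
    exact inv_anti₀ (by norm_num) (by linarith [Real.add_one_le_exp (κ * a)])
  have e2 : 1 / (8 * κ) = 1 / 2 * (1 / 2 / (2 * κ)) := by field_simp; norm_num
  rw [e2]
  gcongr
  linarith

/-- Transverse trial functions. -/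
lemma exists_isTrial (ha : 0 < a) :
    ∃ C ≥ 0, ∃ κ₀ ≥ 1, ∀ κ ≥ κ₀, ∃ ψ ψ', IsTrial a κ C ψ ψ' := by
  set b : ContDiffBump (0 : ℝ) := ⟨a / 2, 3 * a / 4, by linarith, by linarith⟩ with hb
  have hbd : ContDiff ℝ 1 b := b.contDiff
  have hb' : Continuous (deriv b) := hbd.continuous_deriv (by norm_num)
  obtain ⟨M, hM⟩ := hb'.bounded_above_of_compact_support b.hasCompactSupport.deriv
  have hb0 : ∀ u, |u| < a / 2 → deriv b u = 0 := fun u hu => by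
    have := (b.eventuallyEq_one_of_mem_ball (x := u) (by simpa using hu)).deriv_eq
    rw [this]
    exact deriv_const u 1
  refine ⟨64 * (M ^ 2 / a + 1), by positivity, max 2 (1 / a), le_trans (by norm_num)
    (le_max_left _ _), fun κ hκ => ?_⟩
  have hκ2 : 2 ≤ κ := (le_max_left _ _).trans hκ
  have hκ0 : 0 < κ := by linarith
  have hκa : 1 ≤ κ * a := by
    have := (le_max_right _ _).trans hκ
    rwa [div_le_iff₀ ha] at this
  -- With this choice the smoothing error `κ²ε` is `κ⁻²`.
  set ε := (κ ^ 4)⁻¹ with hε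
  have hε0 : 0 < ε := by positivity
  set m : ℝ → ℝ := fun u => Real.sqrt (u ^ 2 + ε ^ 2) with hm
  have hm0 : ∀ u : ℝ, 0 < m u := fun u => Real.sqrt_pos.mpr (by positivity)
  have hmc : Continuous m := by fun_prop
  set ψ : ℝ → ℝ := fun u => b u * Real.exp (-κ * m u) with hψ
  set ψ' : ℝ → ℝ := fun u => (deriv b u - κ * (u / m u) * b u) * Real.exp (-κ * m u) with hψ'
  have hd : ∀ u, HasDerivAt ψ (ψ' u) u := fun u => by
    have h1 := (hbd.differentiable (by norm_num) u).hasDerivAt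
    refine (h1.mul ((hasDerivAt_sqrt_sq_add hε0 u).const_mul (-κ)).exp).congr_deriv ?_
    simp only [hψ', hm]
    ring
  have hψc : Continuous ψ := continuous_iff_continuousAt.mpr fun u => (hd u).continuousAt
  have hψ'c : Continuous ψ' :=
    (hb'.sub ((continuous_const.mul (continuous_id.div hmc fun u => (hm0 u).ne')).mul
      b.continuous)).mul (by fun_prop)
  have hz : ∀ u, 3 * a / 4 ≤ |u| → ψ u = 0 := fun u hu => by
    simp only [hψ]
    rw [b.zero_of_le_dist (by simpa using hu), zero_mul]
  have hev : ∀ u, ψ (-u) = ψ u := fun u => by simp only [hψ, hm, b.neg, neg_sq]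
  have hev' : ∀ u, ψ' (-u) = -ψ' u := fun u => by
    have h1 := hasDerivAt_comp_neg (hd (-u))
    simp only [hev] at h1
    have := h1.unique (hd u)
    linarith
  have I0 := integral_even ha.le (hψc.pow 2) fun u => by simp only [Pi.pow_apply, hev]
  have I1 := integral_even ha.le (hψ'c.pow 2) fun u => by simp only [Pi.pow_apply, hev', neg_sq]
  have I2 := integral_even ha.le (continuous_abs.mul (hψc.pow 2)) fun u => by
    simp only [Pi.mul_apply, Pi.pow_apply, hev, abs_neg]
  simp only [Pi.mul_apply, Pi.pow_apply] at I0 I1 I2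
  have hκε : κ ^ 2 * ε = (κ ^ 2)⁻¹ := by rw [hε]; field_simp
  have hlow : 1 / (8 * κ) ≤ ∫ u in 0..a, ψ u ^ 2 := by
    refine integral_sq_ge_of_smoothed ha hε0 hκ0 hκa ?_ hψc fun u hu => ?_
    · rw [hε, ← div_eq_mul_inv, div_le_iff₀ (by positivity)]
      nlinarith [mul_pos hκ0 hκ0, mul_pos (mul_pos hκ0 hκ0) hκ0, pow_le_pow_left₀ (by norm_num) hκ2 3]
    · simp only [hψ]
      rw [b.one_of_mem_closedBall (by simpa [abs_of_nonneg hu.1] using hu.2), one_mul]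
  -- Absolute errors of order `κ⁻²` are relative errors of order `1/κ`, since the squared norm is at
  -- least of order `1/κ`.
  have hinv : (κ ^ 2)⁻¹ ≤ 8 / κ * ∫ u in 0..a, ψ u ^ 2 := by
    refine le_trans (le_of_eq ?_) (mul_le_mul_of_nonneg_left hlow (by positivity))
    field_simp
  have hpos : 0 < ∫ u in 0..a, ψ u ^ 2 := lt_of_lt_of_le (by positivity) hlow
  refine ⟨ψ, ψ', hd, hψ'c, hz, by rw [I0]; linarith, ?_, ?_⟩
  · rw [I0, I2]
    have h1 : ∫ u in 0..a, |u| * ψ u ^ 2 ≤ 1 / (2 * κ) ^ 2 := by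
      refine le_trans (intervalIntegral.integral_mono_on ha.le
        ((continuous_abs.mul (hψc.pow 2)).intervalIntegrable _ _)
        ((by fun_prop : Continuous fun u => u * Real.exp (-(2 * κ) * u)).intervalIntegrable _ _)
        fun u hu => ?_) (integral_mul_exp_neg_le (by positivity) ha.le)
      rw [abs_of_nonneg hu.1]
      refine mul_le_mul_of_nonneg_left ?_ hu.1
      simp only [hψ]
      rw [mul_pow, ← Real.exp_nat_mul]
      have h2 : u ≤ m u := Real.le_sqrt_of_sq_le (by nlinarith [sq_nonneg ε])
      have h3 : Real.exp ((2 : ℕ) * (-κ * m u)) ≤ Real.exp (-(2 * κ) * u) := by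
        apply Real.exp_le_exp.mpr
        push_cast
        nlinarith
      calc b u ^ 2 * Real.exp ((2 : ℕ) * (-κ * m u)) ≤ 1 * Real.exp (-(2 * κ) * u) :=
            mul_le_mul (pow_le_one₀ b.nonneg b.le_one) h3 (Real.exp_pos _).le zero_le_one
        _ = _ := one_mul _
    have h2 : 1 / (2 * κ) ^ 2 = (κ ^ 2)⁻¹ / 4 := by field_simp; norm_num
    have h3 : 64 * (M ^ 2 / a + 1) / κ * (2 * ∫ u in 0..a, ψ u ^ 2)
        = 16 * (M ^ 2 / a + 1) * (8 / κ * ∫ u in 0..a, ψ u ^ 2) := by ring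
    have h4 : 0 < (κ ^ 2)⁻¹ := by positivity
    have h5 : 0 ≤ M ^ 2 / a := by positivity
    rw [h3]
    nlinarith
  · rw [I0, I1]
    have h1 := integral_deriv_add_sq (κ := κ) ha.le hd hψ'c
      (hz a (by rw [abs_of_pos ha]; linarith))
    have h2 := integral_sq_le_of_smoothed (M := M) (χ := b) (χ' := deriv b) ha hε0 hκ0
      (fun u => ⟨b.nonneg, b.le_one⟩) hM hb0 (f := fun u => ψ' u + κ * ψ u)
      (hψ'c.add (continuous_const.mul hψc)) fun u => by simp only [hψ, hψ', hm]; ring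
    have h3 : Real.exp (-κ * a) ≤ 2 / (κ * a) ^ 2 := by
      have h4 : (κ * a) ^ 2 / 2 ≤ Real.exp (κ * a) := by
        have := Real.pow_div_factorial_le_exp (κ * a) (by positivity) 2
        simpa [Nat.factorial] using this
      rw [neg_mul, Real.exp_neg, ← inv_div]
      exact inv_anti₀ (by positivity) h4
    have h5 : 2 * M ^ 2 * a * Real.exp (-κ * a) ≤ 4 * (M ^ 2 / a) * (κ ^ 2)⁻¹ := by
      refine (mul_le_mul_of_nonneg_left h3 (by positivity)).trans (le_of_eq ?_)
      field_simp
      ring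
    have h6 : 2 * M ^ 2 * a * Real.exp (-κ * a) + 2 * κ ^ 2 * ε
        ≤ (4 * (M ^ 2 / a) + 2) * (κ ^ 2)⁻¹ := by
      rw [mul_assoc 2 (κ ^ 2), hκε]
      linarith
    have h7 : (4 * (M ^ 2 / a) + 2) * (κ ^ 2)⁻¹
        ≤ 4 * (M ^ 2 / a + 1) * (8 / κ * ∫ u in 0..a, ψ u ^ 2) :=
      mul_le_mul (by linarith) hinv (by positivity) (by positivity)
    have h8 : 0 ≤ (M ^ 2 / a + 1) * (8 / κ * ∫ u in 0..a, ψ u ^ 2) := by positivity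
    have h9 : (-κ ^ 2 + 64 * (M ^ 2 / a + 1) / κ) * (2 * ∫ u in 0..a, ψ u ^ 2)
        = -κ ^ 2 * (2 * ∫ u in 0..a, ψ u ^ 2)
          + 16 * ((M ^ 2 / a + 1) * (8 / κ * ∫ u in 0..a, ψ u ^ 2)) := by ring
    rw [h9]
    linarith

end Trial

end StrongDelta

end

/-! ### Functions on the plane given in curvilinear coordinates. -/

noncomputable section

namespace StrongDelta

namespace IsTube

variable {N : ℝ → ℝ × ℝ} {α γ γ' : ℝ → ℝ} {L k₁ k₂ a G : ℝ}

/-- Functions in curvilinear coordinates, extended by zero. -/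
lemma exists_pushforward (h : IsTube N α γ γ' L k₁ k₂ a G) {g : ℝ × ℝ → ℂ} {K : Set (ℝ × ℝ)}
    (hK : IsCompact K) (hKU : K ⊆ univ ×ˢ Ioo (-a) a)
    (hg : ∀ p ∈ univ ×ˢ Ioo (-a) a, ContDiffAt ℝ 1 g p) (h0 : ∀ p ∉ K, g p = 0) :
    ∃ F : ℝ × ℝ → ℂ, ContDiff ℝ 1 F ∧ (∀ p ∈ univ ×ˢ Ioo (-a) a, F (tubeCoord N α p) = g p) ∧
      ∀ x ∉ tubeCoord N α '' K, F x = 0 := by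
  set U : Set (ℝ × ℝ) := univ ×ˢ Ioo (-a) a with hU
  have hUo : IsOpen U := isOpen_univ.prod isOpen_Ioo
  set F : ℝ × ℝ → ℂ := Function.extend (fun p : U => tubeCoord N α p) (fun p => g p) 0 with hF
  have hinj : Function.Injective fun p : U => tubeCoord N α p := fun p q e =>
    Subtype.ext (h.injOn_univ p.2 q.2 e)
  have hFU : ∀ p ∈ U, F (tubeCoord N α p) = g p := fun p hp => hinj.extend_apply _ _ ⟨p, hp⟩
  have hF0 : ∀ x ∉ tubeCoord N α '' K, F x = 0 := by
    intro x hx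
    by_cases hxU : ∃ p : U, tubeCoord N α p = x
    · obtain ⟨p, rfl⟩ := hxU
      rw [hFU p p.2]
      exact h0 _ fun hp => hx ⟨p, hp, rfl⟩
    · exact Function.extend_apply' _ _ _ hxU
  refine ⟨F, contDiff_iff_contDiffAt.mpr fun x => ?_, hFU, hF0⟩
  -- At points of the image of `K` the inverse function theorem applies, and the local inverse stays
  -- in the tube, where the coordinates are injective. The complement of the compact image is open
  -- and `F` vanishes there.
  by_cases hx : x ∈ tubeCoord N α '' K
  · obtain ⟨p, hp, rfl⟩ := hx
    have hpU := hKU hp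
    have hdet : (tubeDeriv α γ p).det ≠ 0 := by
      rw [det_tubeDeriv]
      exact (h.jacobian_pos (Ioo_subset_Icc_self hpU.2) p.1).ne'
    have hc : ContDiffAt ℝ 1 (tubeCoord N α) p := h.contDiff_tubeCoord.contDiffAt
    have hd : HasFDerivAt (tubeCoord N α)
        (((tubeDeriv α γ p).toContinuousLinearEquivOfDetNeZero hdet : (ℝ × ℝ) ≃L[ℝ] (ℝ × ℝ)) :
          (ℝ × ℝ) →L[ℝ] (ℝ × ℝ)) p := h.hasFDerivAt_tubeCoord p
    set e := hc.toOpenPartialHomeomorph (tubeCoord N α) hd one_ne_zero with he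
    have hpe : p ∈ e.source := hc.mem_toOpenPartialHomeomorph_source hd one_ne_zero
    have hxe : tubeCoord N α p ∈ e.target :=
      hc.image_mem_toOpenPartialHomeomorph_target hd one_ne_zero
    have hcoe : ∀ q, e q = tubeCoord N α q := fun q => rfl
    have hsymm : e.symm (tubeCoord N α p) = p := by rw [← hcoe]; exact e.left_inv hpe
    have hes : ContDiffAt ℝ 1 e.symm (tubeCoord N α p) := hc.to_localInverse hd one_ne_zero
    have hcomp : ContDiffAt ℝ 1 (g ∘ e.symm) (tubeCoord N α p) :=
      ContDiffAt.comp _ (by rw [hsymm]; exact hg p hpU) hes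
    refine hcomp.congr_of_eventuallyEq ?_
    have h1 : ∀ᶠ y in nhds (tubeCoord N α p), y ∈ e.target := e.open_target.mem_nhds hxe
    have h2 : ∀ᶠ y in nhds (tubeCoord N α p), e.symm y ∈ U :=
      hes.continuousAt.eventually_mem (by rw [hsymm]; exact hUo.mem_nhds hpU)
    filter_upwards [h1, h2] with y hy1 hy2
    rw [Function.comp_apply, ← hFU _ hy2, ← hcoe, e.right_inv hy1]
  · refine (contDiffAt_const (c := (0 : ℂ))).congr_of_eventuallyEq ?_
    filter_upwards [(hK.image h.continuous_tubeCoord).isClosed.isOpen_compl.mem_nhds hx] with y hy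
    exact hF0 y hy

lemma lt_fst_tubeCoord (h : IsTube N α γ γ' L k₁ k₂ a G) {s u : ℝ} (hs : s ∈ Ioo L (2 * L))
    (hu : u ∈ Ioo (-a) a) : k₁ < (tubeCoord N α (s, u)).1 := by
  have h1 := h.maps (x := (s - L, u)) ⟨⟨by linarith [hs.1], by linarith [hs.2]⟩, hu⟩
  have h2 := h.tubeCoord_add (s - L) u
  rw [sub_add_cancel] at h2
  rw [h2, Prod.fst_add]
  linarith [h1.1.1]

/-- The position of the curvilinear coordinates relative to the boundary lines. -/
lemma eq_or_mem_of_fst_mem (h : IsTube N α γ γ' L k₁ k₂ a G) {s u : ℝ}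
    (hs : s ∈ Icc (-(L / 2)) (3 * L / 2)) (hu : u ∈ Ioo (-a) a) :
    ((tubeCoord N α (s, u)).1 = 0 → s = 0) ∧ ((tubeCoord N α (s, u)).1 = k₁ → s = L) ∧
      ((tubeCoord N α (s, u)).1 ∈ Ioo 0 k₁ → s ∈ Ioo 0 L) := by
  have hL := h.L_pos
  have hk := h.k_pos
  rcases lt_trichotomy s 0 with h1 | h1 | h1
  · have := h.fst_tubeCoord_lt ⟨by linarith [hs.1], h1⟩ hu
    exact ⟨fun e => by linarith, fun e => by linarith, fun e => by linarith [e.1]⟩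
  · subst h1
    rw [h.tubeCoord_zero]
    exact ⟨fun _ => rfl, fun e => absurd e hk.ne, fun e => absurd e.1 (lt_irrefl _)⟩
  rcases lt_trichotomy s L with h2 | h2 | h2
  · have := (h.maps (x := (s, u)) ⟨⟨h1, h2⟩, hu⟩).1
    exact ⟨fun e => by linarith [this.1], fun e => by linarith [this.2], fun _ => ⟨h1, h2⟩⟩
  · subst h2
    rw [h.tubeCoord_right]
    exact ⟨fun e => absurd e hk.ne', fun _ => rfl, fun e => absurd e.2 (lt_irrefl _)⟩
  · have := h.lt_fst_tubeCoord ⟨h2, by linarith [hs.2]⟩ hu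
    exact ⟨fun e => by linarith, fun e => by linarith, fun e => by linarith [e.2]⟩

end IsTube

/-- A regular element of `H¹((0, L))` extends to a compactly supported `C¹` function. -/
lemma exists_contDiff_extension {L : ℝ} (hL : 0 < L) (y : H1Interval L) {f₁ : ℝ → ℂ}
    (hf₁ : ContinuousOn f₁ (Icc 0 L)) (hy : y.snd =ᵐ[volume.restrict (Ioo 0 L)] f₁) :
    ∃ H : ℝ → ℂ, ContDiff ℝ 1 H ∧ (∀ s ∈ Icc 0 L, H s = evalAt L s y) ∧
      (∀ s ∈ Ioo 0 L, deriv H s = f₁ s) ∧ ∀ s ∉ Icc (-(L / 2)) (3 * L / 2), H s = 0 := by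
  set k : ℝ → ℂ := IccExtend hL.le ((Icc 0 L).domRestrict f₁) with hk
  have hkc : Continuous k := (continuousOn_iff_continuous_domRestrict.mp hf₁).Icc_extend'
  have hke : ∀ s ∈ Icc 0 L, k s = f₁ s := fun s hs => IccExtend_of_mem hL.le _ hs
  set P : ℝ → ℂ := fun t => y.fst + ∫ s in (0 : ℝ)..t, k s with hP
  have hPd : ∀ t, HasDerivAt P (k t) t := fun t =>
    (intervalIntegral.integral_hasDerivAt_right (hkc.intervalIntegrable _ _)
      hkc.stronglyMeasurable.stronglyMeasurableAtFilter hkc.continuousAt).const_add _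
  have hP1 : ContDiff ℝ 1 P := contDiff_one_iff_deriv.mpr
    ⟨fun t => (hPd t).differentiableAt, by rw [funext fun t => (hPd t).deriv]; exact hkc⟩
  -- Equal to `1` on a neighbourhood of `[0, L]` and zero at distance `L` from the midpoint.
  -- Continuing the function beyond both ends avoids any cut at the sides of the strip.
  set b : ContDiffBump (L / 2) := ⟨3 * L / 4, L, by linarith, by linarith⟩ with hb
  have hb1 : ∀ s ∈ Ioo (-(L / 4)) (5 * L / 4), b s = 1 := fun s hs =>
    b.one_of_mem_closedBall (by
      rw [Metric.mem_closedBall, Real.dist_eq, abs_le]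
      constructor <;> simp only [hb] <;> linarith [hs.1, hs.2])
  refine ⟨fun s => (b s : ℂ) * P s, (Complex.ofRealCLM.contDiff.comp b.contDiff).mul hP1,
    fun s hs => ?_, fun s hs => ?_, fun s hs => ?_⟩
  · simp only
    rw [hb1 s ⟨by linarith [hs.1], by linarith [hs.2]⟩, Complex.ofReal_one, one_mul,
      evalAt_apply hs.2]
    simp only [hP]
    rw [intervalIntegral.integral_of_le hs.1, integral_Ioc_eq_integral_Ioo]
    congr 1
    refine integral_congr_ae ?_
    filter_upwards [ae_restrict_of_ae_restrict_of_subset (Ioo_subset_Ioo_right hs.2) hy,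
      ae_restrict_mem measurableSet_Ioo] with t h1 h2
    rw [h1, hke t ⟨h2.1.le, h2.2.le.trans hs.2⟩]
  · have : (fun s => (b s : ℂ) * P s) =ᶠ[nhds s] P := by
      filter_upwards [isOpen_Ioo.mem_nhds (show s ∈ Ioo (-(L / 4)) (5 * L / 4) from
        ⟨by linarith [hs.1], by linarith [hs.2]⟩)] with t ht
      rw [hb1 t ht, Complex.ofReal_one, one_mul]
    rw [this.deriv_eq, (hPd s).deriv, hke s (Ioo_subset_Icc_self hs)]
  · have : L ≤ dist s (L / 2) := by
      rw [Real.dist_eq]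
      by_contra! hlt
      rw [abs_lt] at hlt
      exact hs ⟨by linarith [hlt.1], by linarith [hlt.2]⟩
    simp only
    rw [b.zero_of_le_dist this, Complex.ofReal_zero, zero_mul]

end StrongDelta

end

/-! ### Trial functions on the strip and their pointwise energy. -/

noncomputable section

namespace StrongDelta

/-- The trial function in curvilinear coordinates. -/
def trialFn (γ ψ : ℝ → ℝ) (H : ℝ → ℂ) (p : ℝ × ℝ) : ℂ :=
  (((Real.sqrt (1 + p.2 * γ p.1))⁻¹ * ψ p.2 : ℝ) : ℂ) * H p.1

lemma hasDerivAt_inv_sqrt {j : ℝ → ℝ} {j' x : ℝ} (hj : HasDerivAt j j' x) (h0 : 0 < j x) :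
    HasDerivAt (fun x => (Real.sqrt (j x))⁻¹) (-((Real.sqrt (j x))⁻¹ * (j' / (2 * j x)))) x := by
  refine ((hj.sqrt h0.ne').fun_inv (Real.sqrt_pos.mpr h0).ne').congr_deriv ?_
  rw [Real.sq_sqrt h0.le]
  field_simp

namespace IsTube

variable {N : ℝ → ℝ × ℝ} {α γ γ' : ℝ → ℝ} {L k₁ k₂ a G : ℝ} {ψ ψ' : ℝ → ℝ} {H : ℝ → ℂ}

lemma contDiffAt_trialFn (h : IsTube N α γ γ' L k₁ k₂ a G) (hψ : ContDiff ℝ 1 ψ)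
    (hH : ContDiff ℝ 1 H) {p : ℝ × ℝ} (hp : p ∈ univ ×ˢ Ioo (-a) a) :
    ContDiffAt ℝ 1 (trialFn γ ψ H) p := by
  have h1 : ContDiff ℝ 1 γ := contDiff_one_iff_deriv.mpr
    ⟨fun s => (h.hasDerivAt_curvature s).differentiableAt, by
      rw [funext fun s => (h.hasDerivAt_curvature s).deriv]; exact h.continuous_deriv⟩
  have h2 : ContDiff ℝ 1 fun p : ℝ × ℝ => 1 + p.2 * γ p.1 :=
    contDiff_const.add (contDiff_snd.mul (h1.comp contDiff_fst))
  have hj := h.jacobian_pos (Ioo_subset_Icc_self hp.2) p.1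
  have h3 : ContDiffAt ℝ 1 (fun p : ℝ × ℝ => (Real.sqrt (1 + p.2 * γ p.1))⁻¹ * ψ p.2) p :=
    ((h2.contDiffAt.sqrt hj.ne').inv (Real.sqrt_pos.mpr hj).ne').mul
      (hψ.comp contDiff_snd).contDiffAt
  exact (Complex.ofRealCLM.contDiff.contDiffAt.comp p h3).mul (hH.comp contDiff_fst).contDiffAt

/-- The function lives on a piece of the tube that sticks out of the strip on both sides, so it is
`C¹` on the plane. By `eq_or_mem_of_fst_mem` the closed strip sees only the fibers with `0 ≤ s ≤ L`,
and the two boundary fibers are related by the condition on `H`. -/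
lemma exists_trial_function (h : IsTube N α γ γ' L k₁ k₂ a G) (hψ : ContDiff ℝ 1 ψ)
    (hψ0 : ∀ u, 3 * a / 4 ≤ |u| → ψ u = 0) (hH : ContDiff ℝ 1 H)
    (hH0 : ∀ s ∉ Icc (-(L / 2)) (3 * L / 2), H s = 0) :
    ∃ F : ℝ × ℝ → ℂ, ContDiff ℝ 1 F ∧ HasCompactSupport F ∧
      (∀ p ∈ univ ×ˢ Ioo (-a) a, F (tubeCoord N α p) = trialFn γ ψ H p) ∧
      (∀ x ∈ strip k₁, x ∉ tubeCoord N α '' (Ioo 0 L ×ˢ Ioo (-a) a) → F =ᶠ[nhds x] 0) ∧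
      ∀ c, H L = c * H 0 → ∀ y, F (k₁, k₂ + y) = c * F (0, y) := by
  have ha := h.a_pos
  set K : Set (ℝ × ℝ) := Icc (-(L / 2)) (3 * L / 2) ×ˢ Icc (-(3 * a / 4)) (3 * a / 4) with hKdef
  have hK : IsCompact K := isCompact_Icc.prod isCompact_Icc
  have hKU : K ⊆ univ ×ˢ Ioo (-a) a := fun p hp =>
    ⟨trivial, by linarith [hp.2.1], by linarith [hp.2.2]⟩
  obtain ⟨F, hF1, hFU, hF0⟩ := h.exists_pushforward hK hKU
    (fun p hp => h.contDiffAt_trialFn hψ hH hp) fun p hp => by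
      rw [trialFn]
      by_cases h1 : p.1 ∈ Icc (-(L / 2)) (3 * L / 2)
      · have h2 : 3 * a / 4 ≤ |p.2| := by
          by_contra! hlt
          exact hp ⟨h1, abs_le.mp hlt.le⟩
        rw [hψ0 _ h2]; simp
      · rw [hH0 _ h1, mul_zero]
  have hKc := hK.image h.continuous_tubeCoord
  refine ⟨F, hF1, HasCompactSupport.intro hKc hF0, hFU, fun x hx hxn => ?_, fun c hc y => ?_⟩
  · have : x ∉ tubeCoord N α '' K := by
      rintro ⟨⟨s, u⟩, hp, rfl⟩
      exact hxn ⟨(s, u), ⟨(h.eq_or_mem_of_fst_mem hp.1 (hKU hp).2).2.2 hx.1, (hKU hp).2⟩, rfl⟩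
    filter_upwards [hKc.isClosed.isOpen_compl.mem_nhds this] with y hy
    exact hF0 y hy
  · by_cases hy : y ∈ Ioo (-a) a
    · rw [← h.tubeCoord_right, ← h.tubeCoord_zero, hFU _ ⟨trivial, hy⟩, hFU _ ⟨trivial, hy⟩]
      simp only [trialFn, hc, h.curvature_right]
      ring
    · have e0 : F (0, y) = 0 := hF0 _ (by
        rintro ⟨⟨s, u⟩, hp, he⟩
        have hs := (h.eq_or_mem_of_fst_mem hp.1 (hKU hp).2).1 (by rw [he])
        subst hs
        rw [h.tubeCoord_zero] at he
        exact hy ((Prod.mk.inj he).2 ▸ (hKU hp).2))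
      have e1 : F (k₁, k₂ + y) = 0 := hF0 _ (by
        rintro ⟨⟨s, u⟩, hp, he⟩
        have hs := (h.eq_or_mem_of_fst_mem hp.1 (hKU hp).2).2.1 (by rw [he])
        subst hs
        rw [h.tubeCoord_right] at he
        have := (Prod.mk.inj he).2
        exact hy (add_left_cancel this ▸ (hKU hp).2))
      rw [e0, e1, mul_zero]

lemma pullS_eq (h : IsTube N α γ γ' L k₁ k₂ a G) (hH : ContDiff ℝ 1 H) {F : ℝ × ℝ → ℂ}
    (hF : ContDiff ℝ 1 F)
    (hFU : ∀ p ∈ univ ×ˢ Ioo (-a) a, F (tubeCoord N α p) = trialFn γ ψ H p) (s : ℝ) {u : ℝ}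
    (hu : u ∈ Ioo (-a) a) :
    pullS N α γ F (s, u) = (((Real.sqrt (1 + u * γ s))⁻¹ * ψ u : ℝ) : ℂ) *
      (deriv H s - ((u * γ' s / (2 * (1 + u * γ s)) : ℝ) : ℂ) * H s) := by
  have h1 := h.hasDerivAt_pull_s hF s u
  simp only [fun s => hFU (s, u) ⟨trivial, hu⟩] at h1
  have hj : HasDerivAt (fun s => 1 + u * γ s) (u * γ' s) s :=
    ((h.hasDerivAt_curvature s).const_mul u).const_add 1
  have h2 := ((hasDerivAt_inv_sqrt hj (h.jacobian_pos (Ioo_subset_Icc_self hu) s)).mul_const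
    (ψ u)).ofReal_comp
  have h3 := h2.mul (hH.differentiable (by simp) s).hasDerivAt
  refine (h1.unique h3).trans ?_
  push_cast
  ring

lemma pullU_eq (h : IsTube N α γ γ' L k₁ k₂ a G) (hψ : ∀ u, HasDerivAt ψ (ψ' u) u)
    {F : ℝ × ℝ → ℂ} (hF : ContDiff ℝ 1 F)
    (hFU : ∀ p ∈ univ ×ˢ Ioo (-a) a, F (tubeCoord N α p) = trialFn γ ψ H p) (s : ℝ) {u : ℝ}
    (hu : u ∈ Ioo (-a) a) :
    pullU N α γ F (s, u) = (((Real.sqrt (1 + u * γ s))⁻¹ *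
      (ψ' u - γ s / (2 * (1 + u * γ s)) * ψ u) : ℝ) : ℂ) * H s := by
  have h1 := h.hasDerivAt_pull_u hF s u
  have hev : (fun u => F (tubeCoord N α (s, u))) =ᶠ[nhds u] fun u => trialFn γ ψ H (s, u) := by
    filter_upwards [isOpen_Ioo.mem_nhds hu] with v hv
    exact hFU _ ⟨trivial, hv⟩
  have h1' := h1.congr_of_eventuallyEq hev.symm
  have hj : HasDerivAt (fun u => 1 + u * γ s) (γ s) u := by
    simpa using ((hasDerivAt_id u).mul_const (γ s)).const_add 1
  have h2 := (((hasDerivAt_inv_sqrt hj (h.jacobian_pos (Ioo_subset_Icc_self hu) s)).mul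
    (hψ u)).ofReal_comp).mul_const (H s)
  refine (h1'.unique h2).trans ?_
  push_cast
  ring

end IsTube

lemma norm_sub_mul_sq_le {t ε : ℝ} (ht : t ≤ 1) (hε : |ε| ≤ t) (x y : ℂ) :
    ‖x - (ε : ℂ) * y‖ ^ 2 ≤ (1 + t) * ‖x‖ ^ 2 + 2 * t * ‖y‖ ^ 2 := by
  have ht0 : 0 ≤ t := (abs_nonneg _).trans hε
  have h1 : ‖x - (ε : ℂ) * y‖ ≤ ‖x‖ + t * ‖y‖ := by
    refine (norm_sub_le _ _).trans ?_
    rw [norm_mul, Complex.norm_real, Real.norm_eq_abs]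
    gcongr
  have h2 : ‖x - (ε : ℂ) * y‖ ^ 2 ≤ (‖x‖ + t * ‖y‖) ^ 2 := by gcongr
  refine h2.trans ?_
  have h3 : t ^ 2 * ‖y‖ ^ 2 ≤ t * ‖y‖ ^ 2 := by
    refine mul_le_mul_of_nonneg_right ?_ (sq_nonneg _)
    nlinarith
  nlinarith [mul_nonneg ht0 (sq_nonneg (‖x‖ - ‖y‖))]

/-- The longitudinal part of the energy of a trial function. -/
lemma trial_longitudinal_le {a G u γ γ' p : ℝ} (hG : 1 ≤ G) (haG : a * G ≤ 1 / 8) (hγ : |γ| ≤ G)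
    (hγ' : |γ'| ≤ G) (hu : |u| ≤ a) (x y : ℂ) :
    (1 + u * γ)⁻¹ * ‖(((Real.sqrt (1 + u * γ))⁻¹ * p : ℝ) : ℂ) *
      (x - ((u * γ' / (2 * (1 + u * γ)) : ℝ) : ℂ) * y)‖ ^ 2
      ≤ p ^ 2 * ((1 + 6 * G * |u|) * ‖x‖ ^ 2 + 3 * G * |u| * ‖y‖ ^ 2) := by
  set t := G * |u| with ht
  have ht0 : 0 ≤ t := by positivity
  have ht1 : t ≤ 1 / 8 := by nlinarith
  have hb : ∀ c, |c| ≤ G → |u * c| ≤ t := fun c hc => by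
    rw [abs_mul, ht, mul_comm G]; gcongr
  set j := 1 + u * γ with hj
  have hj1 : 1 - t ≤ j := by have := (abs_le.mp (hb γ hγ)).1; linarith
  have hj0 : 0 < j := by linarith
  have hε : |u * γ' / (2 * j)| ≤ t := by
    rw [abs_div, abs_of_pos (show 0 < 2 * j by linarith), div_le_iff₀ (by linarith)]
    have := hb γ' hγ'
    nlinarith
  have h1 := norm_sub_mul_sq_le (by linarith) hε x y
  have h2 : j⁻¹ ^ 2 ≤ 1 + 4 * t := by
    rw [inv_pow, inv_le_iff_one_le_mul₀ (by positivity)]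
    have h3 : (1 - t) ^ 2 ≤ j ^ 2 := by gcongr; linarith
    have h4 := mul_le_mul_of_nonneg_left h3 (by linarith : 0 ≤ 1 + 4 * t)
    have h5 := mul_nonneg ht0 (by nlinarith : 0 ≤ 2 - 7 * t + 4 * t ^ 2)
    nlinarith
  rw [norm_mul, Complex.norm_real, Real.norm_eq_abs, mul_pow, sq_abs, mul_pow, inv_pow,
    Real.sq_sqrt hj0.le]
  have e : j⁻¹ * (j⁻¹ * p ^ 2 * ‖x - ((u * γ' / (2 * j) : ℝ) : ℂ) * y‖ ^ 2)
      = p ^ 2 * (j⁻¹ ^ 2 * ‖x - ((u * γ' / (2 * j) : ℝ) : ℂ) * y‖ ^ 2) := by ring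
  rw [e]
  refine mul_le_mul_of_nonneg_left ?_ (sq_nonneg _)
  refine (mul_le_mul h2 h1 (sq_nonneg _) (by linarith)).trans ?_
  have q1 := mul_nonneg (mul_nonneg ht0 (by linarith : 0 ≤ 1 / 8 - t)) (sq_nonneg ‖x‖)
  have q2 := mul_nonneg (mul_nonneg ht0 (by linarith : 0 ≤ 1 / 8 - t)) (sq_nonneg ‖y‖)
  have q3 := mul_nonneg ht0 (sq_nonneg ‖x‖)
  rw [mul_assoc 6 G, mul_assoc 3 G, ← ht]
  nlinarith

/-- The transverse part of the energy of a trial function, up to a total derivative. -/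
lemma trial_transverse_le {a G u γ p p' : ℝ} (hG : 1 ≤ G) (haG : a * G ≤ 1 / 8) (hγ : |γ| ≤ G)
    (hu : |u| ≤ a) (y : ℂ) :
    (1 + u * γ) * ‖(((Real.sqrt (1 + u * γ))⁻¹ * (p' - γ / (2 * (1 + u * γ)) * p) : ℝ) : ℂ) * y‖ ^ 2
      ≤ ‖y‖ ^ 2 * (p' ^ 2 - γ ^ 2 / 4 * p ^ 2 + G ^ 3 * |u| * p ^ 2
        - 1 / 2 * (-(γ ^ 2 / (1 + u * γ) ^ 2) * p ^ 2 + γ / (1 + u * γ) * (2 * p * p'))) := by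
  set j := 1 + u * γ with hj
  have hb : |u * γ| ≤ 1 / 8 := by
    rw [abs_mul]
    exact (mul_le_mul hu hγ (abs_nonneg _) ((abs_nonneg _).trans hu)).trans haG
  have hj0 : 0 < j := by have := (abs_le.mp hb).1; linarith
  rw [norm_mul, Complex.norm_real, Real.norm_eq_abs, mul_pow, sq_abs, mul_pow, inv_pow,
    Real.sq_sqrt hj0.le]
  -- Expansion of the square; the bracket with the factor `1/2` is the `u`-derivative of `γ / (1 +
  -- uγ) ψ²` and will integrate to zero.
  have e : j * (j⁻¹ * (p' - γ / (2 * j) * p) ^ 2 * ‖y‖ ^ 2)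
      = ‖y‖ ^ 2 * (p' ^ 2 - γ ^ 2 / j ^ 2 / 4 * p ^ 2
        - 1 / 2 * (-(γ ^ 2 / j ^ 2) * p ^ 2 + γ / j * (2 * p * p'))) := by
    field_simp
    ring
  rw [e]
  refine mul_le_mul_of_nonneg_left ?_ (sq_nonneg _)
  have h1 : 1 - 2 * (G * |u|) ≤ (j ^ 2)⁻¹ := by
    rw [← one_div, le_div_iff₀ (by positivity)]
    have h2 : |u * γ| ≤ G * |u| := by rw [abs_mul, mul_comm G]; gcongr
    have h3 := abs_le.mp h2
    have h4 := abs_le.mp hb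
    have h5 : 1 - 2 * (G * |u|) ≤ 1 - 2 * (u * γ) := by linarith
    have h6 : (1 - 2 * (u * γ)) * j ^ 2 ≤ 1 := by
      rw [hj]; nlinarith [sq_nonneg (u * γ), mul_nonneg (sq_nonneg (u * γ)) (by linarith : 0 ≤ 1 + u * γ)]
    exact (mul_le_mul_of_nonneg_right h5 (sq_nonneg _)).trans h6
  have h7 : γ ^ 2 ≤ G ^ 2 := sq_le_sq' (abs_le.mp hγ).1 (abs_le.mp hγ).2
  have h8 : γ ^ 2 / 4 * p ^ 2 - G ^ 3 * |u| * p ^ 2 ≤ γ ^ 2 / j ^ 2 / 4 * p ^ 2 := by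
    rw [div_eq_mul_inv (γ ^ 2) (j ^ 2), ← sub_mul]
    refine mul_le_mul_of_nonneg_right ?_ (sq_nonneg _)
    have h9 := mul_le_mul_of_nonneg_left h1 (sq_nonneg γ)
    have h10 := mul_le_mul_of_nonneg_right h7 (show 0 ≤ G * |u| by positivity)
    have h11 : 0 ≤ G ^ 2 * (G * |u|) := by positivity
    have h12 : G ^ 3 * |u| = G ^ 2 * (G * |u|) := by ring
    rw [h12]
    linarith
  linarith

end StrongDelta

end

/-! ### Energy and norm of the trial functions. -/

noncomputable section

namespace StrongDelta

namespace IsTube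

variable {N : ℝ → ℝ × ℝ} {α γ γ' : ℝ → ℝ} {L k₁ k₂ a G κ C : ℝ} {ψ ψ' : ℝ → ℝ} {H : ℝ → ℂ}
  {F : ℝ × ℝ → ℂ}

/-- The energy of a trial function on a fiber. -/
lemma trial_fiber_energy_le (h : IsTube N α γ γ' L k₁ k₂ a G) (hψ : IsTrial a κ C ψ ψ')
    (hH : ContDiff ℝ 1 H) (hF : ContDiff ℝ 1 F)
    (hFU : ∀ p ∈ univ ×ˢ Ioo (-a) a, F (tubeCoord N α p) = trialFn γ ψ H p) (s : ℝ) :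
    ∫ u in -a..a, (1 + u * γ s) * (‖fderiv ℝ F (tubeCoord N α (s, u)) (1, 0)‖ ^ 2
        + ‖fderiv ℝ F (tubeCoord N α (s, u)) (0, 1)‖ ^ 2)
      ≤ ((∫ u in -a..a, ψ u ^ 2) + 6 * G * ∫ u in -a..a, |u| * ψ u ^ 2) * ‖deriv H s‖ ^ 2
        + ((∫ u in -a..a, ψ' u ^ 2) - γ s ^ 2 / 4 * (∫ u in -a..a, ψ u ^ 2)
          + 4 * G ^ 3 * ∫ u in -a..a, |u| * ψ u ^ 2) * ‖H s‖ ^ 2 := by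
  have ha := h.a_pos
  have hG := h.one_le
  have hc : Continuous ψ := continuous_iff_continuousAt.mpr fun u => (hψ.hasDerivAt u).continuousAt
  set A := ‖deriv H s‖ ^ 2 with hA
  set B := ‖H s‖ ^ 2 with hB
  set w' : ℝ → ℝ := fun u => -(γ s ^ 2 / (1 + u * γ s) ^ 2) * ψ u ^ 2
    + γ s / (1 + u * γ s) * (2 * ψ u * ψ' u) with hw'
  have hj : ∀ u ∈ Icc (-a) a, 1 + u * γ s ≠ 0 := fun u hu => (h.jacobian_pos hu s).ne'
  have cj : Continuous fun u : ℝ => 1 + u * γ s := by fun_prop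
  have hw'c : ContinuousOn w' (Icc (-a) a) :=
    ((continuousOn_const.div (cj.pow 2).continuousOn fun u hu => pow_ne_zero 2 (hj u hu)).neg.mul
      (hc.pow 2).continuousOn).add ((continuousOn_const.div cj.continuousOn hj).mul
        ((continuous_const.mul hc).mul hψ.continuous_deriv).continuousOn)
  have hle : -a ≤ a := by linarith
  have iw : IntervalIntegrable w' volume (-a) a := hw'c.intervalIntegrable_of_Icc hle
  -- The total derivative integrates to zero because `ψ` vanishes at `±a`; no boundary terms appear,
  -- in contrast to the lower bound.
  have hw0 : ∫ u in -a..a, w' u = 0 := by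
    rw [intervalIntegral.integral_eq_sub_of_hasDerivAt
      (f := fun u => γ s / (1 + u * γ s) * ψ u ^ 2) (fun u hu => ?_) iw]
    · rw [hψ.eq_zero a (by rw [abs_of_pos ha]; linarith),
        hψ.eq_zero (-a) (by rw [abs_neg, abs_of_pos ha]; linarith)]
      simp
    · rw [uIcc_of_le hle] at hu
      have e1 : HasDerivAt (fun u => 1 + u * γ s) (γ s) u := by
        simpa using ((hasDerivAt_id u).mul_const (γ s)).const_add 1
      refine (((hasDerivAt_const u (γ s)).fun_div e1 (hj u hu)).mul
        ((hψ.hasDerivAt u).fun_pow 2)).congr_deriv ?_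
      simp only [hw']
      push_cast
      ring
  have i0 : IntervalIntegrable (fun u => ψ u ^ 2) volume (-a) a := (hc.pow 2).intervalIntegrable _ _
  have i1 : IntervalIntegrable (fun u => |u| * ψ u ^ 2) volume (-a) a :=
    (continuous_abs.mul (hc.pow 2)).intervalIntegrable _ _
  have i2 : IntervalIntegrable (fun u => ψ' u ^ 2) volume (-a) a :=
    (hψ.continuous_deriv.pow 2).intervalIntegrable _ _
  have j0 := i0.const_mul (A - γ s ^ 2 / 4 * B)
  have j1 := i1.const_mul (6 * G * A + 3 * G * B + G ^ 3 * B)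
  have j2 := i2.const_mul B
  have jw := iw.const_mul (B / 2)
  have hmono := intervalIntegral.integral_mono_on_of_le_Ioo hle
    (f := fun u => (1 + u * γ s) * (‖fderiv ℝ F (tubeCoord N α (s, u)) (1, 0)‖ ^ 2
        + ‖fderiv ℝ F (tubeCoord N α (s, u)) (0, 1)‖ ^ 2))
    (g := fun u => (A - γ s ^ 2 / 4 * B) * ψ u ^ 2
      + (6 * G * A + 3 * G * B + G ^ 3 * B) * (|u| * ψ u ^ 2) + B * ψ' u ^ 2 - B / 2 * w' u)
    (by
      have c1 : Continuous fun x => fderiv ℝ F x (1, 0) :=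
        (hF.continuous_fderiv (by simp)).clm_apply continuous_const
      have c2 : Continuous fun x => fderiv ℝ F x (0, 1) :=
        (hF.continuous_fderiv (by simp)).clm_apply continuous_const
      exact ((h.continuous_jacobian_mul ((c1.norm.pow 2).add (c2.norm.pow 2))).comp
        (by fun_prop : Continuous fun u : ℝ => (s, u))).intervalIntegrable _ _)
    (((j0.add j1).add j2).sub jw) (fun u hu => by
      have hu' := Ioo_subset_Icc_self hu
      have hau : |u| ≤ a := abs_le.mpr hu'
      have e := h.jacobian_mul_norm_grad (φ := F) (p := (s, u)) hu'
      simp only at e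
      rw [e, h.pullS_eq hH hF hFU s hu, h.pullU_eq hψ.hasDerivAt hF hFU s hu]
      have l1 := trial_longitudinal_le (p := ψ u) hG h.small (h.curvature_le s) (h.deriv_le s) hau
        (deriv H s) (H s)
      have l2 := trial_transverse_le (p := ψ u) (p' := ψ' u) hG h.small (h.curvature_le s) hau (H s)
      refine (add_le_add l1 l2).trans (le_of_eq ?_)
      simp only [hw']
      ring)
  rw [intervalIntegral.integral_sub ((j0.add j1).add j2) jw,
    intervalIntegral.integral_add (j0.add j1) j2, intervalIntegral.integral_add j0 j1,
    intervalIntegral.integral_const_mul, intervalIntegral.integral_const_mul,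
    intervalIntegral.integral_const_mul, intervalIntegral.integral_const_mul, hw0] at hmono
  refine hmono.trans ?_
  have hm0 : 0 ≤ ∫ u in -a..a, |u| * ψ u ^ 2 :=
    intervalIntegral.integral_nonneg hle fun u _ => by positivity
  have hG3 : G ≤ G ^ 3 := le_self_pow₀ hG (by norm_num)
  have hB0 : 0 ≤ B := sq_nonneg _
  have := mul_nonneg (mul_nonneg (sub_nonneg.mpr hG3) hB0) hm0
  linarith

/-- The factor `(1 + uγ)^{-1/2}` cancels the Jacobian, so the norm of a trial function is exactly
the product of the two norms. -/
lemma trial_fiber_norm (h : IsTube N α γ γ' L k₁ k₂ a G)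
    (hFU : ∀ p ∈ univ ×ˢ Ioo (-a) a, F (tubeCoord N α p) = trialFn γ ψ H p) (s : ℝ) :
    ∫ u in -a..a, (1 + u * γ s) * ‖F (tubeCoord N α (s, u))‖ ^ 2
      = (∫ u in -a..a, ψ u ^ 2) * ‖H s‖ ^ 2 := by
  have ha := h.a_pos
  rw [← intervalIntegral.integral_mul_const]
  refine intervalIntegral.integral_congr_Ioo_of_le (by linarith) fun u hu => ?_
  have hj := h.jacobian_pos (Ioo_subset_Icc_self hu) s
  rw [hFU _ ⟨trivial, hu⟩, trialFn, norm_mul, Complex.norm_real, Real.norm_eq_abs, mul_pow, sq_abs,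
    mul_pow, inv_pow, Real.sq_sqrt hj.le]
  field_simp

/-- Integrals over the strip of a function that vanishes outside of the tube. -/
lemma setIntegral_strip_eq (h : IsTube N α γ γ' L k₁ k₂ a G) {g : ℝ × ℝ → ℝ} (hg : Continuous g)
    (h0 : ∀ x ∈ strip k₁, x ∉ tubeCoord N α '' (Ioo 0 L ×ˢ Ioo (-a) a) → g x = 0) :
    ∫ x in strip k₁, g x
      = ∫ s in Ioo 0 L, ∫ u in -a..a, (1 + u * γ s) * g (tubeCoord N α (s, u)) := by
  rw [← h.setIntegral_tube hg]
  exact setIntegral_eq_of_subset_of_forall_sdiff_eq_zero (isOpen_strip k₁).measurableSet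
    h.image_tube_subset fun x hx => h0 x hx.1 hx.2

lemma trial_energy_le (h : IsTube N α γ γ' L k₁ k₂ a G) (hψ : IsTrial a κ C ψ ψ')
    (hH : ContDiff ℝ 1 H) (hF : ContDiff ℝ 1 F) (hFc : HasCompactSupport F)
    (hFU : ∀ p ∈ univ ×ˢ Ioo (-a) a, F (tubeCoord N α p) = trialFn γ ψ H p)
    (hF0 : ∀ x ∈ strip k₁, x ∉ tubeCoord N α '' (Ioo 0 L ×ˢ Ioo (-a) a) → F =ᶠ[nhds x] 0) :
    (∫ x in strip k₁, ‖fderiv ℝ F x (1, 0)‖ ^ 2) + (∫ x in strip k₁, ‖fderiv ℝ F x (0, 1)‖ ^ 2)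
      ≤ ((∫ u in -a..a, ψ u ^ 2) + 6 * G * ∫ u in -a..a, |u| * ψ u ^ 2) *
          (∫ s in Ioo 0 L, ‖deriv H s‖ ^ 2)
        + ((∫ u in -a..a, ψ' u ^ 2) + 4 * G ^ 3 * ∫ u in -a..a, |u| * ψ u ^ 2) *
          (∫ s in Ioo 0 L, ‖H s‖ ^ 2)
        - (∫ u in -a..a, ψ u ^ 2) * ∫ s in Ioo 0 L, ‖((γ s / 2 : ℝ) : ℂ) * H s‖ ^ 2 := by
  have c1 : Continuous fun x => fderiv ℝ F x (1, 0) :=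
    (hF.continuous_fderiv (by simp)).clm_apply continuous_const
  have c2 : Continuous fun x => fderiv ℝ F x (0, 1) :=
    (hF.continuous_fderiv (by simp)).clm_apply continuous_const
  have cg : Continuous fun x => ‖fderiv ℝ F x (1, 0)‖ ^ 2 + ‖fderiv ℝ F x (0, 1)‖ ^ 2 :=
    (c1.norm.pow 2).add (c2.norm.pow 2)
  rw [← integral_add (integrable_norm_sq_of_hasCompactSupport c1
    (hFc.fderiv_apply ℝ (1, 0))).restrict (integrable_norm_sq_of_hasCompactSupport c2
    (hFc.fderiv_apply ℝ (0, 1))).restrict, h.setIntegral_strip_eq cg fun x hx hxn => by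
      rw [(hF0 x hx hxn).fderiv_eq]; simp]
  have i0 : Integrable (fun s => ∫ u in -a..a, (1 + u * γ s) *
      (‖fderiv ℝ F (tubeCoord N α (s, u)) (1, 0)‖ ^ 2
        + ‖fderiv ℝ F (tubeCoord N α (s, u)) (0, 1)‖ ^ 2)) (volume.restrict (Ioo 0 L)) :=
    integrableOn_of_continuous (continuous_integral_param_real (a := a)
      (h.continuous_jacobian_mul cg)) L
  have i1 : Integrable (fun s => ‖deriv H s‖ ^ 2) (volume.restrict (Ioo 0 L)) :=
    integrableOn_of_continuous ((hH.continuous_deriv (by simp)).norm.pow 2) L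
  have i2 : Integrable (fun s => ‖H s‖ ^ 2) (volume.restrict (Ioo 0 L)) :=
    integrableOn_of_continuous (hH.continuous.norm.pow 2) L
  have i3 : Integrable (fun s => ‖((γ s / 2 : ℝ) : ℂ) * H s‖ ^ 2) (volume.restrict (Ioo 0 L)) :=
    integrableOn_of_continuous (((Complex.continuous_ofReal.comp
      (h.continuous_curvature.div_const 2)).mul hH.continuous).norm.pow 2) L
  have hmono := integral_mono i0 (((i1.const_mul ((∫ u in -a..a, ψ u ^ 2)
    + 6 * G * ∫ u in -a..a, |u| * ψ u ^ 2)).add (i2.const_mul ((∫ u in -a..a, ψ' u ^ 2)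
      + 4 * G ^ 3 * ∫ u in -a..a, |u| * ψ u ^ 2))).sub (i3.const_mul (∫ u in -a..a, ψ u ^ 2)))
    (fun s => by
      refine (h.trial_fiber_energy_le hψ hH hF hFU s).trans (le_of_eq ?_)
      simp only [Pi.add_apply, Pi.sub_apply]
      rw [norm_mul, Complex.norm_real, mul_pow, Real.norm_eq_abs, sq_abs]
      ring)
  refine hmono.trans (le_of_eq ?_)
  rw [integral_sub' ((i1.const_mul _).add (i2.const_mul _)) (i3.const_mul _),
    integral_add' (i1.const_mul _) (i2.const_mul _), integral_const_mul, integral_const_mul,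
    integral_const_mul]

variable {w : C(ℝ, ℝ)} {θ : ℝ}

/-- The trial element of the form domain given by a regular element of the form domain of the
comparison operator. -/
lemma exists_trial_element (h : IsTube N α γ γ' L k₁ k₂ a G) (hψ : IsTrial a κ C ψ ψ')
    (hw : ∀ t, w t = γ t / 2) {x : ComparisonDomain L θ}
    (hx : x ∈ regularElements L θ) :
    ∃ (z : FiberDomain N L k₁ k₂ θ) (F : ℝ × ℝ → ℂ),
      fiberEmbedding N L k₁ k₂ θ z =ᵐ[volume.restrict (strip k₁)] F ∧
      (∀ p ∈ Ioo 0 L ×ˢ Ioo (-a) a, F (tubeCoord N α p)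
        = trialFn γ ψ (fun s => evalAt L s (SubHilbert.incl _ x)) p) ∧
      (∀ q ∈ strip k₁, q ∉ tubeCoord N α '' (Ioo 0 L ×ˢ Ioo (-a) a) → F q = 0) ∧
      ‖fiberEmbedding N L k₁ k₂ θ z‖ ^ 2
        = (∫ u in -a..a, ψ u ^ 2) * ‖comparisonEmbedding h.L_pos.le θ x‖ ^ 2 ∧
      ‖(fiberData N L k₁ k₂ θ z).1.2.1‖ ^ 2 + ‖(fiberData N L k₁ k₂ θ z).1.2.2‖ ^ 2
          - 2 * κ * ‖(fiberData N L k₁ k₂ θ z).2‖ ^ 2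
        ≤ (∫ u in -a..a, ψ u ^ 2) * ((⟪x, comparisonForm h.L_pos.le w θ x⟫_ℂ).re
          + (-κ ^ 2 + C / κ) * ‖comparisonEmbedding h.L_pos.le θ x‖ ^ 2
          + C / κ * (6 * G * ‖(SubHilbert.incl _ x).snd‖ ^ 2
            + 4 * G ^ 3 * ‖comparisonEmbedding h.L_pos.le θ x‖ ^ 2)) := by
  have hL := h.L_pos
  have hG := h.one_le
  obtain ⟨f₁, hf₁, hxf⟩ := hx
  set y := SubHilbert.incl _ x with hy
  obtain ⟨H, hH, hHe, hHd, hH0⟩ := exists_contDiff_extension hL y hf₁ hxf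
  have hψ1 : ContDiff ℝ 1 ψ := contDiff_one_iff_deriv.mpr
    ⟨fun t => (hψ.hasDerivAt t).differentiableAt, by
      rw [funext fun t => (hψ.hasDerivAt t).deriv]; exact hψ.continuous_deriv⟩
  obtain ⟨F, hF, hFc, hFU, hF0, hFb⟩ := h.exists_trial_function hψ1 hψ.eq_zero hH hH0
  have hbc : H L = Complex.exp (Complex.I * θ) * H 0 := by
    rw [hHe L (right_mem_Icc.mpr hL.le), hHe 0 (left_mem_Icc.mpr hL.le), evalAt_zero hL.le]
    exact mem_quasiPeriodic.mp (SubHilbert.incl_mem x)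
  set t : L2P (Ioo 0 L) := (memLp_comp_curve h.continuous_curve hF.continuous L).toLp _ with ht
  have htF : t =ᵐ[volume.restrict (Ioo 0 L)] fun s => F (N s) := MemLp.coeFn_toLp _
  have hT := mem_traceGraph_curve (L := L) (strip k₁) hF hFc h.continuous_curve htF
  have hline : ∀ c d : ℝ, MemLp (fun y => F (c, d + y)) 2 (volume.restrict univ) := by
    intro c d
    have hcl : Topology.IsClosedEmbedding fun y : ℝ => (c, d + y) :=
      Topology.IsClosedEmbedding.of_continuous_injective_isClosedMap (by fun_prop)
        (fun y y' e => add_left_cancel (Prod.mk.inj e).2) (by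
          intro S hS
          have : (fun y : ℝ => (c, d + y)) '' S = {c} ×ˢ ((fun y => d + y) '' S) := by
            rw [singleton_prod, image_image]
          rw [this]
          exact isClosed_singleton.prod ((Homeomorph.addLeft d).isClosedMap S hS))
    exact (hF.continuous.comp (by fun_prop)).memLp_of_hasCompactSupport
      (hFc.comp_isClosedEmbedding hcl)
  set g : L2P univ := (hline 0 0).toLp _ with hg
  have hgF : g =ᵐ[volume.restrict univ] fun y => F (0, 0 + y) := MemLp.coeFn_toLp _
  have hleft := mem_traceGraph_vertical (strip k₁) hF hFc 0 0 hgF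
  simp only [zero_add] at hleft
  have hright := mem_traceGraph_vertical (strip k₁) hF hFc k₁ k₂
    (t := Complex.exp (Complex.I * θ) • g) (by
      filter_upwards [Lp.coeFn_smul (Complex.exp (Complex.I * θ)) g, hgF] with y h1 h2
      rw [h1, Pi.smul_apply, h2, hFb _ hbc, zero_add, smul_eq_mul])
  have hmem : (gradData (strip k₁) hF hFc, t) ∈ formDomain N L k₁ k₂ θ :=
    ⟨fst_mem_H1_of_mem_traceGraph hT, hT, g, hleft, hright⟩
  have hval : ∀ s ∈ Ioo 0 L, H s = evalAt L s y := fun s hs => hHe s (Ioo_subset_Icc_self hs)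
  have nH : ∫ s in Ioo 0 L, ‖H s‖ ^ 2 = ‖comparisonEmbedding hL.le θ x‖ ^ 2 := by
    rw [comparisonEmbedding_apply, norm_sq_congr (coeFn_weightedEmbedding hL.le 1 _)]
    refine setIntegral_congr_fun measurableSet_Ioo fun s hs => ?_
    simp only [ContinuousMap.one_apply, Complex.ofReal_one, one_mul]
    rw [hval s hs]
  have nW : ∫ s in Ioo 0 L, ‖((γ s / 2 : ℝ) : ℂ) * H s‖ ^ 2 = ‖weightedEmbedding hL.le w y‖ ^ 2 := by
    rw [norm_sq_congr (coeFn_weightedEmbedding hL.le w y)]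
    refine setIntegral_congr_fun measurableSet_Ioo fun s hs => ?_
    simp only [hw, hval s hs]
  have nD : ∫ s in Ioo 0 L, ‖deriv H s‖ ^ 2 = ‖y.snd‖ ^ 2 := by
    rw [norm_sq_congr hxf]
    refine setIntegral_congr_fun measurableSet_Ioo fun s hs => ?_
    simp only [hHd s hs]
  refine ⟨ofData _ hmem, F, coeFn_gradData_fst (strip k₁) hF hFc, fun p hp => ?_,
    fun q hq hqn => (hF0 q hq hqn).eq_of_nhds, ?_, ?_⟩
  · rw [hFU p ⟨trivial, hp.2⟩, trialFn, trialFn, hval p.1 hp.1]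
  · rw [fiberEmbedding_apply, fiberData_ofData,
      norm_sq_congr (coeFn_gradData_fst (strip k₁) hF hFc),
      h.setIntegral_strip_eq (g := fun q => ‖F q‖ ^ 2) (hF.continuous.norm.pow 2)
      fun q hq hqn => by
        simp [(hF0 q hq hqn).eq_of_nhds]]
    simp only [h.trial_fiber_norm hFU]
    rw [integral_const_mul, nH]
  · have nt : ‖t‖ ^ 2 = ψ 0 ^ 2 * ‖comparisonEmbedding hL.le θ x‖ ^ 2 := by
      rw [norm_sq_congr htF, ← nH, ← integral_const_mul]
      refine setIntegral_congr_fun measurableSet_Ioo fun s hs => ?_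
      have ha := h.a_pos
      rw [← tubeCoord_curve (N := N) (α := α) s, hFU (s, 0) ⟨trivial, by constructor <;> simp [ha]⟩,
        trialFn]
      simp [mul_pow]
    rw [fiberData_ofData, norm_sq_congr (coeFn_gradData_dx (strip k₁) hF hFc),
      norm_sq_congr (coeFn_gradData_dy (strip k₁) hF hFc), re_inner_comparisonForm, ← hy]
    have key := h.trial_energy_le hψ hH hF hFc hFU hF0
    rw [nH, nW, nD] at key
    simp only [nt]
    have m1 := mul_le_mul_of_nonneg_right hψ.moment (show 0 ≤ 6 * G * ‖y.snd‖ ^ 2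
      + 4 * G ^ 3 * ‖comparisonEmbedding hL.le θ x‖ ^ 2 by positivity)
    have m2 := mul_le_mul_of_nonneg_right hψ.energy
      (sq_nonneg ‖comparisonEmbedding hL.le θ x‖)
    linarith

end IsTube

end StrongDelta

end

/-! ### Trial spaces for the fiber operator. -/

noncomputable section

namespace StrongDelta

/-- `z` is the trial function on the strip with longitudinal part `y` and transverse part `ψ`. -/
def IsTrialElement (N : ℝ → ℝ × ℝ) (α γ ψ : ℝ → ℝ) {L : ℝ} {k₁ : ℝ} (a : ℝ) (z : L2 (strip k₁))
    (y : H1Interval L) : Prop :=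
  ∃ F : ℝ × ℝ → ℂ, z =ᵐ[volume.restrict (strip k₁)] F ∧
    (∀ p ∈ Ioo 0 L ×ˢ Ioo (-a) a, F (tubeCoord N α p) = trialFn γ ψ (fun s => evalAt L s y) p) ∧
    ∀ q ∈ strip k₁, q ∉ tubeCoord N α '' (Ioo 0 L ×ˢ Ioo (-a) a) → F q = 0

namespace IsTrialElement

variable {N : ℝ → ℝ × ℝ} {α γ ψ : ℝ → ℝ} {L k₁ a : ℝ} {z z' : L2 (strip k₁)} {y y' : H1Interval L}

lemma add (h : IsTrialElement N α γ ψ a z y) (h' : IsTrialElement N α γ ψ a z' y') :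
    IsTrialElement N α γ ψ a (z + z') (y + y') := by
  obtain ⟨F, h1, h2, h3⟩ := h
  obtain ⟨F', h1', h2', h3'⟩ := h'
  refine ⟨F + F', (Lp.coeFn_add z z').trans (h1.add h1'), fun p hp => ?_, fun q hq hqn => ?_⟩
  · rw [Pi.add_apply, h2 p hp, h2' p hp]
    simp only [trialFn, map_add]
    ring
  · rw [Pi.add_apply, h3 q hq hqn, h3' q hq hqn, add_zero]

lemma smul (h : IsTrialElement N α γ ψ a z y) (c : ℂ) :
    IsTrialElement N α γ ψ a (c • z) (c • y) := by
  obtain ⟨F, h1, h2, h3⟩ := h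
  refine ⟨c • F, (Lp.coeFn_smul c z).trans (h1.const_smul c), fun p hp => ?_, fun q hq hqn => ?_⟩
  · rw [Pi.smul_apply, h2 p hp]
    simp only [trialFn, map_smul, smul_eq_mul]
    ring
  · rw [Pi.smul_apply, h3 q hq hqn, smul_zero]

/-- Trial elements are obtained by choice; as each is determined by its longitudinal part, the
chosen map is linear. -/
lemma unique (h : IsTrialElement N α γ ψ a z y) (h' : IsTrialElement N α γ ψ a z' y) : z = z' := by
  obtain ⟨F, h1, h2, h3⟩ := h
  obtain ⟨F', h1', h2', h3'⟩ := h'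
  refine Lp.ext ?_
  filter_upwards [h1, h1', ae_restrict_mem (isOpen_strip k₁).measurableSet] with q e e' hq
  rw [e, e']
  by_cases hqt : q ∈ tubeCoord N α '' (Ioo 0 L ×ˢ Ioo (-a) a)
  · obtain ⟨p, hp, rfl⟩ := hqt
    rw [h2 p hp, h2' p hp]
  · rw [h3 q hq hqt, h3' q hq hqt]

end IsTrialElement

namespace IsTube

variable {N : ℝ → ℝ × ℝ} {α γ γ' : ℝ → ℝ} {L k₁ k₂ a G : ℝ}

/-- Spaces of regular elements yield trial spaces for the fiber operator. -/
lemma exists_trialSpace (h : IsTube N α γ γ' L k₁ k₂ a G) (B : ℝ) :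
    ∃ C ≥ 0, ∃ β₀ ≥ 1, ∀ β ≥ β₀, ∀ θ, ∀ A : FiberDomain N L k₁ k₂ θ →L[ℂ] FiberDomain N L k₁ k₂ θ,
      (∀ x y, ⟪x, A y⟫_ℂ
        = deltaForm β (fiberData N L k₁ k₂ θ x) (fiberData N L k₁ k₂ θ y)) →
      ∀ w : C(ℝ, ℝ), (∀ t, w t = γ t / 2) → ∀ μ : ℝ, |μ| ≤ B →
      ∀ E : Submodule ℂ (ComparisonDomain L θ), FiniteDimensional ℂ E → E ≤ regularElements L θ →
        (∀ x ∈ E, (⟪x, comparisonForm h.L_pos.le w θ x⟫_ℂ).re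
          ≤ μ * ‖comparisonEmbedding h.L_pos.le θ x‖ ^ 2) →
        ∃ E' : Submodule ℂ (FiberDomain N L k₁ k₂ θ), FiniteDimensional ℂ E' ∧
          Module.finrank ℂ E' = Module.finrank ℂ E ∧
          ∀ x ∈ E', (⟪x, A x⟫_ℂ).re
            ≤ (-(1 / 4) * β ^ 2 + μ + C / β) * ‖fiberEmbedding N L k₁ k₂ θ x‖ ^ 2 := by
  have hG := h.one_le
  have hL := h.L_pos
  obtain ⟨C, hC, κ₀, hκ₀, hκ⟩ := exists_isTrial h.a_pos
  refine ⟨2 * C * (1 + 6 * G * (|B| + (G / 2) ^ 2) + 4 * G ^ 3), by positivity, 2 * κ₀, by linarith,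
    fun β hβ θ A hA w hw μ hμ E hE hreg hform => ?_⟩
  have hβ0 : 0 < β := by linarith
  -- The coupling is `2κ = β` and the transverse energy is `-κ² = -β²/4`.
  obtain ⟨ψ, ψ', hψ⟩ := hκ (β / 2) (by linarith)
  have hinj := (h.exists_isClosedForm hβ0.le hA).injective
  choose! z hz using fun x (hx : x ∈ E) => h.exists_trial_element hψ hw (hreg hx)
  have htr : ∀ x ∈ E, IsTrialElement N α γ ψ a (fiberEmbedding N L k₁ k₂ θ (z x))
      (SubHilbert.incl _ x) := fun x hx => by
    obtain ⟨F, h1, h2, h3, -⟩ := hz x hx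
    exact ⟨F, h1, h2, h3⟩
  set T : E →ₗ[ℂ] FiberDomain N L k₁ k₂ θ :=
    { toFun := fun x => z x
      map_add' := fun x y => hinj (by
        rw [map_add]
        refine (htr _ (x + y).2).unique ?_
        rw [Submodule.coe_add, map_add]
        exact (htr x x.2).add (htr y y.2))
      map_smul' := fun c x => hinj (by
        rw [RingHom.id_apply, map_smul]
        refine (htr _ (c • x).2).unique ?_
        rw [Submodule.coe_smul, map_smul]
        exact (htr x x.2).smul c) } with hT
  have hTinj : Function.Injective T := by
    rw [injective_iff_map_eq_zero]
    intro x hx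
    obtain ⟨F, -, -, -, h4, -⟩ := hz x x.2
    have hzx : z x = 0 := hx
    rw [hzx, map_zero, norm_zero, zero_pow two_ne_zero, eq_comm, mul_eq_zero] at h4
    have h5 := h4.resolve_left hψ.norm_pos.ne'
    have h6 : comparisonEmbedding hL.le θ x = 0 := by simpa using h5
    rw [comparisonEmbedding_apply, ← map_zero (weightedEmbedding hL.le 1)] at h6
    have h7 := weightedEmbedding_one_injective hL h6
    exact Subtype.ext (SubHilbert.incl_injective _ (h7.trans (map_zero _).symm))
  refine ⟨LinearMap.range T, inferInstance, LinearMap.finrank_range_of_inj hTinj, ?_⟩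
  rintro _ ⟨x, rfl⟩
  obtain ⟨F, -, -, -, h4, h5⟩ := hz x x.2
  have hTx : T x = z x := rfl
  rw [hTx, hA, re_deltaForm_self, h4]
  have e2 : 2 * (β / 2) = β := by ring
  rw [e2] at h5
  refine h5.trans ?_
  have hf := hform x x.2
  set X := ‖comparisonEmbedding hL.le θ x‖ ^ 2 with hX
  have hX0 : 0 ≤ X := sq_nonneg _
  -- The bound on the form over `E` also bounds the derivative, so the error term with `‖x'‖²` is
  -- `O(1/β)` relative to the norm.
  have hsnd : ‖(SubHilbert.incl _ (x : ComparisonDomain L θ)).snd‖ ^ 2 ≤ (|B| + (G / 2) ^ 2) * X := by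
    have h6 := norm_sq_weightedEmbedding_le hL.le (h.abs_half_curvature_le hw)
      (SubHilbert.incl _ (x : ComparisonDomain L θ))
    have h7 := hf
    rw [re_inner_comparisonForm] at h7
    have h8 : μ * X ≤ |B| * X := by
      gcongr
      exact (le_abs_self μ).trans (hμ.trans (le_abs_self B))
    rw [← comparisonEmbedding_apply, ← hX] at h6
    linarith
  have e1 : (-(1 / 4) * β ^ 2 + μ + 2 * C * (1 + 6 * G * (|B| + (G / 2) ^ 2) + 4 * G ^ 3) / β) *
      ((∫ u in -a..a, ψ u ^ 2) * X) = (∫ u in -a..a, ψ u ^ 2) * (μ * X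
        + (-(β / 2) ^ 2 + C / (β / 2)) * X
        + C / (β / 2) * (6 * G * ((|B| + (G / 2) ^ 2) * X) + 4 * G ^ 3 * X)) := by
    field_simp
    ring
  rw [e1]
  refine mul_le_mul_of_nonneg_left ?_ hψ.norm_pos.le
  have hc : 0 ≤ C / (β / 2) := by positivity
  gcongr

end IsTube

end StrongDelta

end

/-! ### Comparison of the eigenvalues. -/

noncomputable section

namespace StrongDelta

/-- `mu` is the `n`th eigenvalue of the comparison operator, together with its variational
description from above and from below. -/
structure IsComparisonEigenvalue {L : ℝ} (hL : 0 < L) (γ : ℝ → ℝ) (w : C(ℝ, ℝ)) (θ : ℝ) (n : ℕ)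
    (mu : ℝ) : Prop where
  isNthEigenvalue : IsNthEigenvalue (comparisonOperator γ L θ) n mu
  upper : ∃ E : Submodule ℂ (ComparisonDomain L θ), FiniteDimensional ℂ E ∧
    n ≤ Module.finrank ℂ E ∧ E ≤ regularElements L θ ∧
    ∀ x ∈ E, (⟪x, comparisonForm hL.le w θ x⟫_ℂ).re ≤ mu * ‖comparisonEmbedding hL.le θ x‖ ^ 2
  lower : ∃ m < n, ∃ ℓ : ComparisonDomain L θ →L[ℂ] (Fin m → ℂ), ∀ x, ℓ x = 0 →
    mu * ‖comparisonEmbedding hL.le θ x‖ ^ 2 ≤ (⟪x, comparisonForm hL.le w θ x⟫_ℂ).re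

lemma IsComparisonEigenvalue.neg_sq_le {L : ℝ} {hL : 0 < L} {γ : ℝ → ℝ} {w : C(ℝ, ℝ)} {θ : ℝ}
    {n : ℕ} {mu M : ℝ} (h : IsComparisonEigenvalue hL γ w θ n mu) (hn : 1 ≤ n)
    (hM : ∀ t ∈ Icc 0 L, |w t| ≤ M) : -M ^ 2 ≤ mu := by
  obtain ⟨E, hE, hEn, -, hform⟩ := h.upper
  have hpos : 0 < Module.finrank ℂ E := lt_of_lt_of_le hn hEn
  have : Nontrivial E := Module.finrank_pos_iff.mp hpos
  obtain ⟨x, hx⟩ := exists_ne (0 : E)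
  have h1 := hform x x.2
  rw [re_inner_comparisonForm] at h1
  have h2 := norm_sq_weightedEmbedding_le hL.le hM (SubHilbert.incl _ (x : ComparisonDomain L θ))
  have h3 : 0 < ‖comparisonEmbedding hL.le θ x‖ ^ 2 := by
    have h4 : comparisonEmbedding hL.le θ x ≠ 0 := fun h0 => hx (by
      rw [comparisonEmbedding_apply] at h0
      have h5 := weightedEmbedding_one_injective hL (h0.trans (map_zero _).symm)
      exact Subtype.ext (SubHilbert.incl_injective _ (h5.trans (map_zero _).symm)))
    positivity
  rw [comparisonEmbedding_apply] at h1 h3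
  by_contra! hlt
  have h6 := mul_lt_mul_of_pos_right hlt h3
  linarith [sq_nonneg ‖(SubHilbert.incl _ (x : ComparisonDomain L θ)).snd‖]

/-- The `n`th eigenvalue is bounded above uniformly in `θ`, and the lower bounds grow with the
index, also uniformly in `θ`. Hence some index `next n`, independent of `θ`, has its eigenvalue at
least `2` higher. This supplies the gap for the min-max principle and, iterated, distinct points of
the spectrum despite multiplicities. -/
lemma exists_comparison_sequence {L : ℝ} (hL : 0 < L) {γ : ℝ → ℝ} {w : C(ℝ, ℝ)}
    (hw : ∀ t, w t = γ t / 2) {M : ℝ} (hM : ∀ t ∈ Icc 0 L, |w t| ≤ M) :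
    ∃ (mu : ℕ → ℝ → ℝ) (B : ℕ → ℝ) (next : ℕ → ℕ), ∀ n, 1 ≤ n → 1 ≤ next n ∧ ∀ θ,
      IsComparisonEigenvalue hL γ w θ n (mu n θ) ∧ |mu n θ| ≤ B n ∧
        mu n θ + 2 ≤ mu (next n) θ := by
  have key : ∀ n : ℕ, ∃ b : ℝ, ∀ θ : ℝ, ∃ mu : ℝ, 1 ≤ n → mu ≤ b ∧
      IsComparisonEigenvalue hL γ w θ n mu ∧ ∀ m : ℕ, 0 < m → m < n → m / L ^ 2 - M ^ 2 ≤ mu := by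
    intro n
    by_cases hn : 1 ≤ n
    · obtain ⟨b, hb⟩ := exists_comparison_eigenvalues hL hw hM hn
      refine ⟨b, fun θ => ?_⟩
      obtain ⟨mu, h1, h2, h3, h4, h5⟩ := hb θ
      exact ⟨mu, fun _ => ⟨h1, ⟨h2, h3, h4⟩, h5⟩⟩
    · exact ⟨0, fun θ => ⟨0, fun h => absurd h hn⟩⟩
  choose b mu hmu using key
  have hnext : ∀ n : ℕ, ∃ m : ℕ, (b n + 2 + M ^ 2) * L ^ 2 ≤ m := fun n => exists_nat_ge _
  choose next hnext using hnext
  refine ⟨mu, fun n => |b n| + M ^ 2, fun n => next n + 2, fun n hn => ⟨Nat.le_add_left 1 (next n + 1), fun θ => ?_⟩⟩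
  obtain ⟨h1, h2, -⟩ := hmu n θ hn
  refine ⟨h2, abs_le.mpr ⟨?_, ?_⟩, ?_⟩
  · linarith [h2.neg_sq_le hn hM, abs_nonneg (b n)]
  · linarith [le_abs_self (b n), sq_nonneg M]
  · have h3 := (hmu (next n + 2) θ (by omega)).2.2 (next n + 1) (by omega) (by omega)
    have h4 : b n + 2 + M ^ 2 ≤ (next n + 1 : ℕ) / L ^ 2 := by
      rw [le_div_iff₀ (by positivity)]
      push_cast
      linarith [hnext n]
    linarith

/-- The trial space for `mu` gives the upper bound and its functionals the lower one. The
functionals of the higher eigenvalue `mu'` only serve to provide a threshold `c` above the trial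
bound: the gap `2` exceeds the two errors, whose sum is at most `1`. -/
lemma IsTube.exists_eigenvalue {N : ℝ → ℝ × ℝ} {α γ γ' : ℝ → ℝ} {L k₁ k₂ a G : ℝ}
    (h : IsTube N α γ γ' L k₁ k₂ a G) {w : C(ℝ, ℝ)} (hw : ∀ t, w t = γ t / 2)
    {n n' : ℕ} (hn : 1 ≤ n) {mu mu' : ℝ → ℝ} {B B' : ℝ}
    (hmu : ∀ θ, IsComparisonEigenvalue h.L_pos γ w θ n (mu θ))
    (hmu' : ∀ θ, IsComparisonEigenvalue h.L_pos γ w θ n' (mu' θ))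
    (hB : ∀ θ, |mu θ| ≤ B) (hB' : ∀ θ, |mu' θ| ≤ B') (hgap : ∀ θ, mu θ + 2 ≤ mu' θ) :
    ∃ C ≥ 0, ∃ β₀ ≥ 1, ∀ β ≥ β₀, ∀ θ, ∃ lam : ℝ,
      IsNthEigenvalue (fiberGraph N L k₁ k₂ β θ).toLinearPMap n lam ∧
      (lam : ℂ) ∈ discreteSpectrum (fiberGraph N L k₁ k₂ β θ).toLinearPMap ∧
      |lam - (-(1 / 4) * β ^ 2 + mu θ)| ≤ C / β := by
  obtain ⟨C₁, hC₁, β₁, hβ₁, H₁⟩ := h.exists_functional (max B B')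
  obtain ⟨C₂, hC₂, β₂, hβ₂, H₂⟩ := h.exists_trialSpace (max B B')
  refine ⟨C₁ + C₂, by positivity, max β₁ (max β₂ (C₁ + C₂)), le_trans hβ₁ (le_max_left _ _),
    fun β hβ θ => ?_⟩
  have b1 : β₁ ≤ β := (le_max_left _ _).trans hβ
  have b2 : β₂ ≤ β := ((le_max_left _ _).trans (le_max_right _ _)).trans hβ
  have b3 : C₁ + C₂ ≤ β := ((le_max_right _ _).trans (le_max_right _ _)).trans hβ
  have hβ0 : 0 < β := by linarith
  obtain ⟨A, hA⟩ := exists_fiberForm N L k₁ k₂ θ h.k_pos β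
  have hcl := h.exists_isClosedForm hβ0.le hA
  have hgr := isFormGraph_fiber hA
  haveI := completeSpace_fiberDomain N L k₁ k₂ θ h.k_pos
  obtain ⟨E, hE, hEn, hEr, hEf⟩ := (hmu θ).upper
  obtain ⟨m, hm, ℓ, hℓ⟩ := (hmu θ).lower
  obtain ⟨m', -, ℓ', hℓ'⟩ := (hmu' θ).lower
  have hBm := (hB θ).trans (le_max_left B B')
  obtain ⟨E', hE', hEn', hEf'⟩ := H₂ β b2 θ A hA w hw (mu θ) hBm E hE hEr hEf
  obtain ⟨f, hf⟩ := H₁ β b1 θ A hA w hw (mu θ) hBm m ℓ hℓ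
  obtain ⟨f', hf'⟩ := H₁ β b1 θ A hA w hw (mu' θ) ((hB' θ).trans (le_max_right B B')) m' ℓ' hℓ'
  have hdiv : C₁ / β + C₂ / β ≤ 1 := by rw [← add_div, div_le_one hβ0]; exact b3
  obtain ⟨lam, hlam, hnth, hds, hfd, hfr, -⟩ := IsFormGraph.exists_nth_eigenvalue hcl hgr
    (by linarith [hgap θ]) hf' hn (E := E') (hEn.trans hEn'.ge) hEf'
  have hlow := le_of_finrank_eigenSpan hcl hm hfr hf
  refine ⟨lam, hnth, hds, ?_⟩
  have h1 : 0 ≤ C₁ / β := by positivity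
  have h2 : 0 ≤ C₂ / β := by positivity
  rw [add_div, abs_le]
  constructor <;> linarith

/-- Eigenvalues with uniformly separated leading terms give many points of the discrete spectrum. -/
lemma le_encard_discreteSpectrum {H : Type*} [NormedAddCommGroup H] [InnerProductSpace ℂ H]
    {T : H →ₗ.[ℂ] H} {n : ℕ} {v lam : ℕ → ℝ} {c : ℝ} (hv : ∀ i, v i + 2 ≤ v (i + 1))
    (hlam : ∀ i < n, (lam i : ℂ) ∈ discreteSpectrum T) (hd : ∀ i < n, |lam i - (c + v i)| < 1) :
    (n : ℕ∞) ≤ (discreteSpectrum T).encard := by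
  have hmono : Monotone v := monotone_nat_of_le_succ fun i => by linarith [hv i]
  have hlt : ∀ i j, i < j → j < n → lam i < lam j := fun i j hij hj => by
    have h1 := abs_lt.mp (hd i (hij.trans hj))
    have h2 := abs_lt.mp (hd j hj)
    have h3 := hmono (Nat.succ_le_of_lt hij)
    have h4 := hv i
    rw [Nat.succ_eq_add_one] at h3
    linarith [h1.2, h2.1]
  have hinj : Function.Injective fun i : Fin n => (lam i : ℂ) := by
    intro i j hij
    have hij' : lam i = lam j := Complex.ofReal_injective hij
    rcases lt_trichotomy i j with h | h | h
    · exact absurd hij' (hlt i j h j.2).ne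
    · exact h
    · exact absurd hij' (hlt j i h i.2).ne'
  have hsub : range (fun i : Fin n => (lam i : ℂ)) ⊆ discreteSpectrum T := by
    rintro _ ⟨i, rfl⟩
    exact hlam i i.2
  refine le_trans (le_of_eq ?_) (encard_le_encard hsub)
  rw [← image_univ, hinj.injOn.encard_image, encard_univ, ENat.card_eq_coe_fintype_card,
    Fintype.card_fin]

end StrongDelta

end

open StrongDelta in
theorem theorem2p1
    (Γ : ℝ → ℝ × ℝ) (hΓ : ContDiff ℝ 2 Γ)
    -- arc-length parametrization
    (hunit : ∀ s, deriv (fun t => (Γ t).1) s ^ 2 + deriv (fun t => (Γ t).2) s ^ 2 = 1)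
    (hA1 : ContDiff ℝ 2 (signedCurvature Γ))
    (L : ℝ) (hL : 0 < L)
    (hA2 : ∀ s, signedCurvature Γ (s + L) = signedCurvature Γ s)
    (hA3 : ∫ t in (0 : ℝ)..L, signedCurvature Γ t = 0)
    (hA4 : 0 < K₁ (signedCurvature Γ) L)
    (hA5 : ∃ a₀ : ℝ, 0 < a₀ ∧ ∀ a ∈ Set.Ioo (0 : ℝ) a₀,
      Set.InjOn (tubeMap (normalized Γ)) (Set.Ico 0 L ×ˢ Set.Ioo (-a) a) ∧
      tubeMap (normalized Γ) '' (Set.Ioo 0 L ×ˢ Set.Ioo (-a) a) ⊆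
        strip (K₁ (signedCurvature Γ) L))
    (n : ℕ) (hn : 1 ≤ n) :
    ∃ βₙ : ℝ, 0 < βₙ ∧
      (∀ β ≥ βₙ, ∀ θ ∈ Set.Ico 0 (2 * Real.pi),
        (n : ℕ∞) ≤ (discreteSpectrum (fiberOperator Γ L β θ)).encard) ∧
      ∃ (lam : ℝ → ℝ → ℝ) (mu : ℝ → ℝ),
        (∀ β ≥ βₙ, ∀ θ ∈ Set.Ico 0 (2 * Real.pi),
          IsNthEigenvalue (fiberOperator Γ L β θ) n (lam β θ) ∧
          (lam β θ : ℂ) ∈ discreteSpectrum (fiberOperator Γ L β θ)) ∧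
        (∀ θ ∈ Set.Ico 0 (2 * Real.pi),
          IsNthEigenvalue (comparisonOperator (signedCurvature Γ) L θ) n (mu θ)) ∧
        ∃ C : ℝ, ∃ β₀ ≥ βₙ, ∀ β ≥ β₀, ∀ θ ∈ Set.Ico 0 (2 * Real.pi),
          |lam β θ - (-(1 / 4) * β ^ 2 + mu θ)| ≤ C * (β⁻¹ * Real.log β) := by
  obtain ⟨α, γ', a, G, h⟩ := exists_isTube hΓ hunit hA1 hL hA2 hA3 hA4 hA5
  set w : C(ℝ, ℝ) := ⟨fun t => signedCurvature Γ t / 2, h.continuous_curvature.div_const 2⟩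
  have hw : ∀ t, w t = signedCurvature Γ t / 2 := fun t => rfl
  obtain ⟨mu, B, next, hmu⟩ := exists_comparison_sequence hL hw (h.abs_half_curvature_le hw)
  have key : ∀ j, ∃ C ≥ 0, ∃ β₀ ≥ 1, 1 ≤ j → ∀ β ≥ β₀, ∀ θ, ∃ lam : ℝ,
      IsNthEigenvalue (fiberOperator Γ L β θ) j lam ∧
      (lam : ℂ) ∈ discreteSpectrum (fiberOperator Γ L β θ) ∧
      |lam - (-(1 / 4) * β ^ 2 + mu j θ)| ≤ C / β := by
    intro j
    by_cases hj : 1 ≤ j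
    · obtain ⟨hj', H⟩ := hmu j hj
      obtain ⟨C, hC, β₀, hβ₀, h1⟩ := h.exists_eigenvalue hw hj (fun θ => (H θ).1)
        (fun θ => ((hmu _ hj').2 θ).1) (fun θ => (H θ).2.1) (fun θ => ((hmu _ hj').2 θ).2.1)
        fun θ => (H θ).2.2
      exact ⟨C, hC, β₀, hβ₀, fun _ => h1⟩
    · exact ⟨0, le_rfl, 1, le_rfl, fun h => absurd h hj⟩
  choose C hC β₀ hβ₀ hlam using key
  -- Indices of comparison eigenvalues with consecutive distances at least `2`.
  set J : ℕ → ℕ := fun i => next^[i] 1 with hJ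
  have hJsucc : ∀ i, J (i + 1) = next (J i) := fun i => Function.iterate_succ_apply' next i 1
  have hJ1 : ∀ i, 1 ≤ J i := fun i => by
    induction i with
    | zero => exact le_rfl
    -- The property `1 ≤ next n` of the sequence keeps all iterates in the range where the
    -- eigenvalues are meaningful.
    | succ i ih => rw [hJsucc]; exact (hmu _ ih).1
  set S : ℝ := ∑ i ∈ Finset.range n, (β₀ (J i) + 2 * C (J i)) with hS
  have hterm : ∀ j, 1 ≤ β₀ j + 2 * C j := fun j => by linarith [hβ₀ j, hC j]
  -- The sum dominates each threshold and each `C (J i)`; hence for `β ≥ S` every error `C (J i) /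
  -- β` is below `1`, half of the distance between the leading terms.
  have hSle : ∀ i < n, β₀ (J i) + 2 * C (J i) ≤ S := fun i hi =>
    Finset.single_le_sum (f := fun i => β₀ (J i) + 2 * C (J i))
      (fun i _ => zero_le_one.trans (hterm _)) (Finset.mem_range.mpr hi)
  refine ⟨max S (β₀ n), lt_of_lt_of_le (by linarith [hβ₀ n]) (le_max_right _ _),
    fun β hβ θ _ => ?_, ?_⟩
  · have hβS : S ≤ β := (le_max_left _ _).trans hβ
    have hβ0 : 0 < β := by linarith [hβ₀ n, (le_max_right S (β₀ n)).trans hβ]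
    have hb : ∀ i < n, β₀ (J i) ≤ β := fun i hi => by linarith [hSle i hi, hC (J i)]
    have hex : ∀ i, ∃ l : ℝ, i < n → (l : ℂ) ∈ discreteSpectrum (fiberOperator Γ L β θ) ∧
        |l - (-(1 / 4) * β ^ 2 + mu (J i) θ)| < 1 := fun i => by
      by_cases hi : i < n
      · obtain ⟨l, -, h2, h3⟩ := hlam (J i) (hJ1 i) β (hb i hi) θ
        refine ⟨l, fun _ => ⟨h2, h3.trans_lt ?_⟩⟩
        rw [div_lt_one hβ0]
        linarith [hSle i hi, hβ₀ (J i), hC (J i)]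
      · exact ⟨0, fun h => absurd h hi⟩
    choose l hl using hex
    refine le_encard_discreteSpectrum (v := fun i => mu (J i) θ) (lam := l)
      (c := -(1 / 4) * β ^ 2) (fun i => ?_) (fun i hi => (hl i hi).1) fun i hi => (hl i hi).2
    simp only [hJsucc]
    exact ((hmu _ (hJ1 i)).2 θ).2.2
  · have hex : ∀ β θ, ∃ l : ℝ, β₀ n ≤ β → IsNthEigenvalue (fiberOperator Γ L β θ) n l ∧
        (l : ℂ) ∈ discreteSpectrum (fiberOperator Γ L β θ) ∧
        |l - (-(1 / 4) * β ^ 2 + mu n θ)| ≤ C n / β := fun β θ => by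
      by_cases hβ : β₀ n ≤ β
      · obtain ⟨l, hl⟩ := hlam n hn β hβ θ
        exact ⟨l, fun _ => hl⟩
      · exact ⟨0, fun h => absurd h hβ⟩
    choose lam hlam' using hex
    refine ⟨lam, mu n, fun β hβ θ _ => ?_, fun θ _ => ((hmu n hn).2 θ).1.isNthEigenvalue,
      C n, max (max S (β₀ n)) (Real.exp 1), le_max_left _ _, fun β hβ θ _ => ?_⟩
    · obtain ⟨h1, h2, -⟩ := hlam' β θ ((le_max_right _ _).trans hβ)
      exact ⟨h1, h2⟩
    · have hβn : β₀ n ≤ β := ((le_max_right _ _).trans (le_max_left _ _)).trans hβ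
      have hβ0 : 0 < β := by linarith [hβ₀ n]
      -- For `β ≥ e` the error `C / β` is at most `C log β / β`.
      have hlog : 1 ≤ Real.log β := by
        rw [Real.le_log_iff_exp_le hβ0]
        exact (le_max_right _ _).trans hβ
      refine (hlam' β θ hβn).2.2.trans ?_
      rw [div_eq_mul_inv]
      refine mul_le_mul_of_nonneg_left ?_ (hC n)
      exact le_mul_of_one_le_right (inv_nonneg.mpr hβ0.le) hlog
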